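/- Let $k\ge 2$ and let $\mathfrak g=\mathfrak{sl}(2k|2)$ with the form $\kappa(x,y)=\tfrac12\,\mathrm{str}(xy)$. Let $\sigma(x)=-\Phi^{-1}x^{st}\Phi$ be the order-two automorphism of $\mathfrak g$ given by the supertranspose and the Gram matrix $\Phi$ of an even orthosymplectic form for which the diagonal matrices fixed by $\sigma$ are $\mathrm{diag}(a_1,\dots,a_k,-a_1,\dots,-a_k;b,-b)$; the fixed algebra of $\sigma$ is $\mathfrak{osp}(2k|2)$. Let ${}^{[j]}\mathfrak g=\{x\mid\sigma(x)=(-1)^jx\}$, and let $$\mathfrak L=A(2k-1,1)^{(2)}=\bigoplus_{j\in\mathbb Z}{}^{[j]}\mathfrak g\otimes t^j\oplus\mathbb Cc\oplus\mathbb Cd,$$ $$[x\otimes t^p+rc+sd,\;y\otimes t^q+r'c+s'd]=[x,y]\otimes t^{p+q}+p\,\kappa(x,y)\delta_{p+q,0}c+sq\,y\otimes t^q-s'p\,x\otimes t^p .$$ Let $\mathfrak h$ be spanned by $c$, $d$ and the diagonal matrices in ${}^{[0]}\mathfrak g\otimes 1$. Let $\epsilon_i,\delta_1,\delta\in\mathfrak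 h^*$ be the functionals giving $a_i$, $b$ and the coefficient of $d$. For $\alpha\in\mathfrak h^*$ put $\mathfrak L^\alpha=\{x\mid[h,x]=\alpha(h)x\ \forall h\in\mathfrak h\}$, and let $R=\{\alpha\mid\mathfrak L^\alpha\ne0\}$ be the root system. On $\mathfrak L$ use the form $(x\otimes t^p+rc+sd,\,y\otimes t^q+r'c+s'd)=\kappa(x,y)\delta_{p+q,0}+rs'+sr'$; let $t_\alpha\in\mathfrak h$ be the element with $\alpha(h)=(t_\alpha,h)$ for all $h\in\mathfrak h$, and put $(\alpha,\beta)=(t_\alpha,t_\beta)$ on $\mathfrak h^*$. Then $(\epsilon_i,\epsilon_j)=\delta_{ij}$ and $(\delta_1,\delta_1)=-1$. A root $\alpha$ is a nonzero real root if $(\alpha,\alpha)\neq0$. A subset $P$ of a root system $\Delta$ is parabolic if $\Delta=P\cup-P$ and $\Delta\cap(P+P)\subseteq P$. For a subalgebra $\mathfrak t\supseteq\mathfrak h$ with root system $\Delta$, a parabolic $P\subseteq\Delta$ and a module $\Omega$ over $\mathfrak t^\circ_P=\bigoplus_{\alpha\in P\cap -P}\mathfrak t^\alpha$, let $\mathfrak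 t^+_P=\bigoplus_{\alpha\in P\setminus-P}\mathfrak t^\alpha$ act on $\Omega$ by zero, put $\mathfrak p=\mathfrak t^\circ_P\oplus\mathfrak t^+_P$, and let $\mathrm{Ind}_P(\Omega)$ be the quotient of $U(\mathfrak t)\otimes_{U(\mathfrak p)}\Omega$ by its largest submodule intersecting $\Omega$ trivially, when such a submodule exists. Let $$P_1=\{0,\epsilon_k\pm\delta_1,\pm2\delta_1\},$$ $$P_2=\{0\}\cup\{\epsilon_i\pm\epsilon_j\mid i<j\}\cup\{\epsilon_i\pm\delta_1\mid i<k\}\cup\{\pm\epsilon_k\pm\delta_1\}\cup\{\pm2\delta_1\},$$ $$P_3=\mathbb Z^{\ge0}\delta\cup(\{\pm\epsilon_i\pm\epsilon_j\mid i\ne j\}+\mathbb Z^{\ge0}\delta)\cup(\{\pm2\epsilon_i\}+\delta+2\mathbb Z^{\ge0}\delta)\cup(\{\pm2\delta_1\}+2\mathbb Z^{\ge0}\delta)\cup(\{\pm\epsilon_i\pm\delta_1\}+\mathbb Z^{\ge0}\delta),$$ let $\mathfrak s_i=P_i\cap-P_i$ and $\mathscr B_i=\bigoplus_{\alpha\in\mathfrak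 s_i}\mathfrak L^\alpha$. Then $P_1$, $P_2$, $P_3$ are parabolic subsets of $\mathfrak s_2$, $\mathfrak s_3$, $R$ respectively, and there exist $e\in\mathfrak L^{2\delta_1}$ and $f\in\mathfrak L^{-2\delta_1}$ with $[e,f]=t_{2\delta_1}$. Let $\zeta\in\mathbb Q\setminus\mathbb Z$, let $\xi$ be an irrational real number, and fix any such $e$ and $f$. Let $K_1$ be the (purely even) space with basis $\{v_\mu\mid\mu\in\zeta+2\mathbb Z\}$ and the action of $\mathscr B_1=\mathfrak h\oplus\mathbb Ce\oplus\mathbb Cf$ given by $$dv_\mu=0,\quad cv_\mu=(2k+2)v_\mu,\quad ev_\mu=v_{\mu+2},\quad fv_\mu=-\tfrac12(\xi-(\mu-1)^2)v_{\mu-2},\quad t_{2\delta_1}v_\mu=-2\mu v_\mu,\quad t_{\epsilon_i}v_\mu=(k-i+2)v_\mu .$$ Then: 1. $K_1$ is an irreducible finite weight $\mathscr B_1$-module with support $\varrho+2\mathbb Z\delta_1$, where $\varrho$ is the weight of $v_\zeta$, and all nonzero elements of $\mathfrak L^{2\delta_1}$ and of $\mathfrak L^{-2\delta_1}$ act injectively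 on $K_1$. 2. The modules $K_2=\mathrm{Ind}_{P_1}(K_1)$ over $\mathscr B_2$, $K_3=\mathrm{Ind}_{P_2}(K_2)$ over $\mathscr B_3$ and $M:=K_4=\mathrm{Ind}_{P_3}(K_3)$ over $\mathfrak L$ are defined (the required largest submodules exist). Each is an irreducible finite weight module, and $K_1\hookrightarrow K_2\hookrightarrow K_3\hookrightarrow K_4$ canonically, as modules over $\mathscr B_1$, $\mathscr B_2$, $\mathscr B_3$ respectively. 3. $M$ is $2$-quasi-integrable, that is, with $$R(1)=2\mathbb Z\delta\cup(\pm2\delta_1+2\mathbb Z\delta),\qquad R(2)=\mathbb Z\delta\cup(\{\pm\epsilon_i\pm\epsilon_j\mid i\ne j\}+\mathbb Z\delta)\cup(\{\pm2\epsilon_i\}+\delta+2\mathbb Z\delta)$$ and $S(i)=\mathbb Z\delta\cup R(i)\cup(R\cap\frac12R(i))$: (a) for every nonzero real root $\alpha$ in $S(2)$, the nonzero elements of $\mathfrak L^\alpha$ act locally nilpotently on $M$; (b) $S(1)$ is hybrid, that is, there is no nonzero real root $\alpha\in S(1)$ such that for all $\beta\in(\alpha+\mathbb Z\delta)\cap S(1)$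 the nonzero elements of $\mathfrak L^\beta$ act locally nilpotently on $M$, or for all such $\beta$ they act injectively on $M$. 4. $M$ is not a highest weight module: for no parabolic subset $P$ of $R$ with $P\cap-P=\{0\}$ is $M$ generated by a nonzero weight vector annihilated by $\mathfrak L^\alpha$ for all $0\ne\alpha\in P$. In particular, a quasi-integrable module need not be a highest weight module. -/

import Mathlib

noncomputable section

namespace SuperAffine

/-- The sign `(-1)^{ij}` attached to two parities. -/
def sgn (i j : ZMod 2) : ℂ := if i = 1 ∧ j = 1 then -1 else 1

/-- Complex Lie superalgebras. -/
class LieSuperalgebra (L : Type*) [AddCommGroup L] [Module ℂ L] where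
  par : ZMod 2 → Submodule ℂ L
  isCompl_par : IsCompl (par 0) (par 1)
  br : L →ₗ[ℂ] L →ₗ[ℂ] L
  br_mem : ∀ {i j : ZMod 2} {x y : L}, x ∈ par i → y ∈ par j → br x y ∈ par (i + j)
  br_skew : ∀ {i j : ZMod 2} {x y : L}, x ∈ par i → y ∈ par j → br x y = -(sgn i j • br y x)
  br_jacobi : ∀ {i j l : ZMod 2} {x y z : L}, x ∈ par i → y ∈ par j → z ∈ par l →
    br x (br y z) = br (br x y) z + sgn i j • br y (br x z)

open LieSuperalgebra

section Matrices

variable (k : ℕ)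

/-- Indices of `(2k|2) × (2k|2)` matrices: `inl (inl i)`, `inl (inr i)`, `inr (inl 0)`,
`inr (inr 0)` label basis vectors of weight `ε i`, `-ε i`, `δ₁`, `-δ₁`. -/
abbrev Idx : Type := (Fin k ⊕ Fin k) ⊕ (Fin 1 ⊕ Fin 1)

/-- The space underlying `𝔤𝔩(2k|2)`. -/
abbrev Mat : Type := Matrix (Idx k) (Idx k) ℂ

variable {k}

/-- The odd component (off-diagonal blocks) of a supermatrix. -/
def oddPart : Mat k →ₗ[ℂ] Mat k where
  toFun x := Matrix.fromBlocks 0 x.toBlocks₁₂ x.toBlocks₂₁ 0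
  map_add' x y := by
    ext (a | a) (b | b) <;> simp [Matrix.toBlocks₁₂, Matrix.toBlocks₂₁]
  map_smul' r x := by
    ext (a | a) (b | b) <;> simp [Matrix.toBlocks₁₂, Matrix.toBlocks₂₁]

/-- The `ℤ/2`-grading of `𝔤𝔩(2k|2)`. -/
def matPar (i : ZMod 2) : Submodule ℂ (Mat k) :=
  if i = 0 then LinearMap.ker oddPart else LinearMap.ker (LinearMap.id - oddPart)

/-- The supercommutator: `[x,y] = xy - (-1)^{|x||y|} yx` on homogeneous elements. -/
def matBr : Mat k →ₗ[ℂ] Mat k →ₗ[ℂ] Mat k :=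
  LinearMap.mk₂ ℂ (fun x y => x * y - y * x + (2 : ℂ) • (oddPart y * oddPart x))
    (by intros; simp only [map_add, add_mul, mul_add, smul_add]; abel)
    (by
      intro c x y
      simp only [map_smul, smul_mul_assoc, mul_smul_comm, smul_add, smul_sub]
      rw [smul_comm])
    (by intros; simp only [map_add, add_mul, mul_add, smul_add]; abel)
    (by
      intro c x y
      simp only [map_smul, smul_mul_assoc, mul_smul_comm, smul_add, smul_sub]
      rw [smul_comm])

/-- The supertrace. -/
def str : Mat k →ₗ[ℂ] ℂ where
  toFun x := x.toBlocks₁₁.trace - x.toBlocks₂₂.trace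
  map_add' x y := by
    simp only [Matrix.toBlocks₁₁, Matrix.toBlocks₂₂, Matrix.trace, Matrix.diag, Matrix.of_apply,
      Matrix.add_apply, Finset.sum_add_distrib]; ring
  map_smul' r x := by
    simp only [Matrix.toBlocks₁₁, Matrix.toBlocks₂₂, Matrix.trace, Matrix.diag, Matrix.of_apply,
      Matrix.smul_apply, smul_eq_mul, ← Finset.mul_sum, RingHom.id_apply]; ring

/-- The invariant form `κ(x,y) = ½ str(xy)`, for which `(ε i, ε j) = δ_{ij}`. -/
def kap : Mat k →ₗ[ℂ] Mat k →ₗ[ℂ] ℂ :=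
  (LinearMap.mul ℂ (Mat k)).compr₂ ((1 / 2 : ℂ) • str)

/-- The supertranspose. -/
def superTranspose : Mat k →ₗ[ℂ] Mat k where
  toFun x := Matrix.fromBlocks x.toBlocks₁₁.transpose (-x.toBlocks₂₁.transpose)
    x.toBlocks₁₂.transpose x.toBlocks₂₂.transpose
  map_add' x y := by
    ext (a | a) (b | b) <;>
      simp [Matrix.toBlocks₁₁, Matrix.toBlocks₁₂, Matrix.toBlocks₂₁, Matrix.toBlocks₂₂, add_comm]
  map_smul' r x := by
    ext (a | a) (b | b) <;>
      simp [Matrix.toBlocks₁₁, Matrix.toBlocks₁₂, Matrix.toBlocks₂₁, Matrix.toBlocks₂₂]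

/-- Gram matrix of the orthosymplectic form: symmetric on the even part `ℂ^{2k}`,
alternating on the odd part `ℂ²`. -/
def gram : Mat k :=
  Matrix.fromBlocks (LieAlgebra.Orthogonal.JD (Fin k) ℂ) 0 0 (Matrix.J (Fin 1) ℂ)

/-- The inverse of `gram`. -/
def gramInv : Mat k :=
  Matrix.fromBlocks (LieAlgebra.Orthogonal.JD (Fin k) ℂ) 0 0 (-Matrix.J (Fin 1) ℂ)

lemma gram_mul_gramInv : (gram : Mat k) * gramInv = 1 := by
  simp [gram, gramInv, LieAlgebra.Orthogonal.JD, Matrix.J, Matrix.fromBlocks_multiply,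
    Matrix.fromBlocks_neg]

lemma gramInv_mul_gram : (gramInv : Mat k) * gram = 1 := by
  simp [gram, gramInv, LieAlgebra.Orthogonal.JD, Matrix.J, Matrix.fromBlocks_multiply,
    Matrix.fromBlocks_neg]

/-- The automorphism `σ(x) = -Φ⁻¹ x^{st} Φ`, whose fixed points in `𝔰𝔩(2k|2)`
form `𝔬𝔰𝔭(2k|2)`. -/
def sig : Mat k →ₗ[ℂ] Mat k :=
  -(LinearMap.mulLeft ℂ gramInv ∘ₗ LinearMap.mulRight ℂ gram ∘ₗ superTranspose)

lemma matBr_apply (x y : Mat k) :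
    matBr x y = x * y - y * x + (2 : ℂ) • (oddPart y * oddPart x) := rfl

lemma sig_apply (x : Mat k) : sig x = -(gramInv * (superTranspose x * gram)) := rfl

lemma zmod2 (i : ZMod 2) : i = 0 ∨ i = 1 := by revert i; decide

lemma mem_matPar_zero {x : Mat k} : x ∈ matPar 0 ↔ oddPart x = 0 := by simp [matPar]

lemma mem_matPar_one {x : Mat k} : x ∈ matPar 1 ↔ oddPart x = x := by
  simp only [matPar, one_ne_zero, if_false, LinearMap.mem_ker, LinearMap.sub_apply,
    LinearMap.id_apply, sub_eq_zero]
  exact eq_comm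

lemma oddPart_fromBlocks (A B C D) :
    oddPart (Matrix.fromBlocks A B C D : Mat k) = Matrix.fromBlocks 0 B C 0 := rfl

lemma oddPart_mul (x y : Mat k) :
    oddPart (x * y) = (x - oddPart x) * oddPart y + oddPart x * (y - oddPart y) := by
  rw [← Matrix.fromBlocks_toBlocks x, ← Matrix.fromBlocks_toBlocks y]
  simp only [Matrix.fromBlocks_multiply, oddPart_fromBlocks, sub_eq_add_neg, Matrix.fromBlocks_neg,
    Matrix.fromBlocks_add]
  simp [add_comm]

lemma oddPart_oddPart (x : Mat k) : oddPart (oddPart x) = oddPart x := by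
  rw [← Matrix.fromBlocks_toBlocks x]
  simp only [oddPart_fromBlocks]

lemma matBr_hom {i j : ZMod 2} {x y : Mat k} (hx : x ∈ matPar i) (hy : y ∈ matPar j) :
    matBr x y = x * y - sgn i j • (y * x) := by
  rcases zmod2 i with rfl | rfl <;> rcases zmod2 j with rfl | rfl <;>
    simp only [mem_matPar_zero, mem_matPar_one] at hx hy <;>
    simp [matBr_apply, hx, hy, sgn, two_smul]

lemma mul_mem_matPar {i j : ZMod 2} {x y : Mat k} (hx : x ∈ matPar i) (hy : y ∈ matPar j) :
    x * y ∈ matPar (i + j) := by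
  have h11 : (1 : ZMod 2) + 1 = 0 := by decide
  rcases zmod2 i with rfl | rfl <;> rcases zmod2 j with rfl | rfl <;>
    simp only [mem_matPar_zero, mem_matPar_one, h11, zero_add, add_zero] at hx hy ⊢ <;>
    rw [oddPart_mul] <;> simp [hx, hy]

lemma matBr_mem {i j : ZMod 2} {x y : Mat k} (hx : x ∈ matPar i) (hy : y ∈ matPar j) :
    matBr x y ∈ matPar (i + j) := by
  rw [matBr_hom hx hy]
  exact Submodule.sub_mem _ (mul_mem_matPar hx hy)
    (Submodule.smul_mem _ _ (add_comm i j ▸ mul_mem_matPar hy hx))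

lemma sgn_comm (i j : ZMod 2) : sgn i j = sgn j i := by simp [sgn, and_comm]

lemma sgn_sq (i j : ZMod 2) : sgn i j * sgn i j = 1 := by unfold sgn; split_ifs <;> norm_num

lemma sgn_add (i j l : ZMod 2) : sgn i (j + l) = sgn i j * sgn i l := by
  have h11 : (1 : ZMod 2) + 1 = 0 := by decide
  rcases zmod2 i with rfl | rfl <;> rcases zmod2 j with rfl | rfl <;>
    rcases zmod2 l with rfl | rfl <;> simp [sgn, h11]

lemma matBr_skew {i j : ZMod 2} {x y : Mat k} (hx : x ∈ matPar i) (hy : y ∈ matPar j) :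
    matBr x y = -(sgn i j • matBr y x) := by
  rw [matBr_hom hx hy, matBr_hom hy hx, smul_sub, smul_smul, sgn_comm j i, sgn_sq]
  simp

lemma matBr_jacobi {i j l : ZMod 2} {x y z : Mat k} (hx : x ∈ matPar i) (hy : y ∈ matPar j)
    (hz : z ∈ matPar l) :
    matBr x (matBr y z) = matBr (matBr x y) z + sgn i j • matBr y (matBr x z) := by
  rw [matBr_hom hx (matBr_mem hy hz), matBr_hom (matBr_mem hx hy) hz,
    matBr_hom hy (matBr_mem hx hz), matBr_hom hx hy, matBr_hom hy hz, matBr_hom hx hz,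
    sgn_comm (i + j) l]
  simp only [sgn_add, sgn_comm l i, sgn_comm l j, sgn_comm j i]
  simp only [mul_sub, sub_mul, smul_sub, mul_smul_comm, smul_mul_assoc, smul_smul, ← mul_assoc,
    sgn_sq]
  match_scalars <;> ring_nf

lemma str_fromBlocks (A B C D) :
    str (Matrix.fromBlocks A B C D : Mat k) = A.trace - D.trace := rfl

lemma str_matBr (x y : Mat k) : str (matBr x y) = 0 := by
  rw [matBr_apply, ← Matrix.fromBlocks_toBlocks x, ← Matrix.fromBlocks_toBlocks y]
  simp only [map_add, map_sub, map_smul, Matrix.fromBlocks_multiply, oddPart_fromBlocks,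
    str_fromBlocks, Matrix.trace_add, smul_eq_mul, mul_zero, add_zero, zero_add,
    Matrix.zero_mul, Matrix.mul_zero]
  rw [Matrix.trace_mul_comm x.toBlocks₁₁, Matrix.trace_mul_comm x.toBlocks₂₂,
    Matrix.trace_mul_comm x.toBlocks₁₂, Matrix.trace_mul_comm x.toBlocks₂₁]
  ring

lemma kap_apply (x y : Mat k) : kap x y = (1 / 2 : ℂ) * str (x * y) := rfl

lemma kap_symm {i j : ZMod 2} {x y : Mat k} (hx : x ∈ matPar i) (hy : y ∈ matPar j) :
    kap x y = sgn i j * kap y x := by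
  have h := str_matBr x y
  rw [matBr_hom hx hy, map_sub, map_smul, smul_eq_mul, sub_eq_zero] at h
  rw [kap_apply, kap_apply, h]; ring

lemma kap_even {i j : ZMod 2} {x y : Mat k} (hx : x ∈ matPar i) (hy : y ∈ matPar j)
    (hij : i ≠ j) : kap x y = 0 := by
  have h := mul_mem_matPar hx hy
  have h1 : i + j = 1 := by clear hx hy h; revert i j; decide
  rw [h1, mem_matPar_one] at h
  rw [kap_apply, ← h, ← Matrix.fromBlocks_toBlocks (x * y), oddPart_fromBlocks, str_fromBlocks]
  simp

lemma kap_inv {i j l : ZMod 2} {x y z : Mat k} (hx : x ∈ matPar i) (hy : y ∈ matPar j)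
    (hz : z ∈ matPar l) : kap (matBr x y) z = kap x (matBr y z) := by
  have h2 := kap_symm (mul_mem_matPar hx hz) hy
  rw [matBr_hom hx hy, matBr_hom hy hz]
  have h3 : sgn (i + l) j = sgn i j * sgn j l := by
    rw [sgn_comm, sgn_add, sgn_comm j i]
  rw [kap_apply, kap_apply, h3] at h2
  rw [kap_apply, kap_apply, sub_mul, mul_sub, smul_mul_assoc, mul_smul_comm, map_sub, map_sub,
    map_smul, map_smul, smul_eq_mul, smul_eq_mul, mul_assoc, mul_assoc]
  rw [mul_assoc] at h2
  linear_combination (sgn j l) * h2 + (1 / 2 * sgn i j * str (y * (x * z))) * sgn_sq j l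

lemma conj_matBr (x y : Mat k) :
    matBr (gramInv * (x * gram)) (gramInv * (y * gram)) = gramInv * (matBr x y * gram) := by
  have h0 : ∀ u : Mat k, oddPart (gramInv * (u * gram)) = gramInv * (oddPart u * gram) := by
    intro u
    have h1 : oddPart (gram : Mat k) = 0 := by simp [gram, oddPart_fromBlocks]
    have h2 : oddPart (gramInv : Mat k) = 0 := by simp [gramInv, oddPart_fromBlocks]
    rw [oddPart_mul, oddPart_mul, h1, h2]; simp
  have h1 : ∀ u v : Mat k, (gramInv * (u * gram)) * (gramInv * (v * gram))
      = gramInv * ((u * v) * gram) := by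
    intro u v
    calc _ = gramInv * u * (gram * gramInv) * v * gram := by noncomm_ring
      _ = _ := by rw [gram_mul_gramInv]; noncomm_ring
  rw [matBr_apply, matBr_apply, h0, h0, h1, h1, h1]
  simp only [sub_mul, add_mul, mul_sub, mul_add, smul_mul_assoc, mul_smul_comm]

lemma superTranspose_fromBlocks (A B C D) :
    superTranspose (Matrix.fromBlocks A B C D : Mat k) =
      Matrix.fromBlocks A.transpose (-C.transpose) B.transpose D.transpose := rfl

lemma superTranspose_matBr (x y : Mat k) :
    superTranspose (matBr x y) = -matBr (superTranspose x) (superTranspose y) := by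
  rw [← Matrix.fromBlocks_toBlocks x, ← Matrix.fromBlocks_toBlocks y]
  simp only [matBr_apply, Matrix.fromBlocks_multiply,
    oddPart_fromBlocks, superTranspose_fromBlocks, sub_eq_add_neg, Matrix.fromBlocks_neg,
    Matrix.fromBlocks_add, Matrix.fromBlocks_smul, Matrix.transpose_add, Matrix.transpose_mul]
  congr 1 <;> simp <;> module

lemma sig_matBr (x y : Mat k) : sig (matBr x y) = matBr (sig x) (sig y) := by
  simp only [sig_apply, superTranspose_matBr, map_neg, LinearMap.neg_apply, conj_matBr]
  simp

lemma sig_sig (x : Mat k) : sig (sig x) = x := by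
  rw [← Matrix.fromBlocks_toBlocks x]
  simp only [sig_apply, gram, gramInv, superTranspose_fromBlocks, Matrix.fromBlocks_multiply,
    Matrix.fromBlocks_neg]
  have h1 : LieAlgebra.Orthogonal.JD (Fin k) ℂ * LieAlgebra.Orthogonal.JD (Fin k) ℂ = 1 := by
    simp [LieAlgebra.Orthogonal.JD, Matrix.fromBlocks_multiply]
  have h2 : Matrix.J (Fin 1) ℂ * Matrix.J (Fin 1) ℂ = -1 := Matrix.J_squared _ _
  have h3 : (LieAlgebra.Orthogonal.JD (Fin k) ℂ).transpose = LieAlgebra.Orthogonal.JD (Fin k) ℂ := by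
    simp [LieAlgebra.Orthogonal.JD, Matrix.fromBlocks_transpose]
  simp [Matrix.transpose_mul, Matrix.mul_assoc, h1, h2, h3]
  simp [← Matrix.mul_assoc, h1, h2]

lemma sig_oddPart (x : Mat k) : sig (oddPart x) = oddPart (sig x) := by
  rw [← Matrix.fromBlocks_toBlocks x]
  simp only [sig_apply, gram, gramInv, oddPart_fromBlocks, superTranspose_fromBlocks,
    Matrix.fromBlocks_multiply, Matrix.fromBlocks_neg]
  simp

end Matrices

section Loops

variable {k : ℕ}

variable (k) in
/-- `(𝔤𝔩(2k|2) ⊗ ℂ[t, t⁻¹]) ⊕ ℂc ⊕ ℂd`; the first component is `∑ x_p ⊗ t^p`, stored as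
`p ↦ x_p`, the other two are the coefficients of `c` and of `d`. -/
abbrev Aff : Type := (ℤ →₀ Mat k) × ℂ × ℂ

/-- `[x ⊗ t^p, y ⊗ t^q] = [x, y] ⊗ t^{p+q}`. -/
def loopBr : (ℤ →₀ Mat k) →ₗ[ℂ] (ℤ →₀ Mat k) →ₗ[ℂ] (ℤ →₀ Mat k) :=
  Finsupp.lsum ℂ fun p => (Finsupp.lsum ℂ fun q =>
    (matBr.compr₂ (Finsupp.lsingle (p + q))).flip).flip

/-- `(x ⊗ t^p, y ⊗ t^q) ↦ δ_{p+q,0} κ(x, y)`. -/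
def loopForm : (ℤ →₀ Mat k) →ₗ[ℂ] (ℤ →₀ Mat k) →ₗ[ℂ] ℂ :=
  Finsupp.lsum ℂ fun p => (Finsupp.lsum ℂ fun q => if p + q = 0 then kap.flip else 0).flip

/-- The derivation `t d/dt`: `x ⊗ t^p ↦ p x ⊗ t^p`. -/
def loopDeg : (ℤ →₀ Mat k) →ₗ[ℂ] (ℤ →₀ Mat k) :=
  Finsupp.lsum ℂ fun p => (p : ℂ) • Finsupp.lsingle p

lemma loopBr_single (p q : ℤ) (x y : Mat k) :
    loopBr (Finsupp.single p x) (Finsupp.single q y) = Finsupp.single (p + q) (matBr x y) := by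
  simp [loopBr]

lemma loopForm_single (p q : ℤ) (x y : Mat k) :
    loopForm (Finsupp.single p x) (Finsupp.single q y) = if p + q = 0 then kap x y else 0 := by
  simp only [loopForm, Finsupp.lsum_single, LinearMap.flip_apply]
  split_ifs <;> simp

lemma loopDeg_single (p : ℤ) (x : Mat k) :
    loopDeg (Finsupp.single p x) = (p : ℂ) • Finsupp.single p x := by
  simp [loopDeg]

/-- The bracket
`[x⊗t^p + rc + sd, y⊗t^q + r'c + s'd]
  = [x,y]⊗t^{p+q} + p κ(x,y) δ_{p+q,0} c + s q y⊗t^q - s' p x⊗t^p`. -/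
def affBr : Aff k →ₗ[ℂ] Aff k →ₗ[ℂ] Aff k :=
  LinearMap.mk₂ ℂ (fun x y =>
    (loopBr x.1 y.1 + x.2.2 • loopDeg y.1 - y.2.2 • loopDeg x.1, loopForm (loopDeg x.1) y.1, 0))
    (by
      intro x x' y
      ext1
      · simp only [Prod.fst_add, Prod.snd_add, map_add, LinearMap.add_apply]; module
      · simp)
    (by
      intro c x y
      ext1
      · simp only [Prod.smul_fst, Prod.smul_snd, map_smul, LinearMap.smul_apply, smul_eq_mul]
        module
      · simp)
    (by
      intro x y y'
      ext1
      · simp only [Prod.fst_add, Prod.snd_add, map_add]; module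
      · simp)
    (by
      intro c x y
      ext1
      · simp only [Prod.smul_fst, Prod.smul_snd, map_smul, smul_eq_mul]
        module
      · simp)

/-- The form `(x⊗t^p + rc + sd, y⊗t^q + r'c + s'd) = κ(x,y) δ_{p+q,0} + r s' + s r'`. -/
def affForm (x y : Aff k) : ℂ := loopForm x.1 y.1 + x.2.1 * y.2.2 + x.2.2 * y.2.1

lemma affBr_apply (x y : Aff k) : affBr x y =
    (loopBr x.1 y.1 + x.2.2 • loopDeg y.1 - y.2.2 • loopDeg x.1,
      loopForm (loopDeg x.1) y.1, 0) := rfl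

/-- Loops whose coefficient at `t^p` lies in `N p`, i.e. `⨁ p, N p ⊗ t^p`. -/
def loopSub (N : ℤ → Submodule ℂ (Mat k)) : Submodule ℂ (ℤ →₀ Mat k) where
  carrier := {X | ∀ p, X p ∈ N p}
  add_mem' hx hy p := (N p).add_mem (hx p) (hy p)
  zero_mem' p := (N p).zero_mem
  smul_mem' c _ hx p := (N p).smul_mem c (hx p)

lemma loop_induction {N : ℤ → Submodule ℂ (Mat k)} {C : (ℤ →₀ Mat k) → Prop} (h0 : C 0)
    (hadd : ∀ X Y, C X → C Y → C (X + Y)) (hs : ∀ p, ∀ x ∈ N p, C (Finsupp.single p x))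
    {X : ℤ →₀ Mat k} (hX : X ∈ loopSub N) : C X := by
  rw [← X.sum_single]
  exact Finset.sum_induction _ C hadd h0 fun p _ => hs p _ (hX p)

/-- The parity decomposition; `c` and `d` are even. -/
def affPar (i : ZMod 2) : Submodule ℂ (Aff k) :=
  (loopSub (fun _ => matPar i)).prod (if i = 0 then ⊤ else ⊥)

lemma loopDeg_mem {N : ℤ → Submodule ℂ (Mat k)} {X : ℤ →₀ Mat k} (hX : X ∈ loopSub N) :
    loopDeg X ∈ loopSub N := by
  refine loop_induction (C := fun X => loopDeg X ∈ loopSub N) (by simp) ?_ ?_ hX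
  · intro X Y h1 h2; rw [map_add]; exact add_mem h1 h2
  · intro p x hx q
    rw [loopDeg_single, Finsupp.smul_apply, Finsupp.single_apply]
    split_ifs with h
    · exact (N q).smul_mem _ (h ▸ hx)
    · simp

lemma loopBr_mem {N N' N'' : ℤ → Submodule ℂ (Mat k)}
    (h : ∀ p q, ∀ x ∈ N p, ∀ y ∈ N' q, matBr x y ∈ N'' (p + q))
    {X Y : ℤ →₀ Mat k} (hX : X ∈ loopSub N) (hY : Y ∈ loopSub N') :
    loopBr X Y ∈ loopSub N'' := by
  refine loop_induction (C := fun X => loopBr X Y ∈ loopSub N'') (by simp) ?_ ?_ hX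
  · intro X X' h1 h2; rw [map_add]; exact add_mem h1 h2
  intro p x hx
  refine loop_induction (C := fun Y => loopBr (Finsupp.single p x) Y ∈ loopSub N'')
    (by simp) ?_ ?_ hY
  · intro X X' h1 h2; rw [map_add]; exact add_mem h1 h2
  intro q y hy n
  rw [loopBr_single, Finsupp.single_apply]
  split_ifs with hn
  · exact hn ▸ h p q x hx y hy
  · simp

lemma loopBr_skew {i j : ZMod 2} {X Y : ℤ →₀ Mat k} (hX : X ∈ loopSub (fun _ => matPar i))
    (hY : Y ∈ loopSub (fun _ => matPar j)) : loopBr X Y = -(sgn i j • loopBr Y X) := by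
  refine loop_induction (C := fun X => loopBr X Y = -(sgn i j • loopBr Y X)) (by simp) ?_ ?_ hX
  · intro X X' h1 h2
    rw [map_add, map_add, LinearMap.add_apply, h1, h2]; module
  intro p x hx
  refine loop_induction (C := fun Y => loopBr (Finsupp.single p x) Y
    = -(sgn i j • loopBr Y (Finsupp.single p x))) (by simp) ?_ ?_ hY
  · intro X X' h1 h2
    rw [map_add, map_add, LinearMap.add_apply, h1, h2]; module
  intro q y hy
  rw [loopBr_single, loopBr_single, matBr_skew hx hy, add_comm q p, Finsupp.smul_single,
    ← Finsupp.single_neg]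

lemma loopForm_symm {i j : ZMod 2} {X Y : ℤ →₀ Mat k} (hX : X ∈ loopSub (fun _ => matPar i))
    (hY : Y ∈ loopSub (fun _ => matPar j)) : loopForm X Y = sgn i j * loopForm Y X := by
  refine loop_induction (C := fun X => loopForm X Y = sgn i j * loopForm Y X) (by simp) ?_ ?_ hX
  · intro X X' h1 h2
    rw [map_add, map_add, LinearMap.add_apply, h1, h2]; ring
  intro p x hx
  refine loop_induction (C := fun Y => loopForm (Finsupp.single p x) Y
    = sgn i j * loopForm Y (Finsupp.single p x)) (by simp) ?_ ?_ hY
  · intro X X' h1 h2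
    rw [map_add, map_add, LinearMap.add_apply, h1, h2]; ring
  intro q y hy
  rw [loopForm_single, loopForm_single, add_comm q p]
  split_ifs
  · exact kap_symm hx hy
  · simp

lemma loopForm_odd {i j : ZMod 2} (hij : i ≠ j) {X Y : ℤ →₀ Mat k}
    (hX : X ∈ loopSub (fun _ => matPar i)) (hY : Y ∈ loopSub (fun _ => matPar j)) : loopForm X Y = 0 := by
  refine loop_induction (C := fun X => loopForm X Y = 0) (by simp) ?_ ?_ hX
  · intro X X' h1 h2
    rw [map_add, LinearMap.add_apply, h1, h2, add_zero]
  intro p x hx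
  refine loop_induction (C := fun Y => loopForm (Finsupp.single p x) Y = 0) (by simp) ?_ ?_ hY
  · intro X X' h1 h2
    rw [map_add, h1, h2, add_zero]
  intro q y hy
  rw [loopForm_single, kap_even hx hy hij, ite_self]

lemma mem_loopSub_top (X : ℤ →₀ Mat k) : X ∈ loopSub (fun _ => (⊤ : Submodule ℂ (Mat k))) :=
  fun _ => Submodule.mem_top

lemma loopForm_loopDeg (X Y : ℤ →₀ Mat k) : loopForm (loopDeg X) Y = -loopForm X (loopDeg Y) := by
  refine loop_induction (C := fun X => loopForm (loopDeg X) Y = -loopForm X (loopDeg Y))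
    (by simp) ?_ ?_ (mem_loopSub_top X)
  · intro X X' h1 h2
    rw [map_add, map_add, LinearMap.add_apply, h1, h2, map_add, LinearMap.add_apply]; ring
  intro p x _
  refine loop_induction (C := fun Y => loopForm (loopDeg (Finsupp.single p x)) Y
    = -loopForm (Finsupp.single p x) (loopDeg Y)) (by simp) ?_ ?_ (mem_loopSub_top Y)
  · intro X X' h1 h2
    rw [map_add, map_add, h1, h2, map_add]; ring
  intro q y _
  rw [loopDeg_single, loopDeg_single, map_smul, map_smul, LinearMap.smul_apply, loopForm_single]
  split_ifs with h
  · have : (p : ℂ) = -q := by rw [eq_neg_iff_add_eq_zero]; exact_mod_cast h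
    rw [this]; simp
  · simp

lemma loopDeg_loopBr (X Y : ℤ →₀ Mat k) :
    loopDeg (loopBr X Y) = loopBr (loopDeg X) Y + loopBr X (loopDeg Y) := by
  refine loop_induction
    (C := fun X => loopDeg (loopBr X Y) = loopBr (loopDeg X) Y + loopBr X (loopDeg Y))
    (by simp) ?_ ?_ (mem_loopSub_top X)
  · intro X X' h1 h2
    simp only [map_add, LinearMap.add_apply, h1, h2]; abel
  intro p x _
  refine loop_induction (C := fun Y => loopDeg (loopBr (Finsupp.single p x) Y)
    = loopBr (loopDeg (Finsupp.single p x)) Y + loopBr (Finsupp.single p x) (loopDeg Y))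
    (by simp) ?_ ?_ (mem_loopSub_top Y)
  · intro X X' h1 h2
    simp only [map_add, h1, h2]; abel
  intro q y _
  rw [loopDeg_single, loopDeg_single, map_smul, map_smul, LinearMap.smul_apply, loopBr_single,
    loopDeg_single]
  push_cast
  module

lemma loopBr_jacobi {i j l : ZMod 2} {X Y Z : ℤ →₀ Mat k} (hX : X ∈ loopSub (fun _ => matPar i))
    (hY : Y ∈ loopSub (fun _ => matPar j)) (hZ : Z ∈ loopSub (fun _ => matPar l)) :
    loopBr X (loopBr Y Z) = loopBr (loopBr X Y) Z + sgn i j • loopBr Y (loopBr X Z) := by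
  refine loop_induction (C := fun X => loopBr X (loopBr Y Z)
    = loopBr (loopBr X Y) Z + sgn i j • loopBr Y (loopBr X Z)) (by simp) ?_ ?_ hX
  · intro X X' h1 h2
    simp only [map_add, LinearMap.add_apply, h1, h2]; module
  intro p x hx
  refine loop_induction (C := fun Y => loopBr (Finsupp.single p x) (loopBr Y Z)
    = loopBr (loopBr (Finsupp.single p x) Y) Z
      + sgn i j • loopBr Y (loopBr (Finsupp.single p x) Z)) (by simp) ?_ ?_ hY
  · intro X X' h1 h2
    simp only [map_add, LinearMap.add_apply, h1, h2]; module
  intro q y hy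
  refine loop_induction (C := fun Z => loopBr (Finsupp.single p x) (loopBr (Finsupp.single q y) Z)
    = loopBr (loopBr (Finsupp.single p x) (Finsupp.single q y)) Z
      + sgn i j • loopBr (Finsupp.single q y) (loopBr (Finsupp.single p x) Z)) (by simp) ?_ ?_ hZ
  · intro X X' h1 h2
    simp only [map_add, h1, h2]; module
  intro r z hz
  simp only [loopBr_single]
  rw [matBr_jacobi hx hy hz, Finsupp.smul_single, ← add_assoc, ← add_assoc, add_comm q p,
    ← Finsupp.single_add]

lemma loopForm_inv {i j l : ZMod 2} {X Y Z : ℤ →₀ Mat k} (hX : X ∈ loopSub (fun _ => matPar i))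
    (hY : Y ∈ loopSub (fun _ => matPar j)) (hZ : Z ∈ loopSub (fun _ => matPar l)) :
    loopForm (loopBr X Y) Z = loopForm X (loopBr Y Z) := by
  refine loop_induction (C := fun X => loopForm (loopBr X Y) Z = loopForm X (loopBr Y Z))
    (by simp) ?_ ?_ hX
  · intro X X' h1 h2
    simp only [map_add, LinearMap.add_apply, h1, h2]
  intro p x hx
  refine loop_induction (C := fun Y => loopForm (loopBr (Finsupp.single p x) Y) Z
    = loopForm (Finsupp.single p x) (loopBr Y Z)) (by simp) ?_ ?_ hY
  · intro X X' h1 h2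
    simp only [map_add, LinearMap.add_apply, h1, h2]
  intro q y hy
  refine loop_induction (C := fun Z => loopForm (loopBr (Finsupp.single p x)
    (Finsupp.single q y)) Z = loopForm (Finsupp.single p x) (loopBr (Finsupp.single q y) Z))
    (by simp) ?_ ?_ hZ
  · intro X X' h1 h2
    simp only [map_add, h1, h2]
  intro r z hz
  simp only [loopBr_single, loopForm_single, add_assoc, kap_inv hx hy hz]

lemma mem_affPar_zero {x : Aff k} : x ∈ affPar 0 ↔ x.1 ∈ loopSub (fun _ => matPar 0) := by
  simp [affPar, Submodule.mem_prod]

lemma mem_affPar_one {x : Aff k} :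
    x ∈ affPar 1 ↔ x.1 ∈ loopSub (fun _ => matPar 1) ∧ x.2.1 = 0 ∧ x.2.2 = 0 := by
  simp [affPar, Submodule.mem_prod, Prod.ext_iff]

lemma affBr_mem {i j : ZMod 2} {x y : Aff k} (hx : x ∈ affPar i) (hy : y ∈ affPar j) :
    affBr x y ∈ affPar (i + j) := by
  have h := loopBr_mem (N'' := fun _ => matPar (i + j)) (fun _ _ a ha b hb => matBr_mem ha hb) hx.1 hy.1
  have hDx := loopDeg_mem hx.1
  have hDy := loopDeg_mem hy.1
  have h11 : (1 : ZMod 2) + 1 = 0 := by decide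
  rcases zmod2 i with rfl | rfl <;> rcases zmod2 j with rfl | rfl <;>
    simp only [mem_affPar_zero, mem_affPar_one, h11, zero_add, add_zero] at hx hy h ⊢
  · exact sub_mem (add_mem h (Submodule.smul_mem _ _ hDy)) (Submodule.smul_mem _ _ hDx)
  · refine ⟨?_, ?_, rfl⟩
    · simp only [affBr_apply, hy.2.2, zero_smul, sub_zero]
      exact add_mem h (Submodule.smul_mem _ _ hDy)
    · exact loopForm_odd (by decide) hDx hy.1
  · refine ⟨?_, ?_, rfl⟩
    · simp only [affBr_apply, hx.2.2, zero_smul, add_zero]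
      exact sub_mem h (Submodule.smul_mem _ _ hDx)
    · exact loopForm_odd (by decide) hDx hy
  · simpa only [affBr_apply, hx.2.2, hy.2.2, zero_smul, add_zero, sub_zero] using h

/-- An element with a nonzero coefficient of `d` that is homogeneous is even. -/
lemma sgn_smul_snd {i : ZMod 2} {x : Aff k} (hx : x ∈ affPar i) (j : ZMod 2) :
    sgn i j * x.2.2 = x.2.2 := by
  rcases zmod2 i with rfl | rfl
  · simp [sgn]
  · rw [(mem_affPar_one.1 hx).2.2, mul_zero]

lemma affBr_skew {i j : ZMod 2} {x y : Aff k} (hx : x ∈ affPar i) (hy : y ∈ affPar j) :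
    affBr x y = -(sgn i j • affBr y x) := by
  have h1 := sgn_smul_snd hx j
  have h2 := sgn_smul_snd hy i
  rw [sgn_comm] at h2
  ext1
  · simp only [affBr_apply, Prod.fst_neg, Prod.smul_fst, smul_sub, smul_add, smul_smul, h1, h2]
    rw [loopBr_skew hx.1 hy.1]; abel
  · ext1
    · simp only [affBr_apply, Prod.snd_neg, Prod.smul_snd, Prod.fst_neg, Prod.smul_fst, smul_eq_mul]
      rw [loopForm_symm (loopDeg_mem hx.1) hy.1, loopForm_loopDeg y.1 x.1]; ring
    · simp [affBr_apply]

lemma affBr_jacobi {i j l : ZMod 2} {x y z : Aff k} (hx : x ∈ affPar i) (hy : y ∈ affPar j)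
    (hz : z ∈ affPar l) :
    affBr x (affBr y z) = affBr (affBr x y) z + sgn i j • affBr y (affBr x z) := by
  have h1 : ∀ j, sgn i j * x.2.2 = x.2.2 := sgn_smul_snd hx
  have h2 : ∀ i, sgn i j * y.2.2 = y.2.2 := fun i => by rw [sgn_comm, sgn_smul_snd hy]
  have e1 := loopBr_jacobi hx.1 hy.1 hz.1
  have e2 := loopBr_skew (loopDeg_mem hx.1) hy.1
  have c1 : loopForm (loopDeg x.1) (loopBr y.1 z.1) = loopForm (loopDeg (loopBr x.1 y.1)) z.1
      + sgn i j * loopForm (loopDeg y.1) (loopBr x.1 z.1) := by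
    have a1 := loopForm_inv (loopDeg_mem hx.1) hy.1 hz.1
    have a2 := loopForm_inv (loopDeg_mem hy.1) hx.1 hz.1
    have a3 := loopBr_skew hx.1 (loopDeg_mem hy.1)
    rw [← a1, ← a2, loopDeg_loopBr, map_add, LinearMap.add_apply, a3]
    simp
  have c2 := loopForm_symm (loopDeg_mem hx.1) (loopDeg_mem hy.1)
  have q1 : loopForm (loopDeg x.1) (loopDeg z.1) = - loopForm (loopDeg (loopDeg x.1)) z.1 := by
    rw [loopForm_loopDeg (loopDeg x.1)]; simp
  have q2 : loopForm (loopDeg y.1) (loopDeg z.1) = - loopForm (loopDeg (loopDeg y.1)) z.1 := by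
    rw [loopForm_loopDeg (loopDeg y.1)]; simp
  ext1
  · simp only [affBr_apply, Prod.fst_add, Prod.smul_fst, map_add, map_sub, map_smul,
      LinearMap.add_apply, LinearMap.sub_apply, LinearMap.smul_apply, zero_smul, sub_zero,
      add_zero, smul_add, smul_sub, smul_smul, loopDeg_loopBr]
    linear_combination (norm := module) e1 + z.2.2 • e2
      - (h1 j) • loopBr y.1 (loopDeg z.1) - (h1 j) • y.2.2 • loopDeg (loopDeg z.1)
      - (h2 i) • (loopBr (loopDeg x.1) z.1 + loopBr x.1 (loopDeg z.1)
        - z.2.2 • loopDeg (loopDeg x.1))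
  · ext1
    · simp only [affBr_apply, Prod.snd_add, Prod.fst_add, Prod.smul_snd, Prod.smul_fst, map_add,
        map_sub, map_smul, smul_eq_mul,
        LinearMap.add_apply, LinearMap.sub_apply, LinearMap.smul_apply]
      linear_combination c1 + y.2.2 * q1 - z.2.2 * c2 - x.2.2 * q2
        - (h1 j) * loopForm (loopDeg y.1) (loopDeg z.1)
    · simp [affBr_apply]

/-- `⁽ʲ⁾𝔤 = {x ∈ 𝔰𝔩(2k|2) | σ(x) = (-1)^j x}`. -/
def twPiece (j : ℤ) : Submodule ℂ (Mat k) :=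
  LinearMap.ker str ⊓ LinearMap.ker (sig - ((-1 : ℂ) ^ j) • LinearMap.id)

lemma mem_twPiece {j : ℤ} {x : Mat k} :
    x ∈ twPiece j ↔ str x = 0 ∧ sig x = ((-1 : ℂ) ^ j) • x := by
  simp [twPiece, sub_eq_zero]

lemma matBr_mem_twPiece (p q : ℤ) (x : Mat k) (hx : x ∈ twPiece p) (y : Mat k)
    (hy : y ∈ twPiece q) : matBr x y ∈ twPiece (p + q) := by
  rw [mem_twPiece] at hx hy ⊢
  refine ⟨str_matBr x y, ?_⟩
  rw [sig_matBr, hx.2, hy.2, map_smul, map_smul, LinearMap.smul_apply, smul_smul,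
    zpow_add₀ (by norm_num), mul_comm]

variable (k) in
/-- `⨁ j, ⁽ʲ⁾𝔤 ⊗ t^j ⊕ ℂc ⊕ ℂd` inside `Aff k`. -/
def twisted : Submodule ℂ (Aff k) := (loopSub twPiece).prod ⊤

lemma affBr_mem_twisted {x y : Aff k} (hx : x ∈ twisted k) (hy : y ∈ twisted k) :
    affBr x y ∈ twisted k := by
  refine ⟨?_, Submodule.mem_top⟩
  exact sub_mem (add_mem (loopBr_mem matBr_mem_twPiece hx.1 hy.1)
    (Submodule.smul_mem _ _ (loopDeg_mem hy.1))) (Submodule.smul_mem _ _ (loopDeg_mem hx.1))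

lemma oddPart_mem_twPiece {j : ℤ} {x : Mat k} (hx : x ∈ twPiece j) :
    oddPart x ∈ twPiece j := by
  rw [mem_twPiece] at hx ⊢
  refine ⟨?_, by rw [sig_oddPart, hx.2, map_smul]⟩
  rw [← Matrix.fromBlocks_toBlocks x, oddPart_fromBlocks, str_fromBlocks]; simp

lemma isCompl_twisted :
    IsCompl ((affPar 0).comap (twisted k).subtype) ((affPar 1).comap (twisted k).subtype) := by
  constructor
  · rw [Submodule.disjoint_def]
    rintro ⟨x, hx⟩ h0 h1
    rw [Submodule.mem_comap, Submodule.subtype_apply] at h0 h1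
    rw [mem_affPar_zero] at h0
    rw [mem_affPar_one] at h1
    ext1
    refine Prod.ext (Finsupp.ext fun p => ?_) (Prod.ext h1.2.1 h1.2.2)
    exact (mem_matPar_one.1 (h1.1 p)).symm.trans (mem_matPar_zero.1 (h0 p))
  · rw [codisjoint_iff, Submodule.eq_top_iff']
    rintro ⟨x, hx⟩
    obtain ⟨y, ho, e, e2⟩ : ∃ y ∈ twisted k, (∀ p, y.1 p = oddPart (x.1 p)) ∧ y.2 = 0 := by
      have e : ∀ p, (x.1.mapRange oddPart (map_zero _)) p = oddPart (x.1 p) := fun p => by simp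
      refine ⟨(x.1.mapRange oddPart (map_zero _), 0), ⟨fun p => ?_, Submodule.mem_top⟩, e, rfl⟩
      rw [e p]; exact oddPart_mem_twPiece (hx.1 p)
    rw [Submodule.mem_sup]
    refine ⟨⟨x - y, sub_mem hx ho⟩, ?_, ⟨y, ho⟩, ?_, Subtype.ext (sub_add_cancel x y)⟩
    · rw [Submodule.mem_comap, Submodule.subtype_apply, mem_affPar_zero]
      intro p
      rw [Prod.fst_sub, Finsupp.sub_apply, e p, mem_matPar_zero, map_sub, oddPart_oddPart, sub_self]
    · rw [Submodule.mem_comap, Submodule.subtype_apply, mem_affPar_one]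
      refine ⟨fun p => ?_, by rw [e2]; rfl, by rw [e2]; rfl⟩
      rw [e p, mem_matPar_one, oddPart_oddPart]

variable (k) in
/-- The twisted affine Lie superalgebra `A(2k-1,1)^{(2)}`. -/
def TwAff : Type := twisted k

instance : AddCommGroup (TwAff k) := inferInstanceAs (AddCommGroup (twisted k))

instance : Module ℂ (TwAff k) := inferInstanceAs (Module ℂ (twisted k))

variable (k) in
/-- The inclusion into `Aff k`. -/
def toAff : TwAff k →ₗ[ℂ] Aff k := (twisted k).subtype

/-- The element `∑ X_p ⊗ t^p + rc + sd`. -/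
def mkTw (X : ℤ →₀ Mat k) (r s : ℂ) (hX : ∀ p, X p ∈ twPiece p) : TwAff k :=
  ⟨(X, r, s), ⟨hX, Submodule.mem_top⟩⟩

lemma toAff_mkTw (X : ℤ →₀ Mat k) (r s : ℂ) (hX : ∀ p, X p ∈ twPiece p) :
    toAff k (mkTw X r s hX) = (X, r, s) := rfl

lemma toAff_injective : Function.Injective (toAff k) := Subtype.val_injective

lemma toAff_mem (x : TwAff k) (p : ℤ) : (toAff k x).1 p ∈ twPiece p := x.2.1 p

instance instTwAff : LieSuperalgebra (TwAff k) where
  par i := (affPar i).comap (toAff k)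
  isCompl_par := isCompl_twisted
  br := LinearMap.mk₂ ℂ (fun x y => ⟨affBr x.1 y.1, affBr_mem_twisted x.2 y.2⟩)
    (fun x y z => Subtype.ext (congrArg (fun f => f z.1) (map_add affBr x.1 y.1)))
    (fun c x z => Subtype.ext (congrArg (fun f => f z.1) (map_smul affBr c x.1)))
    (fun x y z => Subtype.ext (map_add (affBr x.1) y.1 z.1))
    (fun c x z => Subtype.ext (map_smul (affBr x.1) c z.1))
  br_mem hx hy := affBr_mem hx hy
  br_skew hx hy := Subtype.ext (affBr_skew hx hy)
  br_jacobi hx hy hz := Subtype.ext (affBr_jacobi hx hy hz)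

end Loops

/-! ### Representations and parabolic induction -/

section Representations

open scoped TensorProduct Pointwise

variable {L : Type} [AddCommGroup L] [Module ℂ L] [LieSuperalgebra L]

/-- A superspace `V = V₀ ⊕ V₁` with a linear action of a subalgebra `t`.
The module axioms are the predicate `SuperRep.IsModule`. -/
structure SuperRep (t : Submodule ℂ L) where
  V : Type
  [instGroup : AddCommGroup V]
  [instModule : Module ℂ V]
  vpar : ZMod 2 → Submodule ℂ V
  act : t →ₗ[ℂ] Module.End ℂ V

attribute [instance] SuperRep.instGroup SuperRep.instModule

/-- `𝔨^α = {x | [h, x] = α(h) x for all h ∈ 𝔥}`. -/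
def rootSpace (𝔥 : Submodule ℂ L) (α : Module.Dual ℂ 𝔥) : Submodule ℂ L where
  carrier := {x | ∀ h : 𝔥, br (h : L) x = α h • x}
  add_mem' hx hy h := by rw [map_add, hx h, hy h, smul_add]
  zero_mem' h := by simp
  smul_mem' c x hx h := by rw [map_smul, hx h, smul_comm]

/-- The root system with respect to `𝔥` (it contains `0` when `𝔥` is abelian and nonzero). -/
def roots (𝔥 : Submodule ℂ L) : Set (Module.Dual ℂ 𝔥) := {α | rootSpace 𝔥 α ≠ ⊥}

/-- `⨁_{α ∈ T} 𝔨^α`. -/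
def rootSum (𝔥 : Submodule ℂ L) (T : Set (Module.Dual ℂ 𝔥)) : Submodule ℂ L :=
  ⨆ α ∈ T, rootSpace 𝔥 α

/-- `P` is a parabolic subset of `Δ`. -/
def IsParabolic {E : Type*} [AddCommGroup E] (Δ P : Set E) : Prop :=
  Δ = P ∪ -P ∧ Δ ∩ (P + P) ⊆ P

namespace SuperRep

variable {t : Submodule ℂ L} (M : SuperRep t)

/-- `M` is a `ℤ/2`-graded module over the Lie superalgebra `t`. -/
def IsModule : Prop :=
  IsCompl (M.vpar 0) (M.vpar 1) ∧
  (∀ (i j : ZMod 2) (x : t) (v : M.V), (x : L) ∈ par i → v ∈ M.vpar j →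
    M.act x v ∈ M.vpar (i + j)) ∧
  (∀ (i j : ZMod 2) (x y z : t) (v : M.V), (x : L) ∈ par i → (y : L) ∈ par j →
    (z : L) = br (x : L) (y : L) →
    M.act z v = M.act x (M.act y v) - sgn i j • M.act y (M.act x v))

/-- Stability of a subspace under the action. -/
def IsInvariant (N : Submodule ℂ M.V) : Prop := ∀ (x : t), ∀ v ∈ N, M.act x v ∈ N

/-- Irreducibility: no invariant subspace, graded or not, except `0` and the whole space. -/
def IsIrreducible : Prop :=
  Nontrivial M.V ∧ ∀ N : Submodule ℂ M.V, M.IsInvariant N → N = ⊥ ∨ N = ⊤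

/-- The weight space `M^μ`. -/
def weightSpace (𝔥 : Submodule ℂ L) (μ : Module.Dual ℂ 𝔥) : Submodule ℂ M.V where
  carrier := {v | ∀ (x : t) (hx : (x : L) ∈ 𝔥), M.act x v = μ ⟨x, hx⟩ • v}
  add_mem' hv hw x hx := by rw [map_add, hv x hx, hw x hx, smul_add]
  zero_mem' x hx := by simp
  smul_mem' c v hv x hx := by rw [map_smul, hv x hx, smul_comm]

/-- The support `{μ | M^μ ≠ 0}`. -/
def supp (𝔥 : Submodule ℂ L) : Set (Module.Dual ℂ 𝔥) := {μ | M.weightSpace 𝔥 μ ≠ ⊥}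

/-- `M = ⨁_μ M^μ` with all `M^μ` finite dimensional. -/
def IsFiniteWeight (𝔥 : Submodule ℂ L) : Prop :=
  𝔥 ≤ t ∧ iSupIndep (M.weightSpace 𝔥) ∧ ⨆ μ, M.weightSpace 𝔥 μ = ⊤ ∧
    ∀ μ, FiniteDimensional ℂ (M.weightSpace 𝔥 μ)

/-- Irreducible finite weight modules. -/
def IsIrreducibleFiniteWeight (𝔥 : Submodule ℂ L) : Prop :=
  M.IsModule ∧ M.IsFiniteWeight 𝔥 ∧ M.IsIrreducible

/-- The nonzero elements of `𝔨^α` act locally nilpotently. -/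
def ActsLocallyNilpotently (𝔥 : Submodule ℂ L) (α : Module.Dual ℂ 𝔥) : Prop :=
  ∀ x : t, (x : L) ∈ rootSpace 𝔥 α → x ≠ 0 → ∀ v, ∃ n : ℕ, (M.act x ^ n) v = 0

/-- The nonzero elements of `𝔨^α` act injectively. -/
def ActsInjectively (𝔥 : Submodule ℂ L) (α : Module.Dual ℂ 𝔥) : Prop :=
  ∀ x : t, (x : L) ∈ rootSpace 𝔥 α → x ≠ 0 → Function.Injective (M.act x)

end SuperRep

/-- The relations `xy - (-1)^{|x||y|} yx = [x, y]` of the universal enveloping algebra. -/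
inductive EnvRel (t : Submodule ℂ L) : TensorAlgebra ℂ t → TensorAlgebra ℂ t → Prop
  | mk {i j : ZMod 2} {x y z : t} (hx : (x : L) ∈ par i) (hy : (y : L) ∈ par j)
      (hz : (z : L) = br (x : L) (y : L)) :
      EnvRel t
        (TensorAlgebra.ι ℂ x * TensorAlgebra.ι ℂ y)
        (sgn i j • (TensorAlgebra.ι ℂ y * TensorAlgebra.ι ℂ x) + TensorAlgebra.ι ℂ z)

/-- The universal enveloping algebra `U(t)` of a subalgebra `t`. -/
def Env (t : Submodule ℂ L) : Type := RingQuot (EnvRel t)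

instance (t : Submodule ℂ L) : Ring (Env t) := inferInstanceAs (Ring (RingQuot (EnvRel t)))

instance (t : Submodule ℂ L) : Algebra ℂ (Env t) :=
  inferInstanceAs (Algebra ℂ (RingQuot (EnvRel t)))

/-- The canonical map `t → U(t)`. -/
def envι (t : Submodule ℂ L) : t →ₗ[ℂ] Env t :=
  (show TensorAlgebra ℂ t →ₐ[ℂ] Env t from RingQuot.mkAlgHom ℂ (EnvRel t)).toLinearMap ∘ₗ
    TensorAlgebra.ι ℂ

section Induction

variable (t : Submodule ℂ L) {l : Submodule ℂ L} (n : Submodule ℂ L) (Ω : SuperRep l)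

/-- The kernel of `U(t) ⊗_ℂ Ω → U(t) ⊗_{U(l ⊕ n)} Ω`, where `n` acts on `Ω` by zero. -/
def balanced : Submodule (Env t) (Env t ⊗[ℂ] Ω.V) :=
  Submodule.span (Env t)
    ({m | ∃ (x : t) (hx : (x : L) ∈ l) (w : Ω.V),
        m = envι t x ⊗ₜ[ℂ] w - 1 ⊗ₜ[ℂ] Ω.act ⟨x, hx⟩ w} ∪
      {m | ∃ x : t, (x : L) ∈ n ∧ ∃ w : Ω.V, m = envι t x ⊗ₜ[ℂ] w})

/-- `U(t) ⊗_{U(l ⊕ n)} Ω`. -/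
abbrev GenVerma : Type := (Env t ⊗[ℂ] Ω.V) ⧸ balanced t n Ω

/-- `w ↦ 1 ⊗ w`. -/
def toGenVerma : Ω.V →ₗ[ℂ] GenVerma t n Ω :=
  ((balanced t n Ω).mkQ.restrictScalars ℂ) ∘ₗ TensorProduct.mk ℂ (Env t) Ω.V 1

/-- The submodules of `U(t) ⊗_{U(l ⊕ n)} Ω` that intersect `Ω` trivially. -/
def avoiding : Set (Submodule (Env t) (GenVerma t n Ω)) :=
  {N | N.restrictScalars ℂ ⊓ LinearMap.range (toGenVerma t n Ω) = ⊥}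

/-- The sum of all submodules intersecting `Ω` trivially; it is the largest one among them
exactly when it belongs to `avoiding`. -/
def maxAvoiding : Submodule (Env t) (GenVerma t n Ω) := sSup (avoiding t n Ω)

/-- The quotient of `U(t) ⊗_{U(l ⊕ n)} Ω` by `maxAvoiding`. -/
abbrev IndSpace : Type := GenVerma t n Ω ⧸ maxAvoiding t n Ω

/-- The canonical map from `Ω` to the quotient. -/
def toInd : Ω.V →ₗ[ℂ] IndSpace t n Ω :=
  ((maxAvoiding t n Ω).mkQ.restrictScalars ℂ) ∘ₗ toGenVerma t n Ω

/-- Homogeneous elements: generated from those of `Ω` by the action of those of `t`. -/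
inductive IndHom : ZMod 2 → IndSpace t n Ω → Prop
  | of {j : ZMod 2} {w : Ω.V} (hw : w ∈ Ω.vpar j) : IndHom j (toInd t n Ω w)
  | act {i j : ZMod 2} {x : t} {v : IndSpace t n Ω} (hx : (x : L) ∈ par i) (hv : IndHom j v) :
      IndHom (i + j) (envι t x • v)

/-- The induced representation as a representation of `t`. -/
def ind : SuperRep t where
  V := IndSpace t n Ω
  vpar j := Submodule.span ℂ {v | IndHom t n Ω j v}
  act := (Algebra.lsmul ℂ ℂ (IndSpace t n Ω)).toLinearMap ∘ₗ envι t

end Induction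

/-- `Ind_P(Ω)`, for a subalgebra `t ⊇ 𝔥`, a parabolic subset `P` of its root system, and a
module `Ω` over `⨁_{α ∈ P ∩ -P} 𝔨^α`. -/
def parInd {𝔥 : Submodule ℂ L} (t : Submodule ℂ L) (P : Set (Module.Dual ℂ 𝔥))
    (Ω : SuperRep (rootSum 𝔥 (P ∩ -P))) : SuperRep t :=
  ind t (rootSum 𝔥 (P \ -P)) Ω

/-- `U(t) ⊗_{U(𝔭)} Ω` has a largest submodule intersecting `Ω` trivially (and it is the one
factored out in `parInd`). -/
def parIndExists {𝔥 : Submodule ℂ L} (t : Submodule ℂ L) (P : Set (Module.Dual ℂ 𝔥))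
    (Ω : SuperRep (rootSum 𝔥 (P ∩ -P))) : Prop :=
  IsGreatest (avoiding t (rootSum 𝔥 (P \ -P)) Ω) (maxAvoiding t (rootSum 𝔥 (P \ -P)) Ω)

/-- The canonical map `Ω → Ind_P(Ω)` is an embedding of `⨁_{α ∈ P ∩ -P} 𝔨^α`-modules. -/
def parIndEmbeds {𝔥 : Submodule ℂ L} (t : Submodule ℂ L) (P : Set (Module.Dual ℂ 𝔥))
    (Ω : SuperRep (rootSum 𝔥 (P ∩ -P))) : Prop :=
  Function.Injective (toInd t (rootSum 𝔥 (P \ -P)) Ω) ∧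
  ∀ (x : t) (hx : (x : L) ∈ rootSum 𝔥 (P ∩ -P)) (w : Ω.V),
    (parInd t P Ω).act x (toInd t (rootSum 𝔥 (P \ -P)) Ω w) =
      toInd t (rootSum 𝔥 (P \ -P)) Ω (Ω.act ⟨x, hx⟩ w)

end Representations

/-! ### The standard Cartan subalgebra, weights and the form -/

section Cartan

variable (k : ℕ)

/-- The standard Cartan subalgebra `𝔥`: diagonal matrices in degree `0`, plus `ℂc ⊕ ℂd`. -/
def cartan : Submodule ℂ (TwAff k) where
  carrier := {x | (∀ p : ℤ, p ≠ 0 → (toAff k x).1 p = 0) ∧ ((toAff k x).1 0).IsDiag}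
  add_mem' hx hy := ⟨fun p hp => by
    simp [hx.1 p hp, hy.1 p hp], by simpa using hx.2.add hy.2⟩
  zero_mem' := ⟨fun p _ => rfl, Matrix.isDiag_zero⟩
  smul_mem' c x hx := ⟨fun p hp => by simp [hx.1 p hp], by simpa using hx.2.smul c⟩

/-- Weights: linear functionals on `𝔥`. -/
abbrev Wt : Type := Module.Dual ℂ (cartan k)

variable {k}

/-- The `(a, b)` entry of the coefficient at `t^0`. -/
def entry (a b : Idx k) : TwAff k →ₗ[ℂ] ℂ where
  toFun x := (toAff k x).1 0 a b
  map_add' x y := by simp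
  map_smul' c x := by simp

/-- The coefficient of `c`. -/
def cCoef : TwAff k →ₗ[ℂ] ℂ where
  toFun x := (toAff k x).2.1
  map_add' x y := by simp
  map_smul' c x := by simp

/-- The coefficient of `d`. -/
def dCoef : TwAff k →ₗ[ℂ] ℂ where
  toFun x := (toAff k x).2.2
  map_add' x y := by simp
  map_smul' c x := by simp

/-- The index of the basis vector of weight `ε i`. -/
def iE (i : Fin k) : Idx k := Sum.inl (Sum.inl i)

/-- The index of the basis vector of weight `δ₁`. -/
def iDp : Idx k := Sum.inr (Sum.inl 0)

/-- The index of the basis vector of weight `-δ₁`. -/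
def iDm : Idx k := Sum.inr (Sum.inr 0)

/-- The functional `ε_i` (indices start at `0`). -/
def ep (i : Fin k) : Wt k := entry (iE i) (iE i) ∘ₗ (cartan k).subtype

/-- The functional `δ₁`. -/
def dl : Wt k := entry iDp iDp ∘ₗ (cartan k).subtype

/-- The functional `δ`, with `δ(d) = 1`, zero on `c` and on matrices. -/
def im : Wt k := dCoef ∘ₗ (cartan k).subtype

/-- The functional with value `1` on `c`, zero on `d` and on matrices. -/
def Lam : Wt k := cCoef ∘ₗ (cartan k).subtype


/-- The diagonal matrix `diag(a, -a; b, -b)`. -/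
def diagMat (a : Fin k → ℂ) (b : ℂ) : Mat k :=
  Matrix.diagonal (Sum.elim (Sum.elim a (-a)) (Sum.elim (fun _ => b) (fun _ => -b)))

lemma diagMat_blocks (a : Fin k → ℂ) (b : ℂ) : diagMat a b =
    Matrix.fromBlocks
      (Matrix.fromBlocks (Matrix.diagonal a) 0 0 (Matrix.diagonal (-a))) 0 0
      (Matrix.fromBlocks (Matrix.diagonal fun _ => b) 0 0 (Matrix.diagonal fun _ => -b)) := by
  simp only [diagMat, Matrix.fromBlocks_diagonal]

lemma trace_fromBlocks' {p q : Type*} [Fintype p] [Fintype q] (A : Matrix p p ℂ) (B C)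
    (D : Matrix q q ℂ) : (Matrix.fromBlocks A B C D).trace = A.trace + D.trace := by
  simp [Matrix.trace]

lemma diagMat_mem (a : Fin k → ℂ) (b : ℂ) : diagMat a b ∈ twPiece (k := k) 0 := by
  rw [mem_twPiece, diagMat_blocks]
  constructor
  · simp only [str_fromBlocks, trace_fromBlocks']
    simp [Matrix.trace]
  · simp only [sig_apply, gram, gramInv, superTranspose_fromBlocks, Matrix.fromBlocks_multiply,
      LieAlgebra.Orthogonal.JD, Matrix.J, Matrix.fromBlocks_transpose, Matrix.fromBlocks_neg,
      Matrix.diagonal_transpose, zpow_zero, one_smul]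
    simp [Matrix.fromBlocks_multiply, Matrix.fromBlocks_neg, -Matrix.fromBlocks_diagonal]

/-- The element of `𝔥` with the given coordinates. -/
def hElt (a : Fin k → ℂ) (b r s : ℂ) : cartan k :=
  ⟨mkTw (Finsupp.single 0 (diagMat a b)) r s fun p => by
    by_cases hp : p = 0
    · subst hp; simpa using diagMat_mem a b
    · simp [Ne.symm hp],
   ⟨fun p hp => by rw [toAff_mkTw]; simp [hp], by
    rw [toAff_mkTw]; simp [diagMat]⟩⟩

lemma toAff_hElt (a : Fin k → ℂ) (b r s : ℂ) :
    toAff k (hElt a b r s) = (Finsupp.single 0 (diagMat a b), r, s) := rfl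

lemma sig_diagonal (u : Idx k → ℂ) (i : Idx k) :
    sig (Matrix.diagonal u) i i = -u (Sum.map Sum.swap Sum.swap i) := by
  have : Matrix.diagonal u = Matrix.fromBlocks
      (Matrix.fromBlocks (Matrix.diagonal fun i => u (Sum.inl (Sum.inl i))) 0 0
        (Matrix.diagonal fun i => u (Sum.inl (Sum.inr i)))) 0 0
      (Matrix.fromBlocks (Matrix.diagonal fun i => u (Sum.inr (Sum.inl i))) 0 0
        (Matrix.diagonal fun i => u (Sum.inr (Sum.inr i)))) := by
    simp only [Matrix.fromBlocks_diagonal]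
    congr 1
    ext ((i | i) | (i | i)) <;> rfl
  rw [this]
  simp only [sig_apply, gram, gramInv, superTranspose_fromBlocks, Matrix.fromBlocks_multiply,
      LieAlgebra.Orthogonal.JD, Matrix.J, Matrix.fromBlocks_transpose, Matrix.fromBlocks_neg,
      Matrix.diagonal_transpose]
  rcases i with (i | i) | (i | i) <;> simp [Matrix.fromBlocks_multiply]

lemma eq_hElt (h : cartan k) :
    h = hElt (fun i => ep i h) (dl h) (Lam h) (im h) := by
  refine Subtype.ext (toAff_injective ?_)
  rw [toAff_hElt]
  have hX0 := (mem_twPiece.1 (toAff_mem h.1 0)).2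
  obtain ⟨h1, h2⟩ := h.2
  rw [zpow_zero, one_smul] at hX0
  refine Prod.ext (Finsupp.ext fun p => ?_) rfl
  change (toAff k h.1).1 p = (Finsupp.single (0 : ℤ) (diagMat
    (fun i => (toAff k h.1).1 0 (iE i) (iE i)) ((toAff k h.1).1 0 iDp iDp))) p
  generalize (toAff k h.1).1 = X at *
  obtain ⟨u, hu⟩ : ∃ u, X 0 = Matrix.diagonal u := ⟨_, h2.diagonal_diag.symm⟩
  rw [hu] at hX0
  have key : ∀ i, u i = -u (Sum.map Sum.swap Sum.swap i) := fun i => by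
    rw [← sig_diagonal, hX0, Matrix.diagonal_apply_eq]
  by_cases hp : p = 0
  · subst hp
    rw [Finsupp.single_eq_same, hu, diagMat]
    congr 1
    ext ((i | i) | (i | i))
    · simp [iE]
    · simp [iE, key (Sum.inl (Sum.inr i))]
    · simp [iDp, Subsingleton.elim i 0]
    · rw [Subsingleton.elim i 0]; simp [iDp, key (Sum.inr (Sum.inr 0))]
  · rw [h1 p hp, Finsupp.single_apply, if_neg (Ne.symm hp)]

/-- The invariant form of the Lie superalgebra, restricted to `𝔥`. -/
def hForm (x y : cartan k) : ℂ := affForm (toAff k x) (toAff k y)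

lemma hForm_hElt (a a' : Fin k → ℂ) (b b' r r' s s' : ℂ) :
    hForm (hElt a b r s) (hElt a' b' r' s') = ∑ i, a i * a' i - b * b' + r * s' + s * r' := by
  simp only [hForm, affForm, toAff_hElt, loopForm_single, add_zero, if_true, kap_apply, diagMat,
    Matrix.diagonal_mul_diagonal]
  simp only [str, Matrix.trace, LinearMap.coe_mk, AddHom.coe_mk, Matrix.toBlocks₁₁,
    Matrix.toBlocks₂₂, Matrix.diag, Matrix.of_apply, Matrix.diagonal_apply_eq]
  simp
  ring

lemma diagMat_add (a a' : Fin k → ℂ) (b b' : ℂ) :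
    diagMat (a + a') (b + b') = diagMat a b + diagMat a' b' := by
  simp only [diagMat, Matrix.diagonal_add]
  congr 1
  ext ((i | i) | (i | i)) <;> simp [add_comm]

lemma diagMat_smul (c : ℂ) (a : Fin k → ℂ) (b : ℂ) :
    diagMat (c • a) (c * b) = c • diagMat a b := by
  rw [diagMat, diagMat, ← Matrix.diagonal_smul]
  congr 1
  ext ((i | i) | (i | i)) <;> simp

/-- Coordinates on `𝔥`. -/
def hLin : ((Fin k → ℂ) × ℂ × ℂ × ℂ) →ₗ[ℂ] cartan k where
  toFun u := hElt u.1 u.2.1 u.2.2.1 u.2.2.2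
  map_add' u v := by
    refine Subtype.ext (toAff_injective ?_)
    rw [Submodule.coe_add, map_add, toAff_hElt, toAff_hElt, toAff_hElt, Prod.fst_add,
      Prod.snd_add, Prod.fst_add, diagMat_add, Finsupp.single_add]
    rfl
  map_smul' c u := by
    refine Subtype.ext (toAff_injective ?_)
    rw [Submodule.coe_smul, map_smul, toAff_hElt, toAff_hElt, Prod.smul_fst, Prod.smul_snd,
      Prod.smul_fst, smul_eq_mul, diagMat_smul, ← Finsupp.smul_single]
    rfl

lemma existsUnique_dual (α : Wt k) : ∃! t : cartan k, ∀ h, α h = hForm t h := by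
  have dec : ∀ (a : Fin k → ℂ) (b r s : ℂ), α (hElt a b r s) =
      ∑ i, α (hElt (Pi.single i 1) 0 0 0) * a i + b * α (hElt 0 1 0 0) + r * α (hElt 0 0 1 0)
        + s * α (hElt 0 0 0 1) := by
    intro a b r s
    have h1 : ((a, b, r, s) : (Fin k → ℂ) × ℂ × ℂ × ℂ) =
        ∑ i, a i • ((Pi.single i 1, 0, 0, 0) : (Fin k → ℂ) × ℂ × ℂ × ℂ) + b • (0, 1, 0, 0)
          + r • (0, 0, 1, 0) + s • (0, 0, 0, 1) := by
      refine Prod.ext ?_ (Prod.ext ?_ (Prod.ext ?_ ?_))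
      · ext j; simp [Prod.fst_sum, Finset.sum_apply, Pi.single_apply]
      · simp [Prod.snd_sum]
      · simp [Prod.snd_sum]
      · simp [Prod.snd_sum]
    have h2 := congrArg (fun u => α (hLin u)) h1
    simp only [map_add, map_sum, map_smul, smul_eq_mul] at h2
    refine h2.trans ?_
    simp only [hLin, LinearMap.coe_mk, AddHom.coe_mk, mul_comm]
  refine ⟨hElt (fun i => α (hElt (Pi.single i 1) 0 0 0)) (-α (hElt 0 1 0 0))
    (α (hElt 0 0 0 1)) (α (hElt 0 0 1 0)), fun h => ?_, fun t ht => ?_⟩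
  · rw [eq_hElt h, hForm_hElt, dec]; ring
  · have q : ∀ a b r s, α (hElt a b r s) = ∑ i, ep i t * a i - dl t * b + Lam t * s + im t * r :=
      fun a b r s => by rw [ht, eq_hElt t, hForm_hElt, ← eq_hElt t]
    conv_lhs => rw [eq_hElt t]
    have e1 : ∀ i, α (hElt (Pi.single i 1) 0 0 0) = ep i t := fun i => by
      rw [q]; simp [Pi.single_apply]
    have e2 : -α (hElt 0 1 0 0) = dl t := by rw [q]; simp
    have e3 : α (hElt 0 0 0 1) = Lam t := by rw [q]; simp
    have e4 : α (hElt 0 0 1 0) = im t := by rw [q]; simp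
    simp only [e1, e2, e3, e4]

/-- The element `t_α ∈ 𝔥` with `α(h) = (t_α, h)` for all `h ∈ 𝔥`. -/
def tElt (α : Wt k) : cartan k := (existsUnique_dual α).choose

/-- The form on `𝔥*` transferred from `𝔥`. -/
def wtForm (α β : Wt k) : ℂ := hForm (tElt α) (tElt β)

/-- The canonical central element `c`, as an element of `𝔥`. -/
def cElt : cartan k := hElt 0 0 1 0

/-- The derivation `d`, as an element of `𝔥`. -/
def dElt : cartan k := hElt 0 0 0 1

end Cartan

/-! ### The parabolic subsets and the modules of the example -/

section Example

open scoped Pointwise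

variable (k : ℕ)

/-- `{0, ε_k ± δ₁, ±2δ₁}`. -/
def P1 : Set (Wt k) :=
  {0} ∪ {α | ∃ i : Fin k, (i : ℕ) + 1 = k ∧ ∃ s : ℤˣ, α = ep i + (s : ℤ) • dl} ∪
    {α | ∃ s : ℤˣ, α = (2 * s : ℤ) • dl}

/-- `{0} ∪ {ε_i ± ε_j | i < j} ∪ {ε_i ± δ₁ | i < k} ∪ {±ε_k ± δ₁} ∪ {±2δ₁}`. -/
def P2 : Set (Wt k) :=
  {0} ∪ {α | ∃ i j : Fin k, i < j ∧ ∃ s : ℤˣ, α = ep i + (s : ℤ) • ep j} ∪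
    {α | ∃ i : Fin k, (i : ℕ) + 1 < k ∧ ∃ s : ℤˣ, α = ep i + (s : ℤ) • dl} ∪
    {α | ∃ i : Fin k, (i : ℕ) + 1 = k ∧ ∃ s s' : ℤˣ, α = (s : ℤ) • ep i + (s' : ℤ) • dl} ∪
    {α | ∃ s : ℤˣ, α = (2 * s : ℤ) • dl}

/-- The roots whose coefficient at `δ` is nonnegative. -/
def P3 : Set (Wt k) :=
  {α | ∃ n : ℕ, α = n • im} ∪
    {α | ∃ i j : Fin k, i ≠ j ∧ ∃ (s s' : ℤˣ) (n : ℕ),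
      α = (s : ℤ) • ep i + (s' : ℤ) • ep j + n • im} ∪
    {α | ∃ (i : Fin k) (s : ℤˣ) (n : ℕ), α = (2 * s : ℤ) • ep i + (2 * n + 1) • im} ∪
    {α | ∃ (s : ℤˣ) (n : ℕ), α = (2 * s : ℤ) • dl + (2 * n) • im} ∪
    {α | ∃ (i : Fin k) (s s' : ℤˣ) (n : ℕ), α = (s : ℤ) • ep i + (s' : ℤ) • dl + n • im}

/-- `R(1) = 2ℤδ ∪ (±2δ₁ + 2ℤδ)`. -/
def R1 : Set (Wt k) :=
  {α | ∃ n : ℤ, α = (2 * n) • im} ∪ {α | ∃ (s : ℤˣ) (n : ℤ), α = (2 * s : ℤ) • dl + (2 * n) • im}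

/-- `R(2) = ℤδ ∪ ({±ε_i ± ε_j | i ≠ j} + ℤδ) ∪ ({±2ε_i} + (2ℤ+1)δ)`, for `k ≥ 2`. -/
def R2 : Set (Wt k) :=
  {α | ∃ n : ℤ, α = n • im} ∪
    {α | ∃ i j : Fin k, i ≠ j ∧ ∃ (s s' : ℤˣ) (n : ℤ),
      α = (s : ℤ) • ep i + (s' : ℤ) • ep j + n • im} ∪
    {α | ∃ (i : Fin k) (s : ℤˣ) (n : ℤ), α = (2 * s : ℤ) • ep i + (2 * n + 1) • im}

/-- `S(1) = ℤδ ∪ R(1) ∪ (R ∩ ½R(1))`. -/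
def S1 : Set (Wt k) :=
  {α | ∃ n : ℤ, α = n • im} ∪ R1 k ∪ {α | α ∈ roots (cartan k) ∧ (2 : ℤ) • α ∈ R1 k}

/-- `S(2) = ℤδ ∪ R(2) ∪ (R ∩ ½R(2))`. -/
def S2 : Set (Wt k) :=
  {α | ∃ n : ℤ, α = n • im} ∪ R2 k ∪ {α | α ∈ roots (cartan k) ∧ (2 : ℤ) • α ∈ R2 k}

variable {k}

/-- `S^{ln}(M)`. -/
def lnSet {t : Submodule ℂ (TwAff k)} (M : SuperRep t) (S : Set (Wt k)) : Set (Wt k) :=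
  {α | α ∈ S ∧ wtForm α α ≠ 0 ∧ M.ActsLocallyNilpotently (cartan k) α}

/-- `S^{in}(M)`. -/
def inSet {t : Submodule ℂ (TwAff k)} (M : SuperRep t) (S : Set (Wt k)) : Set (Wt k) :=
  {α | α ∈ S ∧ wtForm α α ≠ 0 ∧ M.ActsInjectively (cartan k) α}

/-- A set `S` of roots is tight for `M`. -/
def IsTight {t : Submodule ℂ (TwAff k)} (M : SuperRep t) (S : Set (Wt k)) : Prop :=
  ∃ α ∈ S, wtForm α α ≠ 0 ∧
    ({β | ∃ n : ℤ, β = α + n • im} ∩ S ⊆ lnSet M S ∨ {β | ∃ n : ℤ, β = α + n • im} ∩ S ⊆ inSet M S)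

/-- A set `S` of roots is hybrid for `M`. -/
def IsHybrid {t : Submodule ℂ (TwAff k)} (M : SuperRep t) (S : Set (Wt k)) : Prop := ¬IsTight M S

/-- `2`-quasi-integrability: `S(1)` is hybrid and the real roots of `S(2)` act locally
nilpotently. -/
def IsTwoQuasiIntegrable (M : SuperRep (⊤ : Submodule ℂ (TwAff k))) : Prop :=
  M.IsIrreducibleFiniteWeight (cartan k) ∧ IsHybrid M (S1 k) ∧
    ∀ α ∈ S2 k ∩ roots (cartan k), wtForm α α ≠ 0 → α ∈ lnSet M (roots (cartan k))

/-- `M` is a highest weight module with respect to some positive system, that is, some parabolic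
subset `P` of the root system with `P ∩ -P = {0}`: it is generated by a nonzero weight vector
annihilated by all root spaces of nonzero roots in `P`. -/
def IsHighestWeight (M : SuperRep (⊤ : Submodule ℂ (TwAff k))) : Prop :=
  ∃ P : Set (Wt k), IsParabolic (roots (cartan k)) P ∧ P ∩ -P = {0} ∧
    ∃ (μ : Wt k) (v : M.V), v ≠ 0 ∧ v ∈ M.weightSpace (cartan k) μ ∧
      (∀ α ∈ P, α ≠ 0 → ∀ x : (⊤ : Submodule ℂ (TwAff k)), (x : TwAff k) ∈ rootSpace (cartan k) α →
        M.act x v = 0) ∧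
      ∀ N : Submodule ℂ M.V, M.IsInvariant N → v ∈ N → N = ⊤

variable (k)

/-- `𝓑₁`, with root system `{0, ±2δ₁}`. -/
abbrev B1 : Submodule ℂ (TwAff k) := rootSum (cartan k) (P1 k ∩ -P1 k)

/-- `𝓑₂`, with root system `P₂ ∩ -P₂`. -/
abbrev B2 : Submodule ℂ (TwAff k) := rootSum (cartan k) (P2 k ∩ -P2 k)

/-- `𝓑₃`, with root system `P₃ ∩ -P₃`. -/
abbrev B3 : Submodule ℂ (TwAff k) := rootSum (cartan k) (P3 k ∩ -P3 k)

/-- The linear functional on `𝔥` with `c ↦ 2k+2`, `d ↦ 0`, `t_{2δ₁} ↦ -2μ` and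
`t_{ε_i} ↦ k-i+2` (`1 ≤ i ≤ k`, whereas indices start at `0` here), extended by zero to
the other matrix entries. -/
def topFun (μ : ℂ) : TwAff k →ₗ[ℂ] ℂ :=
  (2 * k + 2 : ℂ) • cCoef + ∑ i : Fin k, ((k : ℂ) - (i : ℕ) + 1) • entry (iE i) (iE i) +
    μ • entry iDp iDp

/-- The weight `ϱ`. -/
def rho (ζ : ℂ) : Wt k := topFun k ζ ∘ₗ (cartan k).subtype

variable {k}

/-- The image of `v_μ`, `μ = ζ + 2n`, under `x`, where `v_{ζ+2n}` is `Finsupp.single n 1`;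
the coefficients of `e` and `f` in `x` are read off from matrix entries. -/
def K1fun (ζ ξ : ℂ) (e f x : TwAff k) (n : ℤ) : ℤ →₀ ℂ :=
  Finsupp.single n (topFun k (ζ + 2 * n) x) +
    Finsupp.single (n + 1) (entry iDp iDm x / entry iDp iDm e) +
    Finsupp.single (n - 1) (entry iDm iDp x / entry iDm iDp f *
      (-(1 / 2) * (ξ - (ζ + 2 * n - 1) ^ 2)))

lemma K1fun_add (ζ ξ : ℂ) (e f x y : TwAff k) :
    K1fun ζ ξ e f (x + y) = K1fun ζ ξ e f x + K1fun ζ ξ e f y := by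
  funext n
  simp only [K1fun, Pi.add_apply, map_add, Finsupp.single_add, add_div, add_mul]
  abel

lemma K1fun_smul (ζ ξ : ℂ) (e f : TwAff k) (c : ℂ) (x : TwAff k) :
    K1fun ζ ξ e f (c • x) = c • K1fun ζ ξ e f x := by
  funext n
  simp only [K1fun, Pi.smul_apply, map_smul, smul_add, Finsupp.smul_single, smul_eq_mul,
    mul_div_assoc, mul_assoc]

/-- The module `K₁` with basis `{v_μ | μ ∈ ζ + 2ℤ}`, `v_{ζ+2n}` being `Finsupp.single n 1`;
it is purely even. -/
def K1 (ζ ξ : ℂ) (e f : TwAff k) : SuperRep (B1 k) where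
  V := ℤ →₀ ℂ
  vpar i := if i = 0 then ⊤ else ⊥
  act :=
    { toFun := fun x => Finsupp.linearCombination ℂ (K1fun ζ ξ e f x)
      map_add' := fun x y => by
        ext n : 2
        simp [K1fun_add]
      map_smul' := fun c x => by
        ext n : 2
        simp [K1fun_smul] }

/-- `K₂ = Ind_{P₁}(K₁)`, over `𝓑₂`. -/
def K2 (ζ ξ : ℂ) (e f : TwAff k) : SuperRep (B2 k) := parInd (B2 k) (P1 k) (K1 ζ ξ e f)

/-- `K₃ = Ind_{P₂}(K₂)`, over `𝓑₃`. -/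
def K3 (ζ ξ : ℂ) (e f : TwAff k) : SuperRep (B3 k) := parInd (B3 k) (P2 k) (K2 ζ ξ e f)

/-- `K₄ = Ind_{P₃}(K₃)`, over the whole of `A(2k-1,1)^{(2)}`. -/
def K4 (ζ ξ : ℂ) (e f : TwAff k) : SuperRep (⊤ : Submodule ℂ (TwAff k)) :=
  parInd ⊤ (P3 k) (K3 ζ ξ e f)

end Example

end SuperAffine

end

open SuperAffine SuperAffine.LieSuperalgebra
open scoped Pointwise

noncomputable section

namespace SuperAffine

open LieSuperalgebra
open scoped TensorProduct Pointwise

set_option linter.unusedSectionVars false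

/-! ### Root spaces, parity, and gradings by an element of the Cartan subalgebra. -/

section RootSpaces

variable {L : Type} [AddCommGroup L] [Module ℂ L] [LieSuperalgebra L]

/-! Each parabolic subset is the set of roots that are nonnegative on one element of `𝔥` with
integral values on the roots: `dElt` for `P₃`, `hTwo` for `P₂`, `hOne` for `P₁`. So the three
inductions are instances of one statement about a subalgebra graded by some `h0`, namely
`parInd_isIrreducibleFiniteWeight`. Its key hypothesis is that `h0` acts on the inducing module `Ω`
by a scalar `a`. Root vectors of negative degree lower the eigenvalue of `h0` by positive integers,
so the generalized Verma module is `Ω` plus eigenspaces for `a-1, a-2, …`. A submodule is stable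
under `h0`; if it avoids `Ω` it lies in the lower eigenspaces, and therefore so does the sum of all
such submodules: this is the largest one. Irreducibility follows by pulling a submodule back to the
Verma module, and weight spaces are finite dimensional because only finitely many words in lowering
root vectors have a given degree. That `Ω` embeds is proved without a PBW theorem
(`toGenVerma_injective`). On words in lowering root vectors applied to `Ω` the whole algebra acts so
that all relations hold except those between two lowering vectors. The subspace generated by the
failures of these is a submodule, by the super Jacobi identity, and it is killed by the projection
onto the empty words. Hence `Ω` survives in the quotient. `K₁` is irreducible because `e` is a shift
and the coefficients of `f` never vanish: `ξ` is irrational, whereas `(ζ+2n-1)²` is rational. For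
the local nilpotency in `M`, `v_ζ` is killed by every root vector that is positive on `hPhi 1`, an
element of `𝔥` whose only root zeros are `0, ±2δ₁`. The roots `εᵢ - εᵢ₊₁` and `δ - 2ε₁` have degree
one for it, and the weight of `v_ζ` takes the values `1` and `0` on their coroots. For `εₖ₋₁ + εₖ`
the extremal vector has to be changed: applying the odd root vectors of `-εₖ ± δ₁` gives a vector
extremal for `hPhi (-1)`, where the value on the coroot is still at least `3`. In each case
`𝔰𝔩₂`-theory (`IsSl2Pair.pow_act_eq_zero`) makes the root vectors of both signs nilpotent on one
nonzero vector, hence locally nilpotent by irreducibility, so the support is stable under the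
reflections (`isWeylStable_supp`). The support is bounded above for `hPhi 1`, so it is left along
every positive direction; reflections carry this to all real roots `±εᵢ ± εⱼ + nδ` and `±2εᵢ +
(2n+1)δ`, and leaving the support means nilpotency (`locallyNilpotent_S2`). Root vectors for `±2δ₁`
are never nilpotent on `v_ζ`, since they act injectively on the embedded `K₁`, whereas those for
`±2δ₁ + 2δ` kill it. This makes `S(1)` hybrid. A highest weight vector would be killed by a root
vector for `2δ₁` or `-2δ₁`, which would then be locally nilpotent on the irreducible module `M`: a
contradiction. -/

lemma exists_par_add (x : L) : ∃ x0 ∈ par (L := L) 0, ∃ x1 ∈ par (L := L) 1, x = x0 + x1 := by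
  have h : x ∈ par (L := L) 0 ⊔ par 1 := by
    rw [(isCompl_par (L := L)).sup_eq_top]; exact Submodule.mem_top
  obtain ⟨y, hy, z, hz, e⟩ := Submodule.mem_sup.1 h
  exact ⟨y, hy, z, hz, e.symm⟩

lemma sgn_zero_left (j : ZMod 2) : sgn 0 j = 1 := by simp [sgn]

lemma sgn_zero_right (j : ZMod 2) : sgn j 0 = 1 := by simp [sgn]

/-- With an even left argument all signs are `1`, so the identity extends linearly to inhomogeneous
`y`, `z`. Weights of brackets can thus be computed without reference to parities. -/
lemma br_jacobi_even {h : L} (hh : h ∈ par (L := L) 0) (y z : L) :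
    br h (br y z) = br (br h y) z + br y (br h z) := by
  obtain ⟨y0, hy0, y1, hy1, rfl⟩ := exists_par_add y
  obtain ⟨z0, hz0, z1, hz1, rfl⟩ := exists_par_add z
  simp only [map_add, LinearMap.add_apply]
  rw [br_jacobi hh hy0 hz0, br_jacobi hh hy0 hz1, br_jacobi hh hy1 hz0, br_jacobi hh hy1 hz1]
  simp only [sgn_zero_left, one_smul]
  abel

/-- `𝔥` is even and abelian, and every root space is homogeneous, of parity `p α`. -/
structure IsHomogeneousCartan (𝔥 : Submodule ℂ L) (p : Module.Dual ℂ 𝔥 → ZMod 2) : Prop where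
  even : 𝔥 ≤ par 0
  abelian : ∀ h ∈ 𝔥, ∀ h' ∈ 𝔥, br h h' = 0
  homog : ∀ α, rootSpace 𝔥 α ≤ par (p α)

variable {𝔥 : Submodule ℂ L} {p : Module.Dual ℂ 𝔥 → ZMod 2}

lemma mem_rootSpace {α : Module.Dual ℂ 𝔥} {x : L} :
    x ∈ rootSpace 𝔥 α ↔ ∀ h : 𝔥, br (h : L) x = α h • x := Iff.rfl

lemma IsHomogeneousCartan.le_rootSpace (H : IsHomogeneousCartan 𝔥 p) : 𝔥 ≤ rootSpace 𝔥 0 :=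
  fun x hx h => by rw [H.abelian _ h.2 _ hx]; simp

lemma IsHomogeneousCartan.br_mem_rootSpace (H : IsHomogeneousCartan 𝔥 p)
    {α β : Module.Dual ℂ 𝔥} {x y : L}
    (hx : x ∈ rootSpace 𝔥 α) (hy : y ∈ rootSpace 𝔥 β) : br x y ∈ rootSpace 𝔥 (α + β) := by
  intro h
  rw [br_jacobi_even (H.even h.2), hx h, hy h, map_smul, map_smul, LinearMap.smul_apply,
    LinearMap.add_apply, add_smul]

lemma eq_zero_of_not_mem_roots {α : Module.Dual ℂ 𝔥} (hα : α ∉ roots 𝔥) {x : L}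
    (hx : x ∈ rootSpace 𝔥 α) : x = 0 := by
  have : rootSpace 𝔥 α = ⊥ := by simpa [roots] using hα
  rwa [this, Submodule.mem_bot] at hx

lemma rootSpace_le_rootSum {T : Set (Module.Dual ℂ 𝔥)} {α} (hα : α ∈ T) :
    rootSpace 𝔥 α ≤ rootSum 𝔥 T := le_biSup (rootSpace 𝔥) hα

lemma rootSum_mono {S T : Set (Module.Dual ℂ 𝔥)} (h : S ⊆ T) : rootSum 𝔥 S ≤ rootSum 𝔥 T :=
  biSup_mono fun _ hα => h hα

lemma rootSum_le {T : Set (Module.Dual ℂ 𝔥)} {N : Submodule ℂ L}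
    (h : ∀ α ∈ T, rootSpace 𝔥 α ≤ N) : rootSum 𝔥 T ≤ N := iSup₂_le h

lemma rootSum_union (S T : Set (Module.Dual ℂ 𝔥)) :
    rootSum 𝔥 (S ∪ T) = rootSum 𝔥 S ⊔ rootSum 𝔥 T := by
  simp only [rootSum, iSup_union]

/-- To check that all elements of `t` lying in `⨁_{α ∈ T} 𝔨^α` belong to a subspace it is enough
to consider root vectors. -/
lemma mem_of_rootSum {t : Submodule ℂ L} {T : Set (Module.Dual ℂ 𝔥)} (hT : rootSum 𝔥 T ≤ t)
    (N : Submodule ℂ t) (h : ∀ α ∈ T, ∀ x : t, (x : L) ∈ rootSpace 𝔥 α → x ∈ N)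
    (x : t) (hx : (x : L) ∈ rootSum 𝔥 T) : x ∈ N := by
  have h1 : rootSum 𝔥 T ≤ N.map t.subtype := by
    refine rootSum_le fun α hα y hy => ?_
    have hyt : y ∈ t := hT (rootSpace_le_rootSum hα hy)
    exact ⟨⟨y, hyt⟩, h α hα ⟨y, hyt⟩ hy, rfl⟩
  obtain ⟨y, hy, e⟩ := h1 hx
  rwa [← Subtype.ext (a1 := y) (a2 := x) e]

/-- Root spaces are homogeneous, so `T` splits by parity. The component of the wrong parity is a
difference of two elements of `par i`, hence lies in both `par 0` and `par 1` and vanishes. -/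
lemma IsHomogeneousCartan.rootSum_inf_par_le (H : IsHomogeneousCartan 𝔥 p)
    (T : Set (Module.Dual ℂ 𝔥)) (i : ZMod 2) :
    rootSum 𝔥 T ⊓ par i ≤ rootSum 𝔥 {α ∈ T | p α = i} := by
  rintro x ⟨hx, hxi⟩
  have hT : T = {α ∈ T | p α = i} ∪ {α ∈ T | p α = i + 1} := by
    ext α
    have : p α = i ∨ p α = i + 1 := by
      have hij : ∀ i j : ZMod 2, j = i ∨ j = i + 1 := by decide
      exact hij _ _
    simp only [Set.mem_union, Set.mem_ofPred_eq]
    tauto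
  rw [hT, rootSum_union] at hx
  obtain ⟨y, hy, z, hz, rfl⟩ := Submodule.mem_sup.1 hx
  have hyi : y ∈ par i := rootSum_le (N := par i) (fun α hα => by
    have := H.homog α; rwa [hα.2] at this) hy
  have hzi : z ∈ par (i + 1) := rootSum_le (N := par (i + 1)) (fun α hα => by
    have := H.homog α; rwa [hα.2] at this) hz
  have hzi' : z ∈ par i := by simpa using sub_mem hxi hyi
  have hz0 : z = 0 := by
    have hd := (isCompl_par (L := L)).disjoint
    have h11 : (1 : ZMod 2) + 1 = 0 := by decide
    rcases zmod2 i with rfl | rfl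
    · exact (Submodule.disjoint_def.1 hd) z hzi' (by simpa using hzi)
    · exact (Submodule.disjoint_def.1 hd) z (by simpa [h11] using hzi) hzi'
  rw [hz0, add_zero]; exact hy

/-- Data for a parabolic decomposition: `t = ⨁_{α ∈ T} 𝔨^α`, where `T` is closed and takes integer
values at `h0 ∈ 𝔥`. -/
structure GradedBy (𝔥 t : Submodule ℂ L) (T : Set (Module.Dual ℂ 𝔥)) (h0 : 𝔥) : Prop where
  eq_rootSum : t = rootSum 𝔥 T
  zero_mem : 0 ∈ T
  closed : ∀ α ∈ T, ∀ β ∈ T, α + β ∈ roots 𝔥 → α + β ∈ T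
  int : ∀ α ∈ T, ∃ n : ℤ, α h0 = n

variable (T : Set (Module.Dual ℂ 𝔥)) (h0 : 𝔥)

/-- The elements of `T` of degree zero. -/
def degZero : Set (Module.Dual ℂ 𝔥) := {α | α ∈ T ∧ α h0 = 0}

/-- The elements of `T` of positive degree. -/
def degPos : Set (Module.Dual ℂ 𝔥) := {α | α ∈ T ∧ ∃ n : ℕ, α h0 = n + 1}

/-- The elements of `T` of negative degree. -/
def degNeg : Set (Module.Dual ℂ 𝔥) := {α | α ∈ T ∧ ∃ n : ℕ, α h0 = -(n + 1)}

variable {T h0}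

variable {t : Submodule ℂ L}

lemma GradedBy.cases (D : GradedBy 𝔥 t T h0) {α} (hα : α ∈ T) :
    α ∈ degZero T h0 ∪ degPos T h0 ∨ α ∈ degNeg T h0 := by
  obtain ⟨n, hn⟩ := D.int α hα
  rcases lt_trichotomy n 0 with h | h | h
  · obtain ⟨m, rfl⟩ : ∃ m : ℕ, n = -(m + 1) := ⟨(-n - 1).toNat, by omega⟩
    exact Or.inr ⟨hα, m, by rw [hn]; push_cast; ring⟩
  · exact Or.inl (Or.inl ⟨hα, by rw [hn, h]; simp⟩)
  · obtain ⟨m, rfl⟩ : ∃ m : ℕ, n = m + 1 := ⟨(n - 1).toNat, by omega⟩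
    exact Or.inl (Or.inr ⟨hα, m, by rw [hn]; push_cast; ring⟩)

lemma degGe_iff {α} : α ∈ degZero T h0 ∪ degPos T h0 ↔ α ∈ T ∧ ∃ n : ℕ, α h0 = n := by
  constructor
  · rintro (⟨h, h'⟩ | ⟨h, n, h'⟩)
    · exact ⟨h, 0, by simp [h']⟩
    · exact ⟨h, n + 1, by simp [h']⟩
  · rintro ⟨h, n, h'⟩
    rcases n with _ | n
    · exact Or.inl ⟨h, by simpa using h'⟩
    · exact Or.inr ⟨h, n, by simpa using h'⟩

lemma add_mem_degGe (D : GradedBy 𝔥 t T h0) {α β} (hα : α ∈ degZero T h0 ∪ degPos T h0)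
    (hβ : β ∈ degZero T h0 ∪ degPos T h0) (h : α + β ∈ roots 𝔥) :
    α + β ∈ degZero T h0 ∪ degPos T h0 := by
  rw [degGe_iff] at *
  obtain ⟨h1, n, h2⟩ := hα
  obtain ⟨h3, m, h4⟩ := hβ
  exact ⟨D.closed _ h1 _ h3 h, n + m, by simp [h2, h4]⟩

lemma add_mem_degNeg (D : GradedBy 𝔥 t T h0) {α β} (hα : α ∈ degNeg T h0)
    (hβ : β ∈ degNeg T h0) (h : α + β ∈ roots 𝔥) : α + β ∈ degNeg T h0 := by
  obtain ⟨h1, n, h2⟩ := hα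
  obtain ⟨h3, m, h4⟩ := hβ
  exact ⟨D.closed _ h1 _ h3 h, n + m + 1, by simp [h2, h4]; ring⟩

lemma degNeg_subset : degNeg T h0 ⊆ T := fun _ h => h.1

lemma degGe_subset : degZero T h0 ∪ degPos T h0 ⊆ T := fun _ h => h.elim (·.1) (·.1)

lemma GradedBy.mem_t (D : GradedBy 𝔥 t T h0) {α} (hα : α ∈ T) {x : L}
    (hx : x ∈ rootSpace 𝔥 α) : x ∈ t := by
  rw [D.eq_rootSum]; exact rootSpace_le_rootSum hα hx

lemma GradedBy.br_mem (D : GradedBy 𝔥 t T h0) (H : IsHomogeneousCartan 𝔥 p) {α β}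
    (hα : α ∈ T) (hβ : β ∈ T) {x y : L} (hx : x ∈ rootSpace 𝔥 α) (hy : y ∈ rootSpace 𝔥 β) :
    br x y ∈ t := by
  have h := H.br_mem_rootSpace hx hy
  by_cases hr : α + β ∈ roots 𝔥
  · exact D.mem_t (D.closed _ hα _ hβ hr) h
  · rw [eq_zero_of_not_mem_roots hr h]; exact t.zero_mem

lemma GradedBy.cartan_le (D : GradedBy 𝔥 t T h0) (H : IsHomogeneousCartan 𝔥 p) : 𝔥 ≤ t :=
  H.le_rootSpace.trans fun _ hx => D.mem_t D.zero_mem hx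

end RootSpaces

/-! ### Subspaces generated by lowering operators. -/

section Closure

variable {V : Type*} [AddCommGroup V] [Module ℂ V]

/-- The least subspace containing `W` and stable under the operators in `O`. -/
def opClosure (O : Set (Module.End ℂ V)) (W : Submodule ℂ V) : Submodule ℂ V :=
  sInf {N | W ≤ N ∧ ∀ f ∈ O, ∀ v ∈ N, f v ∈ N}

variable {O : Set (Module.End ℂ V)} {W : Submodule ℂ V}

lemma le_opClosure : W ≤ opClosure O W := le_sInf fun _ h => h.1

lemma opClosure_stable {f} (hf : f ∈ O) {v} (hv : v ∈ opClosure O W) : f v ∈ opClosure O W := by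
  rw [opClosure, Submodule.mem_sInf] at *
  exact fun N hN => hN.2 f hf v (hv N hN)

lemma opClosure_le {N : Submodule ℂ V} (h : W ≤ N) (h' : ∀ f ∈ O, ∀ v ∈ N, f v ∈ N) :
    opClosure O W ≤ N := sInf_le ⟨h, h'⟩

end Closure

section Relations

variable {L : Type} [AddCommGroup L] [Module ℂ L] [LieSuperalgebra L]
variable {𝔥 t : Submodule ℂ L} {p : Module.Dual ℂ 𝔥 → ZMod 2} {T : Set (Module.Dual ℂ 𝔥)} {h0 : 𝔥}
variable {V : Type*} [AddCommGroup V] [Module ℂ V]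

/-- The relation `[x, y] v = x y v - (-1)^{ij} y x v`. -/
def RelAt (ρ : t →ₗ[ℂ] Module.End ℂ V) (i j : ZMod 2) (x y : t) (v : V) : Prop :=
  ∀ z : t, (z : L) = br (x : L) (y : L) → ρ z v = ρ x (ρ y v) - sgn i j • ρ y (ρ x v)

variable (T h0) in
/-- The operators by which root vectors of negative degree act. -/
def lowOps (ρ : t →ₗ[ℂ] Module.End ℂ V) : Set (Module.End ℂ V) :=
  {f | ∃ γ ∈ degNeg T h0, ∃ y : t, (y : L) ∈ rootSpace 𝔥 γ ∧ f = ρ y}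

/-- Moving `x` past a lowering vector `y` costs only `[x, y]`, which is zero or again a root vector
of `t`, of nonnegative or of negative degree. It is therefore enough to control the nonnegative root
vectors on the generators `W`. -/
lemma opClosure_lowOps_stable (H : IsHomogeneousCartan 𝔥 p) (D : GradedBy 𝔥 t T h0)
    (ρ : t →ₗ[ℂ] Module.End ℂ V)
    (hrel : ∀ α ∈ degZero T h0 ∪ degPos T h0, ∀ γ ∈ degNeg T h0, ∀ x y : t,
      (x : L) ∈ rootSpace 𝔥 α → (y : L) ∈ rootSpace 𝔥 γ → ∀ v, RelAt ρ (p α) (p γ) x y v)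
    {W : Submodule ℂ V}
    (hW : ∀ α ∈ degZero T h0 ∪ degPos T h0, ∀ x : t, (x : L) ∈ rootSpace 𝔥 α → ∀ w ∈ W,
      ρ x w ∈ opClosure (lowOps T h0 ρ) W) (x : t) :
    ∀ v ∈ opClosure (lowOps T h0 ρ) W, ρ x v ∈ opClosure (lowOps T h0 ρ) W := by
  set C := opClosure (lowOps T h0 ρ) W with hC
  have hlow : ∀ γ ∈ degNeg T h0, ∀ y : t, (y : L) ∈ rootSpace 𝔥 γ → ∀ v ∈ C, ρ y v ∈ C :=
    fun γ hγ y hy v hv =>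
      opClosure_stable (show ρ y ∈ lowOps T h0 ρ from ⟨γ, hγ, y, hy, rfl⟩) hv
  -- The induction needs a stronger invariant than membership in the closure: all root vectors of
  -- nonnegative degree must map the vector into the closure at once, because `[x, y]` has a
  -- different root from `x`.
  let N : Submodule ℂ V :=
    { carrier := {v | v ∈ C ∧ ∀ α ∈ degZero T h0 ∪ degPos T h0, ∀ x : t,
        (x : L) ∈ rootSpace 𝔥 α → ρ x v ∈ C}
      add_mem' := fun ha hb => ⟨add_mem ha.1 hb.1, fun α hα x hx => by
        rw [map_add]; exact add_mem (ha.2 α hα x hx) (hb.2 α hα x hx)⟩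
      zero_mem' := ⟨zero_mem _, fun α hα x hx => by rw [map_zero]; exact zero_mem _⟩
      smul_mem' := fun c v hv => ⟨C.smul_mem c hv.1, fun α hα x hx => by
        rw [map_smul]; exact C.smul_mem c (hv.2 α hα x hx)⟩ }
  have hN : C ≤ N := by
    refine opClosure_le (fun w hw => ⟨le_opClosure hw, fun α hα x hx => hW α hα x hx w hw⟩) ?_
    rintro _ ⟨γ, hγ, y, hy, rfl⟩ v ⟨hv, hv'⟩
    refine ⟨hlow γ hγ y hy v hv, fun α hα x hx => ?_⟩
    have hz := D.br_mem H (degGe_subset hα) (degNeg_subset hγ) hx hy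
    have e := hrel α hα γ hγ x y hx hy v (⟨br (x : L) (y : L), hz⟩ : t) rfl
    have e' : ρ x (ρ y v) = ρ ⟨_, hz⟩ v + sgn (p α) (p γ) • ρ y (ρ x v) := by rw [e]; abel
    rw [e']
    refine add_mem ?_ (C.smul_mem _ (hlow γ hγ y hy _ (hv' α hα x hx)))
    have hzr := H.br_mem_rootSpace hx hy
    by_cases hr : α + γ ∈ roots 𝔥
    · rcases D.cases (D.closed _ (degGe_subset hα) _ (degNeg_subset hγ) hr) with h | h
      · exact hv' _ h ⟨_, hz⟩ hzr
      · exact hlow _ h ⟨_, hz⟩ hzr v hv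
    · have : (⟨_, hz⟩ : t) = 0 := Subtype.ext (eq_zero_of_not_mem_roots hr hzr)
      rw [this]; simp
  intro v hv
  let S : Submodule ℂ t := { 
    carrier := {x | ρ x v ∈ C}
    add_mem' := fun ha hb => by
      rw [Set.mem_ofPred_eq, map_add]; exact add_mem ha hb
    zero_mem' := by simp
    smul_mem' := fun c a ha => by
      rw [Set.mem_ofPred_eq, map_smul]; exact C.smul_mem c ha }
  refine mem_of_rootSum (T := T) D.eq_rootSum.ge S (fun α hα x hx => ?_) x (D.eq_rootSum ▸ x.2)
  rcases D.cases hα with h | h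
  · exact (hN hv).2 α h x hx
  · exact hlow α h x hx v hv

/-- If `h0` acts on `W` by `a` then the elements of the closure of `W` outside `W` have lower
degree. -/
lemma opClosure_lowOps_le (ρ : t →ₗ[ℂ] Module.End ℂ V) (h0t : t) (e0 : (h0t : L) = h0)
    (hrel : ∀ γ ∈ degNeg T h0, ∀ y : t, (y : L) ∈ rootSpace 𝔥 γ → ∀ v,
      RelAt ρ 0 (p γ) h0t y v)
    {W : Submodule ℂ V} {a : ℂ} (hW : ∀ w ∈ W, ρ h0t w = a • w) :
    opClosure (lowOps T h0 ρ) W ≤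
      W ⊔ ⨆ n : ℕ, Module.End.eigenspace (ρ h0t) (a - (n + 1)) := by
  have key : ∀ γ ∈ degNeg T h0, ∀ y : t, (y : L) ∈ rootSpace 𝔥 γ → ∃ n : ℕ, ∀ b v,
      v ∈ Module.End.eigenspace (ρ h0t) b →
      ρ y v ∈ Module.End.eigenspace (ρ h0t) (b - (n + 1)) := by
    rintro γ ⟨hγ, n, hn⟩ y hy
    refine ⟨n, fun b v hv => ?_⟩
    rw [Module.End.mem_eigenspace_iff] at *
    have e1 : (((γ h0) • y : t) : L) = br (h0t : L) (y : L) := by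
      rw [e0, hy h0]; rfl
    have e := hrel γ ⟨hγ, n, hn⟩ y hy v _ e1
    rw [map_smul, LinearMap.smul_apply, hv, sgn_zero_left, one_smul, map_smul, hn] at e
    rw [eq_add_of_sub_eq e.symm, ← add_smul]; congr 1; ring
  refine opClosure_le le_sup_left ?_
  rintro _ ⟨γ, hγ, y, hy, rfl⟩ v hv
  obtain ⟨n, hn⟩ := key γ hγ y hy
  obtain ⟨w, hw, u, hu, rfl⟩ := Submodule.mem_sup.1 hv
  rw [map_add]
  refine Submodule.mem_sup_right (add_mem ?_ ?_)
  · exact Submodule.mem_iSup_of_mem n (hn a w (Module.End.mem_eigenspace_iff.2 (hW w hw)))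
  · have : (⨆ n : ℕ, Module.End.eigenspace (ρ h0t) (a - (n + 1))) ≤
        (⨆ n : ℕ, Module.End.eigenspace (ρ h0t) (a - (n + 1))).comap (ρ y) := by
      refine iSup_le fun m v hv => ?_
      -- The eigenvalue `a-(m+1)` is lowered by `n+1`, and `a-(m+1)-(n+1) = a-((m+n+1)+1)`.
      refine Submodule.mem_iSup_of_mem (m + n + 1) ?_
      have := hn _ v hv
      convert this using 2
      push_cast; ring
    exact this hu

end Relations

/-- The sum of `A` and `B` need not be everything. As `A` embeds in `V/B`, any linear left inverse
of this embedding does; its values outside `A + B` never matter. -/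
lemma exists_projection {V : Type*} [AddCommGroup V] [Module ℂ V] {A B : Submodule ℂ V}
    (h : Disjoint A B) : ∃ f : V →ₗ[ℂ] A, (∀ x (hx : x ∈ A), f x = ⟨x, hx⟩) ∧ ∀ x ∈ B, f x = 0 := by
  have hinj : LinearMap.ker (B.mkQ ∘ₗ A.subtype) = ⊥ := by
    rw [LinearMap.ker_eq_bot']
    intro x hx
    have hx' : (x : V) ∈ B := by simpa using hx
    exact Subtype.ext (Submodule.disjoint_def.1 h _ x.2 hx')
  obtain ⟨g, hg⟩ := LinearMap.exists_leftInverse_of_injective _ hinj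
  refine ⟨g ∘ₗ B.mkQ, fun x hx => ?_, fun x hx => ?_⟩
  · exact LinearMap.congr_fun hg ⟨x, hx⟩
  · have : B.mkQ x = 0 := by simpa using hx
    rw [LinearMap.comp_apply, this, map_zero]

/-! ### The module of words in lowering root vectors. -/

section Free

variable {L : Type} [AddCommGroup L] [Module ℂ L] [LieSuperalgebra L]
variable {𝔥 t l n : Submodule ℂ L} {p : Module.Dual ℂ 𝔥 → ZMod 2} {T : Set (Module.Dual ℂ 𝔥)}
  {h0 : 𝔥}

lemma disjoint_of_le_eigenspaces {V : Type*} [AddCommGroup V] [Module ℂ V] (f : Module.End ℂ V)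
    {A B : Set ℂ} (h : Disjoint A B) {M N : Submodule ℂ V} (hM : M ≤ ⨆ c ∈ A, f.eigenspace c)
    (hN : N ≤ ⨆ c ∈ B, f.eigenspace c) : Disjoint M N :=
  Disjoint.mono hM hN (f.eigenspaces_iSupIndep.disjoint_biSup_biSup h)

lemma rootSum_le_eigenspaces (h0 : 𝔥) (S : Set (Module.Dual ℂ 𝔥)) :
    rootSum 𝔥 S ≤ ⨆ c ∈ {c : ℂ | ∃ α ∈ S, α h0 = c}, Module.End.eigenspace (br (h0 : L)) c := by
  refine rootSum_le fun α hα => ?_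
  refine le_trans ?_ (le_biSup (fun c => Module.End.eigenspace (br (h0 : L)) c)
    (show α h0 ∈ {c : ℂ | ∃ α ∈ S, α h0 = c} from ⟨α, hα, rfl⟩))
  intro x hx
  rw [Module.End.mem_eigenspace_iff]
  exact mem_rootSpace.1 hx h0

lemma disjoint_rootSum (h0 : 𝔥) {S S' : Set (Module.Dual ℂ 𝔥)}
    (h : ∀ α ∈ S, ∀ β ∈ S', α h0 ≠ β h0) : Disjoint (rootSum 𝔥 S) (rootSum 𝔥 S') := by
  refine disjoint_of_le_eigenspaces _ ?_ (rootSum_le_eigenspaces h0 S) (rootSum_le_eigenspaces h0 S')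
  rw [Set.disjoint_left]
  rintro _ ⟨α, hα, rfl⟩ ⟨β, hβ, e⟩
  exact h α hα β hβ e.symm

variable (L) in
lemma exists_parity_projections : ∃ P0 P1 : L →ₗ[ℂ] L,
    (∀ x ∈ par (L := L) 0, P0 x = x ∧ P1 x = 0) ∧ ∀ x ∈ par (L := L) 1, P0 x = 0 ∧ P1 x = x := by
  obtain ⟨f, hf, hf'⟩ := exists_projection (isCompl_par (L := L)).disjoint
  obtain ⟨g, hg, hg'⟩ := exists_projection (isCompl_par (L := L)).disjoint.symm
  refine ⟨Submodule.subtype _ ∘ₗ f, Submodule.subtype _ ∘ₗ g, fun x hx => ?_, fun x hx => ?_⟩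
  · simp [hf x hx, hg' x hx]
  · simp [hg x hx, hf' x hx]

/-- One step `(u, φ) ↦ (y u, x ↦ [x, y] u + (-1)^{|x||y|} y φ(x))` in the recursive definition of
the action on `T(m) ⊗ Ω`. -/
def freeStep {m : Submodule ℂ L} {E : Type*} [AddCommGroup E] [Module ℂ E]
    (Y : m →ₗ[ℂ] Module.End ℂ E) (πm : L →ₗ[ℂ] m) (θ : m →ₗ[ℂ] m) (Q P0 P1 : L →ₗ[ℂ] L) :
    m →ₗ[ℂ] Module.End ℂ (E × (L →ₗ[ℂ] E)) :=
  LinearMap.mk₂ ℂ (fun y s => (Y y s.1,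
      (Y ∘ₗ πm).flip (Y y s.1) + Y y ∘ₗ s.2 ∘ₗ P0 ∘ₗ Q + Y (θ y) ∘ₗ s.2 ∘ₗ P1 ∘ₗ Q +
        s.2 ∘ₗ br.flip (y : L) ∘ₗ Q))
    (by
      intro y y' s
      refine Prod.ext (by simp) (LinearMap.ext fun x => ?_)
      simp; abel)
    (by
      intro c y s
      refine Prod.ext (by simp) (LinearMap.ext fun x => ?_)
      simp)
    (by
      intro y s s'
      refine Prod.ext (by simp) (LinearMap.ext fun x => ?_)
      simp; abel)
    (by
      intro c y s
      refine Prod.ext (by simp) (LinearMap.ext fun x => ?_)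
      simp)

lemma freeStep_apply {m : Submodule ℂ L} {E : Type*} [AddCommGroup E] [Module ℂ E]
    (Y : m →ₗ[ℂ] Module.End ℂ E) (πm : L →ₗ[ℂ] m) (θ : m →ₗ[ℂ] m) (Q P0 P1 : L →ₗ[ℂ] L) (y : m)
    (u : E) (φ : L →ₗ[ℂ] E) (x : L) :
    (freeStep Y πm θ Q P0 P1 y (u, φ)).2 x = Y (πm x) (Y y u) + Y y (φ (P0 (Q x)))
      + Y (θ y) (φ (P1 (Q x))) + φ (br (Q x) (y : L)) := rfl

/-- Induction on `T(m) ⊗ Ω`. -/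
lemma tensorAlgebra_tensor_induction {m W : Type*} [AddCommGroup m] [Module ℂ m] [AddCommGroup W]
    [Module ℂ W] (N : Submodule ℂ (TensorAlgebra ℂ m ⊗[ℂ] W)) (h1 : ∀ w, 1 ⊗ₜ w ∈ N)
    (h2 : ∀ (y : m), ∀ u ∈ N, TensorAlgebra.ι ℂ y • u ∈ N) : N = ⊤ := by
  let S : Subalgebra ℂ (TensorAlgebra ℂ m) :=
    { carrier := {a | ∀ u ∈ N, a • u ∈ N}
      mul_mem' := fun ha hb u hu => by rw [mul_smul]; exact ha _ (hb u hu)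
      add_mem' := fun ha hb u hu => by rw [add_smul]; exact add_mem (ha u hu) (hb u hu)
      algebraMap_mem' := fun c u hu => by rw [algebraMap_smul]; exact N.smul_mem c hu }
  have hS : ∀ a : TensorAlgebra ℂ m, a ∈ S := by
    intro a
    induction a using TensorAlgebra.induction with
    | algebraMap r => exact S.algebraMap_mem r
    | ι x => exact h2 x
    | mul a b ha hb => exact S.mul_mem ha hb
    | add a b ha hb => exact S.add_mem ha hb
  rw [Submodule.eq_top_iff']
  intro u
  induction u using TensorProduct.induction_on with
  | zero => exact N.zero_mem
  | add a b ha hb => exact N.add_mem ha hb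
  | tmul a w =>
    have := hS a _ (h1 w)
    rwa [TensorProduct.smul_tmul', smul_eq_mul, mul_one] at this

/-- Words in `m` applied to vectors of `W`, i.e. `T(m) ⊗ W`, with its induction and recursion
principles. -/
lemma exists_word_module (m W : Type) [AddCommGroup m] [Module ℂ m] [AddCommGroup W] [Module ℂ W] :
    ∃ (E : Type) (_ : AddCommGroup E) (_ : Module ℂ E) (Y : m →ₗ[ℂ] Module.End ℂ E)
      (j : W →ₗ[ℂ] E),
      (∀ N : Submodule ℂ E, (∀ w, j w ∈ N) → (∀ y, ∀ u ∈ N, Y y u ∈ N) → N = ⊤) ∧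
      ∀ (S : Type) [AddCommGroup S] [Module ℂ S] (G : m →ₗ[ℂ] Module.End ℂ S) (Ψ0 : W →ₗ[ℂ] S),
        ∃ Ψ : E →ₗ[ℂ] S, (∀ w, Ψ (j w) = Ψ0 w) ∧ ∀ y u, Ψ (Y y u) = G y (Ψ u) := by
  refine ⟨TensorAlgebra ℂ m ⊗[ℂ] W, inferInstance, inferInstance,
    (Algebra.lsmul ℂ ℂ _).toLinearMap ∘ₗ TensorAlgebra.ι ℂ, TensorProduct.mk ℂ _ _ 1,
    fun N h1 h2 => tensorAlgebra_tensor_induction N h1 h2, fun S _ _ G Ψ0 => ?_⟩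
  refine ⟨TensorProduct.lift ((LinearMap.lcomp ℂ _ Ψ0) ∘ₗ (TensorAlgebra.lift ℂ G).toLinearMap),
    fun w => ?_, fun y u => ?_⟩
  · rw [TensorProduct.mk_apply, TensorProduct.lift.tmul]; simp
  · induction u using TensorProduct.induction_on with
    | zero => simp
    | add a b ha hb => simp only [map_add, ha, hb]
    | tmul a w =>
      change TensorProduct.lift _ (TensorAlgebra.ι ℂ y • (a ⊗ₜ[ℂ] w)) = _
      rw [TensorProduct.smul_tmul', smul_eq_mul, TensorProduct.lift.tmul, TensorProduct.lift.tmul]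
      simp

lemma sgn_add_left (i j l : ZMod 2) : sgn (i + j) l = sgn i l * sgn j l := by
  rw [sgn_comm, sgn_add, sgn_comm l, sgn_comm l]

lemma eq_of_mem_par {i j : ZMod 2} {x : L} (hi : x ∈ par i) (hj : x ∈ par j) (hx : x ≠ 0) :
    i = j := by
  by_contra hne
  have hd := (isCompl_par (L := L)).disjoint
  rcases zmod2 i with rfl | rfl <;> rcases zmod2 j with rfl | rfl
  · exact hne rfl
  · exact hx (Submodule.disjoint_def.1 hd x hi hj)
  · exact hx (Submodule.disjoint_def.1 hd x hj hi)
  · exact hne rfl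

/-- By the super Jacobi identity, the relation for the pair `(x, z)` on `y u` follows from relations
on `u` for `(x, z)`, `(x, [z, y])` and `(z, [x, y])`, together with the known relations with the
lowering vector `y`. So the relations spread from `J` to everything that lowering vectors generate
from it. -/
lemma relation_of_generators (H : IsHomogeneousCartan 𝔥 p) (D : GradedBy 𝔥 t T h0)
    {E : Type*} [AddCommGroup E] [Module ℂ E] (ρL : L →ₗ[ℂ] Module.End ℂ E) (J : Submodule ℂ E)
    (hJ : ∀ N : Submodule ℂ E, J ≤ N →
      (∀ γ ∈ degNeg T h0, ∀ y ∈ rootSpace 𝔥 γ, ∀ u ∈ N, ρL y u ∈ N) → N = ⊤)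
    (hlowRel : ∀ u, ∀ α ∈ degZero T h0 ∪ degPos T h0, ∀ β ∈ degNeg T h0,
      ∀ x ∈ rootSpace 𝔥 α, ∀ y ∈ rootSpace 𝔥 β, ρL (br x y) u =
        ρL x (ρL y u) - sgn (p α) (p β) • ρL y (ρL x u))
    (hJrel : ∀ u ∈ J, ∀ α ∈ degZero T h0 ∪ degPos T h0, ∀ β ∈ degZero T h0 ∪ degPos T h0,
      ∀ x ∈ rootSpace 𝔥 α, ∀ y ∈ rootSpace 𝔥 β, ρL (br x y) u =
        ρL x (ρL y u) - sgn (p α) (p β) • ρL y (ρL x u)) :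
    ∀ u, ∀ α ∈ degZero T h0 ∪ degPos T h0, ∀ β ∈ T,
      ∀ x ∈ rootSpace 𝔥 α, ∀ y ∈ rootSpace 𝔥 β, ρL (br x y) u =
        ρL x (ρL y u) - sgn (p α) (p β) • ρL y (ρL x u) := by
  have hmul : ∀ α ∈ degZero T h0 ∪ degPos T h0, ∀ γ ∈ degNeg T h0, ∀ x ∈ rootSpace 𝔥 α,
      ∀ y ∈ rootSpace 𝔥 γ, ∀ u,
      ρL x (ρL y u) = sgn (p α) (p γ) • ρL y (ρL x u) + ρL (br x y) u := by
    intro α hα γ hγ x hx y hy u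
    rw [hlowRel u α hα γ hγ x hx y hy]; abel
  let N : Submodule ℂ E :=
    { carrier := {u | ∀ α ∈ degZero T h0 ∪ degPos T h0, ∀ β ∈ degZero T h0 ∪ degPos T h0,
        ∀ x ∈ rootSpace 𝔥 α, ∀ y ∈ rootSpace 𝔥 β, ρL (br x y) u =
          ρL x (ρL y u) - sgn (p α) (p β) • ρL y (ρL x u)}
      add_mem' := fun ha hb α hα β hβ x hx y hy => by
        simp only [map_add, ha α hα β hβ x hx y hy, hb α hα β hβ x hx y hy]; module
      zero_mem' := by simp
      smul_mem' := fun c a ha α hα β hβ x hx y hy => by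
        simp only [map_smul, ha α hα β hβ x hx y hy]; module }
  have hN : ∀ γ ∈ degNeg T h0, ∀ y ∈ rootSpace 𝔥 γ, ∀ u ∈ N, ρL y u ∈ N := by
    intro γ hγ y hy u hu α hα β hβ x hx z hz
    have full : ∀ α ∈ degZero T h0 ∪ degPos T h0, ∀ x ∈ rootSpace 𝔥 α, ∀ β ∈ T,
        ∀ z ∈ rootSpace 𝔥 β, ρL (br x z) u =
          ρL x (ρL z u) - sgn (p α) (p β) • ρL z (ρL x u) := by
      intro α hα x hx β hβ z hz
      rcases D.cases hβ with h | h
      · exact hu α hα β h x hx z hz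
      · exact hlowRel u α hα β h x hx z hz
    -- The parity is passed as a separate `j`, since `p` is arbitrary at functionals that are not
    -- roots. For nonzero `z` homogeneity forces `p (β + γ) = j`; for `z = 0` there is nothing to
    -- prove.
    have full' : ∀ α ∈ degZero T h0 ∪ degPos T h0, ∀ x ∈ rootSpace 𝔥 α, ∀ j : ZMod 2, ∀ z ∈ par j,
        ∀ β ∈ T, ∀ γ ∈ T, z ∈ rootSpace 𝔥 (β + γ) → ρL (br x z) u =
          ρL x (ρL z u) - sgn (p α) j • ρL z (ρL x u) := by
      intro α hα x hx j z hzj β hβ γ hγ hz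
      by_cases h0z : z = 0
      · subst h0z; simp
      have hr : β + γ ∈ roots 𝔥 := fun h => h0z (by rw [h] at hz; simpa using hz)
      have hj : p (β + γ) = j := by
        exact eq_of_mem_par (H.homog _ hz) hzj h0z
      rw [← hj]
      exact full α hα x hx _ (D.closed _ hβ _ hγ hr) z hz
    have hxz := H.br_mem_rootSpace hx hz
    have hpx := H.homog _ hx
    have hpz := H.homog _ hz
    have hpy := H.homog _ hy
    have e1 : ρL (br x z) (ρL y u) = sgn (p α + p β) (p γ) • ρL y (ρL (br x z) u)
        + ρL (br (br x z) y) u := by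
      by_cases hr : α + β ∈ roots 𝔥
      · have := hmul _ (add_mem_degGe D hα hβ hr) γ hγ _ hxz y hy u
        by_cases h0z : br x z = 0
        · rw [h0z]; simp
        have hj : p (α + β) = p α + p β := by
          exact eq_of_mem_par (H.homog _ hxz) (br_mem hpx hpz) h0z
        rw [hj] at this; exact this
      · rw [eq_zero_of_not_mem_roots hr hxz]; simp
    have f1 := full' α hα x hx _ (br z y) (br_mem hpz hpy) β (degGe_subset hβ) γ
      (degNeg_subset hγ) (H.br_mem_rootSpace hz hy)
    have f2 := full' β hβ z hz _ (br x y) (br_mem hpx hpy) α (degGe_subset hα) γ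
      (degNeg_subset hγ) (H.br_mem_rootSpace hx hy)
    have f3 := full α hα x hx β (degGe_subset hβ) z hz
    have jac := br_jacobi hpx hpz hpy
    have jac' : ρL (br (br x z) y) u = ρL (br x (br z y)) u
        - sgn (p α) (p β) • ρL (br z (br x y)) u := by
      rw [jac, map_add, map_smul]; simp
    rw [e1, jac', f1, f2, f3, hmul β hβ γ hγ z hz y hy, hmul α hα γ hγ x hx y hy, map_add, map_add,
      map_smul, map_smul, hmul α hα γ hγ x hx y hy, hmul β hβ γ hγ z hz y hy]
    rw [sgn_add_left]
    simp only [sgn_add, map_sub, map_smul, smul_sub, smul_add, smul_smul,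
      sgn_comm (p β) (p α)]
    have hs := sgn_sq (p α) (p β)
    have hs1 : sgn (p α) (p β) * (sgn (p α) (p β) * sgn (p β) (p γ)) = sgn (p β) (p γ) := by
      rw [← mul_assoc, hs, one_mul]
    rw [hs1]
    match_scalars <;> ring
  have hNtop : N = ⊤ := hJ N (fun u hu => hJrel u hu) hN
  intro u α hα β hβ x hx y hy
  rcases D.cases hβ with h | h
  · have hu : u ∈ N := hNtop ▸ Submodule.mem_top
    exact hu α hα β h x hx y hy
  · exact hlowRel u α hα β h x hx y hy

/-- The "free" module `T(m) ⊗ Ω` over `t = l ⊕ n ⊕ m`: all relations except those between two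
elements of `m` hold. -/
lemma exists_free_module (H : IsHomogeneousCartan 𝔥 p) (D : GradedBy 𝔥 t T h0)
    (hl : l = rootSum 𝔥 (degZero T h0)) (Ω : SuperRep l)
    (hΩ : ∀ (i j : ZMod 2) (x y z : l) (v : Ω.V), (x : L) ∈ par i → (y : L) ∈ par j →
      (z : L) = br (x : L) (y : L) →
      Ω.act z v = Ω.act x (Ω.act y v) - sgn i j • Ω.act y (Ω.act x v)) :
    ∃ (E : Type) (_ : AddCommGroup E) (_ : Module ℂ E) (ρ : t →ₗ[ℂ] Module.End ℂ E)
      (j : Ω.V →ₗ[ℂ] E) (ε : E →ₗ[ℂ] Ω.V),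
      (∀ (x : t) (hx : (x : L) ∈ l) w, ρ x (j w) = j (Ω.act ⟨x, hx⟩ w)) ∧
      (∀ α ∈ degPos T h0, ∀ x : t, (x : L) ∈ rootSpace 𝔥 α → ∀ w, ρ x (j w) = 0) ∧
      (∀ α ∈ degZero T h0 ∪ degPos T h0, ∀ β ∈ T, ∀ x y : t, (x : L) ∈ rootSpace 𝔥 α →
        (y : L) ∈ rootSpace 𝔥 β → ∀ v, RelAt ρ (p α) (p β) x y v) ∧
      (∀ w, ε (j w) = w) ∧
      (∀ α ∈ degNeg T h0, ∀ x : t, (x : L) ∈ rootSpace 𝔥 α → ∀ v, ε (ρ x v) = 0) := by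
  set m : Submodule ℂ L := rootSum 𝔥 (degNeg T h0) with hm
  have hdl : Disjoint l (rootSum 𝔥 (degPos T h0 ∪ degNeg T h0)) := by
    rw [hl]
    refine disjoint_rootSum h0 ?_
    rintro α ⟨_, hα⟩ β (⟨_, k, hβ⟩ | ⟨_, k, hβ⟩) <;> rw [hα, hβ]
    · exact_mod_cast (Nat.succ_ne_zero k).symm
    · rw [ne_comm, neg_ne_zero]; exact_mod_cast (Nat.succ_ne_zero k)
  have hdm : Disjoint m (rootSum 𝔥 (degZero T h0 ∪ degPos T h0)) := by
    refine disjoint_rootSum h0 ?_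
    rintro α ⟨_, k, hα⟩ β hβ
    obtain ⟨_, k', hβ⟩ := degGe_iff.1 hβ
    rw [hα, hβ, ne_comm, ← sub_ne_zero, sub_neg_eq_add]
    exact_mod_cast (Nat.succ_ne_zero (k' + k))
  obtain ⟨πl, hπl, hπl'⟩ := exists_projection hdl
  obtain ⟨πm, hπm, hπm'⟩ := exists_projection hdm
  obtain ⟨P0, P1, hP0, hP1⟩ := exists_parity_projections L
  have hlT : ∀ α ∈ degZero T h0, ∀ x ∈ rootSpace 𝔥 α, x ∈ l := fun α hα x hx => by
    rw [hl]; exact rootSpace_le_rootSum hα hx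
  obtain ⟨E, _, _, Y, j, hE, hrec⟩ := exists_word_module m Ω.V
  -- The parity automorphism `y ↦ (-1)^{|y|} y` of `m`. It supplies the sign when an odd element
  -- passes `y`.
  let θ : m →ₗ[ℂ] m := πm ∘ₗ (LinearMap.id - (2 : ℂ) • P1) ∘ₗ m.subtype
  -- Elements of `m` act by prefixing a letter; the commutation formula is meant for the remaining
  -- part, which `Q` cuts out.
  let Q : L →ₗ[ℂ] L := LinearMap.id - m.subtype ∘ₗ πm
  -- The recursion produces the pair of a word `u` and the map `x ↦ x u`. The word itself has to be
  -- carried along because the step uses `Y y u`, and `hfst` confirms that it is reproduced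
  -- unchanged.
  let G := freeStep Y πm θ Q P0 P1
  -- On the empty words `l` acts through `Ω`, positive root vectors by zero because `πl` kills them,
  -- and `m` by prefixing.
  let Ψ0 : Ω.V →ₗ[ℂ] E × (L →ₗ[ℂ] E) := LinearMap.prod j
    ((Ω.act ∘ₗ πl).flip.compr₂ j + (Y ∘ₗ πm).flip ∘ₗ j)
  have hΨ0 : ∀ w x, (Ψ0 w).2 x = j (Ω.act (πl x) w) + Y (πm x) (j w) := fun _ _ => rfl
  obtain ⟨Ψ, hΨj, hΨY⟩ := hrec _ G Ψ0
  have hfst : ∀ u, (Ψ u).1 = u := by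
    have := hE (LinearMap.ker (LinearMap.fst ℂ _ _ ∘ₗ Ψ - LinearMap.id))
      (fun w => by
        rw [LinearMap.mem_ker, LinearMap.sub_apply, LinearMap.comp_apply, hΨj]; exact sub_self _)
      (fun y u hu => by
        rw [LinearMap.mem_ker, LinearMap.sub_apply, LinearMap.comp_apply, sub_eq_zero] at *
        rw [hΨY]
        change Y y (Ψ u).1 = Y y u
        exact congrArg (Y y) hu)
    intro u
    have hu : u ∈ (⊤ : Submodule ℂ E) := Submodule.mem_top
    rw [← this, LinearMap.mem_ker, LinearMap.sub_apply, sub_eq_zero] at hu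
    exact hu
  let ρL : L →ₗ[ℂ] Module.End ℂ E := (LinearMap.snd ℂ _ _ ∘ₗ Ψ).flip
  have hρ : ∀ x u, ρL x u = (Ψ u).2 x := fun _ _ => rfl
  have hQm : ∀ y : m, Q y = 0 := fun y => by
    simp [Q, hπm y y.2]
  have hlow : ∀ (y : m) u, ρL y u = Y y u := by
    intro y
    have := hE (LinearMap.ker (ρL y - Y y)) (fun w => ?_) (fun y' u hu => ?_)
    · intro u
      have hu : u ∈ (⊤ : Submodule ℂ E) := Submodule.mem_top
      rwa [← this, LinearMap.mem_ker, LinearMap.sub_apply, sub_eq_zero] at hu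
    · rw [LinearMap.mem_ker, LinearMap.sub_apply, hρ, hΨj, hΨ0, hπm y y.2, hπl' y]
      · simp
      · exact rootSum_mono Set.subset_union_right y.2
    · rw [LinearMap.mem_ker, LinearMap.sub_apply, hρ, hΨY, ← Prod.mk.eta (p := Ψ u), hfst]
      simp only [G]
      rw [freeStep_apply, hQm, hπm y y.2]
      simp
  have hge : ∀ α ∈ degZero T h0 ∪ degPos T h0, ∀ x ∈ rootSpace 𝔥 α, πm x = 0 ∧ Q x = x := by
    intro α hα x hx
    have : πm x = 0 := hπm' x (rootSpace_le_rootSum hα hx)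
    refine ⟨this, by simp [Q, this]⟩
  have hmul : ∀ α ∈ degZero T h0 ∪ degPos T h0, ∀ γ ∈ degNeg T h0, ∀ x ∈ rootSpace 𝔥 α,
      ∀ y : m, (y : L) ∈ rootSpace 𝔥 γ → ∀ u,
      ρL x (Y y u) = sgn (p α) (p γ) • Y y (ρL x u) + ρL (br x (y : L)) u := by
    intro α hα γ hγ x hx y hy u
    obtain ⟨h1, h2⟩ := hge α hα x hx
    rw [hρ, hΨY, ← Prod.mk.eta (p := Ψ u), hfst]
    simp only [G]
    rw [freeStep_apply, h2, h1, map_zero, LinearMap.zero_apply, zero_add]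
    congr 1
    have hpx := H.homog α hx
    have hpy := H.homog γ hy
    have hθ : p γ = 1 → θ y = -y := fun h => by
      rw [h] at hpy
      simp only [θ, LinearMap.comp_apply, LinearMap.sub_apply, LinearMap.smul_apply,
        Submodule.subtype_apply, (hP1 _ hpy).2, LinearMap.id_apply, map_sub, map_smul]
      rw [hπm y y.2, two_smul]; simp
    have hθ' : p γ = 0 → θ y = y := fun h => by
      rw [h] at hpy
      simp only [θ, LinearMap.comp_apply, LinearMap.sub_apply, LinearMap.smul_apply,
        Submodule.subtype_apply, (hP0 _ hpy).2, LinearMap.id_apply, map_sub, map_smul]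
      rw [hπm y y.2]; simp
    rcases zmod2 (p α) with h | h <;> rw [h] at hpx ⊢
    · rw [(hP0 _ hpx).1, (hP0 _ hpx).2, sgn_zero_left]; simp [hρ]
    · rw [(hP1 _ hpx).1, (hP1 _ hpx).2]
      rcases zmod2 (p γ) with h' | h' <;> rw [h']
      · rw [hθ' h']; simp [hρ, sgn]
      · rw [hθ h']; simp [hρ, sgn, neg_smul]
  have hjj : ∀ α ∈ degZero T h0 ∪ degPos T h0, ∀ x ∈ rootSpace 𝔥 α, ∀ w,
      ρL x (j w) = j (Ω.act (πl x) w) := by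
    intro α hα x hx w
    rw [hρ, hΨj, hΨ0, (hge α hα x hx).1]; simp
  have hpos : ∀ α ∈ degPos T h0, ∀ x ∈ rootSpace 𝔥 α, πl x = 0 := fun α hα x hx =>
    hπl' x (rootSpace_le_rootSum (Or.inl hα) hx)
  have hRelj : ∀ α ∈ degZero T h0 ∪ degPos T h0, ∀ β ∈ degZero T h0 ∪ degPos T h0,
      ∀ x ∈ rootSpace 𝔥 α, ∀ y ∈ rootSpace 𝔥 β, ∀ w, ρL (br x y) (j w) =
        ρL x (ρL y (j w)) - sgn (p α) (p β) • ρL y (ρL x (j w)) := by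
    intro α hα β hβ x hx y hy w
    have hz := H.br_mem_rootSpace hx hy
    have ez : ρL (br x y) (j w) = j (Ω.act (πl (br x y)) w) := by
      by_cases hr : α + β ∈ roots 𝔥
      · exact hjj _ (add_mem_degGe D hα hβ hr) _ hz w
      · rw [eq_zero_of_not_mem_roots hr hz]; simp
    rw [ez, hjj α hα x hx, hjj β hβ y hy, hjj α hα x hx, hjj β hβ y hy, ← map_smul, ← map_sub]
    congr 1
    have hz0 : (α ∈ degPos T h0 ∨ β ∈ degPos T h0) → πl (br x y) = 0 := by
      intro h
      by_cases hr : α + β ∈ roots 𝔥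
      · refine hpos (α + β) ?_ _ hz
        obtain ⟨hα1, a, ha⟩ := degGe_iff.1 hα
        obtain ⟨hβ1, b, hb⟩ := degGe_iff.1 hβ
        refine ⟨D.closed _ hα1 _ hβ1 hr, ?_⟩
        rcases h with ⟨_, a', ha'⟩ | ⟨_, a', ha'⟩
        · exact ⟨a' + b, by simp [ha', hb]; ring⟩
        · exact ⟨a + a', by simp [ha, ha']; ring⟩
      · rw [eq_zero_of_not_mem_roots hr hz]; simp
    rcases hα with hα | hα
    · rcases hβ with hβ | hβ
      · have hxl := hlT α hα x hx
        have hyl := hlT β hβ y hy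
        have hzl : br x y ∈ l := by
          by_cases hr : α + β ∈ roots 𝔥
          · exact hlT (α + β) ⟨D.closed _ hα.1 _ hβ.1 hr, by simp [hα.2, hβ.2]⟩ _ hz
          · rw [eq_zero_of_not_mem_roots hr hz]; exact l.zero_mem
        rw [hπl _ hxl, hπl _ hyl, hπl _ hzl]
        exact hΩ _ _ _ _ _ w (H.homog α hx) (H.homog β hy) rfl
      · rw [hz0 (Or.inr hβ), hpos β hβ y hy]; simp
    · rw [hz0 (Or.inl hα), hpos α hα x hx]; simp
  -- Recursion with zero as the step gives the projection onto the empty words. It kills every image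
  -- of a lowering vector, and it is what detects `Ω` after passing to a quotient.
  obtain ⟨ε, hεj, hεY⟩ := hrec _ (0 : m →ₗ[ℂ] Module.End ℂ Ω.V) LinearMap.id
  have hlowRel : ∀ u, ∀ α ∈ degZero T h0 ∪ degPos T h0, ∀ β ∈ degNeg T h0,
      ∀ x ∈ rootSpace 𝔥 α, ∀ y ∈ rootSpace 𝔥 β, ρL (br x y) u =
      ρL x (ρL y u) - sgn (p α) (p β) • ρL y (ρL x u) := by
    intro u α hα β hβ x hx y hy
    have hym : y ∈ m := rootSpace_le_rootSum hβ hy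
    have e1 := hlow ⟨y, hym⟩
    simp only at e1
    rw [e1, e1, hmul α hα β hβ x hx ⟨y, hym⟩ hy]; abel
  have hRel := relation_of_generators H D ρL (LinearMap.range j) (fun N h1 h2 => by
      refine hE N (fun w => h1 ⟨w, rfl⟩) fun y => ?_
      let S : Submodule ℂ m :=
        { carrier := {y | ∀ u ∈ N, Y y u ∈ N}
          add_mem' := fun ha hb u hu => by
            rw [map_add]; exact N.add_mem (ha u hu) (hb u hu)
          zero_mem' := fun u _ => by simp
          smul_mem' := fun c a ha u hu => by
            rw [map_smul]; exact N.smul_mem c (ha u hu) }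
      refine mem_of_rootSum (T := degNeg T h0) le_rfl S (fun γ hγ y hy u hu => ?_) y y.2
      rw [← hlow]; exact h2 γ hγ y hy u hu) hlowRel (by
      rintro _ ⟨w, rfl⟩ α hα β hβ x hx y hy; exact hRelj α hα β hβ x hx y hy w)
  refine ⟨E, inferInstance, inferInstance, ρL ∘ₗ t.subtype, j, ε, ?_, ?_, ?_, ?_, ?_⟩
  · intro x hx w
    have hx' : (x : L) ∈ rootSum 𝔥 (degZero T h0) := hl ▸ hx
    have : πm (x : L) = 0 := hπm' _ (rootSum_mono Set.subset_union_left hx')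
    change (Ψ (j w)).2 x = _
    rw [hΨj, hΨ0, this, hπl _ hx]; simp
  · intro α hα x hx w
    change ρL x (j w) = 0
    rw [hjj α (Or.inr hα) x hx, hpos α hα x hx]; simp
  · intro α hα β hβ x y hx hy v z hz
    change ρL z v = ρL x (ρL y v) - _ • ρL y (ρL x v)
    rw [hz]; exact hRel v α hα β hβ x hx y hy
  · intro w; rw [hεj]; rfl
  · intro α hα x hx v
    have := hlow ⟨x, rootSpace_le_rootSum hα hx⟩ v
    change ε (ρL x v) = 0
    rw [this, hεY]; rfl

end Free

/-! ### Relations on root vectors and the universal enveloping algebra. -/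

section Enveloping

variable {L : Type} [AddCommGroup L] [Module ℂ L] [LieSuperalgebra L]
variable {𝔥 t l n : Submodule ℂ L} {p : Module.Dual ℂ 𝔥 → ZMod 2} {T : Set (Module.Dual ℂ 𝔥)}
  {h0 : 𝔥}

lemma GradedBy.br_mem_t (D : GradedBy 𝔥 t T h0) (H : IsHomogeneousCartan 𝔥 p) (x y : t) :
    br (x : L) (y : L) ∈ t := by
  let S : Submodule ℂ t := { 
    carrier := {x | ∀ y : t, br (x : L) (y : L) ∈ t}
    add_mem' := fun ha hb y => by
      rw [Submodule.coe_add, map_add]; exact add_mem (ha y) (hb y)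
    zero_mem' := fun y => by simp
    smul_mem' := fun c a ha y => by
      rw [Submodule.coe_smul, map_smul]; exact t.smul_mem c (ha y) }
  refine mem_of_rootSum (T := T) D.eq_rootSum.ge S (fun α hα x hx y => ?_) x (D.eq_rootSum ▸ x.2) y
  let S' : Submodule ℂ t := t.comap (br (x : L) ∘ₗ t.subtype)
  exact mem_of_rootSum (T := T) D.eq_rootSum.ge S' (fun β hβ y hy => D.br_mem H hα hβ hx hy) y
    (D.eq_rootSum ▸ y.2)

/-- It is enough to check the relations on root vectors. -/
lemma relAt_of_root_vectors (H : IsHomogeneousCartan 𝔥 p) (D : GradedBy 𝔥 t T h0)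
    {V : Type*} [AddCommGroup V] [Module ℂ V] (ρ : t →ₗ[ℂ] Module.End ℂ V)
    (h : ∀ α ∈ T, ∀ β ∈ T, ∀ x y : t, (x : L) ∈ rootSpace 𝔥 α → (y : L) ∈ rootSpace 𝔥 β →
      ∀ v, RelAt ρ (p α) (p β) x y v) {i j : ZMod 2} {x y : t} (hx : (x : L) ∈ par i)
    (hy : (y : L) ∈ par j) (v : V) : RelAt ρ i j x y v := by
  have hclosed : ∀ (i j : ZMod 2) (v : V) (x x' y : t) , RelAt ρ i j x y v → RelAt ρ i j x' y v →
      RelAt ρ i j (x + x') y v := by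
    intro i j v x x' y h1 h2 z hz
    have e : z = ⟨_, D.br_mem_t H x y⟩ + ⟨_, D.br_mem_t H x' y⟩ := Subtype.ext (by simp [hz])
    rw [e, map_add, LinearMap.add_apply, h1 ⟨_, D.br_mem_t H x y⟩ rfl,
      h2 ⟨_, D.br_mem_t H x' y⟩ rfl]
    simp only [map_add, LinearMap.add_apply, smul_add]; abel
  have hclosed' : ∀ (i j : ZMod 2) (v : V) (x y y' : t) , RelAt ρ i j x y v → RelAt ρ i j x y' v →
      RelAt ρ i j x (y + y') v := by
    intro i j v x y y' h1 h2 z hz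
    have e : z = ⟨_, D.br_mem_t H x y⟩ + ⟨_, D.br_mem_t H x y'⟩ := Subtype.ext (by simp [hz])
    rw [e, map_add, LinearMap.add_apply, h1 ⟨_, D.br_mem_t H x y⟩ rfl,
      h2 ⟨_, D.br_mem_t H x y'⟩ rfl]
    simp only [map_add, LinearMap.add_apply, smul_add]; abel
  have hsmul : ∀ (i j : ZMod 2) (v : V) (c : ℂ) (x y : t) , RelAt ρ i j x y v →
      RelAt ρ i j (c • x) y v := by
    intro i j v c x y h1 z hz
    have e : z = c • ⟨_, D.br_mem_t H x y⟩ := Subtype.ext (by simp [hz])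
    rw [e, map_smul, LinearMap.smul_apply, h1 ⟨_, D.br_mem_t H x y⟩ rfl]
    simp only [map_smul, LinearMap.smul_apply]; module
  have hsmul' : ∀ (i j : ZMod 2) (v : V) (c : ℂ) (x y : t) , RelAt ρ i j x y v →
      RelAt ρ i j x (c • y) v := by
    intro i j v c x y h1 z hz
    have e : z = c • ⟨_, D.br_mem_t H x y⟩ := Subtype.ext (by simp [hz])
    rw [e, map_smul, LinearMap.smul_apply, h1 ⟨_, D.br_mem_t H x y⟩ rfl]
    simp only [map_smul, LinearMap.smul_apply]; module
  have hzero : ∀ (i j : ZMod 2) (v : V) (y : t) , RelAt ρ i j 0 y v := by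
    intro i j v y z hz
    have e : z = 0 := Subtype.ext (by simp [hz])
    simp [e]
  have hzero' : ∀ (i j : ZMod 2) (v : V) (x : t) , RelAt ρ i j x 0 v := by
    intro i j v y z hz
    have e : z = 0 := Subtype.ext (by simp [hz])
    simp [e]
  have hT : ∀ i, rootSum 𝔥 {α ∈ T | p α = i} ≤ t := fun i => by
    rw [D.eq_rootSum]; exact rootSum_mono fun _ hα => hα.1
  have hx' := H.rootSum_inf_par_le T i ⟨D.eq_rootSum ▸ x.2, hx⟩
  have hy' := H.rootSum_inf_par_le T j ⟨D.eq_rootSum ▸ y.2, hy⟩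
  let S : Submodule ℂ t :=
    { carrier := {x | RelAt ρ i j x y v}
      add_mem' := fun ha hb => hclosed _ _ _ _ _ _ ha hb
      zero_mem' := hzero _ _ _ _
      smul_mem' := fun c _ ha => hsmul _ _ _ c _ _ ha }
  refine mem_of_rootSum (hT i) S (fun α hα x hx => ?_) x hx'
  let S' : Submodule ℂ t :=
    { carrier := {y | RelAt ρ i j x y v}
      add_mem' := fun ha hb => hclosed' _ _ _ _ _ _ ha hb
      zero_mem' := hzero' _ _ _ _
      smul_mem' := fun c _ ha => hsmul' _ _ _ c _ _ ha }
  refine mem_of_rootSum (hT j) S' (fun β hβ y hy => ?_) y hy'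
  have := h α hα.1 β hβ.1 x y hx hy v
  rw [hα.2, hβ.2] at this
  exact this

lemma envι_bracket {i j : ZMod 2} {x y z : t} (hx : (x : L) ∈ par i) (hy : (y : L) ∈ par j)
    (hz : (z : L) = br (x : L) (y : L)) :
    envι t z = envι t x * envι t y - sgn i j • (envι t y * envι t x) := by
  have h := RingQuot.mkAlgHom_rel ℂ (EnvRel.mk hx hy hz)
  rw [map_mul, map_add, map_smul, map_mul] at h
  exact eq_sub_of_add_eq' h.symm

lemma exists_env_lift {V : Type*} [AddCommGroup V] [Module ℂ V] (ρ : t →ₗ[ℂ] Module.End ℂ V)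
    (h : ∀ (i j : ZMod 2) (x y : t), (x : L) ∈ par i → (y : L) ∈ par j → ∀ v, RelAt ρ i j x y v) :
    ∃ Φ : Env t →ₐ[ℂ] Module.End ℂ V, ∀ x, Φ (envι t x) = ρ x := by
  let Φ : RingQuot (EnvRel t) →ₐ[ℂ] Module.End ℂ V :=
    RingQuot.liftAlgHom ℂ ⟨TensorAlgebra.lift ℂ ρ, by
      rintro _ _ ⟨hx, hy, hz⟩
      rename_i i j x y z
      ext v
      simp only [map_mul, map_add, map_smul, TensorAlgebra.lift_ι_apply]
      rw [LinearMap.add_apply, h i j x y hx hy v z hz]; simp⟩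
  refine ⟨Φ, fun x => ?_⟩
  have : Φ (RingQuot.mkAlgHom ℂ (EnvRel t) (TensorAlgebra.ι ℂ x)) = ρ x := by
    simp only [Φ, RingQuot.liftAlgHom_mkAlgHom_apply, TensorAlgebra.lift_ι_apply]
  exact this

lemma env_induction (S : Subalgebra ℂ (Env t)) (h : ∀ x, envι t x ∈ S) (a : Env t) : a ∈ S := by
  obtain ⟨b, rfl⟩ := RingQuot.mkAlgHom_surjective ℂ (EnvRel t) a
  induction b using TensorAlgebra.induction with
  | algebraMap r => rw [AlgHom.commutes]; exact S.algebraMap_mem r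
  | ι x => exact h x
  | mul a b ha hb => rw [map_mul]; exact S.mul_mem ha hb
  | add a b ha hb => rw [map_add]; exact S.add_mem ha hb

/-- A subspace stable under `t` is a `U(t)`-submodule. -/
lemma env_smul_mem {V : Type*} [AddCommGroup V] [Module ℂ V] [Module (Env t) V]
    [IsScalarTower ℂ (Env t) V] (N : Submodule ℂ V) (h : ∀ x, ∀ v ∈ N, envι t x • v ∈ N)
    (a : Env t) {v : V} (hv : v ∈ N) : a • v ∈ N := by
  let S : Subalgebra ℂ (Env t) :=
    { carrier := {a | ∀ u ∈ N, a • u ∈ N}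
      mul_mem' := fun ha hb u hu => by rw [mul_smul]; exact ha _ (hb u hu)
      add_mem' := fun ha hb u hu => by rw [add_smul]; exact add_mem (ha u hu) (hb u hu)
      algebraMap_mem' := fun c u hu => by rw [algebraMap_smul]; exact N.smul_mem c hu }
  exact env_induction S h a v hv

end Enveloping

/-! ### The embedding of `Ω` into the generalized Verma module. -/

section Embedding

variable {L : Type} [AddCommGroup L] [Module ℂ L] [LieSuperalgebra L]
variable {𝔥 t l n : Submodule ℂ L} {p : Module.Dual ℂ 𝔥 → ZMod 2} {T : Set (Module.Dual ℂ 𝔥)}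
  {h0 : 𝔥}

/-- A quotient of the free module in which all relations hold, and into which `Ω` embeds. -/
lemma exists_module_extension (H : IsHomogeneousCartan 𝔥 p) (D : GradedBy 𝔥 t T h0)
    {E W : Type*} [AddCommGroup E] [Module ℂ E] [AddCommGroup W] [Module ℂ W]
    (ρ : t →ₗ[ℂ] Module.End ℂ E) (ε : E →ₗ[ℂ] W)
    (hrel : ∀ α ∈ degZero T h0 ∪ degPos T h0, ∀ β ∈ T, ∀ x y : t, (x : L) ∈ rootSpace 𝔥 α →
        (y : L) ∈ rootSpace 𝔥 β → ∀ v, RelAt ρ (p α) (p β) x y v)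
    (hε : ∀ α ∈ degNeg T h0, ∀ x : t, (x : L) ∈ rootSpace 𝔥 α → ∀ v, ε (ρ x v) = 0) :
    ∃ I : Submodule ℂ E, (∀ v ∈ I, ε v = 0) ∧ (∀ (x : t), ∀ v ∈ I, ρ x v ∈ I) ∧
      ∀ α ∈ T, ∀ β ∈ T, ∀ x y z : t, (x : L) ∈ rootSpace 𝔥 α → (y : L) ∈ rootSpace 𝔥 β →
        (z : L) = br (x : L) (y : L) → ∀ v,
        ρ x (ρ y v) - sgn (p α) (p β) • ρ y (ρ x v) - ρ z v ∈ I := by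
  let Qf : ZMod 2 → ZMod 2 → t → t → t → E → E :=
    fun i j x y z v => ρ x (ρ y v) - sgn i j • ρ y (ρ x v) - ρ z v
  -- Only the defects of pairs of lowering root vectors are needed: `hQ` shows that all other pairs
  -- have defect zero, using skew-symmetry when the nonnegative vector comes second.
  let W0 : Submodule ℂ E := Submodule.span ℂ
    {q | ∃ α ∈ degNeg T h0, ∃ β ∈ degNeg T h0, ∃ x y z : t, (x : L) ∈ rootSpace 𝔥 α ∧
      (y : L) ∈ rootSpace 𝔥 β ∧ (z : L) = br (x : L) (y : L) ∧
      ∃ v, q = Qf (p α) (p β) x y z v}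
  have hQ : ∀ α ∈ T, ∀ β ∈ T, ∀ x y z : t, (x : L) ∈ rootSpace 𝔥 α → (y : L) ∈ rootSpace 𝔥 β →
      (z : L) = br (x : L) (y : L) → ∀ v, Qf (p α) (p β) x y z v ∈ W0 := by
    intro α hα β hβ x y z hx hy hz v
    rcases D.cases hα with h | h
    · have : Qf (p α) (p β) x y z v = 0 := by
        simp only [Qf]; rw [hrel α h β hβ x y hx hy v z hz]; simp
      rw [this]; exact W0.zero_mem
    rcases D.cases hβ with h' | h'
    · have hz' : ((-(sgn (p α) (p β) • z) : t) : L) = br (y : L) (x : L) := by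
        rw [Submodule.coe_neg, Submodule.coe_smul, hz, br_skew (H.homog _ hx) (H.homog _ hy)]
        simp [smul_smul, sgn_sq]
      have e := hrel β h' α hα y x hy hx v _ hz'
      have : Qf (p α) (p β) x y z v = 0 := by
        simp only [Qf]
        rw [map_neg, map_smul, LinearMap.neg_apply, LinearMap.smul_apply] at e
        have e2 := congrArg (fun u => sgn (p α) (p β) • u) e
        simp only [smul_neg, smul_smul, smul_sub, sgn_sq, one_smul, sgn_comm (p β) (p α)] at e2
        rw [eq_neg_of_add_eq_zero_left (a := ρ z v)
          (b := sgn (p α) (p β) • ρ y (ρ x v) - ρ x (ρ y v)) (by rw [← e2]; abel)]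
        abel
      rw [this]; exact W0.zero_mem
    · exact Submodule.subset_span ⟨α, h, β, h', x, y, z, hx, hy, hz, v, rfl⟩
  have hQ' : ∀ (i j : ZMod 2) (α β γ : Module.Dual ℂ 𝔥), α ∈ T → β ∈ T → γ ∈ T → ∀ x y z : t,
      (x : L) ∈ par i → (y : L) ∈ par j → (x : L) ∈ rootSpace 𝔥 (α + β) →
      (y : L) ∈ rootSpace 𝔥 γ →
      (z : L) = br (x : L) (y : L) → ∀ v, Qf i j x y z v ∈ W0 ∧
        ∀ z' : t, (z' : L) = br (y : L) (x : L) → Qf j i y x z' v ∈ W0 := by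
    intro i j α β γ hα hβ hγ x y z hxi hyj hx hy hz v
    by_cases hx0 : x = 0
    · subst hx0
      have : z = 0 := Subtype.ext (by simp [hz])
      refine ⟨by simp [Qf, this], fun z' hz' => ?_⟩
      have : z' = 0 := Subtype.ext (by simp [hz'])
      simp [Qf, this]
    by_cases hy0 : y = 0
    · subst hy0
      have : z = 0 := Subtype.ext (by simp [hz])
      refine ⟨by simp [Qf, this], fun z' hz' => ?_⟩
      have : z' = 0 := Subtype.ext (by simp [hz'])
      simp [Qf, this]
    have hx0' : (x : L) ≠ 0 := fun h => hx0 (Subtype.ext h)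
    have hy0' : (y : L) ≠ 0 := fun h => hy0 (Subtype.ext h)
    have hr : α + β ∈ roots 𝔥 := by
      by_contra hr
      exact hx0' (eq_zero_of_not_mem_roots hr hx)
    have h1 := eq_of_mem_par (H.homog _ hx) hxi hx0'
    have h2 := eq_of_mem_par (H.homog _ hy) hyj hy0'
    rw [← h1, ← h2]
    exact ⟨hQ _ (D.closed _ hα _ hβ hr) _ hγ x y z hx hy hz v,
      fun z' hz' => hQ _ hγ _ (D.closed _ hα _ hβ hr) y x z' hy hx hz' v⟩
  have hW0 : ∀ α ∈ degZero T h0 ∪ degPos T h0, ∀ x : t, (x : L) ∈ rootSpace 𝔥 α → ∀ w ∈ W0,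
      ρ x w ∈ W0 := by
    intro α hα x hx w hw
    refine Submodule.span_induction ?_ (by simp) (fun a b _ _ ha hb => by
      rw [map_add]; exact add_mem ha hb) (fun c a _ ha => by
      rw [map_smul]; exact W0.smul_mem c ha) hw
    rintro _ ⟨β, hβ, γ, hγ, y, y', z, hy, hy', hz, v, rfl⟩
    have hαT := degGe_subset hα
    have hβT := degNeg_subset hβ
    have hγT := degNeg_subset hγ
    have hpx := H.homog _ hx
    have hpy := H.homog _ hy
    have hpy' := H.homog _ hy'
    let a : t := ⟨_, D.br_mem_t H x y⟩
    let b : t := ⟨_, D.br_mem_t H x y'⟩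
    let c : t := ⟨_, D.br_mem_t H x z⟩
    let a' : t := ⟨_, D.br_mem_t H a y'⟩
    let b' : t := ⟨_, D.br_mem_t H y b⟩
    have hxy := H.br_mem_rootSpace hx hy
    have hxy' := H.br_mem_rootSpace hx hy'
    have q1 := hQ β hβT γ hγT y y' z hy hy' hz (ρ x v)
    have q2 := (hQ' (p α + p β) (p γ) α β γ hαT hβT hγT a y' a' (br_mem hpx hpy) hpy' hxy hy' rfl
      v).1
    have q3 := (hQ' (p α + p γ) (p β) α γ β hαT hγT hβT b y ⟨_, D.br_mem_t H b y⟩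
      (br_mem hpx hpy') hpy hxy' hy rfl v).2 b' rfl
    have hzr : (z : L) ∈ rootSpace 𝔥 (β + γ) := hz ▸ H.br_mem_rootSpace hy hy'
    have hzp : (z : L) ∈ par (p β + p γ) := hz ▸ br_mem hpy hpy'
    have ec : c = a' + sgn (p α) (p β) • b' := by
      refine Subtype.ext ?_
      have := br_jacobi hpx hpy hpy'
      rw [← hz] at this
      exact this
    have hrz : ρ c v = ρ x (ρ z v) - sgn (p α) (p β + p γ) • ρ z (ρ x v) := by
      by_cases hz0 : z = 0
      · have : c = 0 := Subtype.ext (by simp [c, hz0])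
        simp [this, hz0]
      have hz0' : (z : L) ≠ 0 := fun h => hz0 (Subtype.ext h)
      have hr : β + γ ∈ roots 𝔥 := by
        by_contra hr
        exact hz0' (eq_zero_of_not_mem_roots hr hzr)
      rw [← eq_of_mem_par (H.homog _ hzr) hzp hz0']
      exact hrel α hα _ (D.closed _ hβT _ hγT hr) x z hx hzr v c rfl
    have r1 : ∀ u, ρ x (ρ y u) = sgn (p α) (p β) • ρ y (ρ x u) + ρ a u := fun u => by
      rw [hrel α hα β hβT x y hx hy u a rfl]; abel
    have r2 : ∀ u, ρ x (ρ y' u) = sgn (p α) (p γ) • ρ y' (ρ x u) + ρ b u := fun u => by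
      rw [hrel α hα γ hγT x y' hx hy' u b rfl]; abel
    have r3 : ρ x (ρ z v) = sgn (p α) (p β + p γ) • ρ z (ρ x v) + ρ a' v
        + sgn (p α) (p β) • ρ b' v := by
      have : ρ c v = ρ a' v + sgn (p α) (p β) • ρ b' v := by rw [ec]; simp
      rw [eq_add_of_sub_eq hrz.symm, this]; abel
    -- Super Jacobi identity for defects: `x` applied to the defect of `(y, y')` at `v` is, up to
    -- signs, the sum of the defects of `(y, y')` at `x v`, of `([x, y], y')` at `v` and of `(y, [x,
    -- y'])` at `v`. So `W0` is stable under nonnegative root vectors.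
    have e : ρ x (Qf (p β) (p γ) y y' z v) =
        (sgn (p α) (p β) * sgn (p α) (p γ)) • Qf (p β) (p γ) y y' z (ρ x v) +
        Qf (p α + p β) (p γ) a y' a' v + sgn (p α) (p β) • Qf (p β) (p α + p γ) y b b' v := by
      simp only [Qf]
      rw [map_sub, map_sub, map_smul, r1, r2, r2, r1, r3]
      simp only [sgn_add, sgn_add_left, map_add, map_smul, smul_add, smul_sub, smul_smul]
      have hs := sgn_sq (p α) (p β)
      have hs1 : sgn (p α) (p β) * (sgn (p β) (p α) * sgn (p β) (p γ)) = sgn (p β) (p γ) := by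
        rw [← mul_assoc, sgn_comm (p β) (p α), hs, one_mul]
      rw [hs1]
      match_scalars <;> ring
    rw [e]
    exact add_mem (add_mem (W0.smul_mem _ q1) q2) (W0.smul_mem _ q3)
  -- The closure of `W0` under lowering vectors is a submodule by `opClosure_lowOps_stable`. It is
  -- killed by `ε` because each term of a defect of two lowering vectors, the bracket term included,
  -- is an image of a lowering vector.
  refine ⟨opClosure (lowOps T h0 ρ) W0, ?_, ?_, ?_⟩
  · have : opClosure (lowOps T h0 ρ) W0 ≤ LinearMap.ker ε := by
      refine opClosure_le ?_ ?_
      · refine Submodule.span_le.2 ?_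
        rintro _ ⟨β, hβ, γ, hγ, y, y', z, hy, hy', hz, v, rfl⟩
        have hzε : ε (ρ z v) = 0 := by
          have hzr : (z : L) ∈ rootSpace 𝔥 (β + γ) := hz ▸ H.br_mem_rootSpace hy hy'
          by_cases hr : β + γ ∈ roots 𝔥
          · exact hε _ (add_mem_degNeg D hβ hγ hr) z hzr v
          · have : z = 0 := Subtype.ext (eq_zero_of_not_mem_roots hr hzr)
            simp [this]
        simp only [SetLike.mem_coe, LinearMap.mem_ker, Qf, map_sub, map_smul, hε β hβ y hy,
          hε γ hγ y' hy', hzε]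
        simp
      · rintro _ ⟨γ, hγ, y, hy, rfl⟩ v _
        exact hε γ hγ y hy v
    exact fun v hv => this hv
  · exact opClosure_lowOps_stable H D ρ
      (fun α hα γ hγ x y hx hy v => hrel α hα γ (degNeg_subset hγ) x y hx hy v)
      (fun α hα x hx w hw => le_opClosure (hW0 α hα x hx w hw))
  · exact fun α hα β hβ x y z hx hy hz v => le_opClosure (hQ α hα β hβ x y z hx hy hz v)

/-- `Ω` embeds into the generalized Verma module. -/
theorem toGenVerma_injective (H : IsHomogeneousCartan 𝔥 p) (D : GradedBy 𝔥 t T h0)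
    (hl : l = rootSum 𝔥 (degZero T h0)) (hn : n = rootSum 𝔥 (degPos T h0)) (Ω : SuperRep l)
    (hΩ : ∀ (i j : ZMod 2) (x y z : l) (v : Ω.V), (x : L) ∈ par i → (y : L) ∈ par j →
      (z : L) = br (x : L) (y : L) →
      Ω.act z v = Ω.act x (Ω.act y v) - sgn i j • Ω.act y (Ω.act x v)) :
    Function.Injective (toGenVerma t n Ω) := by
  obtain ⟨E, _, _, ρ, j, ε, hj, hjn, hrel, hεj, hε⟩ := exists_free_module H D hl Ω hΩ
  obtain ⟨I, hI, hIst, hIrel⟩ := exists_module_extension H D ρ ε hrel hε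
  let σ : t →ₗ[ℂ] Module.End ℂ (E ⧸ I) :=
    { toFun := fun x => I.mapQ I (ρ x) (fun v hv => hIst x v hv)
      map_add' := fun x y => by ext v; simp
      map_smul' := fun c x => by ext v; simp }
  have hσ : ∀ x v, σ x (I.mkQ v) = I.mkQ (ρ x v) := fun x v => rfl
  obtain ⟨Φ, hΦ⟩ := exists_env_lift σ (fun i i' x y hx hy v =>
    relAt_of_root_vectors H D σ (fun α hα β hβ x y hx hy v z hz => by
      obtain ⟨v, rfl⟩ := I.mkQ_surjective v
      have := hIrel α hα β hβ x y z hx hy hz v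
      simp only [hσ]
      rw [← map_smul, ← map_sub, ← sub_eq_zero, ← map_sub, Submodule.mkQ_apply,
        Submodule.Quotient.mk_eq_zero, ← neg_mem_iff, neg_sub]
      exact this) hx hy v)
  let B : Env t ⊗[ℂ] Ω.V →ₗ[ℂ] E ⧸ I := TensorProduct.lift
    (LinearMap.lcomp ℂ _ (I.mkQ ∘ₗ j) ∘ₗ Φ.toLinearMap)
  have hB : ∀ a w, B (a ⊗ₜ w) = Φ a (I.mkQ (j w)) := fun a w => rfl
  have hBs : ∀ (a : Env t) u, B (a • u) = Φ a (B u) := by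
    intro a u
    induction u using TensorProduct.induction_on with
    | zero => simp
    | add u v hu hv => rw [smul_add, map_add, map_add, map_add, hu, hv]
    | tmul b w => rw [TensorProduct.smul_tmul', smul_eq_mul, hB, hB, map_mul]; rfl
  let N : Submodule (Env t) (Env t ⊗[ℂ] Ω.V) :=
    { carrier := {u | B u = 0}
      add_mem' := fun {a b} ha hb => by
        rw [Set.mem_ofPred_eq] at *
        rw [map_add, ha, hb, add_zero]
      zero_mem' := map_zero B
      smul_mem' := fun a u hu => by
        rw [Set.mem_ofPred_eq] at *
        rw [hBs, hu, map_zero] }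
  -- The relations defining the tensor product over `U(l ⊕ n)` hold in `E/I`, so `B` factors through
  -- the generalized Verma module.
  have hN : balanced t n Ω ≤ N := by
    refine Submodule.span_le.2 ?_
    rintro _ (⟨x, hx, w, rfl⟩ | ⟨x, hx, w, rfl⟩)
    · change B _ = 0
      rw [map_sub, hB, hB, hΦ, hσ, hj x hx, map_one, Module.End.one_apply, sub_self]
    · change B _ = 0
      rw [hB, hΦ, hσ]
      let S : Submodule ℂ t := LinearMap.ker ((LinearMap.applyₗ (j w)) ∘ₗ ρ)
      have hpt : rootSum 𝔥 (degPos T h0) ≤ t := by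
        rw [D.eq_rootSum]; exact rootSum_mono fun _ h => h.1
      have : x ∈ S := mem_of_rootSum hpt S (fun α hα x hx => hjn α hα x hx w) x (hn ▸ hx)
      have h0' : ρ x (j w) = 0 := this
      rw [h0', map_zero]
  rw [← LinearMap.ker_eq_bot, LinearMap.ker_eq_bot']
  intro w hw
  have h1 : (1 : Env t) ⊗ₜ[ℂ] w ∈ balanced t n Ω := by
    have h2 : (balanced t n Ω).mkQ ((1 : Env t) ⊗ₜ[ℂ] w) = 0 := hw
    rwa [Submodule.mkQ_apply, Submodule.Quotient.mk_eq_zero] at h2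
  -- If `w` dies in the Verma module, then `j w ∈ I`, and `w = ε (j w) = 0`.
  have h2 : B ((1 : Env t) ⊗ₜ[ℂ] w) = 0 := hN h1
  rw [hB, map_one, Module.End.one_apply, Submodule.mkQ_apply, Submodule.Quotient.mk_eq_zero] at h2
  rw [← hεj w, hI _ h2]

end Embedding

/-- If `r + w` lies in a stable subspace `N`, where `r` is an eigenvector and `w` is a sum of
eigenvectors with other eigenvalues, then `r ∈ N`. -/
lemma mem_of_add_mem_of_eigen {V : Type*} [AddCommGroup V] [Module ℂ V] (f : Module.End ℂ V)
    (N : Submodule ℂ V) (hN : ∀ v ∈ N, f v ∈ N) {a : ℂ} {B : Set ℂ} (ha : a ∉ B) {r w : V}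
    (hr : f r = a • r) (hw : w ∈ ⨆ c ∈ B, f.eigenspace c) (h : r + w ∈ N) : r ∈ N := by
  -- In `V/N` the classes of `r` and `-w` coincide, yet they lie in independent sums of eigenspaces
  -- of the induced operator, so both vanish.
  let g : Module.End ℂ (V ⧸ N) := N.mapQ N f hN
  have key : ∀ c, f.eigenspace c ≤ (g.eigenspace c).comap N.mkQ := by
    intro c v hv
    rw [Module.End.mem_eigenspace_iff] at hv
    rw [Submodule.mem_comap, Module.End.mem_eigenspace_iff, ← map_smul, ← hv]
    rfl
  have h1 : N.mkQ r ∈ g.eigenspace a := key a (Module.End.mem_eigenspace_iff.2 hr)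
  have h2 : N.mkQ w ∈ ⨆ c ∈ B, g.eigenspace c := by
    have : (⨆ c ∈ B, f.eigenspace c) ≤ (⨆ c ∈ B, g.eigenspace c).comap N.mkQ :=
      iSup₂_le fun c hc v hv => (le_biSup g.eigenspace hc) (key c hv)
    exact this hw
  have h3 : N.mkQ r = -N.mkQ w := by
    rw [eq_neg_iff_add_eq_zero, ← map_add, Submodule.mkQ_apply, Submodule.Quotient.mk_eq_zero]
    exact h
  have h4 : N.mkQ r = 0 := by
    refine Submodule.disjoint_def.1 (g.eigenspaces_iSupIndep.disjoint_biSup ha) _ h1 ?_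
    rw [h3]; exact neg_mem h2
  rwa [Submodule.mkQ_apply, Submodule.Quotient.mk_eq_zero] at h4

/-! ### Weights of modules over a subalgebra. -/

section

variable {L : Type} [AddCommGroup L] [Module ℂ L] [LieSuperalgebra L]

namespace SuperRep

variable {t : Submodule ℂ L} (M : SuperRep t)

/-- The relations `[x, y] = xy - (-1)^{|x||y|} yx` hold on `M`. -/
def Relations : Prop := ∀ (i j : ZMod 2) (x y : t), (x : L) ∈ par i → (y : L) ∈ par j → ∀ v,
  RelAt M.act i j x y v

variable {M}

lemma IsModule.relations (h : M.IsModule) : M.Relations :=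
  fun i j x y hx hy v z hz => h.2.2 i j x y z v hx hy hz

end SuperRep

variable {𝔥 t l n : Submodule ℂ L} {p : Module.Dual ℂ 𝔥 → ZMod 2} {T : Set (Module.Dual ℂ 𝔥)}
  {h0 : 𝔥}

/-- The action of a root vector shifts weights. -/
lemma act_mem_weightSpace (H : IsHomogeneousCartan 𝔥 p) {M : SuperRep t} (hM : M.Relations)
    {α μ : Module.Dual ℂ 𝔥} {x : t} (hx : (x : L) ∈ rootSpace 𝔥 α) {v : M.V}
    (hv : v ∈ M.weightSpace 𝔥 μ) : M.act x v ∈ M.weightSpace 𝔥 (μ + α) := by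
  intro h hh
  have e : ((α ⟨h, hh⟩ • x : t) : L) = br (h : L) (x : L) := (hx ⟨h, hh⟩).symm
  have := hM 0 (p α) h x (H.even hh) (H.homog _ hx) v _ e
  rw [map_smul, LinearMap.smul_apply, sgn_zero_left, one_smul, hv h hh, map_smul] at this
  rw [eq_add_of_sub_eq this.symm, ← add_smul, LinearMap.add_apply, add_comm]

lemma act_mem_eigenspace (H : IsHomogeneousCartan 𝔥 p) {M : SuperRep t} (hM : M.Relations)
    {α : Module.Dual ℂ 𝔥} {x h : t} (hx : (x : L) ∈ rootSpace 𝔥 α) (hh : (h : L) ∈ 𝔥) {c : ℂ}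
    {v : M.V} (hv : v ∈ Module.End.eigenspace (M.act h) c) :
    M.act x v ∈ Module.End.eigenspace (M.act h) (c + α ⟨h, hh⟩) := by
  rw [Module.End.mem_eigenspace_iff] at *
  have e : ((α ⟨h, hh⟩ • x : t) : L) = br (h : L) (x : L) := (hx ⟨h, hh⟩).symm
  have := hM 0 (p α) h x (H.even hh) (H.homog _ hx) v _ e
  rw [map_smul, LinearMap.smul_apply, sgn_zero_left, one_smul, hv, map_smul] at this
  rw [eq_add_of_sub_eq this.symm, ← add_smul, add_comm]

lemma weightSpace_le_eigenspace {M : SuperRep t} (μ : Module.Dual ℂ 𝔥) {h : t} (hh : (h : L) ∈ 𝔥) :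
    M.weightSpace 𝔥 μ ≤ Module.End.eigenspace (M.act h) (μ ⟨h, hh⟩) := fun v hv => by
  rw [Module.End.mem_eigenspace_iff]; exact hv h hh

/-- `𝔥` is even and abelian, so it acts by commuting operators, whose simultaneous generalized
eigenspaces are independent. Each weight space sits in one of them, and distinct functionals are
distinct families of eigenvalues. -/
lemma iSupIndep_weightSpace (H : IsHomogeneousCartan 𝔥 p) (ht : 𝔥 ≤ t) {M : SuperRep t}
    (hM : M.Relations) : iSupIndep (M.weightSpace 𝔥) := by
  let f : 𝔥 → Module.End ℂ M.V := fun h => M.act ⟨h, ht h.2⟩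
  have hcomm : ∀ h h', Commute (f h) (f h') := by
    intro h h'
    ext v
    have e : ((0 : t) : L) = br (h : L) (h' : L) := (H.abelian _ h.2 _ h'.2).symm
    have := hM 0 0 ⟨h, ht h.2⟩ ⟨h', ht h'.2⟩ (H.even h.2) (H.even h'.2) v _ e
    rw [map_zero, sgn_zero_left, one_smul, LinearMap.zero_apply] at this
    exact sub_eq_zero.1 this.symm
  have h1 := Module.End.independent_iInf_maxGenEigenspace_of_forall_mapsTo f
    (fun i j φ => Module.End.mapsTo_maxGenEigenspace_of_comm (hcomm j i) φ)
  have hinj : Function.Injective (fun (μ : Module.Dual ℂ 𝔥) (h : 𝔥) => μ h) :=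
    fun μ ν h => LinearMap.ext fun x => congrFun h x
  refine (h1.comp hinj).mono fun μ => le_iInf fun h => ?_
  refine (weightSpace_le_eigenspace μ (h := ⟨h, ht h.2⟩) h.2).trans ?_
  exact (f h).genEigenspace_le_maximal _ _

end

/-! ### The induced module: existence, embedding, irreducibility and parity. -/

section Ind

variable {L : Type} [AddCommGroup L] [Module ℂ L] [LieSuperalgebra L]
variable {𝔥 t l n : Submodule ℂ L} {p : Module.Dual ℂ 𝔥 → ZMod 2} {T : Set (Module.Dual ℂ 𝔥)}
  {h0 : 𝔥} (Ω : SuperRep l)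

lemma envι_smul_toGenVerma (x : t) (hx : (x : L) ∈ l) (w : Ω.V) :
    envι t x • toGenVerma t n Ω w = toGenVerma t n Ω (Ω.act ⟨x, hx⟩ w) := by
  rw [← sub_eq_zero]
  change envι t x • (balanced t n Ω).mkQ (1 ⊗ₜ[ℂ] w) - (balanced t n Ω).mkQ (1 ⊗ₜ[ℂ] _) = 0
  rw [← map_smul, ← map_sub, Submodule.mkQ_apply, Submodule.Quotient.mk_eq_zero,
    TensorProduct.smul_tmul', smul_eq_mul, mul_one]
  exact Submodule.subset_span (Or.inl ⟨x, hx, w, rfl⟩)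

lemma envι_smul_toGenVerma_eq_zero (x : t) (hx : (x : L) ∈ n) (w : Ω.V) :
    envι t x • toGenVerma t n Ω w = 0 := by
  change envι t x • (balanced t n Ω).mkQ (1 ⊗ₜ[ℂ] w) = 0
  rw [← map_smul, Submodule.mkQ_apply, Submodule.Quotient.mk_eq_zero,
    TensorProduct.smul_tmul', smul_eq_mul, mul_one]
  exact Submodule.subset_span (Or.inr ⟨x, hx, w, rfl⟩)

lemma genVerma_eq_top (N : Submodule ℂ (GenVerma t n Ω))
    (h1 : ∀ w, toGenVerma t n Ω w ∈ N) (h2 : ∀ x : t, ∀ v ∈ N, envι t x • v ∈ N) : N = ⊤ := by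
  rw [Submodule.eq_top_iff']
  intro v
  obtain ⟨u, rfl⟩ := (balanced t n Ω).mkQ_surjective v
  induction u using TensorProduct.induction_on with
  | zero => rw [map_zero]; exact N.zero_mem
  | add a b ha hb => rw [map_add]; exact N.add_mem ha hb
  | tmul a w =>
    have := env_smul_mem N h2 a (h1 w)
    have e : a • toGenVerma t n Ω w = (balanced t n Ω).mkQ (a ⊗ₜ[ℂ] w) := by
      change a • (balanced t n Ω).mkQ (1 ⊗ₜ[ℂ] w) = _
      rw [← map_smul, TensorProduct.smul_tmul', smul_eq_mul, mul_one]
    rwa [e] at this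

variable (t n) in
/-- The canonical map from `Ω` to the induced module. -/
def indIncl : Ω.V →ₗ[ℂ] (ind t n Ω).V := toInd t n Ω

lemma ind_act_incl (x : t) (hx : (x : L) ∈ l) (w : Ω.V) :
    (ind t n Ω).act x (indIncl t n Ω w) = indIncl t n Ω (Ω.act ⟨x, hx⟩ w) := by
  change envι t x • (maxAvoiding t n Ω).mkQ (toGenVerma t n Ω w) = (maxAvoiding t n Ω).mkQ _
  rw [← map_smul, envι_smul_toGenVerma Ω x hx]

lemma ind_act_incl_eq_zero (x : t) (hx : (x : L) ∈ n) (w : Ω.V) :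
    (ind t n Ω).act x (indIncl t n Ω w) = 0 := by
  change envι t x • (maxAvoiding t n Ω).mkQ (toGenVerma t n Ω w) = 0
  rw [← map_smul, envι_smul_toGenVerma_eq_zero Ω x hx, map_zero]

lemma ind_eq_top (N : Submodule ℂ (ind t n Ω).V) (h1 : ∀ w, indIncl t n Ω w ∈ N)
    (h2 : (ind t n Ω).IsInvariant N) : N = ⊤ := by
  let q : GenVerma t n Ω →ₗ[ℂ] (ind t n Ω).V := (maxAvoiding t n Ω).mkQ.restrictScalars ℂ
  have hq : ∀ x v, q (envι t x • v) = (ind t n Ω).act x (q v) := fun x v =>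
    map_smul (maxAvoiding t n Ω).mkQ _ _
  have := genVerma_eq_top Ω (N.comap q) h1 (fun x v hv => by
    rw [Submodule.mem_comap, hq] at *
    exact h2 x _ hv)
  rw [Submodule.eq_top_iff']
  intro v
  obtain ⟨u, rfl⟩ := (maxAvoiding t n Ω).mkQ_surjective v
  have hu : u ∈ (⊤ : Submodule ℂ (GenVerma t n Ω)) := Submodule.mem_top
  rw [← this] at hu
  exact hu

lemma ind_relations : (ind t n Ω).Relations := by
  intro i j x y hx hy v z hz
  have : ∀ v : IndSpace t n Ω, envι t z • v =
      envι t x • envι t y • v - sgn i j • envι t y • envι t x • v := fun v => by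
    rw [envι_bracket hx hy hz, sub_smul, mul_smul, smul_assoc, mul_smul]
  exact this v

lemma ind_vpar_le (N : ZMod 2 → Submodule ℂ (ind t n Ω).V)
    (h1 : ∀ j, ∀ w ∈ Ω.vpar j, indIncl t n Ω w ∈ N j)
    (h2 : ∀ (i j : ZMod 2) (x : t), (x : L) ∈ par i → ∀ v ∈ N j, (ind t n Ω).act x v ∈ N (i + j))
    (j : ZMod 2) : (ind t n Ω).vpar j ≤ N j := by
  refine Submodule.span_le.2 fun v hv => ?_
  induction hv with
  | of hw => exact h1 _ _ hw
  | act hx _ ih => exact h2 _ _ _ hx _ ih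

lemma indIncl_mem_vpar {j : ZMod 2} {w : Ω.V} (hw : w ∈ Ω.vpar j) :
    indIncl t n Ω w ∈ (ind t n Ω).vpar j := by
  change toInd t n Ω w ∈ Submodule.span ℂ {v : IndSpace t n Ω | IndHom t n Ω j v}
  exact Submodule.subset_span (IndHom.of hw)

lemma ind_act_mem_vpar {i j : ZMod 2} {x : t} (hx : (x : L) ∈ par i) {v : (ind t n Ω).V}
    (hv : v ∈ (ind t n Ω).vpar j) : (ind t n Ω).act x v ∈ (ind t n Ω).vpar (i + j) := by
  have : (ind t n Ω).vpar j ≤ ((ind t n Ω).vpar (i + j)).comap ((ind t n Ω).act x) :=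
    Submodule.span_le.2 fun u hu => Submodule.subset_span (IndHom.act hx hu)
  exact this hv

lemma GradedBy.cartan_le_degZero (H : IsHomogeneousCartan 𝔥 p) (D : GradedBy 𝔥 t T h0) :
    𝔥 ≤ rootSum 𝔥 (degZero T h0) :=
  H.le_rootSpace.trans (rootSpace_le_rootSum (show (0 : Module.Dual ℂ 𝔥) ∈ degZero T h0 from
    ⟨D.zero_mem, rfl⟩))

/-- The whole Verma module is the lowering closure of `Ω`, and lowering reduces the eigenvalue of
`h0` from `a` by positive integers. One element of `𝔥` thereby separates `Ω` from the rest. -/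
lemma genVerma_le (H : IsHomogeneousCartan 𝔥 p) (D : GradedBy 𝔥 t T h0)
    (hl : l = rootSum 𝔥 (degZero T h0)) (hn : n = rootSum 𝔥 (degPos T h0)) {a : ℂ}
    (ha : ∀ x : l, (x : L) = h0 → ∀ w, Ω.act x w = a • w) (h0t : t) (e0 : (h0t : L) = h0) :
    (∀ w, envι t h0t • toGenVerma t n Ω w = a • toGenVerma t n Ω w) ∧
    (⊤ : Submodule ℂ (GenVerma t n Ω)) ≤ LinearMap.range (toGenVerma t n Ω) ⊔
      ⨆ k : ℕ, Module.End.eigenspace (((Algebra.lsmul ℂ ℂ (GenVerma t n Ω)).toLinearMap ∘ₗ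
        envι t) h0t) (a - (k + 1)) := by
  set ρ : t →ₗ[ℂ] Module.End ℂ (GenVerma t n Ω) :=
    (Algebra.lsmul ℂ ℂ (GenVerma t n Ω)).toLinearMap ∘ₗ envι t with hρ
  have hρa : ∀ x v, ρ x v = envι t x • v := fun _ _ => rfl
  have hrel : ∀ (i j : ZMod 2) (x y : t), (x : L) ∈ par i → (y : L) ∈ par j → ∀ v,
      RelAt ρ i j x y v := by
    intro i j x y hx hy v z hz
    rw [hρa, envι_bracket hx hy hz, sub_smul, mul_smul, smul_assoc, mul_smul]
    rfl
  have h0l : (h0t : L) ∈ l := by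
    rw [e0, hl]
    exact D.cartan_le_degZero H h0.2
  have h1 : ∀ w, envι t h0t • toGenVerma t n Ω w = a • toGenVerma t n Ω w := fun w => by
    rw [envι_smul_toGenVerma Ω _ h0l, ha ⟨h0t, h0l⟩ e0, map_smul]
  refine ⟨h1, ?_⟩
  have htop : opClosure (lowOps T h0 ρ) (LinearMap.range (toGenVerma t n Ω)) = ⊤ := by
    refine genVerma_eq_top Ω _ (fun w => le_opClosure ⟨w, rfl⟩) ?_
    refine opClosure_lowOps_stable H D ρ
      (fun α _ γ _ x y hx hy v => hrel _ _ x y (H.homog _ hx) (H.homog _ hy) v) ?_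
    rintro α hα x hx _ ⟨w, rfl⟩
    refine le_opClosure ?_
    rcases hα with hα | hα
    · exact ⟨_, (envι_smul_toGenVerma Ω x (hl ▸ rootSpace_le_rootSum hα hx) w).symm⟩
    · exact ⟨0, by
        rw [map_zero]
        exact (envι_smul_toGenVerma_eq_zero Ω x (hn ▸ rootSpace_le_rootSum hα hx) w).symm⟩
  rw [← htop]
  refine opClosure_lowOps_le ρ h0t e0 (p := p) (fun γ _ y hy v => hrel _ _ h0t y
    (e0 ▸ H.even h0.2) (H.homog _ hy) v) ?_
  rintro _ ⟨w, rfl⟩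
  exact h1 w

/-- Existence of the largest submodule intersecting `Ω` trivially. -/
theorem isGreatest_maxAvoiding (H : IsHomogeneousCartan 𝔥 p) (D : GradedBy 𝔥 t T h0)
    (hl : l = rootSum 𝔥 (degZero T h0)) (hn : n = rootSum 𝔥 (degPos T h0)) {a : ℂ}
    (ha : ∀ x : l, (x : L) = h0 → ∀ w, Ω.act x w = a • w) :
    IsGreatest (avoiding t n Ω) (maxAvoiding t n Ω) := by
  refine ⟨?_, fun N hN => le_sSup hN⟩
  have h0t : (h0 : L) ∈ t := D.cartan_le H h0.2
  obtain ⟨h1, h2⟩ := genVerma_le Ω H D hl hn ha ⟨h0, h0t⟩ rfl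
  set f := ((Algebra.lsmul ℂ ℂ (GenVerma t n Ω)).toLinearMap ∘ₗ envι t) ⟨h0, h0t⟩ with hf
  let B : Set ℂ := {c | ∃ k : ℕ, c = a - (k + 1)}
  have haB : a ∉ B := by
    rintro ⟨k, hk⟩
    have : (k : ℂ) + 1 = 0 := by linear_combination hk
    exact Nat.cast_add_one_ne_zero k this
  have hW : (⨆ k : ℕ, f.eigenspace (a - (k + 1))) ≤ ⨆ c ∈ B, f.eigenspace c :=
    iSup_le fun k => le_biSup f.eigenspace (show a - (k + 1) ∈ B from ⟨k, rfl⟩)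
  -- A submodule is stable under `h0`, so it contains the `Ω`-component of each of its elements, and
  -- this component is zero if the submodule avoids `Ω`. Lying in the lower eigenspaces is a
  -- condition that passes to sums, unlike avoiding `Ω`.
  have hmem : ∀ N ∈ avoiding t n Ω, ∀ v ∈ N, v ∈ ⨆ c ∈ B, f.eigenspace c := by
    intro N hN v hv
    obtain ⟨r, ⟨w, rfl⟩, u, hu, e⟩ := Submodule.mem_sup.1 (h2 (Submodule.mem_top (x := v)))
    have hr : toGenVerma t n Ω w ∈ N.restrictScalars ℂ :=
      mem_of_add_mem_of_eigen f (N.restrictScalars ℂ) (fun v hv => N.smul_mem _ hv) haB (h1 w)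
        (hW hu) (e ▸ hv)
    have : toGenVerma t n Ω w ∈ N.restrictScalars ℂ ⊓ LinearMap.range (toGenVerma t n Ω) :=
      ⟨hr, w, rfl⟩
    have hN' : N.restrictScalars ℂ ⊓ LinearMap.range (toGenVerma t n Ω) = ⊥ := hN
    rw [hN', Submodule.mem_bot] at this
    rw [← e, this, zero_add]; exact hW hu
  have hmax : ∀ v ∈ maxAvoiding t n Ω, v ∈ ⨆ c ∈ B, f.eigenspace c := by
    intro v hv
    rw [maxAvoiding, sSup_eq_iSup'] at hv
    exact Submodule.iSup_induction _ (motive := fun v => v ∈ ⨆ c ∈ B, f.eigenspace c) hv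
      (fun N v hv => hmem N N.2 v hv) (zero_mem _) (fun x y => add_mem)
  change (maxAvoiding t n Ω).restrictScalars ℂ ⊓ LinearMap.range (toGenVerma t n Ω) = ⊥
  rw [eq_bot_iff]
  rintro _ ⟨hv, ⟨w, rfl⟩⟩
  exact Submodule.disjoint_def.1 (f.eigenspaces_iSupIndep.disjoint_biSup haB) _
    (Module.End.mem_eigenspace_iff.2 (h1 w)) (hmax _ hv)

/-- The relations on `Ω` give injectivity into the Verma module, and the scalar action of `h0`
ensures that the submodule factored out still meets `Ω` trivially. -/
theorem indIncl_injective (H : IsHomogeneousCartan 𝔥 p) (D : GradedBy 𝔥 t T h0)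
    (hl : l = rootSum 𝔥 (degZero T h0)) (hn : n = rootSum 𝔥 (degPos T h0)) {a : ℂ}
    (ha : ∀ x : l, (x : L) = h0 → ∀ w, Ω.act x w = a • w) (hΩ : Ω.Relations) :
    Function.Injective (indIncl t n Ω) := by
  have h1 := toGenVerma_injective H D hl hn Ω
    (fun i j x y z v hx hy hz => hΩ i j x y hx hy v z hz)
  have h2 : (maxAvoiding t n Ω).restrictScalars ℂ ⊓ LinearMap.range (toGenVerma t n Ω) = ⊥ :=
    (isGreatest_maxAvoiding Ω H D hl hn ha).1
  rw [← LinearMap.ker_eq_bot, LinearMap.ker_eq_bot']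
  intro w hw
  have h3 : (maxAvoiding t n Ω).mkQ (toGenVerma t n Ω w) = 0 := hw
  rw [Submodule.mkQ_apply, Submodule.Quotient.mk_eq_zero] at h3
  have h4 : toGenVerma t n Ω w ∈ (maxAvoiding t n Ω).restrictScalars ℂ ⊓
    LinearMap.range (toGenVerma t n Ω) := ⟨h3, w, rfl⟩
  rw [h2, Submodule.mem_bot] at h4
  exact h1 (h4.trans (map_zero _).symm)

/-- The preimage of `N` in the Verma module either avoids `Ω`, and is then contained in what was
factored out, or meets `Ω` in a nonzero submodule, which is all of `Ω` by irreducibility and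
generates everything. -/
theorem ind_isIrreducible (hinj : Function.Injective (indIncl t n Ω)) (hlt : l ≤ t)
    (hΩ : Ω.IsIrreducible) : (ind t n Ω).IsIrreducible := by
  obtain ⟨hnt, hirr⟩ := hΩ
  refine ⟨hinj.nontrivial, fun N hN => ?_⟩
  let q : GenVerma t n Ω →ₗ[ℂ] (ind t n Ω).V := (maxAvoiding t n Ω).mkQ.restrictScalars ℂ
  have hq : ∀ x v, q (envι t x • v) = (ind t n Ω).act x (q v) := fun x v =>
    map_smul (maxAvoiding t n Ω).mkQ _ _
  have hN' : ∀ x, ∀ v ∈ N.comap q, envι t x • v ∈ N.comap q := fun x v hv => by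
    rw [Submodule.mem_comap, hq] at *
    exact hN x _ hv
  let N' : Submodule (Env t) (GenVerma t n Ω) :=
    { (N.comap q).toAddSubmonoid with
      smul_mem' := fun c v hv => env_smul_mem (N.comap q) hN' c hv }
  by_cases h : N' ∈ avoiding t n Ω
  · left
    have hle : N' ≤ maxAvoiding t n Ω := le_sSup h
    rw [eq_bot_iff]
    intro v hv
    obtain ⟨u, rfl⟩ := (maxAvoiding t n Ω).mkQ_surjective v
    have : u ∈ maxAvoiding t n Ω := hle hv
    exact (Submodule.Quotient.mk_eq_zero _).2 this
  · right
    have h' : N'.restrictScalars ℂ ⊓ LinearMap.range (toGenVerma t n Ω) ≠ ⊥ := h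
    obtain ⟨v, ⟨hv, w, rfl⟩, hv0⟩ := Submodule.exists_mem_ne_zero_of_ne_bot h'
    have hw : (N.comap (indIncl t n Ω)) = ⊤ := by
      refine (hirr (N.comap (indIncl t n Ω)) (fun x w hw => ?_)).resolve_left ?_
      · have := hN ⟨x, hlt x.2⟩ _ hw
        rwa [ind_act_incl (t := t) Ω ⟨x, hlt x.2⟩ x.2 w] at this
      · intro hb
        have : w ∈ N.comap (indIncl t n Ω) := hv
        rw [hb, Submodule.mem_bot] at this
        exact hv0 (by rw [this, map_zero])
    refine ind_eq_top Ω N (fun w => ?_) hN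
    have : w ∈ N.comap (indIncl t n Ω) := hw ▸ Submodule.mem_top
    exact this

/-- An element of `𝔥` on which all roots of `t` vanish, acting by a scalar on `Ω`, acts by the same
scalar on the induced module. -/
theorem ind_act_scalar (H : IsHomogeneousCartan 𝔥 p) (D : GradedBy 𝔥 t T h0)
    (hl : l = rootSum 𝔥 (degZero T h0)) {h : 𝔥} (hT : ∀ α ∈ T, α h = 0) {c : ℂ}
    (hc : ∀ x : l, (x : L) = h → ∀ w, Ω.act x w = c • w) :
    ∀ x : t, (x : L) = h → ∀ v, (ind t n Ω).act x v = c • v := by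
  intro x hx
  have hxl : (x : L) ∈ l := by
    rw [hx, hl]
    exact D.cartan_le_degZero H h.2
  have hxh : (x : L) ∈ 𝔥 := hx ▸ h.2
  have := ind_eq_top Ω (Module.End.eigenspace ((ind t n Ω).act x) c) (fun w => by
    rw [Module.End.mem_eigenspace_iff, ind_act_incl Ω x hxl, hc ⟨x, hxl⟩ hx, map_smul]) (by
    intro y v hv
    let S : Submodule ℂ t := (Module.End.eigenspace ((ind t n Ω).act x) c).comap
      ((LinearMap.applyₗ v) ∘ₗ (ind t n Ω).act)
    refine mem_of_rootSum (T := T) D.eq_rootSum.ge S (fun α hα y hy => ?_) y (D.eq_rootSum ▸ y.2)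
    have := act_mem_eigenspace H (ind_relations Ω) hy hxh hv
    have e : (⟨x, hxh⟩ : 𝔥) = h := Subtype.ext hx
    rw [e, hT α hα, add_zero] at this
    exact this)
  intro v
  have hv : v ∈ (⊤ : Submodule ℂ (ind t n Ω).V) := Submodule.mem_top
  rw [← this] at hv
  exact Module.End.mem_eigenspace_iff.1 hv

/-- The sum of the eigenspaces of `x` with eigenvalues `b + m`, `m` an integer of parity `j`. -/
def parityEigen {V : Type*} [AddCommGroup V] [Module ℂ V] (f : Module.End ℂ V) (b : ℂ)
    (j : ZMod 2) : Submodule ℂ V :=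
  ⨆ c ∈ {c : ℂ | ∃ m : ℤ, (m : ZMod 2) = j ∧ c = b + m}, f.eigenspace c

lemma mem_parityEigen_map {V W : Type*} [AddCommGroup V] [Module ℂ V] [AddCommGroup W] [Module ℂ W]
    (f : Module.End ℂ V) (g : Module.End ℂ W) {b : ℂ} {j j' : ZMod 2} (F : V →ₗ[ℂ] W) (m : ℤ)
    (hm : j' = j + m) (hF : ∀ c, ∀ v ∈ f.eigenspace c, F v ∈ g.eigenspace (c + m)) {v : V}
    (hv : v ∈ parityEigen f b j) : F v ∈ parityEigen g b j' := by
  have : parityEigen f b j ≤ (parityEigen g b j').comap F := by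
    refine iSup₂_le ?_
    rintro c ⟨k, hk, rfl⟩ v hv
    refine le_biSup g.eigenspace (show b + k + m ∈ {c : ℂ | ∃ m : ℤ, (m : ZMod 2) = j' ∧
      c = b + m} from ⟨k + m, by rw [hm, ← hk]; push_cast; rfl, by push_cast; ring⟩) (hF _ v hv)
  exact this hv

lemma disjoint_parityEigen {V : Type*} [AddCommGroup V] [Module ℂ V] (f : Module.End ℂ V) (b : ℂ) :
    Disjoint (parityEigen f b 0) (parityEigen f b 1) := by
  refine disjoint_of_le_eigenspaces f ?_ le_rfl le_rfl
  rw [Set.disjoint_left]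
  rintro _ ⟨m, hm, rfl⟩ ⟨m', hm', e⟩
  have : m = m' := by exact_mod_cast add_left_cancel e
  rw [this, hm'] at hm
  exact one_ne_zero hm

variable {Ω} in
-- The homogeneous parts of the induced module are mere spans, so their independence has to be
-- proved. The element `hb` does this: its values on roots are integers whose parity is that of the
-- root, so the even and the odd part have `hb`-eigenvalues in `b + 2ℤ` and `b + 2ℤ + 1`. The second
-- conclusion passes this property to the next induction.
theorem ind_isModule (H : IsHomogeneousCartan 𝔥 p) (D : GradedBy 𝔥 t T h0)
    (hl : l = rootSum 𝔥 (degZero T h0)) {hb : 𝔥}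
    (hpar : ∀ α ∈ T, ∃ m : ℤ, α hb = m ∧ (m : ZMod 2) = p α) {b : ℂ} (hΩ : Ω.IsModule)
    (hΩb : ∀ x : l, (x : L) = hb → ∀ j, Ω.vpar j ≤ parityEigen (Ω.act x) b j) :
    (ind t n Ω).IsModule ∧ ∀ x : t, (x : L) = hb → ∀ j,
      (ind t n Ω).vpar j ≤ parityEigen ((ind t n Ω).act x) b j := by
  have hpe : ∀ x : t, (x : L) = hb → ∀ j,
      (ind t n Ω).vpar j ≤ parityEigen ((ind t n Ω).act x) b j := by
    intro x hx
    have hxl : (x : L) ∈ l := by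
      rw [hx, hl]
      exact D.cartan_le_degZero H hb.2
    have hxh : (x : L) ∈ 𝔥 := hx ▸ hb.2
    refine ind_vpar_le Ω _ (fun j w hw => ?_) (fun i j y hy v hv => ?_)
    · refine mem_parityEigen_map (Ω.act ⟨x, hxl⟩) _ (indIncl t n Ω) 0 (by simp) ?_
        (hΩb ⟨x, hxl⟩ hx _ hw)
      intro c v hv
      rw [Module.End.mem_eigenspace_iff] at *
      rw [ind_act_incl Ω x hxl, hv, map_smul]; simp
    · have hy' := H.rootSum_inf_par_le T i ⟨D.eq_rootSum ▸ y.2, hy⟩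
      let S : Submodule ℂ t := (parityEigen ((ind t n Ω).act x) b (i + j)).comap
        ((LinearMap.applyₗ v) ∘ₗ (ind t n Ω).act)
      refine mem_of_rootSum (T := {α ∈ T | p α = i}) (t := t)
        ((rootSum_mono fun _ h => h.1).trans D.eq_rootSum.ge) S
        (fun α hα z hz => ?_) y hy'
      obtain ⟨m, hm, hmp⟩ := hpar α hα.1
      refine mem_parityEigen_map ((ind t n Ω).act x) _ ((ind t n Ω).act z) m
        (by rw [hmp, hα.2, add_comm]) (fun c v hv => ?_) hv
      have := act_mem_eigenspace H (ind_relations Ω) hz hxh hv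
      have e : (⟨x, hxh⟩ : 𝔥) = hb := Subtype.ext hx
      rwa [e, hm] at this
  refine ⟨⟨⟨?_, ?_⟩, ?_, fun i j x y z v hx hy hz => ind_relations Ω i j x y hx hy v z hz⟩, hpe⟩
  · have hbt : (hb : L) ∈ t := D.cartan_le H hb.2
    exact (disjoint_parityEigen ((ind t n Ω).act ⟨hb, hbt⟩) b).mono (hpe _ rfl 0) (hpe _ rfl 1)
  · rw [codisjoint_iff]
    refine ind_eq_top Ω _ (fun w => ?_) ?_
    · have hw : w ∈ Ω.vpar 0 ⊔ Ω.vpar 1 := by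
        rw [hΩ.1.sup_eq_top]; exact Submodule.mem_top
      obtain ⟨w0, h0, w1, h1, rfl⟩ := Submodule.mem_sup.1 hw
      rw [map_add]
      exact add_mem (Submodule.mem_sup_left (indIncl_mem_vpar Ω h0))
        (Submodule.mem_sup_right (indIncl_mem_vpar Ω h1))
    · intro x v hv
      have hle : ∀ j, (ind t n Ω).vpar j ≤ (ind t n Ω).vpar 0 ⊔ (ind t n Ω).vpar 1 := fun j => by
        rcases zmod2 j with rfl | rfl
        · exact le_sup_left
        · exact le_sup_right
      let S : Submodule ℂ t := ((ind t n Ω).vpar 0 ⊔ (ind t n Ω).vpar 1).comap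
        ((LinearMap.applyₗ v) ∘ₗ (ind t n Ω).act)
      refine mem_of_rootSum (T := T) D.eq_rootSum.ge S (fun α hα y hy => ?_) x (D.eq_rootSum ▸ x.2)
      have : ∀ j, (ind t n Ω).vpar j ≤
          ((ind t n Ω).vpar 0 ⊔ (ind t n Ω).vpar 1).comap ((ind t n Ω).act y) :=
        fun j u hu => hle (p α + j) (ind_act_mem_vpar Ω (H.homog _ hy) hu)
      exact (sup_le (this 0) (this 1)) hv
  · exact fun i j x v hx hv => ind_act_mem_vpar Ω hx hv

end Ind

/-! ### Finite dimensionality of weight spaces, and the summary of parabolic induction. -/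

section

variable {L : Type} [AddCommGroup L] [Module ℂ L] [LieSuperalgebra L]
variable {𝔥 t l n : Submodule ℂ L} {p : Module.Dual ℂ 𝔥 → ZMod 2} {T : Set (Module.Dual ℂ 𝔥)}
  {h0 : 𝔥}

/-- The span of the vectors `x₁ ⋯ xᵣ w`, `xᵢ` of weight `αᵢ` and `w ∈ W`. -/
def wordSpan (M : SuperRep t) (W : Submodule ℂ M.V) :
    List (Module.Dual ℂ 𝔥) → Submodule ℂ M.V
  | [] => W
  | α :: s => Submodule.map₂ M.act ((rootSpace 𝔥 α).comap t.subtype) (wordSpan M W s)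

lemma wordSpan_fg (hfd : ∀ α, FiniteDimensional ℂ (rootSpace 𝔥 α)) {M : SuperRep t}
    {W : Submodule ℂ M.V} (hW : W.FG) (s : List (Module.Dual ℂ 𝔥)) : (wordSpan M W s).FG := by
  induction s with
  | nil => exact hW
  | cons α s ih =>
    refine Submodule.FG.map₂ _ ?_ ih
    have := hfd α
    have : FiniteDimensional ℂ ((rootSpace 𝔥 α).comap t.subtype) :=
      Module.Finite.of_injective
        ((t.subtype.restrict (p := (rootSpace 𝔥 α).comap t.subtype) (q := rootSpace 𝔥 α)
          fun _ h => h)) (fun x y h => by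
            ext; exact congrArg (fun u : rootSpace 𝔥 α => (u : L)) h)
    exact (Submodule.fg_iff_finiteDimensional _).2 this

lemma wordSpan_le_weightSpace (H : IsHomogeneousCartan 𝔥 p) {M : SuperRep t} (hM : M.Relations)
    {W : Submodule ℂ M.V} {ν : Module.Dual ℂ 𝔥} (hW : W ≤ M.weightSpace 𝔥 ν)
    (s : List (Module.Dual ℂ 𝔥)) : wordSpan M W s ≤ M.weightSpace 𝔥 (ν + s.sum) := by
  induction s with
  | nil => simpa [wordSpan] using hW
  | cons α s ih =>
    refine Submodule.map₂_le.2 fun x hx v hv => ?_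
    have := act_mem_weightSpace H hM hx (ih hv)
    rwa [List.sum_cons, add_comm α, ← add_assoc]

lemma wordSpan_bot (M : SuperRep t) (s : List (Module.Dual ℂ 𝔥)) : wordSpan M ⊥ s = ⊥ := by
  induction s with
  | nil => rfl
  | cons α s ih => rw [wordSpan, ih, Submodule.map₂_bot_right]

/-- Every letter has degree at most `-1`, so a word of degree `-N` has at most `N` letters, all of
degree between `-N` and `-1`, and there are finitely many such roots. No word has a degree outside
`-ℕ`. -/
lemma finite_words {h0 : 𝔥} (hfin : ∀ m : ℕ, {α | α ∈ T ∧ α h0 = -((m : ℂ) + 1)}.Finite) (c : ℂ) :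
    {s : List (Module.Dual ℂ 𝔥) | (∀ α ∈ s, α ∈ degNeg T h0) ∧ s.sum h0 = c}.Finite := by
  have key : ∀ s : List (Module.Dual ℂ 𝔥), (∀ α ∈ s, α ∈ degNeg T h0) →
      ∃ N : ℕ, s.sum h0 = -(N : ℂ) ∧ s.length ≤ N ∧
        ∀ α ∈ s, ∃ m : ℕ, m < N ∧ α ∈ T ∧ α h0 = -((m : ℂ) + 1) := by
    intro s
    induction s with
    | nil => exact fun _ => ⟨0, by simp, by simp, by simp⟩
    | cons α s ih =>
      intro h
      obtain ⟨N, h1, h2, h3⟩ := ih fun β hβ => h β (List.mem_cons_of_mem _ hβ)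
      obtain ⟨hα, m, hm⟩ := h α List.mem_cons_self
      refine ⟨N + (m + 1), ?_, ?_, ?_⟩
      · rw [List.sum_cons, LinearMap.add_apply, h1, hm]; push_cast; ring
      · rw [List.length_cons]; omega
      · intro β hβ
        rcases List.mem_cons.1 hβ with rfl | hβ
        · exact ⟨m, by omega, hα, hm⟩
        · obtain ⟨m', h4, h5⟩ := h3 β hβ
          exact ⟨m', by omega, h5⟩
  by_cases hc : ∃ N : ℕ, c = -(N : ℂ)
  · obtain ⟨N, rfl⟩ := hc
    set A : Set (Module.Dual ℂ 𝔥) := ⋃ m ∈ Finset.range N, {α | α ∈ T ∧ α h0 = -((m : ℂ) + 1)}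
      with hA
    have hAf : A.Finite := (Finset.range N).finite_toSet.biUnion fun m _ => hfin m
    have : Finite A := hAf
    refine ((List.finite_length_le A N).image (List.map (↑))).subset ?_
    rintro s ⟨hs, hsum⟩
    obtain ⟨N', h1, h2, h3⟩ := key s hs
    have hN : N' = N := by
      rw [h1, neg_inj] at hsum; exact_mod_cast hsum
    subst hN
    have hsA : s ∈ Set.range (List.map ((↑) : A → Module.Dual ℂ 𝔥)) := by
      rw [Set.range_list_map_coe]
      intro α hα
      obtain ⟨m, hm, h⟩ := h3 α hα
      exact Set.mem_biUnion (Finset.mem_coe.2 (Finset.mem_range.2 hm)) h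
    obtain ⟨s', rfl⟩ := hsA
    exact ⟨s', by simpa using h2, rfl⟩
  · convert Set.finite_empty
    rw [Set.eq_empty_iff_forall_notMem]
    rintro s ⟨hs, hsum⟩
    obtain ⟨N, h1, _⟩ := key s hs
    exact hc ⟨N, by rw [← hsum, h1]⟩

/-- A module generated by lowering operators from finite dimensional weight spaces lying in one
degree is a finite weight module. -/
theorem isFiniteWeight_of_lowOps (H : IsHomogeneousCartan 𝔥 p) (ht : 𝔥 ≤ t) {M : SuperRep t}
    (hM : M.Relations) {a : ℂ} (hfd : ∀ α, FiniteDimensional ℂ (rootSpace 𝔥 α))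
    (hfin : ∀ m : ℕ, {α | α ∈ T ∧ α h0 = -((m : ℂ) + 1)}.Finite)
    {W : Module.Dual ℂ 𝔥 → Submodule ℂ M.V} (hW : ∀ ν, W ν ≤ M.weightSpace 𝔥 ν)
    (hWfg : ∀ ν, (W ν).FG) (hWa : ∀ ν, ν h0 ≠ a → W ν = ⊥)
    (htop : opClosure (lowOps T h0 M.act) (⨆ ν, W ν) = ⊤) : M.IsFiniteWeight 𝔥 := by
  have hind := iSupIndep_weightSpace H ht hM
  let Ls : Set (List (Module.Dual ℂ 𝔥)) := {s | ∀ α ∈ s, α ∈ degNeg T h0}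
  let G : Module.Dual ℂ 𝔥 → Submodule ℂ M.V := fun μ => ⨆ s ∈ Ls, wordSpan M (W (μ - s.sum)) s
  have hG : ∀ μ, G μ ≤ M.weightSpace 𝔥 μ := fun μ => iSup₂_le fun s _ => by
    have := wordSpan_le_weightSpace H hM (hW (μ - s.sum)) s
    rwa [sub_add_cancel] at this
  have hGtop : ⨆ μ, G μ = ⊤ := by
    rw [eq_top_iff, ← htop]
    refine opClosure_le (iSup_le fun ν => le_trans ?_ (le_iSup _ ν)) ?_
    · have : wordSpan M (W (ν - ([] : List (Module.Dual ℂ 𝔥)).sum)) [] ≤ G ν :=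
        le_biSup (fun s => wordSpan M (W (ν - s.sum)) s) (by simp [Ls])
      rwa [List.sum_nil, sub_zero] at this
    rintro _ ⟨γ, hγ, y, hy, rfl⟩ v hv
    have : ⨆ μ, G μ ≤ (⨆ μ, G μ).comap (M.act y) := by
      refine iSup_le fun μ => iSup₂_le fun s hs v hv => ?_
      have h1 : M.act y v ∈ wordSpan M (W (μ + γ - (γ :: s).sum)) (γ :: s) := by
        have e : μ + γ - (γ :: s).sum = μ - s.sum := by rw [List.sum_cons]; abel
        rw [e]
        exact Submodule.apply_mem_map₂ _ hy hv
      have h2 : wordSpan M (W (μ + γ - (γ :: s).sum)) (γ :: s) ≤ G (μ + γ) :=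
        le_biSup (fun s => wordSpan M (W (μ + γ - s.sum)) s) (by
          intro α hα
          rcases List.mem_cons.1 hα with rfl | hα
          · exact hγ
          · exact hs α hα)
      exact (h2.trans (le_iSup G (μ + γ))) h1
    exact this hv
  -- The subspaces `G μ` lie in the independent weight spaces and together span the module, so they
  -- are the full weight spaces.
  have hEq : G = M.weightSpace 𝔥 := (hind.le_iff_eq_of_iSup_eq_top hGtop).1 hG
  refine ⟨ht, hind, by rw [← hEq, hGtop], fun μ => ?_⟩
  rw [← hEq, ← Submodule.fg_iff_finiteDimensional]
  let S : Set (List (Module.Dual ℂ 𝔥)) := {s | s ∈ Ls ∧ s.sum h0 = μ h0 - a}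
  have hS : S.Finite := finite_words hfin _
  -- A word of degree other than `μ(h0) - a` would start from some `W ν` with `ν(h0) ≠ a`, which is
  -- zero.
  have h1 : G μ = ⨆ s ∈ hS.toFinset, wordSpan M (W (μ - s.sum)) s := by
    refine le_antisymm (iSup₂_le fun s hs => ?_) (iSup₂_le fun s hs => ?_)
    · by_cases h : s.sum h0 = μ h0 - a
      · exact le_biSup (fun s => wordSpan M (W (μ - s.sum)) s) (hS.mem_toFinset.2 ⟨hs, h⟩)
      · have : W (μ - s.sum) = ⊥ := hWa _ fun e => h (by
          rw [LinearMap.sub_apply] at e; linear_combination -e)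
        rw [this, wordSpan_bot]; exact bot_le
    · exact le_biSup (fun s => wordSpan M (W (μ - s.sum)) s) (hS.mem_toFinset.1 hs).1
  rw [h1]
  exact Submodule.fg_biSup _ _ fun s _ => wordSpan_fg hfd (hWfg _) s

lemma ind_opClosure_eq_top (Ω : SuperRep l) (H : IsHomogeneousCartan 𝔥 p) (D : GradedBy 𝔥 t T h0)
    (hl : l = rootSum 𝔥 (degZero T h0)) (hn : n = rootSum 𝔥 (degPos T h0)) :
    opClosure (lowOps T h0 (ind t n Ω).act) (LinearMap.range (indIncl t n Ω)) = ⊤ := by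
  refine ind_eq_top Ω _ (fun w => le_opClosure (LinearMap.mem_range_self _ w)) ?_
  refine opClosure_lowOps_stable H D _
    (fun α _ γ _ x y hx hy v => ind_relations Ω _ _ x y (H.homog _ hx) (H.homog _ hy) v) ?_
  rintro α hα x hx _ ⟨w, rfl⟩
  rcases hα with hα | hα
  · rw [ind_act_incl Ω x (hl ▸ rootSpace_le_rootSum hα hx) w]
    exact le_opClosure (LinearMap.mem_range_self _ _)
  · rw [ind_act_incl_eq_zero Ω x (hn ▸ rootSpace_le_rootSum hα hx) w]
    exact zero_mem _

/-- The induced module of a finite weight module is a finite weight module. -/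
theorem ind_isFiniteWeight (Ω : SuperRep l) (H : IsHomogeneousCartan 𝔥 p) (D : GradedBy 𝔥 t T h0)
    (hl : l = rootSum 𝔥 (degZero T h0)) (hn : n = rootSum 𝔥 (degPos T h0)) {a : ℂ}
    (ha : ∀ x : l, (x : L) = h0 → ∀ w, Ω.act x w = a • w)
    (hfd : ∀ α, FiniteDimensional ℂ (rootSpace 𝔥 α))
    (hfin : ∀ m : ℕ, {α | α ∈ T ∧ α h0 = -((m : ℂ) + 1)}.Finite)
    (hΩ : Ω.IsFiniteWeight 𝔥) : (ind t n Ω).IsFiniteWeight 𝔥 := by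
  obtain ⟨hl', -, hΩtop, hΩfd⟩ := hΩ
  refine isFiniteWeight_of_lowOps (a := a) H (D.cartan_le H) (ind_relations Ω) hfd hfin
    (W := fun ν => (Ω.weightSpace 𝔥 ν).map (indIncl t n Ω)) ?_ ?_ ?_ ?_
  · rintro ν _ ⟨w, hw, rfl⟩ x hx
    rw [ind_act_incl Ω x (hl' hx), hw ⟨x, hl' hx⟩ hx, map_smul]
  · exact fun ν => ((Submodule.fg_iff_finiteDimensional _).2 (hΩfd ν)).map _
  · intro ν hν
    suffices h : Ω.weightSpace 𝔥 ν = ⊥ by simp only [h, Submodule.map_bot]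
    rw [eq_bot_iff]
    intro w hw
    have e1 := hw ⟨h0, hl' h0.2⟩ h0.2
    rw [ha _ rfl] at e1
    have e2 : (a - ν h0) • w = 0 := by rw [sub_smul, e1, sub_self]
    exact (smul_eq_zero.1 e2).resolve_left (sub_ne_zero.2 (Ne.symm hν))
  · rw [← Submodule.map_iSup, hΩtop, ← LinearMap.range_eq_map]
    exact ind_opClosure_eq_top Ω H D hl hn

/-- The main properties of parabolic induction from a grading. -/
theorem parInd_isIrreducibleFiniteWeight {P : Set (Module.Dual ℂ 𝔥)}
    (Ω : SuperRep (rootSum 𝔥 (P ∩ -P))) (H : IsHomogeneousCartan 𝔥 p) (D : GradedBy 𝔥 t T h0)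
    (hP0 : P ∩ -P = degZero T h0) (hP1 : P \ -P = degPos T h0) {a : ℂ}
    (ha : ∀ x : rootSum 𝔥 (P ∩ -P), (x : L) = h0 → ∀ w, Ω.act x w = a • w)
    (hfd : ∀ α, FiniteDimensional ℂ (rootSpace 𝔥 α))
    (hfin : ∀ m : ℕ, {α | α ∈ T ∧ α h0 = -((m : ℂ) + 1)}.Finite) {hb : 𝔥}
    (hpar : ∀ α ∈ T, ∃ m : ℤ, α hb = m ∧ (m : ZMod 2) = p α) {b : ℂ}
    (hΩb : ∀ x : rootSum 𝔥 (P ∩ -P), (x : L) = hb → ∀ j, Ω.vpar j ≤ parityEigen (Ω.act x) b j)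
    (hΩ : Ω.IsIrreducibleFiniteWeight 𝔥) :
    parIndExists t P Ω ∧ parIndEmbeds t P Ω ∧ (parInd t P Ω).IsIrreducibleFiniteWeight 𝔥 ∧
      ∀ x : t, (x : L) = hb → ∀ j,
        (parInd t P Ω).vpar j ≤ parityEigen ((parInd t P Ω).act x) b j := by
  have hl : rootSum 𝔥 (P ∩ -P) = rootSum 𝔥 (degZero T h0) := by rw [hP0]
  have hn : rootSum 𝔥 (P \ -P) = rootSum 𝔥 (degPos T h0) := by rw [hP1]
  have hlt : rootSum 𝔥 (P ∩ -P) ≤ t := by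
    rw [hl, D.eq_rootSum]; exact rootSum_mono fun _ h => h.1
  have hinj := indIncl_injective Ω H D hl hn ha hΩ.1.relations
  obtain ⟨h1, h2⟩ := ind_isModule (n := rootSum 𝔥 (P \ -P)) H D hl hpar hΩ.1 hΩb
  exact ⟨isGreatest_maxAvoiding Ω H D hl hn ha, ⟨hinj, fun x hx w => ind_act_incl Ω x hx w⟩,
    ⟨h1, ind_isFiniteWeight Ω H D hl hn ha hfd hfin hΩ.2.1, ind_isIrreducible Ω hinj hlt hΩ.2.2⟩,
    h2⟩

end

/-! ### Matrix coordinates of root vectors. -/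

section

variable {k : ℕ}

/-- The weight of a basis vector. -/
def wI (a : Idx k) : Wt k := entry a a ∘ₗ (cartan k).subtype

@[simp] lemma ep_hElt (i : Fin k) (a : Fin k → ℂ) (b r s : ℂ) : ep i (hElt a b r s) = a i := by
  change (toAff k (hElt a b r s)).1 0 (iE i) (iE i) = _
  rw [toAff_hElt]; simp [diagMat, iE]

@[simp] lemma dl_hElt (a : Fin k → ℂ) (b r s : ℂ) : dl (hElt a b r s) = b := by
  change (toAff k (hElt a b r s)).1 0 iDp iDp = _
  rw [toAff_hElt]; simp [diagMat, iDp]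

@[simp] lemma im_hElt (a : Fin k → ℂ) (b r s : ℂ) : im (hElt a b r s) = s := rfl

lemma wI_hElt (u : Idx k) (a : Fin k → ℂ) (b r s : ℂ) : wI u (hElt a b r s) =
    Sum.elim (Sum.elim a (-a)) (Sum.elim (fun _ => b) (fun _ => -b)) u := by
  change (toAff k (hElt a b r s)).1 0 u u = _
  rw [toAff_hElt]; simp [diagMat]

lemma wI_inl_inl (i : Fin k) : wI (Sum.inl (Sum.inl i)) = ep i := rfl

lemma wI_inl_inr (i : Fin k) : wI (Sum.inl (Sum.inr i)) = -ep i := by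
  ext h
  rw [eq_hElt h, wI_hElt]; simp

lemma wI_inr_inl (i : Fin 1) : wI (k := k) (Sum.inr (Sum.inl i)) = dl := by
  rw [Subsingleton.elim i 0]; rfl

lemma wI_inr_inr (i : Fin 1) : wI (k := k) (Sum.inr (Sum.inr i)) = -dl := by
  ext h
  rw [eq_hElt h, wI_hElt]; simp

lemma matBr_diagMat (a : Fin k → ℂ) (b : ℂ) (y : Mat k) (u v : Idx k) (r s : ℂ) :
    matBr (diagMat a b) y u v = (wI u (hElt a b r s) - wI v (hElt a b r s)) * y u v := by
  have : oddPart (diagMat a b : Mat k) = 0 := by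
    rw [diagMat_blocks, oddPart_fromBlocks]; simp
  rw [matBr_apply, this, mul_zero, smul_zero, add_zero, wI_hElt, wI_hElt, diagMat,
    Matrix.sub_apply, Matrix.diagonal_mul, Matrix.mul_diagonal]
  ring

lemma toAff_br (x y : TwAff k) : toAff k (br x y) = affBr (toAff k x) (toAff k y) := rfl

lemma loopBr_single_apply (x : Mat k) (Y : ℤ →₀ Mat k) (q : ℤ) :
    loopBr (Finsupp.single 0 x) Y q = matBr x (Y q) := by
  refine loop_induction (C := fun Y => loopBr (Finsupp.single 0 x) Y q = matBr x (Y q))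
    (by simp) ?_ ?_ (mem_loopSub_top Y)
  · intro Y Y' h h'; rw [map_add, Finsupp.add_apply, h, h', Finsupp.add_apply, map_add]
  · intro r y _
    rw [loopBr_single, zero_add, Finsupp.single_apply, Finsupp.single_apply]
    split_ifs <;> simp

lemma loopDeg_apply (Y : ℤ →₀ Mat k) (q : ℤ) : loopDeg Y q = (q : ℂ) • Y q := by
  refine loop_induction (C := fun Y => loopDeg Y q = (q : ℂ) • Y q) (by simp) ?_ ?_
    (mem_loopSub_top Y)
  · intro Y Y' h h'; rw [map_add, Finsupp.add_apply, h, h', Finsupp.add_apply, smul_add]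
  · intro r y _
    rw [loopDeg_single, Finsupp.smul_apply, Finsupp.single_apply]
    split_ifs with h
    · rw [h]
    · simp

lemma br_cartan_snd (h : cartan k) (x : TwAff k) : (toAff k (br (h : TwAff k) x)).2 = 0 := by
  rw [toAff_br, affBr_apply, eq_hElt h, toAff_hElt]
  simp [loopDeg_single]

lemma br_cartan_apply (h : cartan k) (x : TwAff k) (p : ℤ) (u v : Idx k) :
    (toAff k (br (h : TwAff k) x)).1 p u v =
      (wI u - wI v + p • im : Wt k) h * (toAff k x).1 p u v := by
  rw [toAff_br, affBr_apply, eq_hElt h, toAff_hElt]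
  simp only [LinearMap.add_apply, LinearMap.sub_apply, LinearMap.smul_apply, im_hElt,
    loopDeg_single, Int.cast_zero, zero_smul, smul_zero, sub_zero, Finsupp.add_apply,
    Finsupp.smul_apply, loopBr_single_apply, loopDeg_apply, Matrix.add_apply, Matrix.smul_apply]
  rw [matBr_diagMat _ _ _ _ _ (Lam h) (im h)]
  simp only [smul_eq_mul, zsmul_eq_mul]
  ring

/-- `ad h` multiplies the `(u, v)` entry at `t^p` by `(wI u - wI v + p δ)(h)` and kills the `c`- and
`d`-coordinates. So the roots are read off from the nonzero coordinates. -/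
lemma mem_rootSpace_iff {α : Wt k} {x : TwAff k} : x ∈ rootSpace (cartan k) α ↔
    (∀ p u v, (toAff k x).1 p u v ≠ 0 → α = wI u - wI v + p • im) ∧
      ((toAff k x).2 ≠ 0 → α = 0) := by
  constructor
  · intro hx
    refine ⟨fun p u v h0 => LinearMap.ext fun h => ?_, fun h0 => LinearMap.ext fun h => ?_⟩
    · have h1 := br_cartan_apply h x p u v
      rw [hx h, map_smul] at h1
      exact mul_right_cancel₀ h0 h1
    · have h1 := br_cartan_snd h x
      rw [hx h, map_smul] at h1
      exact (smul_eq_zero.1 h1).resolve_right h0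
  · rintro ⟨h1, h2⟩ h
    refine toAff_injective (Prod.ext (Finsupp.ext fun p => Matrix.ext fun u v => ?_) ?_)
    · rw [br_cartan_apply, map_smul]
      by_cases h0 : (toAff k x).1 p u v = 0
      · rw [h0, mul_zero]
        change 0 = α h * (toAff k x).1 p u v
        rw [h0, mul_zero]
      · rw [← h1 p u v h0]; rfl
    · rw [br_cartan_snd, map_smul]
      by_cases h0 : (toAff k x).2 = 0
      · rw [Prod.smul_snd, h0, smul_zero]
      · rw [h2 h0]; simp

/-- The involution of the index set induced by the form. -/
def flipI : Idx k → Idx k := Sum.map Sum.swap Sum.swap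

/-- The sign is `-1` here and `+1` in `sig_odd`. At the entries joining opposite basis vectors,
which `σ` maps to themselves, this allows `±2εᵢ` only in odd degree and `±2δ₁` only in even degree.
-/
lemma sig_even (x : Mat k) (u v : Fin k ⊕ Fin k) :
    sig x (Sum.inl u) (Sum.inl v) = -x (Sum.inl v.swap) (Sum.inl u.swap) := by
  rw [← Matrix.fromBlocks_toBlocks x, ← Matrix.fromBlocks_toBlocks x.toBlocks₁₁]
  simp only [sig_apply, gram, gramInv, superTranspose_fromBlocks, Matrix.fromBlocks_multiply,
    LieAlgebra.Orthogonal.JD, Matrix.fromBlocks_transpose]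
  rcases u with u | u <;> rcases v with v | v <;> simp [Matrix.fromBlocks_multiply]

lemma sig_odd (x : Mat k) : sig x iDp iDm = x iDp iDm ∧ sig x iDm iDp = x iDm iDp := by
  rw [← Matrix.fromBlocks_toBlocks x, ← Matrix.fromBlocks_toBlocks x.toBlocks₂₂]
  simp only [sig_apply, gram, gramInv, superTranspose_fromBlocks, Matrix.fromBlocks_multiply,
    Matrix.J, Matrix.fromBlocks_transpose, iDp, iDm]
  constructor <;> simp [Matrix.fromBlocks_multiply, Matrix.fromBlocks_neg]

/-- Weights depend only on positions, so it suffices that `σ` permutes the matrix positions up to a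
constant; the sign pattern of the mixed blocks is left unspecified. -/
lemma sig_entry (u v : Idx k) : ∃ c : ℂ, ∀ x : Mat k, sig x u v = c * x (flipI v) (flipI u) := by
  have h : (∀ x : Mat k, sig x u v = 1 * x (flipI v) (flipI u)) ∨
      (∀ x : Mat k, sig x u v = (-1) * x (flipI v) (flipI u)) := by
    rcases u with (u | u) | (u | u) <;> rcases v with (v | v) | (v | v) <;>
    first
    | (left; intro x
       rw [← Matrix.fromBlocks_toBlocks x, ← Matrix.fromBlocks_toBlocks x.toBlocks₁₁,
          ← Matrix.fromBlocks_toBlocks x.toBlocks₁₂, ← Matrix.fromBlocks_toBlocks x.toBlocks₂₁,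
          ← Matrix.fromBlocks_toBlocks x.toBlocks₂₂]
       simp only [sig_apply, gram, gramInv, superTranspose_fromBlocks, Matrix.fromBlocks_multiply,
          LieAlgebra.Orthogonal.JD, Matrix.J, Matrix.fromBlocks_transpose, flipI]
       simp [Matrix.fromBlocks_multiply, Matrix.fromBlocks_neg, Subsingleton.elim _ (0 : Fin 1)]
       done)
    | (right; intro x
       rw [← Matrix.fromBlocks_toBlocks x, ← Matrix.fromBlocks_toBlocks x.toBlocks₁₁,
          ← Matrix.fromBlocks_toBlocks x.toBlocks₁₂, ← Matrix.fromBlocks_toBlocks x.toBlocks₂₁,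
          ← Matrix.fromBlocks_toBlocks x.toBlocks₂₂]
       simp only [sig_apply, gram, gramInv, superTranspose_fromBlocks, Matrix.fromBlocks_multiply,
          LieAlgebra.Orthogonal.JD, Matrix.J, Matrix.fromBlocks_transpose, flipI]
       simp [Matrix.fromBlocks_multiply, Matrix.fromBlocks_neg, Subsingleton.elim _ (0 : Fin 1)])
  exact h.elim (fun h => ⟨1, h⟩) (fun h => ⟨-1, h⟩)

lemma wI_flipI (u : Idx k) : wI (flipI u) = -wI u := by
  rcases u with (u | u) | (u | u) <;>
    simp [flipI, wI_inl_inl, wI_inl_inr, wI_inr_inl, wI_inr_inr]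

lemma str_sig (x : Mat k) : str (sig x) = -str x := by
  rw [← Matrix.fromBlocks_toBlocks x]
  have h1 : LieAlgebra.Orthogonal.JD (Fin k) ℂ * LieAlgebra.Orthogonal.JD (Fin k) ℂ = 1 := by
    simp [LieAlgebra.Orthogonal.JD, Matrix.fromBlocks_multiply]
  have h2 : Matrix.J (Fin 1) ℂ * Matrix.J (Fin 1) ℂ = -1 := Matrix.J_squared _ _
  simp only [sig_apply, gram, gramInv, superTranspose_fromBlocks, Matrix.fromBlocks_multiply,
    map_neg, str_fromBlocks]
  simp only [Matrix.zero_mul, Matrix.mul_zero, add_zero, zero_add]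
  rw [Matrix.trace_mul_comm, Matrix.mul_assoc, h1, Matrix.trace_mul_comm (-Matrix.J (Fin 1) ℂ),
    Matrix.mul_assoc, Matrix.mul_neg, h2]
  simp

/-- `σ` exchanges the two indices and replaces each by its opposite, which negates its weight; the
two changes cancel in the difference. -/
lemma sig_weight {β : Wt k} {y : Mat k} (hy : ∀ u v, y u v ≠ 0 → wI u - wI v = β) (u v : Idx k)
    (h : sig y u v ≠ 0) : wI u - wI v = β := by
  obtain ⟨c, hc⟩ := sig_entry u v
  rw [hc] at h
  have := hy _ _ (right_ne_zero_of_mul h)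
  rw [wI_flipI, wI_flipI] at this
  rw [← this]; abel

/-- The projection of a matrix to the eigenspace of `sig` with eigenvalue `(-1)^p`. -/
def symm (p : ℤ) : Mat k →ₗ[ℂ] Mat k := (1 / 2 : ℂ) • (LinearMap.id + ((-1 : ℂ) ^ p) • sig)

lemma symm_apply (p : ℤ) (y : Mat k) : symm p y = (1 / 2 : ℂ) • (y + ((-1 : ℂ) ^ p) • sig y) := rfl

lemma neg_one_zpow_sq (p : ℤ) : (-1 : ℂ) ^ p * (-1 : ℂ) ^ p = 1 := by
  rw [← mul_zpow]; simp

lemma symm_mem (p : ℤ) {y : Mat k} (hy : str (symm p y) = 0) : symm p y ∈ twPiece p := by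
  refine mem_twPiece.2 ⟨hy, ?_⟩
  rw [symm_apply, map_smul, map_add, map_smul, sig_sig, smul_comm, smul_add (_ ^ p), smul_smul,
    neg_one_zpow_sq, one_smul, add_comm]

lemma symm_eq_self {p : ℤ} {y : Mat k} (hy : y ∈ twPiece p) : symm p y = y := by
  rw [symm_apply, (mem_twPiece.1 hy).2, smul_smul, neg_one_zpow_sq, one_smul, ← two_smul ℂ,
    smul_smul]
  norm_num

lemma str_eq_zero_of_offDiag {y : Mat k} (hy : ∀ u, y u u = 0) : str y = 0 := by
  simp [str, Matrix.trace, Matrix.toBlocks₁₁, Matrix.toBlocks₂₂, hy]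

lemma str_symm {p : ℤ} {y : Mat k} (hy : str y = 0) : str (symm p y) = 0 := by
  rw [symm_apply, map_smul, map_add, map_smul, str_sig, hy]; simp

/-- The element `y ⊗ t^p`. -/
def single (p : ℤ) (y : Mat k) (hy : y ∈ twPiece p) : TwAff k :=
  mkTw (Finsupp.single p y) 0 0 fun q => by
    rw [Finsupp.single_apply]; split_ifs with h
    · exact h ▸ hy
    · exact zero_mem _

lemma toAff_single (p : ℤ) (y : Mat k) (hy : y ∈ twPiece p) :
    toAff k (single p y hy) = (Finsupp.single p y, 0, 0) := rfl

lemma single_mem_rootSpace {p : ℤ} {y : Mat k} (hy : y ∈ twPiece p) {β : Wt k}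
    (h : ∀ u v, y u v ≠ 0 → wI u - wI v = β) :
    single p y hy ∈ rootSpace (cartan k) (β + p • im) := by
  rw [mem_rootSpace_iff, toAff_single]
  refine ⟨fun q u v h0 => ?_, fun h0 => absurd rfl h0⟩
  change (Finsupp.single p y) q u v ≠ 0 at h0
  rw [Finsupp.single_apply] at h0
  split_ifs at h0 with e
  · rw [h u v h0, e]
  · exact absurd rfl h0

lemma symm_weight {p : ℤ} {β : Wt k} {y : Mat k} (hy : ∀ u v, y u v ≠ 0 → wI u - wI v = β)
    (u v : Idx k) (h : symm p y u v ≠ 0) : wI u - wI v = β := by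
  by_cases h0 : y u v = 0
  · refine sig_weight hy u v fun h1 => h ?_
    rw [symm_apply, Matrix.smul_apply, Matrix.add_apply, Matrix.smul_apply, h0, h1]; simp
  · exact hy u v h0

lemma mem_roots_of_symm {p : ℤ} {β : Wt k} {y : Mat k} (hy : ∀ u v, y u v ≠ 0 → wI u - wI v = β)
    (hs : str y = 0) {u v : Idx k} (h : symm p y u v ≠ 0) : β + p • im ∈ roots (cartan k) := by
  have h1 := single_mem_rootSpace (symm_mem p (str_symm hs)) (symm_weight hy)
  rw [roots, Set.mem_ofPred_eq, Submodule.ne_bot_iff]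
  refine ⟨_, h1, fun h2 => h ?_⟩
  have h3 : (toAff k (single p (symm p y) (symm_mem p (str_symm hs)))).1 p u v = 0 := by
    rw [h2]; rfl
  rw [toAff_single] at h3
  simpa using h3

lemma symm_diag_weight (p : ℤ) (w : Idx k → ℂ) (u v : Idx k)
    (h : symm p (Matrix.diagonal w) u v ≠ 0) : wI u - wI v = (0 : Wt k) :=
  symm_weight (fun u v h => by
    have : u = v := by by_contra hne; exact h (Matrix.diagonal_apply_ne _ hne)
    rw [this, sub_self]) u v h

/-- `A(2k-1,1)^{(2)}` is the sum of its root spaces. -/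
theorem rootSum_roots : (⊤ : Submodule ℂ (TwAff k)) = rootSum (cartan k) (roots (cartan k)) := by
  have hrs : ∀ {α : Wt k} {x : TwAff k}, x ∈ rootSpace (cartan k) α →
      x ∈ rootSum (cartan k) (roots (cartan k)) := fun {α x} hx => by
    by_cases hα : α ∈ roots (cartan k)
    · exact rootSpace_le_rootSum hα hx
    · rw [eq_zero_of_not_mem_roots hα hx]; exact zero_mem _
  have hsingle : ∀ p (y : Mat k) (hy : y ∈ twPiece p),
      single p y hy ∈ rootSum (cartan k) (roots (cartan k)) := by
    intro p y hy
    let f : twPiece (k := k) p →ₗ[ℂ] TwAff k :=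
      { toFun := fun y => single p y y.2
        map_add' := fun a b => toAff_injective (by
          rw [map_add, toAff_single, toAff_single, toAff_single, Submodule.coe_add,
            Finsupp.single_add]; simp)
        map_smul' := fun c a => toAff_injective (by
          rw [map_smul, toAff_single, toAff_single, Submodule.coe_smul, ← Finsupp.smul_single]
          simp) }
    let N : Submodule ℂ (Mat k) := ((rootSum (cartan k) (roots (cartan k))).comap f).map
      (twPiece p).subtype
    have hmem : ∀ z, z ∈ twPiece p → ∀ β : Wt k, (∀ u v, z u v ≠ 0 → wI u - wI v = β) → z ∈ N :=
      fun z hz β h => ⟨⟨z, hz⟩, hrs (single_mem_rootSpace hz h), rfl⟩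
    suffices h : y ∈ N by
      obtain ⟨⟨z, hz⟩, h1, rfl⟩ := h
      exact h1
    -- The diagonal is kept in one piece because a single diagonal unit has nonzero supertrace,
    -- whereas off-diagonal units are supertraceless one by one. All diagonal entries have weight
    -- zero anyway.
    have hdec : y = Matrix.diagonal (fun u => y u u) +
        ∑ u, ∑ v, if u = v then 0 else Matrix.single u v (y u v) := by
      conv_lhs => rw [Matrix.matrix_eq_sum_single y]
      rw [← Matrix.sum_single_eq_diagonal, ← Finset.sum_add_distrib]
      refine Finset.sum_congr rfl fun u _ => ?_
      rw [← Finset.add_sum_erase _ _ (Finset.mem_univ u),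
        ← Finset.add_sum_erase _ (fun v => if u = v then _ else _) (Finset.mem_univ u), if_pos rfl,
        zero_add]
      congr 1
      refine Finset.sum_congr rfl fun v hv => ?_
      rw [if_neg (Ne.symm (Finset.ne_of_mem_erase hv))]
    rw [← symm_eq_self hy, hdec, map_add, map_sum]
    refine add_mem (hmem _ (symm_mem p (str_symm ?_)) 0 (symm_diag_weight p _))
      (sum_mem fun u _ => ?_)
    · rw [← (mem_twPiece.1 hy).1]
      simp [str, Matrix.trace, Matrix.toBlocks₁₁, Matrix.toBlocks₂₂]
    rw [map_sum]
    refine sum_mem fun v _ => ?_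
    split_ifs with huv
    · rw [map_zero]; exact zero_mem _
    · refine hmem _ (symm_mem p (str_symm (str_eq_zero_of_offDiag fun a => ?_))) (wI u - wI v)
        (symm_weight fun a b h => ?_)
      · rw [Matrix.single_apply, if_neg]
        rintro ⟨rfl, rfl⟩; exact huv rfl
      · rw [Matrix.single_apply] at h
        split_ifs at h with e
        · rw [e.1, e.2]
        · exact absurd rfl h
  symm
  rw [Submodule.eq_top_iff']
  intro x
  have hx : x = ∑ p ∈ (toAff k x).1.support, single p ((toAff k x).1 p) (toAff_mem x p) +
      (hElt 0 0 (toAff k x).2.1 (toAff k x).2.2 : cartan k) := by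
    refine toAff_injective ?_
    rw [map_add, map_sum, toAff_hElt]
    simp only [toAff_single]
    refine Prod.ext ?_ (Prod.ext ?_ ?_)
    · rw [Prod.fst_add, Prod.fst_sum]
      have : (diagMat (0 : Fin k → ℂ) 0 : Mat k) = 0 := by
        simpa using diagMat_smul (k := k) 0 0 0
      rw [this, Finsupp.single_zero, add_zero]
      exact (Finsupp.sum_single _).symm
    · simp [Prod.snd_sum]
    · simp [Prod.snd_sum]
  rw [hx]
  refine add_mem (sum_mem fun p _ => hsingle p _ _) (hrs (α := 0) ?_)
  rw [mem_rootSpace_iff, toAff_hElt]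
  refine ⟨fun p u v h => absurd ?_ h, fun _ => rfl⟩
  have : (diagMat (0 : Fin k → ℂ) 0 : Mat k) = 0 := by
    simpa using diagMat_smul (k := k) 0 0 0
  simp [this]

end

/-! ### The list of roots. -/

section

variable {k : ℕ}

variable (k) in
/-- The explicit list of roots of `A(2k-1,1)^{(2)}`. -/
def rootList : Set (Wt k) :=
  {α | ∃ n : ℤ, α = n • im} ∪
    {α | ∃ i j : Fin k, i ≠ j ∧ ∃ (s s' : ℤˣ) (n : ℤ),
      α = (s : ℤ) • ep i + (s' : ℤ) • ep j + n • im} ∪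
    {α | ∃ (i : Fin k) (s : ℤˣ) (n : ℤ), α = (2 * s : ℤ) • ep i + (2 * n + 1) • im} ∪
    {α | ∃ (s : ℤˣ) (n : ℤ), α = (2 * s : ℤ) • dl + (2 * n) • im} ∪
    {α | ∃ (i : Fin k) (s s' : ℤˣ) (n : ℤ), α = (s : ℤ) • ep i + (s' : ℤ) • dl + n • im}

lemma entry_eq_zero_of_even {p : ℤ} (hp : Even p) {y : Mat k} (hy : y ∈ twPiece p)
    (u : Fin k ⊕ Fin k) : y (Sum.inl u) (Sum.inl u.swap) = 0 := by
  have h := congrFun (congrFun (mem_twPiece.1 hy).2 (Sum.inl u)) (Sum.inl u.swap)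
  rw [sig_even, hp.neg_one_zpow, one_smul, Sum.swap_swap] at h
  linear_combination (-1 / 2 : ℂ) * h

lemma entry_eq_zero_of_odd {p : ℤ} (hp : Odd p) {y : Mat k} (hy : y ∈ twPiece p) :
    y iDp iDm = 0 ∧ y iDm iDp = 0 := by
  have h1 := congrFun (congrFun (mem_twPiece.1 hy).2 iDp) iDm
  have h2 := congrFun (congrFun (mem_twPiece.1 hy).2 iDm) iDp
  rw [(sig_odd y).1, hp.neg_one_zpow, neg_smul, one_smul, Matrix.neg_apply] at h1
  rw [(sig_odd y).2, hp.neg_one_zpow, neg_smul, one_smul, Matrix.neg_apply] at h2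
  exact ⟨by linear_combination (1 / 2 : ℂ) * h1, by linear_combination (1 / 2 : ℂ) * h2⟩

/-- A nonzero coordinate of a root vector determines the root. Position and degree are independent
except at entries joining opposite basis vectors, where `entry_eq_zero_of_even` and
`entry_eq_zero_of_odd` restrict the parity of the degree. -/
lemma roots_subset_rootList : roots (cartan k) ⊆ rootList k := by
  intro α hα
  rw [roots, Set.mem_ofPred_eq, Submodule.ne_bot_iff] at hα
  obtain ⟨x, hx, hx0⟩ := hα
  obtain ⟨h1, h2⟩ := mem_rootSpace_iff.1 hx
  have im0 : ∀ n : ℤ, n • im ∈ rootList k := fun n => Or.inl (Or.inl (Or.inl (Or.inl ⟨n, rfl⟩)))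
  by_cases h : (toAff k x).2 = 0
  · obtain ⟨p, u, v, huv⟩ : ∃ p u v, (toAff k x).1 p u v ≠ 0 := by
      by_contra! hc
      exact hx0 (toAff_injective (Prod.ext (Finsupp.ext fun p => Matrix.ext fun u v => hc p u v) h))
    rw [h1 p u v huv]
    have hmem := toAff_mem x p
    generalize (toAff k x).1 p = y at *
    have h3 : ∀ i j : Fin k, i ≠ j → ∀ s s' : ℤˣ,
        (s : ℤ) • ep i + (s' : ℤ) • ep j + p • im ∈ rootList k := fun i j hij s s' =>
      Or.inl (Or.inl (Or.inl (Or.inr ⟨i, j, hij, s, s', p, rfl⟩)))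
    have h4 : ∀ (u' : Fin k ⊕ Fin k), y (Sum.inl u') (Sum.inl u'.swap) ≠ 0 → ∀ (i : Fin k) (s : ℤˣ),
        (2 * s : ℤ) • ep i + p • im ∈ rootList k := fun u' hu i s => by
      rcases Int.even_or_odd p with hp | ⟨m, rfl⟩
      · exact absurd (entry_eq_zero_of_even hp hmem u') hu
      · exact Or.inl (Or.inl (Or.inr ⟨i, s, m, rfl⟩))
    have h5 : (y iDp iDm ≠ 0 ∨ y iDm iDp ≠ 0) → ∀ s : ℤˣ,
        (2 * s : ℤ) • dl + p • im ∈ rootList k := fun hu s => by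
      rcases Int.even_or_odd' p with ⟨m, rfl | hp⟩
      · exact Or.inl (Or.inr ⟨s, m, rfl⟩)
      · have := entry_eq_zero_of_odd ⟨m, hp⟩ hmem
        exact absurd this (by tauto)
    have h6 : ∀ (i : Fin k) (s s' : ℤˣ), (s : ℤ) • ep i + (s' : ℤ) • dl + p • im ∈ rootList k :=
      fun i s s' => Or.inr ⟨i, s, s', p, rfl⟩
    rcases u with (i | i) | (i | i) <;> rcases v with (j | j) | (j | j) <;>
      simp only [wI_inl_inl, wI_inl_inr, wI_inr_inl, wI_inr_inr] <;>
      try rw [Subsingleton.elim i 0] at huv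
    all_goals try rw [Subsingleton.elim j 0] at huv
    · by_cases hij : i = j
      · rw [hij, sub_self, zero_add]; exact im0 p
      · convert h3 i j hij 1 (-1) using 2; simp [sub_eq_add_neg]
    · by_cases hij : i = j
      · subst hij
        convert h4 _ huv i 1 using 2; simp [two_smul]
      · convert h3 i j hij 1 1 using 2; simp
    · convert h6 i 1 (-1) using 2; simp [sub_eq_add_neg]
    · convert h6 i 1 1 using 2; simp
    · by_cases hij : i = j
      · subst hij
        convert h4 _ huv i (-1) using 2; simp [two_smul]; abel
      · convert h3 i j hij (-1) (-1) using 2; simp [sub_eq_add_neg]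
    · by_cases hij : i = j
      · rw [hij, sub_self, zero_add]; exact im0 p
      · convert h3 i j hij (-1) 1 using 2; simp
    · convert h6 i (-1) (-1) using 2; simp [sub_eq_add_neg]
    · convert h6 i (-1) 1 using 2; simp
    · convert h6 j (-1) 1 using 2; simp; abel
    · convert h6 j 1 1 using 2; simp [add_comm]
    · rw [sub_self, zero_add]; exact im0 p
    · convert h5 (Or.inl huv) 1 using 2; simp [two_smul]
    · convert h6 j (-1) (-1) using 2; simp; abel
    · convert h6 j 1 (-1) using 2; simp [add_comm]
    · convert h5 (Or.inr huv) (-1) using 2; simp [two_smul]; abel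
    · rw [sub_self, zero_add]; exact im0 p
  · rw [h2 h, ← zero_smul ℤ (im : Wt k)]; exact im0 0

lemma single_weight (u v a b : Idx k) (h : Matrix.single u v (1 : ℂ) a b ≠ 0) :
    (wI a - wI b : Wt k) = wI u - wI v := by
  rw [Matrix.single_apply] at h
  split_ifs at h with e
  · rw [e.1, e.2]
  · exact absurd rfl h

/-- Projecting a matrix unit to the eigenspace of `σ` gives a root vector; the hypothesis says that
twice its `(u, v)` entry is nonzero. -/
lemma unit_mem_roots {u v : Idx k} (huv : u ≠ v) {p : ℤ}
    (h : 1 + (-1 : ℂ) ^ p * sig (Matrix.single u v (1 : ℂ)) u v ≠ 0) :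
    wI u - wI v + p • im ∈ roots (cartan k) := by
  refine mem_roots_of_symm (single_weight u v)
    (str_eq_zero_of_offDiag fun a => ?_) (u := u) (v := v) ?_
  · rw [Matrix.single_apply, if_neg]
    rintro ⟨rfl, rfl⟩; exact huv rfl
  · rw [symm_apply, Matrix.smul_apply, Matrix.add_apply, Matrix.smul_apply,
      Matrix.single_apply_same]
    simpa using h

lemma rootList_subset_roots (hk : 2 ≤ k) : rootList k ⊆ roots (cartan k) := by
  rintro α ((((⟨n, rfl⟩ | ⟨i, j, hij, s, s', n, rfl⟩) | ⟨i, s, n, rfl⟩) | ⟨s, n, rfl⟩) |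
    ⟨i, s, s', n, rfl⟩)
  · rw [← zero_add (n • im)]
    let i0 : Fin k := ⟨0, by omega⟩
    let i1 : Fin k := ⟨1, by omega⟩
    have hne : i0 ≠ i1 := by simp [i0, i1, Fin.ext_iff]
    -- For `nδ` a supertraceless diagonal matrix in the `(-1)^n`-eigenspace of `σ` is needed. The
    -- difference of two units has sum zero and exists because `k ≥ 2`; the sign `(-1)^(n+1)` on the
    -- second half compensates the sign of `σ`.
    let a : Fin k → ℂ := Pi.single i0 1 - Pi.single i1 1
    let w : Idx k → ℂ := Sum.elim (Sum.elim a (((-1 : ℂ) ^ (n + 1)) • a)) 0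
    have ha : ∑ i, a i = 0 := by simp [a, Finset.sum_sub_distrib]
    refine mem_roots_of_symm (y := Matrix.diagonal w) (fun u v h => ?_) ?_ (u := iE i0) (v := iE i0) ?_
    · have : u = v := by by_contra hne; exact h (Matrix.diagonal_apply_ne _ hne)
      rw [this, sub_self]
    · simp [str, Matrix.trace, Matrix.toBlocks₁₁, Matrix.toBlocks₂₂, w, ← Finset.mul_sum, ha]
    · rw [symm_apply, Matrix.smul_apply, Matrix.add_apply, Matrix.smul_apply, sig_diagonal]
      have : (-1 : ℂ) ^ n * (-1) ^ (n + 1) = -1 := by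
        rw [zpow_add₀ (by norm_num), ← mul_assoc, neg_one_zpow_sq]; norm_num
      have ha0 : a i0 = 1 := by simp [a, hne]
      simp only [iE, Matrix.diagonal_apply_eq, w, Sum.elim_inl, Sum.map_inl, Sum.swap_inl,
        Sum.elim_inr, Pi.smul_apply, ha0, smul_eq_mul, mul_one, mul_neg, this]
      norm_num
  · have key : ∀ u v : Fin k ⊕ Fin k, Sum.inl (β := Fin 1 ⊕ Fin 1) u ≠ Sum.inl v → v.swap ≠ u →
        wI (Sum.inl u) - wI (Sum.inl v) + n • im ∈ roots (cartan k) := fun u v h1 h2 =>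
      unit_mem_roots h1 (by
        rw [sig_even, Matrix.single_apply, if_neg]; simp
        rintro ⟨h3, -⟩; exact h2 (Sum.inl_injective h3).symm)
    rcases Int.units_eq_one_or s with rfl | rfl <;> rcases Int.units_eq_one_or s' with rfl | rfl
    · convert key (Sum.inl i) (Sum.inr j) (by simp) (by simpa using Ne.symm hij) using 2
      simp [wI_inl_inl, wI_inl_inr]
    · convert key (Sum.inl i) (Sum.inl j) (by simpa using hij) (by simp) using 2
      simp [wI_inl_inl, sub_eq_add_neg]
    · convert key (Sum.inr i) (Sum.inr j) (by simpa using hij) (by simp) using 2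
      simp [wI_inl_inr]
    · convert key (Sum.inr i) (Sum.inl j) (by simp) (by simpa using Ne.symm hij) using 2
      simp [wI_inl_inl, wI_inl_inr, sub_eq_add_neg]
  · have key : ∀ u : Fin k ⊕ Fin k, u ≠ u.swap →
        wI (Sum.inl u) - wI (Sum.inl u.swap) + (2 * n + 1) • im ∈ roots (cartan k) := fun u h1 =>
      unit_mem_roots (by simpa using h1) (by
        rw [sig_even, Sum.swap_swap, Matrix.single_apply_same,
          Odd.neg_one_zpow (⟨n, rfl⟩ : Odd (2 * n + 1))]; norm_num)
    rcases Int.units_eq_one_or s with rfl | rfl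
    · convert key (Sum.inl i) (by simp) using 2
      simp [wI_inl_inl, wI_inl_inr, two_smul]
    · convert key (Sum.inr i) (by simp) using 2
      simp [wI_inl_inl, wI_inl_inr, two_smul]; abel
  · have hne : (iDp : Idx k) ≠ iDm := by simp [iDp, iDm]
    rcases Int.units_eq_one_or s with rfl | rfl
    · convert unit_mem_roots hne (p := 2 * n) (by
        rw [(sig_odd _).1, Matrix.single_apply_same, (even_two_mul n).neg_one_zpow]; norm_num)
        using 2
      simp [iDp, iDm, wI_inr_inl, wI_inr_inr, two_smul]
    · convert unit_mem_roots hne.symm (p := 2 * n) (by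
        rw [(sig_odd _).2, Matrix.single_apply_same, (even_two_mul n).neg_one_zpow]; norm_num)
        using 2
      simp [iDp, iDm, wI_inr_inl, wI_inr_inr, two_smul]; abel
  · have key : ∀ (u : Fin k ⊕ Fin k) (v : Fin 1 ⊕ Fin 1),
        wI (Sum.inl u) - wI (Sum.inr v) + n • im ∈ roots (cartan k) := fun u v =>
      unit_mem_roots (by simp) (by
        obtain ⟨c, hc⟩ := sig_entry (k := k) (Sum.inl u) (Sum.inr v)
        rw [hc, Matrix.single_apply, if_neg]; simp
        simp [flipI])
    rcases Int.units_eq_one_or s with rfl | rfl <;> rcases Int.units_eq_one_or s' with rfl | rfl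
    · convert key (Sum.inl i) (Sum.inr 0) using 2
      simp [wI_inl_inl, wI_inr_inr]
    · convert key (Sum.inl i) (Sum.inl 0) using 2
      simp [wI_inl_inl, wI_inr_inl, sub_eq_add_neg]
    · convert key (Sum.inr i) (Sum.inr 0) using 2
      simp [wI_inl_inr, wI_inr_inr]
    · convert key (Sum.inr i) (Sum.inl 0) using 2
      simp [wI_inl_inr, wI_inr_inl, sub_eq_add_neg]

/-- The root system of `A(2k-1,1)^{(2)}`. -/
theorem roots_eq (hk : 2 ≤ k) : roots (cartan k) = rootList k :=
  roots_subset_rootList.antisymm (rootList_subset_roots hk)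

end

/-! ### Parabolic subsets defined by a degree. -/

section Degree

variable {L : Type} [AddCommGroup L] [Module ℂ L] [LieSuperalgebra L]
variable {𝔥 t : Submodule ℂ L} {T P : Set (Module.Dual ℂ 𝔥)} {h0 : 𝔥}

/-- Degrees are integers and `T = -T`, so `α` or `-α` has natural degree, and natural numbers are
closed under addition. Both have natural degree exactly when the degree is zero; this identifies the
Levi part and the nilradical. -/
lemma isParabolic_of_degree (hneg : ∀ α ∈ T, -α ∈ T) (hint : ∀ α ∈ T, ∃ n : ℤ, α h0 = n)
    (hP : ∀ α, α ∈ P ↔ α ∈ T ∧ ∃ n : ℕ, α h0 = n) :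
    IsParabolic T P ∧ P ∩ -P = degZero T h0 ∧ P \ -P = degPos T h0 := by
  have hneg' : ∀ α, -α ∈ T → α ∈ T := fun α h => neg_neg α ▸ hneg _ h
  refine ⟨⟨?_, ?_⟩, ?_, ?_⟩
  · ext α
    simp only [Set.mem_union, Set.mem_neg, hP, LinearMap.neg_apply]
    constructor
    · intro hα
      obtain ⟨n, hn⟩ := hint α hα
      rcases le_total 0 n with h | h
      · exact Or.inl ⟨hα, n.toNat, by rw [hn, ← Int.cast_natCast, Int.toNat_of_nonneg h]⟩
      · exact Or.inr ⟨hneg _ hα, (-n).toNat, by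
          rw [hn, ← Int.cast_natCast, Int.toNat_of_nonneg (by omega), Int.cast_neg]⟩
    · rintro (h | h)
      · exact h.1
      · exact hneg' _ h.1
  · rintro _ ⟨hα, ⟨β, hβ, γ, hγ, rfl⟩⟩
    rw [hP] at hβ hγ ⊢
    obtain ⟨-, n, hn⟩ := hβ
    obtain ⟨-, m, hm⟩ := hγ
    refine ⟨hα, n + m, ?_⟩
    rw [LinearMap.add_apply, hn, hm]; push_cast; rfl
  · ext α
    simp only [degZero, Set.mem_inter_iff, Set.mem_neg, hP, LinearMap.neg_apply,
      Set.mem_ofPred_eq]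
    constructor
    · rintro ⟨⟨h, n, hn⟩, -, m, hm⟩
      refine ⟨h, ?_⟩
      rw [hn] at hm ⊢
      have : (n : ℤ) + m = 0 := by
        have : (n : ℂ) + m = 0 := by rw [← hm]; ring
        exact_mod_cast this
      have : n = 0 := by omega
      simp [this]
    · rintro ⟨h, h'⟩
      exact ⟨⟨h, 0, by simp [h']⟩, hneg _ h, 0, by simp [h']⟩
  · ext α
    simp only [degPos, Set.mem_sdiff, Set.mem_neg, hP, LinearMap.neg_apply, Set.mem_ofPred_eq]
    constructor
    · rintro ⟨⟨h, n, hn⟩, hm⟩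
      refine ⟨h, ?_⟩
      rcases n with _ | n
      · exact absurd ⟨hneg _ h, 0, by simp [hn]⟩ hm
      · exact ⟨n, by rw [hn]; push_cast; rfl⟩
    · rintro ⟨h, n, hn⟩
      refine ⟨⟨h, n + 1, by rw [hn]; push_cast; rfl⟩, ?_⟩
      rintro ⟨-, m, hm⟩
      rw [hn] at hm
      have : (n : ℤ) + 1 + m = 0 := by
        have : (n : ℂ) + 1 + m = 0 := by rw [← hm]; ring
        exact_mod_cast this
      omega

lemma gradedBy_degZero {h1 : 𝔥} (h0mem : (0 : Module.Dual ℂ 𝔥) ∈ T)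
    (hcl : ∀ α ∈ T, ∀ β ∈ T, α + β ∈ roots 𝔥 → α + β ∈ T)
    (hint : ∀ α ∈ degZero T h0, ∃ n : ℤ, α h1 = n) :
    GradedBy 𝔥 (rootSum 𝔥 (degZero T h0)) (degZero T h0) h1 where
  eq_rootSum := rfl
  zero_mem := ⟨h0mem, rfl⟩
  closed α hα β hβ h := ⟨hcl _ hα.1 _ hβ.1 h, by rw [LinearMap.add_apply, hα.2, hβ.2, add_zero]⟩
  int := hint

end Degree

/-! ### The subsets `P₁`, `P₂`, `P₃` as degree conditions. -/

section

variable {k : ℕ}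

/-- The element of `𝔥` defining the subset `P₂`. -/
def hTwo : cartan k := hElt (fun i => (k : ℂ) - 1 - (i : ℕ)) 0 0 0

/-- The element of `𝔥` defining the subset `P₁`. -/
def hOne : cartan k := hElt (fun i => if (i : ℕ) + 1 = k then 1 else 0) 0 0 0

/-- The element of `𝔥` detecting parity. -/
def hPar : cartan k := hElt 0 1 0 0

lemma rootList_neg {α : Wt k} (h : α ∈ rootList k) : -α ∈ rootList k := by
  rcases h with (((⟨n, rfl⟩ | ⟨i, j, hij, s, s', n, rfl⟩) | ⟨i, s, n, rfl⟩) | ⟨s, n, rfl⟩) |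
    ⟨i, s, s', n, rfl⟩
  · exact Or.inl (Or.inl (Or.inl (Or.inl ⟨-n, by simp⟩)))
  · exact Or.inl (Or.inl (Or.inl (Or.inr ⟨i, j, hij, -s, -s', -n, by push_cast; module⟩)))
  · exact Or.inl (Or.inl (Or.inr ⟨i, -s, -n - 1, by push_cast; module⟩))
  · exact Or.inl (Or.inr ⟨-s, -n, by push_cast; module⟩)
  · exact Or.inr ⟨i, -s, -s', -n, by push_cast; module⟩

lemma rootList_int {a : Fin k → ℂ} {b r s : ℂ} (ha : ∀ i, ∃ m : ℤ, a i = m) (hb : ∃ m : ℤ, b = m)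
    (hs : ∃ m : ℤ, s = m) {α : Wt k} (hα : α ∈ rootList k) : ∃ m : ℤ, α (hElt a b r s) = m := by
  obtain ⟨b', rfl⟩ := hb
  obtain ⟨s', rfl⟩ := hs
  choose a' ha using ha
  rcases hα with (((⟨n, rfl⟩ | ⟨i, j, hij, s, t, n, rfl⟩) | ⟨i, s, n, rfl⟩) | ⟨s, n, rfl⟩) |
    ⟨i, s, t, n, rfl⟩
  all_goals
    simp only [LinearMap.add_apply, LinearMap.smul_apply, ep_hElt, dl_hElt, im_hElt, ha,
      zsmul_eq_mul]
  · exact ⟨n * s', by push_cast; ring⟩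
  · exact ⟨s * a' i + t * a' j + n * s', by push_cast; ring⟩
  · exact ⟨2 * s * a' i + (2 * n + 1) * s', by push_cast; ring⟩
  · exact ⟨2 * s * b' + 2 * n * s', by push_cast; ring⟩
  · exact ⟨s * a' i + t * b' + n * s', by push_cast; ring⟩

/-- The degree is the coefficient at `δ`. It is `2n + 1` along `±2εᵢ` and `2n` along `±2δ₁`, so
nonnegativity of the degree is the same as `n ≥ 0` in every family. -/
lemma mem_P3 (hk : 2 ≤ k) (α : Wt k) :
    α ∈ P3 k ↔ α ∈ roots (cartan k) ∧ ∃ n : ℕ, α dElt = n := by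
  rw [roots_eq hk]
  constructor
  · rintro ((((⟨n, rfl⟩ | ⟨i, j, hij, s, s', n, rfl⟩) | ⟨i, s, n, rfl⟩) | ⟨s, n, rfl⟩) |
      ⟨i, s, s', n, rfl⟩)
    · exact ⟨Or.inl (Or.inl (Or.inl (Or.inl ⟨n, by simp⟩))), n, by simp [dElt]⟩
    · exact ⟨Or.inl (Or.inl (Or.inl (Or.inr ⟨i, j, hij, s, s', n, by simp⟩))), n, by simp [dElt]⟩
    · exact ⟨Or.inl (Or.inl (Or.inr ⟨i, s, n, by module⟩)), 2 * n + 1, by simp [dElt]⟩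
    · exact ⟨Or.inl (Or.inr ⟨s, n, by module⟩), 2 * n, by simp [dElt]⟩
    · exact ⟨Or.inr ⟨i, s, s', n, by simp⟩, n, by simp [dElt]⟩
  · rintro ⟨(((⟨n, rfl⟩ | ⟨i, j, hij, s, s', n, rfl⟩) | ⟨i, s, n, rfl⟩) | ⟨s, n, rfl⟩) |
      ⟨i, s, s', n, rfl⟩, m, hm⟩ <;> simp [dElt] at hm
    · have e : n = m := by exact_mod_cast hm
      subst e
      exact Or.inl (Or.inl (Or.inl (Or.inl ⟨m, by simp⟩)))
    · have e : n = m := by exact_mod_cast hm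
      subst e
      exact Or.inl (Or.inl (Or.inl (Or.inr ⟨i, j, hij, s, s', m, by simp⟩)))
    · have e : 2 * n + 1 = m := by
        have : ((2 * n + 1 : ℤ) : ℂ) = ((m : ℤ) : ℂ) := by push_cast; exact hm
        exact Int.cast_injective this
      obtain ⟨n, rfl⟩ := Int.eq_ofNat_of_zero_le (show 0 ≤ n by omega)
      exact Or.inl (Or.inl (Or.inr ⟨i, s, n, by module⟩))
    · have e : 2 * n = m := by
        have : ((2 * n : ℤ) : ℂ) = ((m : ℤ) : ℂ) := by push_cast; exact hm
        exact Int.cast_injective this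
      obtain ⟨n, rfl⟩ := Int.eq_ofNat_of_zero_le (show 0 ≤ n by omega)
      exact Or.inl (Or.inr ⟨s, n, by module⟩)
    · have e : n = m := by exact_mod_cast hm
      subst e
      exact Or.inr ⟨i, s, s', m, by simp⟩

lemma roots_neg (hk : 2 ≤ k) : ∀ α ∈ roots (cartan k), -α ∈ roots (cartan k) := by
  rw [roots_eq hk]; exact fun _ => rootList_neg

lemma roots_int (hk : 2 ≤ k) {a : Fin k → ℂ} {b r s : ℂ} (ha : ∀ i, ∃ m : ℤ, a i = m)
    (hb : ∃ m : ℤ, b = m) (hs : ∃ m : ℤ, s = m) :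
    ∀ α ∈ roots (cartan k), ∃ m : ℤ, α (hElt a b r s) = m := by
  rw [roots_eq hk]; exact fun _ => rootList_int ha hb hs

lemma roots_int_dElt (hk : 2 ≤ k) : ∀ α ∈ roots (cartan k), ∃ m : ℤ, α dElt = m :=
  roots_int hk (fun _ => ⟨0, by simp⟩) ⟨0, by simp⟩ ⟨1, by simp⟩

lemma roots_int_hTwo (hk : 2 ≤ k) : ∀ α ∈ roots (cartan k), ∃ m : ℤ, α hTwo = m :=
  roots_int hk (fun i => ⟨(k : ℤ) - 1 - (i : ℕ), by push_cast; rfl⟩) ⟨0, by simp⟩ ⟨0, by simp⟩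

lemma roots_int_hOne (hk : 2 ≤ k) : ∀ α ∈ roots (cartan k), ∃ m : ℤ, α hOne = m :=
  roots_int hk (fun i => ⟨if (i : ℕ) + 1 = k then 1 else 0, by split_ifs <;> simp⟩)
    ⟨0, by simp⟩ ⟨0, by simp⟩

lemma isParabolic_P3 (hk : 2 ≤ k) : IsParabolic (roots (cartan k)) (P3 k) ∧
    P3 k ∩ -P3 k = degZero (roots (cartan k)) dElt ∧
    P3 k \ -P3 k = degPos (roots (cartan k)) dElt :=
  isParabolic_of_degree (roots_neg hk) (roots_int_dElt hk) (mem_P3 hk)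

lemma mem_P3_inter (hk : 2 ≤ k) (α : Wt k) : α ∈ P3 k ∩ -P3 k ↔
    (((α = 0 ∨ ∃ i j : Fin k, i < j ∧ ∃ s s' : ℤˣ, α = (s : ℤ) • ep i + (s' : ℤ) • ep j) ∨
      ∃ s : ℤˣ, α = (2 * s : ℤ) • dl) ∨ ∃ (i : Fin k) (s s' : ℤˣ),
      α = (s : ℤ) • ep i + (s' : ℤ) • dl) := by
  rw [(isParabolic_P3 hk).2.1, degZero, Set.mem_ofPred_eq, roots_eq hk]
  constructor
  · rintro ⟨(((⟨n, rfl⟩ | ⟨i, j, hij, s, s', n, rfl⟩) | ⟨i, s, n, rfl⟩) | ⟨s, n, rfl⟩) |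
      ⟨i, s, s', n, rfl⟩, hm⟩ <;> simp [dElt] at hm
    · subst hm; simp
    · subst hm
      rcases lt_or_gt_of_ne hij with h | h
      · exact Or.inl (Or.inl (Or.inr ⟨i, j, h, s, s', by simp⟩))
      · exact Or.inl (Or.inl (Or.inr ⟨j, i, h, s', s, by simp [add_comm]⟩))
    · have : 2 * n + 1 = 0 := by
        have : ((2 * n + 1 : ℤ) : ℂ) = ((0 : ℤ) : ℂ) := by push_cast; exact hm
        exact Int.cast_injective this
      omega
    · subst hm
      exact Or.inl (Or.inr ⟨s, by simp⟩)
    · subst hm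
      exact Or.inr ⟨i, s, s', by simp⟩
  · rintro (((rfl | ⟨i, j, hij, s, s', rfl⟩) | ⟨s, rfl⟩) | ⟨i, s, s', rfl⟩)
    · exact ⟨Or.inl (Or.inl (Or.inl (Or.inl ⟨0, by simp⟩))), rfl⟩
    · exact ⟨Or.inl (Or.inl (Or.inl (Or.inr ⟨i, j, hij.ne, s, s', 0, by simp⟩))), by simp [dElt]⟩
    · exact ⟨Or.inl (Or.inr ⟨s, 0, by simp⟩), by simp [dElt]⟩
    · exact ⟨Or.inr ⟨i, s, s', 0, by simp⟩, by simp [dElt]⟩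

/-- `hTwo` takes the values `k-1, k-2, …, 0` on `ε₁, …, εₖ` and `0` on `δ₁`. So `εᵢ ± εⱼ` with `i <
j` is positive, and only `0`, `±εₖ ± δ₁`, `±2δ₁` have degree zero. -/
lemma mem_P2 (hk : 2 ≤ k) (α : Wt k) :
    α ∈ P2 k ↔ α ∈ P3 k ∩ -P3 k ∧ ∃ n : ℕ, α hTwo = n := by
  rw [mem_P3_inter hk]
  constructor
  · rintro ((((rfl | ⟨i, j, hij, s, rfl⟩) | ⟨i, hi, s, rfl⟩) | ⟨i, hi, s, s', rfl⟩) | ⟨s, rfl⟩)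
    · exact ⟨Or.inl (Or.inl (Or.inl rfl)), 0, by simp⟩
    · have hij' : (i : ℕ) < j := hij
      have hj := j.2
      refine ⟨Or.inl (Or.inl (Or.inr ⟨i, j, hij, 1, s, by simp⟩)), ?_⟩
      rcases Int.units_eq_one_or s with rfl | rfl
      · refine ⟨(k - 1 - i) + (k - 1 - j), ?_⟩
        simp only [hTwo, LinearMap.add_apply, LinearMap.smul_apply, ep_hElt]
        rw [Nat.cast_add, Nat.cast_sub (by omega), Nat.cast_sub (by omega),
          Nat.cast_sub (by omega), Nat.cast_sub (by omega)]
        simp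
      · refine ⟨j - i, ?_⟩
        simp only [hTwo, LinearMap.add_apply, LinearMap.smul_apply, ep_hElt]
        rw [Nat.cast_sub (by omega)]
        simp
    · refine ⟨Or.inr ⟨i, 1, s, by simp⟩, k - 1 - i, ?_⟩
      simp only [hTwo, LinearMap.add_apply, LinearMap.smul_apply, ep_hElt, dl_hElt]
      rw [Nat.cast_sub (by omega), Nat.cast_sub (by omega)]
      simp
    · refine ⟨Or.inr ⟨i, s, s', rfl⟩, 0, ?_⟩
      have : (k : ℂ) - 1 - (i : ℕ) = 0 := by
        have : (k : ℂ) = (i : ℕ) + 1 := by exact_mod_cast hi.symm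
        rw [this]; ring
      simp [hTwo, this]
    · exact ⟨Or.inl (Or.inr ⟨s, rfl⟩), 0, by simp [hTwo]⟩
  · rintro ⟨((rfl | ⟨i, j, hij, s, s', rfl⟩) | ⟨s, rfl⟩) | ⟨i, s, s', rfl⟩, n, hn⟩
    · exact Or.inl (Or.inl (Or.inl (Or.inl rfl)))
    · have hij' : (i : ℕ) < j := hij
      have hj := j.2
      rcases Int.units_eq_one_or s with rfl | rfl
      · exact Or.inl (Or.inl (Or.inl (Or.inr ⟨i, j, hij, s', by simp⟩)))
      · exfalso
        simp only [hTwo, LinearMap.add_apply, LinearMap.smul_apply, ep_hElt, zsmul_eq_mul] at hn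
        have h1 : ((-1 : ℤˣ) : ℤ) * ((k : ℤ) - 1 - (i : ℕ)) + (s' : ℤ) * ((k : ℤ) - 1 - (j : ℕ)) = n := by
          exact_mod_cast hn
        rcases Int.units_eq_one_or s' with rfl | rfl <;> simp at h1 <;> omega
    · exact Or.inr ⟨s, rfl⟩
    · have hi := i.2
      by_cases h : (i : ℕ) + 1 = k
      · exact Or.inl (Or.inr ⟨i, h, s, s', rfl⟩)
      · rcases Int.units_eq_one_or s with rfl | rfl
        · exact Or.inl (Or.inl (Or.inr ⟨i, by omega, s', by simp⟩))
        · exfalso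
          simp only [hTwo, LinearMap.add_apply, LinearMap.smul_apply, ep_hElt, dl_hElt,
            smul_zero, add_zero, zsmul_eq_mul] at hn
          have h1 : ((-1 : ℤˣ) : ℤ) * ((k : ℤ) - 1 - (i : ℕ)) = n := by exact_mod_cast hn
          simp at h1; omega

lemma P3_inter_neg : ∀ α ∈ P3 k ∩ -P3 k, -α ∈ P3 k ∩ -P3 k := by
  rintro α ⟨h, h'⟩
  exact ⟨h', by rwa [Set.mem_neg, neg_neg]⟩

lemma isParabolic_P2 (hk : 2 ≤ k) : IsParabolic (P3 k ∩ -P3 k) (P2 k) ∧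
    P2 k ∩ -P2 k = degZero (P3 k ∩ -P3 k) hTwo ∧ P2 k \ -P2 k = degPos (P3 k ∩ -P3 k) hTwo :=
  isParabolic_of_degree P3_inter_neg
    (fun α hα => roots_int_hTwo hk α ((mem_P3 hk α).1 hα.1).1) (mem_P2 hk)

lemma mem_P2_inter (hk : 2 ≤ k) (α : Wt k) : α ∈ P2 k ∩ -P2 k ↔
    ((α = 0 ∨ ∃ s : ℤˣ, α = (2 * s : ℤ) • dl) ∨ ∃ i : Fin k, (i : ℕ) + 1 = k ∧ ∃ s s' : ℤˣ,
      α = (s : ℤ) • ep i + (s' : ℤ) • dl) := by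
  rw [(isParabolic_P2 hk).2.1, degZero, Set.mem_ofPred_eq, mem_P3_inter hk]
  constructor
  · rintro ⟨((rfl | ⟨i, j, hij, s, s', rfl⟩) | ⟨s, rfl⟩) | ⟨i, s, s', rfl⟩, hn⟩
    · exact Or.inl (Or.inl rfl)
    · exfalso
      have hij' : (i : ℕ) < j := hij
      have hj := j.2
      simp only [hTwo, LinearMap.add_apply, LinearMap.smul_apply, ep_hElt, zsmul_eq_mul] at hn
      have h1 : (s : ℤ) * ((k : ℤ) - 1 - (i : ℕ)) + (s' : ℤ) * ((k : ℤ) - 1 - (j : ℕ)) = 0 := by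
        exact_mod_cast hn
      rcases Int.units_eq_one_or s with rfl | rfl <;>
        rcases Int.units_eq_one_or s' with rfl | rfl <;> simp at h1 <;> omega
    · exact Or.inl (Or.inr ⟨s, rfl⟩)
    · refine Or.inr ⟨i, ?_, s, s', rfl⟩
      simp only [hTwo, LinearMap.add_apply, LinearMap.smul_apply, ep_hElt, dl_hElt,
        smul_zero, add_zero, zsmul_eq_mul] at hn
      have h1 : (s : ℤ) * ((k : ℤ) - 1 - (i : ℕ)) = 0 := by exact_mod_cast hn
      have := (mul_eq_zero.1 h1).resolve_left s.ne_zero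
      omega
  · rintro ((rfl | ⟨s, rfl⟩) | ⟨i, hi, s, s', rfl⟩)
    · exact ⟨Or.inl (Or.inl (Or.inl rfl)), rfl⟩
    · exact ⟨Or.inl (Or.inr ⟨s, rfl⟩), by simp [hTwo]⟩
    · refine ⟨Or.inr ⟨i, s, s', rfl⟩, ?_⟩
      have : (k : ℂ) - 1 - (i : ℕ) = 0 := by
        have : (k : ℂ) = (i : ℕ) + 1 := by exact_mod_cast hi.symm
        rw [this]; ring
      simp [hTwo, this]

/-- `hOne` is `1` on `εₖ` and `0` on `δ₁`, so within the Levi roots of `P₂` it separates `εₖ ± δ₁`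
from their negatives and vanishes on `±2δ₁`. -/
lemma mem_P1 (hk : 2 ≤ k) (α : Wt k) :
    α ∈ P1 k ↔ α ∈ P2 k ∩ -P2 k ∧ ∃ n : ℕ, α hOne = n := by
  rw [mem_P2_inter hk]
  constructor
  · rintro ((rfl | ⟨i, hi, s, rfl⟩) | ⟨s, rfl⟩)
    · exact ⟨Or.inl (Or.inl rfl), 0, by simp⟩
    · exact ⟨Or.inr ⟨i, hi, 1, s, by simp⟩, 1, by simp [hOne, hi]⟩
    · exact ⟨Or.inl (Or.inr ⟨s, rfl⟩), 0, by simp [hOne]⟩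
  · rintro ⟨(rfl | ⟨s, rfl⟩) | ⟨i, hi, s, s', rfl⟩, n, hn⟩
    · exact Or.inl (Or.inl rfl)
    · exact Or.inr ⟨s, rfl⟩
    · rcases Int.units_eq_one_or s with rfl | rfl
      · exact Or.inl (Or.inr ⟨i, hi, s', by simp⟩)
      · exfalso
        simp only [hOne, LinearMap.add_apply, LinearMap.smul_apply, ep_hElt, dl_hElt, if_pos hi,
          smul_zero, add_zero, zsmul_eq_mul, mul_one] at hn
        have h1 : ((-1 : ℤˣ) : ℤ) = n := by exact_mod_cast hn
        simp at h1

lemma P2_inter_neg : ∀ α ∈ P2 k ∩ -P2 k, -α ∈ P2 k ∩ -P2 k := by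
  rintro α ⟨h, h'⟩
  exact ⟨h', by rwa [Set.mem_neg, neg_neg]⟩

lemma P2_subset_roots (hk : 2 ≤ k) {α : Wt k} (h : α ∈ P2 k) : α ∈ roots (cartan k) :=
  ((mem_P3 hk α).1 ((mem_P2 hk α).1 h).1.1).1

lemma isParabolic_P1 (hk : 2 ≤ k) : IsParabolic (P2 k ∩ -P2 k) (P1 k) ∧
    P1 k ∩ -P1 k = degZero (P2 k ∩ -P2 k) hOne ∧ P1 k \ -P1 k = degPos (P2 k ∩ -P2 k) hOne :=
  isParabolic_of_degree P2_inter_neg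
    (fun α hα => roots_int_hOne hk α (P2_subset_roots hk hα.1)) (mem_P1 hk)

lemma mem_P1_inter (hk : 2 ≤ k) (α : Wt k) : α ∈ P1 k ∩ -P1 k ↔
    α = 0 ∨ ∃ s : ℤˣ, α = (2 * s : ℤ) • dl := by
  rw [(isParabolic_P1 hk).2.1, degZero, Set.mem_ofPred_eq, mem_P2_inter hk]
  constructor
  · rintro ⟨(rfl | ⟨s, rfl⟩) | ⟨i, hi, s, s', rfl⟩, hn⟩
    · exact Or.inl rfl
    · exact Or.inr ⟨s, rfl⟩
    · exfalso
      simp only [hOne, LinearMap.add_apply, LinearMap.smul_apply, ep_hElt, dl_hElt, if_pos hi,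
        smul_zero, add_zero, zsmul_eq_mul, mul_one] at hn
      have h1 : (s : ℤ) = 0 := by exact_mod_cast hn
      exact s.ne_zero h1
  · rintro (rfl | ⟨s, rfl⟩)
    · exact ⟨Or.inl (Or.inl rfl), rfl⟩
    · exact ⟨Or.inl (Or.inr ⟨s, rfl⟩), by simp [hOne]⟩

lemma zero_mem_roots (hk : 2 ≤ k) : (0 : Wt k) ∈ roots (cartan k) := by
  rw [roots_eq hk]; exact Or.inl (Or.inl (Or.inl (Or.inl ⟨0, by simp⟩)))

lemma gradedBy_P3 (hk : 2 ≤ k) : GradedBy (cartan k) ⊤ (roots (cartan k)) dElt where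
  eq_rootSum := rootSum_roots
  zero_mem := zero_mem_roots hk
  closed _ _ _ _ h := h
  int := roots_int_dElt hk

lemma gradedBy_P2 (hk : 2 ≤ k) : GradedBy (cartan k) (B3 k) (P3 k ∩ -P3 k) hTwo := by
  have := gradedBy_degZero (h0 := (dElt : cartan k)) (h1 := hTwo) (zero_mem_roots hk)
    (fun _ _ _ _ h => h) (fun α hα => roots_int_hTwo hk α hα.1)
  rwa [← (isParabolic_P3 hk).2.1] at this

lemma gradedBy_P1 (hk : 2 ≤ k) : GradedBy (cartan k) (B2 k) (P2 k ∩ -P2 k) hOne := by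
  have := gradedBy_degZero (h0 := (hTwo : cartan k)) (h1 := hOne) (gradedBy_P2 hk).zero_mem
    (gradedBy_P2 hk).closed
    (fun α hα => roots_int_hOne hk α ((mem_P3 hk α).1 hα.1.1).1)
  rwa [← (isParabolic_P2 hk).2.1] at this

end

/-! ### Parity of roots, the zero root space, and finiteness. -/

section

variable {k : ℕ}

open Classical in
/-- The parity of a root. -/
def wtPar (α : Wt k) : ZMod 2 := if h : ∃ m : ℤ, α hPar = m then (h.choose : ZMod 2) else 0

lemma wtPar_eq {α : Wt k} {m : ℤ} (h : α hPar = m) : wtPar α = m := by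
  have h' : ∃ m : ℤ, α hPar = m := ⟨m, h⟩
  have e : h'.choose = m := by
    have := h.symm.trans h'.choose_spec
    exact_mod_cast this.symm
  rw [wtPar, dif_pos h', e]

lemma wtPar_spec (hk : 2 ≤ k) : ∀ α ∈ roots (cartan k), ∃ m : ℤ, α hPar = m ∧ (m : ZMod 2) = wtPar α := by
  intro α hα
  obtain ⟨m, hm⟩ : ∃ m : ℤ, α hPar = m :=
    roots_int hk (fun _ => ⟨0, by simp⟩) ⟨1, by simp⟩ ⟨0, by simp⟩ α hα
  exact ⟨m, hm, (wtPar_eq hm).symm⟩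

lemma mem_par_zero {x : TwAff k} : x ∈ (par 0 : Submodule ℂ (TwAff k)) ↔
    ∀ p, oddPart ((toAff k x).1 p) = 0 := by
  change toAff k x ∈ affPar 0 ↔ _
  rw [mem_affPar_zero]
  exact forall_congr' fun p => mem_matPar_zero

lemma mem_par_one {x : TwAff k} : x ∈ (par 1 : Submodule ℂ (TwAff k)) ↔
    (∀ p, oddPart ((toAff k x).1 p) = (toAff k x).1 p) ∧ (toAff k x).2 = 0 := by
  change toAff k x ∈ affPar 1 ↔ _
  rw [mem_affPar_one, Prod.ext_iff]
  exact and_congr_left fun _ => forall_congr' fun p => mem_matPar_one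

lemma oddPart_inl_inl (y : Mat k) (u v) : oddPart y (Sum.inl u) (Sum.inl v) = 0 := rfl
lemma oddPart_inr_inr (y : Mat k) (u v) : oddPart y (Sum.inr u) (Sum.inr v) = 0 := rfl
lemma oddPart_inl_inr (y : Mat k) (u v) :
    oddPart y (Sum.inl u) (Sum.inr v) = y (Sum.inl u) (Sum.inr v) := rfl
lemma oddPart_inr_inl (y : Mat k) (u v) :
    oddPart y (Sum.inr u) (Sum.inl v) = y (Sum.inr u) (Sum.inl v) := rfl

lemma wI_hPar_inl (u : Fin k ⊕ Fin k) : wI (Sum.inl u) hPar = 0 := by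
  rw [hPar, wI_hElt]; rcases u with u | u <;> simp

lemma wI_hPar_inr (u : Fin 1 ⊕ Fin 1) : ∃ m : ℤ, Odd m ∧ wI (k := k) (Sum.inr u) hPar = m := by
  rcases u with u | u
  · exact ⟨1, odd_one, by rw [hPar, wI_hElt]; simp⟩
  · exact ⟨-1, odd_one.neg, by rw [hPar, wI_hElt]; simp⟩

lemma cartan_le_rootSpace : cartan k ≤ rootSpace (cartan k) 0 := by
  intro x hx
  rw [mem_rootSpace_iff]
  refine ⟨fun p u v h => ?_, fun _ => rfl⟩
  have hp : p = 0 := by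
    by_contra hp
    rw [hx.1 p hp] at h; exact h rfl
  subst hp
  have : u = v := by
    by_contra huv
    exact h (hx.2 huv)
  rw [this]; simp

/-- The weights of the basis vectors are pairwise distinct and involve no `δ`, so a matrix entry of
weight zero lies on the diagonal in degree zero. -/
lemma rootSpace_zero_le : rootSpace (cartan k) 0 ≤ cartan k := by
  intro x hx
  obtain ⟨h1, -⟩ := mem_rootSpace_iff.1 hx
  have hp : ∀ p u v, (toAff k x).1 p u v ≠ 0 → p = 0 := fun p u v h => by
    have := congrArg (fun α : Wt k => α dElt) (h1 p u v h)
    simp only [dElt, LinearMap.add_apply, LinearMap.sub_apply, wI_hElt, LinearMap.smul_apply,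
      im_hElt, LinearMap.zero_apply] at this
    rcases u with (u | u) | (u | u) <;> rcases v with (v | v) | (v | v) <;> simpa using this.symm
  refine ⟨fun p h => ?_, fun u v huv => ?_⟩
  · by_contra h0
    obtain ⟨u, v, h2⟩ : ∃ u v, (toAff k x).1 p u v ≠ 0 := by
      by_contra! hc
      exact h0 (Matrix.ext hc)
    exact h (hp p u v h2)
  · by_contra h0
    have h2 := h1 0 u v h0
    rw [zero_smul, add_zero, eq_comm, sub_eq_zero] at h2
    have h3 : ∀ (a : Fin k → ℂ) (b : ℂ), Sum.elim (Sum.elim a (-a)) (Sum.elim (fun _ => b)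
        (fun _ => -b)) u = Sum.elim (Sum.elim a (-a)) (Sum.elim (fun _ => b) (fun _ => -b)) v := by
      intro a b
      rw [← wI_hElt u a b 0 0, h2, wI_hElt]
    -- A regular element: the values of the basis weights are `±1, …, ±k` and `±1/2`, all different.
    have h4 := h3 (fun i => (i : ℕ) + 1) (-1 / 2)
    apply huv
    have pos : ∀ i j : ℕ, ((i : ℂ) + 1 = -(j + 1)) → False := fun i j h => by
      have : (i : ℤ) + 1 = -(j + 1) := by exact_mod_cast h
      omega
    have half : ∀ i : ℤ, ((i : ℂ) = 1 / 2) → False := fun i h => by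
      have : ((2 * i : ℤ) : ℂ) = ((1 : ℤ) : ℂ) := by push_cast; rw [h]; norm_num
      have : 2 * i = 1 := Int.cast_injective this
      omega
    rcases u with (u | u) | (u | u) <;> rcases v with (v | v) | (v | v) <;>
      simp only [Sum.elim_inl, Sum.elim_inr, Pi.neg_apply] at h4
    · have : (u : ℕ) = v := by exact_mod_cast add_right_cancel h4
      rw [Fin.ext this]
    · exact (pos _ _ h4).elim
    · exact (half (-(u + 1)) (by push_cast; linear_combination -h4)).elim
    · exact (half (u + 1) (by push_cast; linear_combination h4)).elim
    · exact (pos _ _ h4.symm).elim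
    · have : (u : ℕ) = v := by exact_mod_cast add_right_cancel (neg_injective h4)
      rw [Fin.ext this]
    · exact (half (u + 1) (by push_cast; linear_combination -h4)).elim
    · exact (half (-(u + 1)) (by push_cast; linear_combination h4)).elim
    · exact (half (-(v + 1)) (by push_cast; linear_combination h4)).elim
    · exact (half (v + 1) (by push_cast; linear_combination h4)).elim
    · rw [Subsingleton.elim u v]
    · norm_num at h4
    · exact (half (v + 1) (by push_cast; linear_combination -h4)).elim
    · exact (half (-(v + 1)) (by push_cast; linear_combination -h4)).elim
    · norm_num at h4
    · rw [Subsingleton.elim u v]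

/-- The parity of a root is the parity of its `δ₁`-coefficient: entries of the diagonal blocks have
coefficient `0` or `±2`, those of the off-diagonal blocks `±1`. -/
theorem isHomogeneousCartan : IsHomogeneousCartan (cartan k) wtPar where
  even x hx := by
    rw [mem_par_zero]
    intro p
    have := eq_hElt ⟨x, hx⟩
    rw [show x = (⟨x, hx⟩ : cartan k) from rfl, this, toAff_hElt, Finsupp.single_apply]
    split_ifs
    · rw [diagMat_blocks, oddPart_fromBlocks]; simp
    · simp
  abelian h hh h' hh' := by
    have := cartan_le_rootSpace hh' ⟨h, hh⟩
    simpa using this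
  homog α x hx := by
    obtain ⟨h1, h2⟩ := mem_rootSpace_iff.1 hx
    have e : ∀ p u v, (toAff k x).1 p u v ≠ 0 → α hPar = wI u hPar - wI v hPar := fun p u v h => by
      rw [h1 p u v h]
      simp [hPar]
    have e0 : ∀ p u v, wtPar α = 1 → (toAff k x).1 p (Sum.inl u) (Sum.inl v) = 0 := by
      intro p u v hα
      by_contra h
      have := e p _ _ h
      rw [wI_hPar_inl, wI_hPar_inl, sub_zero, ← Int.cast_zero] at this
      rw [wtPar_eq this] at hα
      exact absurd hα (by decide)
    have e1 : ∀ p u v, wtPar α = 1 → (toAff k x).1 p (Sum.inr u) (Sum.inr v) = 0 := by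
      intro p u v hα
      by_contra h
      have := e p _ _ h
      obtain ⟨m, hm, hm'⟩ := wI_hPar_inr (k := k) u
      obtain ⟨l, hl, hl'⟩ := wI_hPar_inr (k := k) v
      rw [hm', hl', ← Int.cast_sub] at this
      rw [wtPar_eq this, (ZMod.intCast_eq_zero_iff_even).2 (hm.sub_odd hl)] at hα
      exact absurd hα (by decide)
    have e2 : ∀ p u v, wtPar α = 0 → (toAff k x).1 p (Sum.inl u) (Sum.inr v) = 0 := by
      intro p u v hα
      by_contra h
      have := e p _ _ h
      obtain ⟨l, hl, hl'⟩ := wI_hPar_inr (k := k) v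
      rw [wI_hPar_inl, hl', zero_sub, ← Int.cast_neg] at this
      rw [wtPar_eq this, (ZMod.intCast_eq_zero_iff_even)] at hα
      exact Int.not_even_iff_odd.2 hl.neg hα
    have e3 : ∀ p u v, wtPar α = 0 → (toAff k x).1 p (Sum.inr u) (Sum.inl v) = 0 := by
      intro p u v hα
      by_contra h
      have := e p _ _ h
      obtain ⟨l, hl, hl'⟩ := wI_hPar_inr (k := k) u
      rw [wI_hPar_inl, hl', sub_zero] at this
      rw [wtPar_eq this, (ZMod.intCast_eq_zero_iff_even)] at hα
      exact Int.not_even_iff_odd.2 hl hα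
    rcases zmod2 (wtPar α) with hα | hα
    · rw [hα, mem_par_zero]
      intro p
      ext (u | u) (v | v)
      · rfl
      · exact e2 p u v hα
      · exact e3 p u v hα
      · rfl
    · rw [hα, mem_par_one]
      refine ⟨fun p => ?_, ?_⟩
      · ext (u | u) (v | v)
        · exact (e0 p u v hα).symm
        · rfl
        · rfl
        · exact (e1 p u v hα).symm
      · by_contra h
        have : α hPar = (0 : ℤ) := by rw [h2 h]; simp
        rw [wtPar_eq this] at hα
        exact absurd hα (by decide)

/-- The value `α(d)` fixes the only possible power of `t`, so a root vector is determined by one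
matrix and the two coefficients of `c` and `d`. -/
instance finiteDimensional_rootSpace (α : Wt k) : FiniteDimensional ℂ (rootSpace (cartan k) α) := by
  obtain ⟨p, hp⟩ : ∃ p : ℤ, ∀ q : ℤ, α dElt = q → q = p := by
    by_cases h : ∃ p : ℤ, α dElt = p
    · obtain ⟨p, hp⟩ := h
      exact ⟨p, fun q hq => by rw [hp] at hq; exact_mod_cast hq.symm⟩
    · exact ⟨0, fun q hq => absurd ⟨q, hq⟩ h⟩
  let f : rootSpace (cartan k) α →ₗ[ℂ] Mat k × ℂ × ℂ :=
    { toFun := fun x => ((toAff k x).1 p, (toAff k x).2)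
      map_add' := fun x y => by simp
      map_smul' := fun c x => by simp }
  refine Module.Finite.of_injective f fun x y hxy => Subtype.ext (toAff_injective ?_)
  obtain ⟨hxy1, hxy2⟩ : (toAff k x).1 p = (toAff k y).1 p ∧ (toAff k x).2 = (toAff k y).2 :=
    Prod.ext_iff.1 hxy
  refine Prod.ext (Finsupp.ext fun q => ?_) hxy2
  by_cases hq : q = p
  · rw [hq]; exact hxy1
  · have key : ∀ x : rootSpace (cartan k) α, (toAff k x).1 q = 0 := by
      intro x
      ext u v
      by_contra h
      refine hq (hp q ?_)
      rw [(mem_rootSpace_iff.1 x.2).1 q u v h]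
      simp only [dElt, LinearMap.add_apply, LinearMap.sub_apply, wI_hElt, LinearMap.smul_apply,
        im_hElt]
      rcases u with (u | u) | (u | u) <;> rcases v with (v | v) | (v | v) <;> simp
    rw [key, key]

/-- With the power of `t` fixed, a nonzero root comes from one of finitely many matrix positions. -/
lemma finite_roots_dElt (p : ℤ) : {α : Wt k | α ∈ roots (cartan k) ∧ α dElt = p}.Finite := by
  refine ((Set.finite_range fun uv : Idx k × Idx k => (wI uv.1 - wI uv.2 + p • im : Wt k)).union
    (Set.finite_singleton 0)).subset ?_
  rintro α ⟨hα, hp⟩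
  rw [roots, Set.mem_ofPred_eq, Submodule.ne_bot_iff] at hα
  obtain ⟨x, hx, hx0⟩ := hα
  obtain ⟨h1, h2⟩ := mem_rootSpace_iff.1 hx
  by_cases h : (toAff k x).2 = 0
  · obtain ⟨q, u, v, huv⟩ : ∃ p u v, (toAff k x).1 p u v ≠ 0 := by
      by_contra! hc
      exact hx0 (toAff_injective (Prod.ext (Finsupp.ext fun p => Matrix.ext fun u v => hc p u v) h))
    have e := h1 q u v huv
    have : q = p := by
      rw [e] at hp
      simp only [dElt, LinearMap.add_apply, LinearMap.sub_apply, wI_hElt, LinearMap.smul_apply,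
        im_hElt] at hp
      rcases u with (u | u) | (u | u) <;> rcases v with (v | v) | (v | v) <;> simpa using hp
    exact Or.inl ⟨(u, v), by rw [e, this]⟩
  · exact Or.inr (h2 h)

lemma tElt_eq (α : Wt k) : tElt α = hElt (fun i => α (hElt (Pi.single i 1) 0 0 0)) (-α hPar)
    (α dElt) (α cElt) := by
  have h : ∀ x, α x = hForm (tElt α) x := (existsUnique_dual α).choose_spec.1
  rw [hPar, dElt, cElt]
  simp only [h]
  rw [eq_hElt (tElt α)]
  simp only [hForm_hElt]
  simp [Pi.single_apply]

lemma wtForm_eq (α β : Wt k) : wtForm α β = ∑ i, α (hElt (Pi.single i 1) 0 0 0) *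
    β (hElt (Pi.single i 1) 0 0 0) - α hPar * β hPar + α dElt * β cElt + α cElt * β dElt := by
  rw [wtForm, tElt_eq, tElt_eq, hForm_hElt]; ring

end

/-! ### The `𝔰𝔩₂` of the root `2δ₁`. -/

section

variable {k : ℕ}

lemma single_delta_mem (hne : (iDp : Idx k) ≠ iDm) :
    Matrix.single (iDp : Idx k) iDm (1 : ℂ) ∈ twPiece (k := k) 0 ∧
      Matrix.single (iDm : Idx k) iDp (1 : ℂ) ∈ twPiece (k := k) 0 := by
  have key : ∀ u v : Idx k, u ≠ v → (∀ y : Mat k, sig y u v = y u v) → flipI v = u → flipI u = v →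
      Matrix.single u v (1 : ℂ) ∈ twPiece (k := k) 0 := by
    intro u v huv hs hf hf'
    rw [mem_twPiece, zpow_zero, one_smul]
    refine ⟨str_eq_zero_of_offDiag fun a => ?_, Matrix.ext fun a b => ?_⟩
    · rw [Matrix.single_apply, if_neg]
      rintro ⟨rfl, rfl⟩; exact huv rfl
    · by_cases hab : u = a ∧ v = b
      · rw [← hab.1, ← hab.2, hs]
      · obtain ⟨c, hc⟩ := sig_entry a b
        rw [hc, Matrix.single_apply, Matrix.single_apply, if_neg hab, if_neg, mul_zero]
        rintro ⟨h1, h2⟩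
        refine hab ⟨?_, ?_⟩
        · rw [← hf, h2]; simp [flipI]
        · rw [← hf', h1]; simp [flipI]
  exact ⟨key _ _ hne (fun y => (sig_odd y).1) rfl rfl,
    key _ _ hne.symm (fun y => (sig_odd y).2) rfl rfl⟩

lemma iDp_ne_iDm : (iDp : Idx k) ≠ iDm := by simp [iDp, iDm]

/-- The root vector `E_{δ₁,-δ₁}`. -/
def eVec : TwAff k := single 0 _ (single_delta_mem iDp_ne_iDm).1

/-- The root vector `E_{-δ₁,δ₁}`. -/
def fVec : TwAff k := single 0 _ (single_delta_mem iDp_ne_iDm).2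

lemma eVec_mem : (eVec : TwAff k) ∈ rootSpace (cartan k) ((2 : ℤ) • dl) := by
  have := single_mem_rootSpace (single_delta_mem (k := k) iDp_ne_iDm).1 (single_weight iDp iDm)
  have e : (wI iDp - wI iDm + (0 : ℤ) • im : Wt k) = (2 : ℤ) • dl := by
    rw [iDp, iDm, wI_inr_inl, wI_inr_inr]; module
  rwa [e] at this

lemma fVec_mem : (fVec : TwAff k) ∈ rootSpace (cartan k) (-((2 : ℤ) • dl)) := by
  have := single_mem_rootSpace (single_delta_mem (k := k) iDp_ne_iDm).2 (single_weight iDm iDp)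
  have e : (wI iDm - wI iDp + (0 : ℤ) • im : Wt k) = -((2 : ℤ) • dl) := by
    rw [iDp, iDm, wI_inr_inl, wI_inr_inr]; module
  rwa [e] at this

/-- The values of a weight of the form `wI u - wI v + p • im` determine `u`, `v`, `p`. -/
lemma eq_of_wI_sub {p : ℤ} {u v : Idx k} :
    ((2 : ℤ) • dl = (wI u - wI v + p • im : Wt k) → p = 0 ∧ u = iDp ∧ v = iDm) ∧
    (-((2 : ℤ) • dl) = (wI u - wI v + p • im : Wt k) → p = 0 ∧ u = iDm ∧ v = iDp) := by
  have key : ∀ c : ℤ, c • dl = (wI u - wI v + p • im : Wt k) → p = 0 ∧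
      (wI u (hPar : cartan k) - wI v hPar) = c := by
    intro c h
    constructor
    · have := congrArg (fun α : Wt k => α dElt) h
      simp only [dElt, LinearMap.add_apply, LinearMap.sub_apply, wI_hElt, LinearMap.smul_apply,
        im_hElt, dl_hElt] at this
      rcases u with (u | u) | (u | u) <;> rcases v with (v | v) | (v | v) <;>
        simpa using this.symm
    · have := congrArg (fun α : Wt k => α hPar) h
      simpa [hPar] using this.symm
  constructor
  · intro h
    obtain ⟨hp, h2⟩ := key 2 h
    refine ⟨hp, ?_⟩
    rw [hPar, wI_hElt, wI_hElt] at h2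
    rcases u with (u | u) | (u | u) <;> rcases v with (v | v) | (v | v) <;>
      norm_num at h2
    rw [Subsingleton.elim u 0, Subsingleton.elim v 0]; exact ⟨rfl, rfl⟩
  · intro h
    rw [← neg_smul] at h
    obtain ⟨hp, h2⟩ := key (-2) h
    refine ⟨hp, ?_⟩
    rw [hPar, wI_hElt, wI_hElt] at h2
    rcases u with (u | u) | (u | u) <;> rcases v with (v | v) | (v | v) <;>
      norm_num at h2
    rw [Subsingleton.elim u 0, Subsingleton.elim v 0]; exact ⟨rfl, rfl⟩

lemma two_dl_ne_zero : ((2 : ℤ) • dl : Wt k) ≠ 0 := fun h => by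
  have := congrArg (fun α : Wt k => α hPar) h
  simp [hPar] at this

lemma entry_mkTw_single (a b : Idx k) (y : Mat k) (hy) : entry a b (single 0 y hy) = y a b := by
  change (toAff k (single 0 y hy)).1 0 a b = _
  rw [toAff_single]; simp

lemma rootSpace_two_dl {x : TwAff k} (hx : x ∈ rootSpace (cartan k) ((2 : ℤ) • dl)) :
    x = entry iDp iDm x • eVec := by
  obtain ⟨h1, h2⟩ := mem_rootSpace_iff.1 hx
  refine toAff_injective (Prod.ext (Finsupp.ext fun p => Matrix.ext fun u v => ?_) ?_)
  · by_cases h : p = 0 ∧ u = iDp ∧ v = iDm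
    · obtain ⟨rfl, rfl, rfl⟩ := h
      rw [map_smul, eVec, toAff_single]
      simp [entry]
    · have h0 : (toAff k x).1 p u v = 0 := by
        by_contra hc
        exact h (eq_of_wI_sub.1 (h1 p u v hc))
      rw [h0, map_smul, eVec, toAff_single]
      change 0 = (entry iDp iDm x • (Finsupp.single (0 : ℤ) (Matrix.single iDp iDm (1 : ℂ)))) p u v
      rw [Finsupp.smul_apply, Finsupp.single_apply]
      split_ifs with hp
      · rw [Matrix.smul_apply, Matrix.single_apply, if_neg, smul_zero]
        rintro ⟨rfl, rfl⟩; exact h ⟨hp.symm, rfl, rfl⟩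
      · simp
  · have : (toAff k x).2 = 0 := by
      by_contra hc; exact two_dl_ne_zero (h2 hc)
    rw [this, map_smul, eVec, toAff_single]; simp; rfl

lemma rootSpace_neg_two_dl {x : TwAff k} (hx : x ∈ rootSpace (cartan k) (-((2 : ℤ) • dl))) :
    x = entry iDm iDp x • fVec := by
  obtain ⟨h1, h2⟩ := mem_rootSpace_iff.1 hx
  refine toAff_injective (Prod.ext (Finsupp.ext fun p => Matrix.ext fun u v => ?_) ?_)
  · by_cases h : p = 0 ∧ u = iDm ∧ v = iDp
    · obtain ⟨rfl, rfl, rfl⟩ := h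
      rw [map_smul, fVec, toAff_single]
      simp [entry]
    · have h0 : (toAff k x).1 p u v = 0 := by
        by_contra hc
        exact h (eq_of_wI_sub.2 (h1 p u v hc))
      rw [h0, map_smul, fVec, toAff_single]
      change 0 = (entry iDm iDp x • (Finsupp.single (0 : ℤ) (Matrix.single iDm iDp (1 : ℂ)))) p u v
      rw [Finsupp.smul_apply, Finsupp.single_apply]
      split_ifs with hp
      · rw [Matrix.smul_apply, Matrix.single_apply, if_neg, smul_zero]
        rintro ⟨rfl, rfl⟩; exact h ⟨hp.symm, rfl, rfl⟩
      · simp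
  · have : (toAff k x).2 = 0 := by
      by_contra hc; exact two_dl_ne_zero (neg_eq_zero.1 (h2 hc))
    rw [this, map_smul, fVec, toAff_single]; simp; rfl

lemma br_eVec_fVec : br (eVec : TwAff k) fVec = (hElt 0 1 0 0 : cartan k) := by
  refine toAff_injective ?_
  rw [toAff_br, eVec, fVec, toAff_single, toAff_single, toAff_hElt, affBr_apply]
  simp only [loopBr_single, loopDeg_single, zero_smul, add_zero, sub_zero, Int.cast_zero, map_zero,
    LinearMap.zero_apply]
  congr 2
  have h1 : oddPart (Matrix.single iDp iDm (1 : ℂ) : Mat k) = 0 := by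
    ext (u | u) (v | v) <;> simp [oddPart, iDp, iDm, Matrix.toBlocks₁₂, Matrix.toBlocks₂₁]
  rw [matBr_apply, h1, mul_zero, smul_zero, add_zero, Matrix.single_mul_single_same,
    Matrix.single_mul_single_same, diagMat]
  ext u v
  rw [Matrix.sub_apply, Matrix.single_apply, Matrix.single_apply, Matrix.diagonal_apply]
  rcases u with (u | u) | (u | u) <;> rcases v with (v | v) | (v | v) <;>
    simp [iDp, iDm, Subsingleton.elim _ (0 : Fin 1)]

lemma tElt_two_dl : tElt ((2 : ℤ) • dl : Wt k) = hElt 0 (-2) 0 0 := by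
  rw [tElt_eq]
  simp [hPar, dElt, cElt]; rfl

lemma tElt_ep (i : Fin k) : tElt (ep i : Wt k) = hElt (Pi.single i 1) 0 0 0 := by
  rw [tElt_eq]
  simp only [hPar, dElt, cElt, ep_hElt, Pi.zero_apply, neg_zero]
  congr 1
  ext j; simp [Pi.single_apply, eq_comm]

lemma hElt_smul (c : ℂ) (a : Fin k → ℂ) (b r s : ℂ) :
    c • hElt a b r s = hElt (c • a) (c * b) (c * r) (c * s) :=
  (hLin.map_smul c (a, b, r, s)).symm

/-- The matrix units have bracket `hPar`, whereas `t_{2δ₁} = -2 hPar` because `(δ₁, δ₁) = -1`; this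
is the origin of the factor `-2`. -/
lemma exists_ef : ∃ e f : TwAff k, e ∈ rootSpace (cartan k) ((2 : ℤ) • dl) ∧
    f ∈ rootSpace (cartan k) (-((2 : ℤ) • dl)) ∧ br e f = tElt ((2 : ℤ) • dl : Wt k) := by
  refine ⟨(-2 : ℂ) • eVec, fVec, Submodule.smul_mem _ _ eVec_mem, fVec_mem, ?_⟩
  rw [map_smul, LinearMap.smul_apply, br_eVec_fVec, tElt_two_dl, ← Submodule.coe_smul, hElt_smul]
  simp

lemma ef_entries {e f : TwAff k} (he : e ∈ rootSpace (cartan k) ((2 : ℤ) • dl))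
    (hf : f ∈ rootSpace (cartan k) (-((2 : ℤ) • dl)))
    (hef : br e f = tElt ((2 : ℤ) • dl : Wt k)) :
    entry iDp iDm e ≠ 0 ∧ entry iDm iDp f ≠ 0 := by
  rw [← not_or]
  intro h
  have h0 : br e f = 0 := by
    rw [rootSpace_two_dl he, rootSpace_neg_two_dl hf]
    rcases h with h | h <;> rw [h] <;> simp
  rw [h0, tElt_two_dl] at hef
  have h1 : (hElt 0 (-2) 0 0 : cartan k) = 0 := Subtype.ext hef.symm
  have h2 := congrArg (fun h => dl h) h1
  rw [dl_hElt, map_zero] at h2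
  norm_num at h2

end

/-! ### The action on `K₁`. -/

section

variable {k : ℕ}

lemma topFun_hElt (μ : ℂ) (a : Fin k → ℂ) (b r s : ℂ) : topFun k μ (hElt a b r s : cartan k) =
    (2 * k + 2) * r + ∑ i : Fin k, ((k : ℂ) - (i : ℕ) + 1) * a i + μ * b := by
  have h1 : ∀ i, entry (iE i) (iE i) (hElt a b r s : cartan k).1 = a i := fun i => ep_hElt i a b r s
  have h2 : entry iDp iDp (hElt a b r s : cartan k).1 = b := dl_hElt a b r s
  have h3 : cCoef (hElt a b r s : cartan k).1 = r := rfl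
  simp [topFun, h1, h2, h3]

lemma topFun_cartan (μ : ℂ) (h : cartan k) : topFun k μ h = topFun k 0 h + μ * dl h := by
  rw [eq_hElt h, topFun_hElt, topFun_hElt, dl_hElt]; ring

lemma entry_cartan {u v : Idx k} (huv : u ≠ v) (h : cartan k) : entry u v (h : TwAff k) = 0 :=
  h.2.2 huv

lemma topFun_single (μ : ℂ) (y : Mat k) (hy) (h0 : ∀ u, y u u = 0) :
    topFun k μ (single 0 y hy) = 0 := by
  have h3 : cCoef (single 0 y hy) = 0 := rfl
  simp [topFun, h3, entry_mkTw_single, h0]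

lemma single_diag {u v : Idx k} (huv : u ≠ v) (w : Idx k) :
    (Matrix.single u v (1 : ℂ)) w w = 0 := by
  rw [Matrix.single_apply, if_neg]
  rintro ⟨rfl, rfl⟩; exact huv rfl

variable (ζ ξ : ℂ) (e f : TwAff k)

/-- The operators on `K₁`, for all elements of the superalgebra. -/
def K1op : TwAff k →ₗ[ℂ] Module.End ℂ (ℤ →₀ ℂ) where
  toFun x := Finsupp.linearCombination ℂ (K1fun ζ ξ e f x)
  map_add' x y := by
    ext n : 2
    simp [K1fun_add]
  map_smul' c x := by
    ext n : 2
    simp [K1fun_smul]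

lemma K1op_single (x : TwAff k) (n : ℤ) (c : ℂ) :
    K1op ζ ξ e f x (Finsupp.single n c) = c • K1fun ζ ξ e f x n := by
  simp [K1op]

/-- The coefficients of the action of `f`. -/
def fCoef (n : ℤ) : ℂ := -(1 / 2) * (ξ - (ζ + 2 * n - 1) ^ 2)

lemma K1op_cartan (h : cartan k) (n : ℤ) (c : ℂ) : K1op ζ ξ e f h (Finsupp.single n c) =
    topFun k (ζ + 2 * n) h • Finsupp.single n c := by
  rw [K1op_single, K1fun, entry_cartan iDp_ne_iDm, entry_cartan iDp_ne_iDm.symm]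
  simp [mul_comm]

/-- `e` and `f` are root vectors for `±2δ₁` with `[e, f] = t_{2δ₁}`. -/
structure IsDeltaPair (e f : TwAff k) : Prop where
  e_mem : e ∈ rootSpace (cartan k) ((2 : ℤ) • dl)
  f_mem : f ∈ rootSpace (cartan k) (-((2 : ℤ) • dl))
  br_eq : br e f = tElt ((2 : ℤ) • dl : Wt k)

variable {e f}

lemma IsDeltaPair.entries (E : IsDeltaPair e f) : entry iDp iDm e ≠ 0 ∧ entry iDm iDp f ≠ 0 :=
  ef_entries E.e_mem E.f_mem E.br_eq

lemma K1op_e (E : IsDeltaPair e f) (n : ℤ) (c : ℂ) : K1op ζ ξ e f e (Finsupp.single n c) = Finsupp.single (n + 1) c := by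
  have h1 : entry iDm iDp e = 0 := by
    rw [rootSpace_two_dl E.e_mem, map_smul, eVec, entry_mkTw_single, Matrix.single_apply, if_neg,
      smul_zero]
    exact fun h => iDp_ne_iDm h.1
  have h2 : topFun k (ζ + 2 * n) e = 0 := by
    rw [rootSpace_two_dl E.e_mem, map_smul, eVec, topFun_single _ _ _ (single_diag iDp_ne_iDm),
      smul_zero]
  rw [K1op_single, K1fun, h1, h2, div_self E.entries.1]
  simp

lemma K1op_f (E : IsDeltaPair e f) (n : ℤ) (c : ℂ) : K1op ζ ξ e f f (Finsupp.single n c) =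
    Finsupp.single (n - 1) (fCoef ζ ξ n * c) := by
  have h1 : entry iDp iDm f = 0 := by
    rw [rootSpace_neg_two_dl E.f_mem, map_smul, fVec, entry_mkTw_single, Matrix.single_apply, if_neg,
      smul_zero]
    exact fun h => iDp_ne_iDm h.2
  have h2 : topFun k (ζ + 2 * n) f = 0 := by
    rw [rootSpace_neg_two_dl E.f_mem, map_smul, fVec,
      topFun_single _ _ _ (single_diag iDp_ne_iDm.symm), smul_zero]
  rw [K1op_single, K1fun, h1, h2, div_self E.entries.2]
  simp only [Finsupp.single_zero, zero_div, zero_add, one_mul, Finsupp.smul_single, smul_eq_mul,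
    fCoef, mul_comm c]

lemma rootSpace_two_dl_eq (E : IsDeltaPair e f) {x : TwAff k} (hx : x ∈ rootSpace (cartan k) ((2 : ℤ) • dl)) :
    ∃ c : ℂ, x = c • e := by
  refine ⟨entry iDp iDm x * (entry iDp iDm e)⁻¹, (rootSpace_two_dl hx).trans ?_⟩
  rw [mul_smul]
  congr 1
  rw [eq_inv_smul_iff₀ E.entries.1]
  exact (rootSpace_two_dl E.e_mem).symm

lemma rootSpace_neg_two_dl_eq (E : IsDeltaPair e f) {x : TwAff k} (hx : x ∈ rootSpace (cartan k) (-((2 : ℤ) • dl))) :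
    ∃ c : ℂ, x = c • f := by
  refine ⟨entry iDm iDp x * (entry iDm iDp f)⁻¹, (rootSpace_neg_two_dl hx).trans ?_⟩
  rw [mul_smul]
  congr 1
  rw [eq_inv_smul_iff₀ E.entries.2]
  exact (rootSpace_neg_two_dl E.f_mem).symm

lemma mem_P1_cases (hk : 2 ≤ k) {α : Wt k} (hα : α ∈ P1 k ∩ -P1 k) :
    α = 0 ∨ α = (2 : ℤ) • dl ∨ α = -((2 : ℤ) • dl) := by
  rcases (mem_P1_inter hk α).1 hα with h | ⟨s, rfl⟩
  · exact Or.inl h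
  · rcases Int.units_eq_one_or s with rfl | rfl
    · exact Or.inr (Or.inl (by simp))
    · exact Or.inr (Or.inr (by simp))

lemma two_dl_mem_P1 (hk : 2 ≤ k) : (2 : ℤ) • dl ∈ P1 k ∩ -P1 k :=
  (mem_P1_inter hk _).2 (Or.inr ⟨1, by simp⟩)

lemma neg_two_dl_mem_P1 (hk : 2 ≤ k) : -((2 : ℤ) • dl) ∈ P1 k ∩ -P1 k :=
  (mem_P1_inter hk _).2 (Or.inr ⟨-1, by simp⟩)

lemma cartan_le_B1 (hk : 2 ≤ k) : cartan k ≤ B1 k :=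
  cartan_le_rootSpace.trans (rootSpace_le_rootSum ((mem_P1_inter hk _).2 (Or.inl rfl)))

lemma B1_decomp (E : IsDeltaPair e f) (hk : 2 ≤ k) {x : TwAff k} (hx : x ∈ B1 k) :
    ∃ (h : cartan k) (a b : ℂ), x = h + a • e + b • f := by
  have hle : B1 k ≤ cartan k ⊔ (Submodule.span ℂ {e} ⊔ Submodule.span ℂ {f}) := by
    refine rootSum_le fun α hα y hy => ?_
    rcases mem_P1_cases hk hα with rfl | rfl | rfl
    · exact Submodule.mem_sup_left (rootSpace_zero_le hy)
    · obtain ⟨c, rfl⟩ := rootSpace_two_dl_eq E hy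
      exact Submodule.mem_sup_right (Submodule.mem_sup_left
        (Submodule.smul_mem _ _ (Submodule.mem_span_singleton_self e)))
    · obtain ⟨c, rfl⟩ := rootSpace_neg_two_dl_eq E hy
      exact Submodule.mem_sup_right (Submodule.mem_sup_right
        (Submodule.smul_mem _ _ (Submodule.mem_span_singleton_self f)))
  obtain ⟨h, hh, y, hy, rfl⟩ := Submodule.mem_sup.1 (hle hx)
  obtain ⟨y1, h1, y2, h2, rfl⟩ := Submodule.mem_sup.1 hy
  obtain ⟨a, rfl⟩ := Submodule.mem_span_singleton.1 h1
  obtain ⟨b, rfl⟩ := Submodule.mem_span_singleton.1 h2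
  exact ⟨⟨h, hh⟩, a, b, by rw [add_assoc]⟩

lemma B1_even (hk : 2 ≤ k) : B1 k ≤ par 0 := by
  refine rootSum_le fun α hα => ?_
  have : wtPar α = 0 := by
    rcases mem_P1_cases hk hα with rfl | rfl | rfl
    · rw [wtPar_eq (m := 0) (by simp)]; rfl
    · rw [wtPar_eq (m := 2) (by simp [hPar])]; rfl
    · rw [wtPar_eq (m := -2) (by simp [hPar])]; rfl
  rw [← this]
  exact isHomogeneousCartan.homog α

/-- The bilinear expansion of a commutator of elements `H + aE + bF`, stated in an abstract ring so
that it is a formal identity in the commutation rules. -/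
lemma commutator_aux {R : Type*} [Ring R] [Algebra ℂ R] {H H' E F : R} {l l' a b a' b' : ℂ}
    (c1 : H * E - E * H = l • E) (c1' : H' * E - E * H' = l' • E)
    (c2 : H * F - F * H = -(l • F)) (c2' : H' * F - F * H' = -(l' • F)) (c4 : H * H' = H' * H) :
    a • -(l' • E) + b • l' • F + a' • (l • E + b • -(E * F - F * E)) +
        b' • (-(l • F) + a • (E * F - F * E)) = (H + a • E + b • F) * (H' + a' • E + b' • F) -
      (H' + a' • E + b' • F) * (H + a • E + b • F) := by
  simp only [mul_add, add_mul, smul_mul_assoc, mul_smul_comm]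
  linear_combination (norm := module) -a' • c1 - b' • c2 + a • c1' + b • c2' - c4

/-- Since `𝓑₁ = 𝔥 ⊕ ℂe ⊕ ℂf`, only brackets among `𝔥`, `e`, `f` have to be checked. Those with `𝔥`
hold because `e` and `f` shift the weight `ζ + 2n` by `±2`. -/
lemma K1op_br (E : IsDeltaPair e f) (hk : 2 ≤ k) {x y : TwAff k} (hx : x ∈ B1 k) (hy : y ∈ B1 k) :
    K1op ζ ξ e f (br x y) =
      K1op ζ ξ e f x * K1op ζ ξ e f y - K1op ζ ξ e f y * K1op ζ ξ e f x := by
  obtain ⟨h, a, b, rfl⟩ := B1_decomp E hk hx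
  obtain ⟨h', a', b', rfl⟩ := B1_decomp E hk hy
  have H := isHomogeneousCartan (k := k)
  have hle : ∀ α ∈ P1 k ∩ -P1 k, rootSpace (cartan k) α ≤ par 0 := fun α hα =>
    (rootSpace_le_rootSum hα).trans (B1_even hk)
  have ee : e ∈ (par 0 : Submodule ℂ (TwAff k)) := hle _ (two_dl_mem_P1 hk) E.e_mem
  have fe : f ∈ (par 0 : Submodule ℂ (TwAff k)) := hle _ (neg_two_dl_mem_P1 hk) E.f_mem
  have skew : ∀ {x y : TwAff k}, x ∈ (par 0 : Submodule ℂ (TwAff k)) →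
      y ∈ (par 0 : Submodule ℂ (TwAff k)) → br x y = -br y x := fun hx hy => by
    rw [br_skew hx hy, sgn_zero_left, one_smul]
  have self : ∀ {x : TwAff k}, x ∈ (par 0 : Submodule ℂ (TwAff k)) → br x x = 0 := fun {x} hx => by
    have h2 : (2 : ℂ) • br x x = 0 := by
      rw [two_smul]; nth_rewrite 1 [skew hx hx]; exact neg_add_cancel _
    exact (smul_eq_zero.1 h2).resolve_left two_ne_zero
  set A := K1op ζ ξ e f with hA
  have c1 : ∀ h : cartan k, A h * A e - A e * A h = ((2 : ℤ) • dl : Wt k) h • A e := by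
    intro h
    ext n : 2
    simp only [LinearMap.comp_apply, LinearMap.sub_apply, Module.End.mul_apply,
      Finsupp.lsingle_apply, LinearMap.smul_apply, hA, K1op_e ζ ξ E, K1op_cartan, map_smul]
    rw [topFun_cartan (ζ + 2 * n), topFun_cartan (ζ + 2 * (n + 1 : ℤ)), ← sub_smul]
    congr 1
    simp only [zsmul_eq_mul]; push_cast; ring
  have c2 : ∀ h : cartan k, A h * A f - A f * A h = -(((2 : ℤ) • dl : Wt k) h • A f) := by
    intro h
    ext n : 2
    simp only [LinearMap.comp_apply, LinearMap.sub_apply, Module.End.mul_apply,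
      Finsupp.lsingle_apply, LinearMap.smul_apply, hA, K1op_f ζ ξ E, K1op_cartan, map_smul,
      LinearMap.neg_apply]
    rw [topFun_cartan (ζ + 2 * n), topFun_cartan (ζ + 2 * (n - 1 : ℤ)), ← sub_smul, ← neg_smul]
    congr 1
    simp only [zsmul_eq_mul]; push_cast; ring
  -- With `μ = ζ + 2n`, the difference `fCoef n - fCoef (n+1)` is `-((μ+1)² - (μ-1)²)/2 = -2μ`, the
  -- eigenvalue of `t_{2δ₁}`; the parameter `ξ` cancels.
  have c3 : A e * A f - A f * A e = A (br e f) := by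
    rw [E.br_eq, tElt_two_dl]
    ext n : 2
    simp only [LinearMap.comp_apply, LinearMap.sub_apply, Module.End.mul_apply,
      Finsupp.lsingle_apply, hA, K1op_f ζ ξ E, K1op_e ζ ξ E, K1op_cartan,
      topFun_hElt]
    rw [sub_add_cancel, add_sub_cancel_right, ← Finsupp.single_sub, Finsupp.smul_single]
    congr 1
    simp [fCoef]; ring
  have c4 : ∀ h h' : cartan k, A h * A h' = A h' * A h := by
    intro h h'
    ext n : 2
    simp only [LinearMap.comp_apply, Module.End.mul_apply,
      Finsupp.lsingle_apply, hA, K1op_cartan, map_smul]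
    rw [smul_comm]
  have b1 : ∀ h h' : cartan k, br (h : TwAff k) h' = 0 := fun h h' => H.abelian _ h.2 _ h'.2
  have b2 : ∀ h : cartan k, br (h : TwAff k) e = ((2 : ℤ) • dl : Wt k) h • e := fun h => E.e_mem h
  have b3 : ∀ h : cartan k, br (h : TwAff k) f = -(((2 : ℤ) • dl : Wt k) h • f) := fun h => by
    rw [E.f_mem h, LinearMap.neg_apply, neg_smul]
  have b4 : ∀ h : cartan k, br e (h : TwAff k) = -(((2 : ℤ) • dl : Wt k) h • e) := fun h => by
    rw [skew ee (H.even h.2), b2]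
  have b5 : ∀ h : cartan k, br f (h : TwAff k) = ((2 : ℤ) • dl : Wt k) h • f := fun h => by
    rw [skew fe (H.even h.2), b3, neg_neg]
  have b6 : br f e = -br e f := skew fe ee
  simp only [map_add, map_smul, LinearMap.add_apply, LinearMap.smul_apply, b1, b2, b3, b4, b5, b6,
    self ee, self fe, map_neg, smul_zero, add_zero, zero_add, ← c3]
  exact commutator_aux (R := Module.End ℂ (ℤ →₀ ℂ)) (c1 h) (c1 h') (c2 h) (c2 h') (c4 h h')

theorem K1_isModule (E : IsDeltaPair e f) (hk : 2 ≤ k) : (K1 ζ ξ e f).IsModule := by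
  refine ⟨?_, fun i j x v hx hv => ?_, fun i j x y z v hx hy hz => ?_⟩
  · change IsCompl (⊤ : Submodule ℂ (ℤ →₀ ℂ)) ⊥
    exact isCompl_top_bot
  · have h0 := B1_even hk x.2
    rcases zmod2 i with rfl | rfl
    · rw [zero_add]
      rcases zmod2 j with rfl | rfl
      · exact Submodule.mem_top (R := ℂ) (M := ℤ →₀ ℂ)
      · have hv0 : v = 0 := (Submodule.mem_bot (R := ℂ) (M := ℤ →₀ ℂ)).1 hv
        rw [hv0, map_zero]; exact zero_mem _
    · have hx0 : x = 0 := Subtype.ext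
        (Submodule.disjoint_def.1 isCompl_par.disjoint _ h0 hx)
      rw [hx0, map_zero, LinearMap.zero_apply]; exact zero_mem _
  · have hs : sgn i j • (K1 ζ ξ e f).act y ((K1 ζ ξ e f).act x v) =
        (K1 ζ ξ e f).act y ((K1 ζ ξ e f).act x v) := by
      rcases zmod2 i with rfl | rfl
      · rw [sgn_zero_left, one_smul]
      · have hx0 : x = 0 := Subtype.ext
          (Submodule.disjoint_def.1 isCompl_par.disjoint _ (B1_even hk x.2) hx)
        rw [hx0]; simp
    rw [hs]
    have := K1op_br ζ ξ E hk x.2 y.2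
    rw [← hz] at this
    exact LinearMap.congr_fun this v

end

/-! ### Weights, support and irreducibility of `K₁`. -/

section

variable {k : ℕ} (ζ ξ : ℂ) {e f : TwAff k}

lemma K1_single_mem_weightSpace (n : ℤ) (c : ℂ) : (Finsupp.single n c : (K1 ζ ξ e f).V) ∈
    (K1 ζ ξ e f).weightSpace (cartan k) (rho k ζ + (2 * n) • dl) := by
  intro x hx
  have h1 := K1op_cartan ζ ξ e f ⟨x, hx⟩ n c
  rw [topFun_cartan] at h1
  refine Eq.trans h1 ?_
  have h2 : (rho k ζ + (2 * n) • dl : Wt k) ⟨x, hx⟩ =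
      topFun k 0 (⟨x, hx⟩ : cartan k) + (ζ + 2 * n) * dl (⟨x, hx⟩ : cartan k) := by
    have : rho k ζ ⟨x, hx⟩ = topFun k ζ (⟨x, hx⟩ : cartan k) := rfl
    rw [LinearMap.add_apply, this, topFun_cartan]
    simp only [LinearMap.smul_apply, zsmul_eq_mul]; push_cast; ring
  exact congrArg (fun a : ℂ => a • (Finsupp.single n c : ℤ →₀ ℂ)) h2.symm

lemma K1op_cartan_apply (h : cartan k) (v : ℤ →₀ ℂ) (n : ℤ) :
    K1op ζ ξ e f h v n = topFun k (ζ + 2 * n) h * v n := by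
  induction v using Finsupp.induction_linear with
  | zero => simp
  | add v w hv hw => rw [map_add, Finsupp.add_apply, hv, hw, Finsupp.add_apply]; ring
  | single m c =>
    rw [K1op_cartan, Finsupp.smul_apply, Finsupp.single_apply]
    split_ifs with hm
    · rw [hm, smul_eq_mul]
    · simp

lemma K1_weight_eq (hk : 2 ≤ k) {ν : Wt k} {v : ℤ →₀ ℂ}
    (hv : v ∈ (K1 ζ ξ e f).weightSpace (cartan k) ν) {n : ℤ} (hn : v n ≠ 0) :
    ν = rho k ζ + (2 * n) • dl := by
  ext h
  have h1 := congrArg (fun v : ℤ →₀ ℂ => v n) (hv ⟨h, cartan_le_B1 hk h.2⟩ h.2)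
  have h2 : topFun k (ζ + 2 * n) h * v n = ν h * v n := by
    rw [← K1op_cartan_apply ζ ξ (e := e) (f := f)]; exact h1
  rw [← mul_right_cancel₀ hn h2, topFun_cartan (ζ + 2 * n)]
  have : rho k ζ h = topFun k ζ h := rfl
  rw [LinearMap.add_apply, this, topFun_cartan ζ]
  simp only [LinearMap.smul_apply, zsmul_eq_mul]; push_cast; ring

lemma rho_add_inj {n m : ℤ} (h : rho k ζ + (2 * n) • dl = rho k ζ + (2 * m) • dl) : n = m := by
  have := congrArg (fun α : Wt k => α hPar) (add_left_cancel h)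
  simp only [hPar, LinearMap.smul_apply, dl_hElt, zsmul_eq_mul, mul_one] at this
  have : 2 * n = 2 * m := by exact_mod_cast this
  omega

theorem K1_supp (hk : 2 ≤ k) :
    (K1 ζ ξ e f).supp (cartan k) = {μ | ∃ n : ℤ, μ = rho k ζ + (2 * n) • dl} := by
  ext μ
  simp only [SuperRep.supp, Set.mem_ofPred_eq, Submodule.ne_bot_iff]
  constructor
  · rintro ⟨v, hv, hv0⟩
    obtain ⟨n, hn⟩ := Finsupp.ne_iff.1 (show (v : ℤ →₀ ℂ) ≠ 0 from hv0)
    exact ⟨n, K1_weight_eq ζ ξ hk hv hn⟩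
  · rintro ⟨n, rfl⟩
    exact ⟨_, K1_single_mem_weightSpace ζ ξ n 1,
      (Finsupp.single_ne_zero.2 one_ne_zero : (Finsupp.single n (1 : ℂ) : ℤ →₀ ℂ) ≠ 0)⟩

lemma K1_weightSpace_le (hk : 2 ≤ k) (ν : Wt k) :
    ∃ n : ℤ, ∀ v : ℤ →₀ ℂ, v ∈ (K1 ζ ξ e f).weightSpace (cartan k) ν →
      v ∈ (Submodule.span ℂ {Finsupp.single n 1} : Submodule ℂ (ℤ →₀ ℂ)) := by
  by_cases h : ∃ n : ℤ, ν = rho k ζ + (2 * n) • dl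
  · obtain ⟨n, rfl⟩ := h
    refine ⟨n, fun v hv => Submodule.mem_span_singleton.2 ⟨v n, ?_⟩⟩
    ext m
    rw [Finsupp.smul_single, smul_eq_mul, mul_one, Finsupp.single_apply]
    split_ifs with hm
    · rw [hm]
    · by_contra h0
      exact hm (rho_add_inj ζ (K1_weight_eq ζ ξ hk hv (Ne.symm h0)))
  · refine ⟨0, fun v hv => ?_⟩
    have : v = 0 := by
      by_contra h0
      obtain ⟨n, hn⟩ := Finsupp.ne_iff.1 h0
      exact h ⟨n, K1_weight_eq ζ ξ hk hv hn⟩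
    rw [this]; exact zero_mem _

lemma K1_span_single (N : Submodule ℂ (ℤ →₀ ℂ)) (h : ∀ n, Finsupp.single n (1 : ℂ) ∈ N) : N = ⊤ := by
  rw [Submodule.eq_top_iff']
  intro v
  induction v using Finsupp.induction_linear with
  | zero => exact zero_mem _
  | add v w hv hw => exact add_mem hv hw
  | single m c =>
    rw [← mul_one c, ← smul_eq_mul, ← Finsupp.smul_single]; exact N.smul_mem _ (h m)

theorem K1_isFiniteWeight (hk : 2 ≤ k) (E : IsDeltaPair e f) :
    (K1 ζ ξ e f).IsFiniteWeight (cartan k) := by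
  refine ⟨cartan_le_B1 hk, iSupIndep_weightSpace isHomogeneousCartan (cartan_le_B1 hk)
    (K1_isModule ζ ξ E hk).relations, ?_, fun ν => ?_⟩
  · exact K1_span_single _ fun n =>
      le_iSup (fun μ => (K1 ζ ξ e f).weightSpace (cartan k) μ) _ (K1_single_mem_weightSpace ζ ξ n 1)
  · obtain ⟨n, hn⟩ := K1_weightSpace_le ζ ξ (e := e) (f := f) hk ν
    let W : Submodule ℂ (ℤ →₀ ℂ) := (K1 ζ ξ e f).weightSpace (cartan k) ν
    have hle : W ≤ Submodule.span ℂ {Finsupp.single n 1} := hn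
    have : FiniteDimensional ℂ W := Submodule.finiteDimensional_of_le hle
    exact this

/-- `hPar` has the pairwise different eigenvalues `ζ + 2n` on the basis, so a nonzero invariant
subspace contains a basis vector. From there `e` reaches all higher ones and `f`, having nonzero
coefficients, all lower ones. -/
theorem K1_isIrreducible (hk : 2 ≤ k) (E : IsDeltaPair e f) (hc : ∀ n, fCoef ζ ξ n ≠ 0) :
    (K1 ζ ξ e f).IsIrreducible := by
  refine ⟨(inferInstance : Nontrivial (ℤ →₀ ℂ)), fun N hN => or_iff_not_imp_left.2 fun h0 => ?_⟩
  have heB : e ∈ B1 k := rootSpace_le_rootSum (two_dl_mem_P1 hk) E.e_mem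
  have hfB : f ∈ B1 k := rootSpace_le_rootSum (neg_two_dl_mem_P1 hk) E.f_mem
  let N' : Submodule ℂ (ℤ →₀ ℂ) := N
  have hNe : ∀ v ∈ N', K1op ζ ξ e f e v ∈ N' := hN ⟨e, heB⟩
  have hNf : ∀ v ∈ N', K1op ζ ξ e f f v ∈ N' := hN ⟨f, hfB⟩
  have hNh : ∀ v ∈ N', K1op ζ ξ e f (hPar : cartan k) v ∈ N' :=
    hN ⟨(hPar : cartan k), cartan_le_B1 hk hPar.2⟩
  have hPv : ∀ (m : ℤ) (c : ℂ), K1op ζ ξ e f (hPar : cartan k) (Finsupp.single m c) =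
      (ζ + 2 * m) • Finsupp.single m c := fun m c => by
    rw [K1op_cartan, hPar, topFun_hElt]; simp
  obtain ⟨v, hv, hv0⟩ := Submodule.exists_mem_ne_zero_of_ne_bot (p := N') h0
  obtain ⟨n, hn⟩ := Finsupp.ne_iff.1 hv0
  have hn1 : Finsupp.single n (v n) ∈ N' := by
    refine mem_of_add_mem_of_eigen (K1op ζ ξ e f (hPar : cartan k)) N' hNh (a := ζ + 2 * n)
      (B := {c | c ≠ ζ + 2 * n}) (w := Finsupp.erase n v) (by simp) (hPv _ _) ?_ ?_
    · rw [← Finsupp.sum_single (Finsupp.erase n v)]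
      refine sum_mem fun m hm => ?_
      have hmn : m ≠ n := by
        rintro rfl; simp at hm
      refine le_biSup (fun c => Module.End.eigenspace (K1op ζ ξ e f (hPar : cartan k)) c)
        (show ζ + 2 * (m : ℂ) ∈ {c | c ≠ ζ + 2 * (n : ℂ)} from fun h => hmn ?_)
        (Module.End.mem_eigenspace_iff.2 (hPv _ _))
      have : (m : ℂ) = n := by linear_combination (1 / 2 : ℂ) * h
      exact_mod_cast this
    · rw [Finsupp.single_add_erase]; exact hv
  have hone : Finsupp.single n (1 : ℂ) ∈ N' := by
    have := N'.smul_mem (v n)⁻¹ hn1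
    rwa [Finsupp.smul_single, smul_eq_mul, inv_mul_cancel₀ hn] at this
  have hup : ∀ m, Finsupp.single m (1 : ℂ) ∈ N' → Finsupp.single (m + 1) (1 : ℂ) ∈ N' := fun m hm => by
    have := hNe _ hm
    rwa [K1op_e ζ ξ E] at this
  have hdown : ∀ m, Finsupp.single m (1 : ℂ) ∈ N' → Finsupp.single (m - 1) (1 : ℂ) ∈ N' := fun m hm => by
    have := N'.smul_mem (fCoef ζ ξ m)⁻¹ (hNf _ hm)
    rwa [K1op_f ζ ξ E, Finsupp.smul_single, smul_eq_mul, mul_one, inv_mul_cancel₀ (hc m)] at this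
  refine K1_span_single N' fun m => ?_
  induction m using Int.inductionOn' (b := n) with
  | zero => exact hone
  | succ m _ ih => exact hup m ih
  | pred m _ ih => exact hdown m ih

lemma K1op_e_injective (E : IsDeltaPair e f) : Function.Injective (K1op ζ ξ e f e) := by
  rw [← LinearMap.ker_eq_bot, LinearMap.ker_eq_bot']
  intro v hv
  have key : ∀ (v : ℤ →₀ ℂ) n, K1op ζ ξ e f e v (n + 1) = v n := by
    intro v n
    induction v using Finsupp.induction_linear with
    | zero => simp
    | add v w hv hw => rw [map_add (K1op ζ ξ e f e), Finsupp.add_apply, hv, hw, Finsupp.add_apply]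
    | single m c => rw [K1op_e ζ ξ E]; simp [Finsupp.single_apply]
  ext n
  rw [← key, hv]; rfl

lemma K1op_f_injective (E : IsDeltaPair e f) (hc : ∀ n, fCoef ζ ξ n ≠ 0) :
    Function.Injective (K1op ζ ξ e f f) := by
  rw [← LinearMap.ker_eq_bot, LinearMap.ker_eq_bot']
  intro v hv
  have key : ∀ (v : ℤ →₀ ℂ) n, K1op ζ ξ e f f v (n - 1) = fCoef ζ ξ n * v n := by
    intro v n
    induction v using Finsupp.induction_linear with
    | zero => simp
    | add v w hv hw => rw [map_add, Finsupp.add_apply, hv, hw, Finsupp.add_apply]; ring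
    | single m c =>
      rw [K1op_f ζ ξ E, Finsupp.single_apply, Finsupp.single_apply]
      by_cases h : m = n
      · simp [h]
      · rw [if_neg h, if_neg (by omega), mul_zero]
  ext n
  have := key v n
  rw [hv] at this
  exact (mul_eq_zero.1 this.symm).resolve_left (hc n)

theorem K1_injective (E : IsDeltaPair e f) (hc : ∀ n, fCoef ζ ξ n ≠ 0) :
    (K1 ζ ξ e f).ActsInjectively (cartan k) ((2 : ℤ) • dl) ∧
      (K1 ζ ξ e f).ActsInjectively (cartan k) (-((2 : ℤ) • dl)) := by
  have smul_inj : ∀ (g : Module.End ℂ (ℤ →₀ ℂ)) (c : ℂ), c ≠ 0 → Function.Injective g →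
      Function.Injective (c • g) := fun g c hc hg v w h => hg (by
    have : c • g v = c • g w := h
    exact smul_right_injective _ hc this)
  constructor
  · intro x hx hx0
    obtain ⟨c, hc'⟩ := rootSpace_two_dl_eq E hx
    have hc0 : c ≠ 0 := by
      rintro rfl; exact hx0 (Subtype.ext (by rw [hc', zero_smul]; rfl))
    have := smul_inj _ c hc0 (K1op_e_injective ζ ξ E)
    rw [← map_smul, ← hc'] at this
    exact this
  · intro x hx hx0
    obtain ⟨c, hc'⟩ := rootSpace_neg_two_dl_eq E hx
    have hc0 : c ≠ 0 := by
      rintro rfl; exact hx0 (Subtype.ext (by rw [hc', zero_smul]; rfl))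
    have := smul_inj _ c hc0 (K1op_f_injective ζ ξ E hc)
    rw [← map_smul, ← hc'] at this
    exact this

lemma wtForm_two_dl : wtForm ((2 : ℤ) • dl : Wt k) ((2 : ℤ) • dl) = -4 := by
  rw [wtForm_eq]; simp [hPar, dElt, cElt]; norm_num

lemma wtForm_neg (α : Wt k) : wtForm (-α) (-α) = wtForm α α := by
  rw [wtForm_eq, wtForm_eq]; simp

theorem K1_inSet (hk : 2 ≤ k) (E : IsDeltaPair e f) (hc : ∀ n, fCoef ζ ξ n ≠ 0) :
    (2 : ℤ) • dl ∈ inSet (K1 ζ ξ e f) (P1 k ∩ -P1 k) ∧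
      -((2 : ℤ) • dl) ∈ inSet (K1 ζ ξ e f) (P1 k ∩ -P1 k) := by
  have h := K1_injective ζ ξ E hc
  refine ⟨⟨two_dl_mem_P1 hk, ?_, h.1⟩, ⟨neg_two_dl_mem_P1 hk, ?_, h.2⟩⟩
  · rw [wtForm_two_dl]; norm_num
  · rw [wtForm_neg, wtForm_two_dl]; norm_num

/-- The weights of `K₁` differ by multiples of `δ₁`. Elements on which `δ₁` vanishes therefore act
by one scalar, as is required of the element defining a parabolic induction. -/
lemma K1_act_scalar {h : cartan k} (hd : dl h = 0) (x : B1 k) (hx : (x : TwAff k) = h) :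
    ∀ w, (K1 ζ ξ e f).act x w = topFun k 0 h • w := by
  change ∀ w : ℤ →₀ ℂ, K1op ζ ξ e f x w = topFun k 0 h • w
  intro w
  rw [hx]
  ext n
  rw [K1op_cartan_apply, topFun_cartan, hd, mul_zero, add_zero]; rfl

/-- Start of the parity argument along the tower: `hPar` acts on the purely even `K₁` with
eigenvalues in `ζ + 2ℤ`. -/
lemma K1_parity (x : B1 k) (hx : (x : TwAff k) = (hPar : cartan k)) (j : ZMod 2) :
    (K1 ζ ξ e f).vpar j ≤ parityEigen ((K1 ζ ξ e f).act x) ζ j := by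
  rcases zmod2 j with rfl | rfl
  · refine (le_top (α := Submodule ℂ (ℤ →₀ ℂ))).trans (le_of_eq (Eq.symm ?_))
    refine K1_span_single _ fun n => ?_
    refine le_biSup (fun c => Module.End.eigenspace ((K1 ζ ξ e f).act x) c)
      (show ζ + ((2 * n : ℤ) : ℂ) ∈ {c : ℂ | ∃ m : ℤ, (m : ZMod 2) = 0 ∧ c = ζ + m} from
        ⟨2 * n, by push_cast; rw [show (2 : ZMod 2) = 0 from rfl, zero_mul], rfl⟩) ?_
    refine Module.End.mem_eigenspace_iff.2 ?_
    change K1op ζ ξ e f x (Finsupp.single n 1) = _ • (Finsupp.single n 1 : ℤ →₀ ℂ)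
    rw [hx, K1op_cartan, hPar, topFun_hElt]
    congr 1
    simp
  · exact bot_le (α := Submodule ℂ (ℤ →₀ ℂ))

theorem K1_action (hk : 2 ≤ k) (E : IsDeltaPair e f) :
    e ∈ B1 k ∧ f ∈ B1 k ∧ ∀ (x : B1 k) (n : ℤ),
        ((x : TwAff k) = e →
          (K1 ζ ξ e f).act x (Finsupp.single n 1) = Finsupp.single (n + 1) 1) ∧
        ((x : TwAff k) = f → (K1 ζ ξ e f).act x (Finsupp.single n 1) =
          Finsupp.single (n - 1) (-(1 / 2) * (ξ - (ζ + 2 * n - 1) ^ 2))) ∧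
        ((x : TwAff k) = (dElt : cartan k) → (K1 ζ ξ e f).act x (Finsupp.single n 1) = 0) ∧
        ((x : TwAff k) = (cElt : cartan k) → (K1 ζ ξ e f).act x (Finsupp.single n 1) =
          Finsupp.single n (2 * k + 2 : ℂ)) ∧
        ((x : TwAff k) = (tElt ((2 : ℤ) • dl : Wt k) : TwAff k) →
          (K1 ζ ξ e f).act x (Finsupp.single n 1) =
            Finsupp.single n (-2 * (ζ + 2 * n))) ∧
        ∀ i : Fin k, (x : TwAff k) = (tElt (ep i) : TwAff k) →
          (K1 ζ ξ e f).act x (Finsupp.single n 1) =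
            Finsupp.single n ((k : ℂ) - ((i : ℕ) + 1) + 2) := by
  refine ⟨rootSpace_le_rootSum (two_dl_mem_P1 hk) E.e_mem,
    rootSpace_le_rootSum (neg_two_dl_mem_P1 hk) E.f_mem, fun x n => ?_⟩
  have hcar : ∀ (h : cartan k) (c : ℂ), topFun k (ζ + 2 * n) h = c → (x : TwAff k) = h →
      (K1 ζ ξ e f).act x (Finsupp.single n 1) = Finsupp.single n c := by
    intro h c hc hx
    change K1op ζ ξ e f x (Finsupp.single n 1) = _
    rw [hx, K1op_cartan, hc, Finsupp.smul_single, smul_eq_mul, mul_one]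
  refine ⟨fun hx => ?_, fun hx => ?_, fun hx => ?_, hcar _ _ ?_, hcar _ _ ?_, fun i => hcar _ _ ?_⟩
  · change K1op ζ ξ e f x (Finsupp.single n 1) = _
    rw [hx, K1op_e ζ ξ E]
  · change K1op ζ ξ e f x (Finsupp.single n 1) = _
    rw [hx, K1op_f ζ ξ E, mul_one, fCoef]
  · have := hcar dElt 0 (by rw [dElt, topFun_hElt]; simp) hx
    rw [this, Finsupp.single_zero]; rfl
  · rw [cElt, topFun_hElt]; simp
  · rw [tElt_two_dl, topFun_hElt]; simp; ring
  · rw [tElt_ep, topFun_hElt]; simp [Pi.single_apply]; ring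

/-- A zero coefficient would make `ξ` equal to the rational number `(ζ + 2n - 1)²`. -/
lemma fCoef_ne_zero (ζ : ℚ) {ξ : ℝ} (hξ : Irrational ξ) (n : ℤ) : fCoef (ζ : ℂ) (ξ : ℂ) n ≠ 0 := by
  intro h
  have h1 : (ξ : ℂ) = (((ζ + 2 * n - 1) ^ 2 : ℚ) : ℂ) := by
    rw [fCoef] at h
    push_cast
    linear_combination (-2 : ℂ) * h
  have h2 : ξ = (((ζ + 2 * n - 1) ^ 2 : ℚ) : ℝ) := by exact_mod_cast h1
  exact hξ ⟨_, h2.symm⟩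

end

/-! ### The tower of embeddings from `K₁` to `K₄`. -/

section

variable {k : ℕ}

lemma finite_neg_dElt (m : ℕ) :
    {α : Wt k | α ∈ roots (cartan k) ∧ α dElt = -((m : ℂ) + 1)}.Finite := by
  have := finite_roots_dElt (k := k) (-(m + 1))
  push_cast at this
  exact this

/-- The roots in `P₃ ∩ -P₃` are those of degree zero in `δ`; there are finitely many of them
altogether. -/
lemma finite_neg_of_subset {T : Set (Wt k)} (hk : 2 ≤ k) (hT : T ⊆ P3 k ∩ -P3 k) (h0 : cartan k)
    (m : ℕ) : {α : Wt k | α ∈ T ∧ α h0 = -((m : ℂ) + 1)}.Finite := by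
  refine (finite_roots_dElt (k := k) 0).subset ?_
  rintro α ⟨hα, -⟩
  have := hT hα
  rw [(isParabolic_P3 hk).2.1] at this
  exact ⟨this.1, by rw [this.2]; simp⟩

lemma P2_inter_subset (hk : 2 ≤ k) : P2 k ∩ -P2 k ⊆ P3 k ∩ -P3 k :=
  fun α hα => ((mem_P2 hk α).1 hα.1).1

lemma P3_inter_subset (hk : 2 ≤ k) : P3 k ∩ -P3 k ⊆ roots (cartan k) :=
  fun α hα => ((mem_P3 hk α).1 hα.1).1

variable {ζ ξ : ℂ} {e f : TwAff k}

theorem K1_isIrreducibleFiniteWeight (hk : 2 ≤ k) (E : IsDeltaPair e f)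
    (hc : ∀ n, fCoef ζ ξ n ≠ 0) : (K1 ζ ξ e f).IsIrreducibleFiniteWeight (cartan k) :=
  ⟨K1_isModule ζ ξ E hk, K1_isFiniteWeight ζ ξ hk E, K1_isIrreducible ζ ξ hk E hc⟩

/-- The properties of one step of parabolic induction used in the next one. -/
structure IsGoodStep (t : Submodule ℂ (TwAff k)) (P : Set (Wt k))
    (Ω : SuperRep (rootSum (cartan k) (P ∩ -P))) (b : ℂ) : Prop where
  isExists : parIndExists t P Ω
  isEmbeds : parIndEmbeds t P Ω
  irred : (parInd t P Ω).IsIrreducibleFiniteWeight (cartan k)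
  parity : ∀ x : t, (x : TwAff k) = (hPar : cartan k) → ∀ j,
    (parInd t P Ω).vpar j ≤ parityEigen ((parInd t P Ω).act x) b j

theorem K2_step (hk : 2 ≤ k) (E : IsDeltaPair e f) (hc : ∀ n, fCoef ζ ξ n ≠ 0) :
    IsGoodStep (B2 k) (P1 k) (K1 ζ ξ e f) ζ := by
  obtain ⟨h1, h2, h3, h4⟩ := parInd_isIrreducibleFiniteWeight (K1 ζ ξ e f) isHomogeneousCartan
    (gradedBy_P1 hk) (isParabolic_P1 hk).2.1 (isParabolic_P1 hk).2.2
    (fun x hx => K1_act_scalar ζ ξ (h := hOne) (by simp [hOne]) x hx)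
    (fun α => inferInstance) (finite_neg_of_subset hk (P2_inter_subset hk) hOne)
    (fun α hα => wtPar_spec hk α (P2_subset_roots hk hα.1))
    (fun x hx => K1_parity ζ ξ x hx) (K1_isIrreducibleFiniteWeight hk E hc)
  exact ⟨h1, h2, h3, h4⟩

/-- An element of `𝔥` on which all roots of `𝓑₂` vanish commutes with `𝓑₂`, so its scalar on `K₁`
persists on `K₂`. As `2δ₁` is one of these roots, `δ₁` vanishes on it and the scalar exists. -/
lemma K2_act_scalar (hk : 2 ≤ k) {h : cartan k}
    (hT : ∀ α ∈ P2 k ∩ -P2 k, α h = 0) : ∀ x : B2 k, (x : TwAff k) = h →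
      ∀ v, (K2 ζ ξ e f).act x v = topFun k 0 h • v := by
  have hd : dl h = 0 := by
    have := hT ((2 : ℤ) • dl) ((mem_P2_inter hk _).2 (Or.inl (Or.inr ⟨1, by simp⟩)))
    simpa using this
  exact ind_act_scalar (K1 ζ ξ e f) isHomogeneousCartan (gradedBy_P1 hk)
    (congrArg (rootSum (cartan k)) (isParabolic_P1 hk).2.1) hT (fun x hx => K1_act_scalar ζ ξ hd x hx)

theorem K3_step (hk : 2 ≤ k) (E : IsDeltaPair e f) (hc : ∀ n, fCoef ζ ξ n ≠ 0) :
    IsGoodStep (B3 k) (P2 k) (K2 ζ ξ e f) ζ := by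
  have S := K2_step (ζ := ζ) (ξ := ξ) hk E hc
  obtain ⟨h1, h2, h3, h4⟩ := parInd_isIrreducibleFiniteWeight (K2 ζ ξ e f) isHomogeneousCartan
    (gradedBy_P2 hk) (isParabolic_P2 hk).2.1 (isParabolic_P2 hk).2.2
    (K2_act_scalar hk (h := hTwo) fun α hα => by
      rw [(isParabolic_P2 hk).2.1] at hα; exact hα.2)
    (fun α => inferInstance) (finite_neg_of_subset hk subset_rfl hTwo)
    (fun α hα => wtPar_spec hk α (P3_inter_subset hk hα)) S.parity S.irred
  exact ⟨h1, h2, h3, h4⟩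

lemma K3_act_scalar (hk : 2 ≤ k) {h : cartan k}
    (hT : ∀ α ∈ P3 k ∩ -P3 k, α h = 0) : ∀ x : B3 k, (x : TwAff k) = h →
      ∀ v, (K3 ζ ξ e f).act x v = topFun k 0 h • v :=
  ind_act_scalar (K2 ζ ξ e f) isHomogeneousCartan (gradedBy_P2 hk)
    (congrArg (rootSum (cartan k)) (isParabolic_P2 hk).2.1) hT
    (K2_act_scalar hk fun α hα => hT α (P2_inter_subset hk hα))

theorem K4_step (hk : 2 ≤ k) (E : IsDeltaPair e f) (hc : ∀ n, fCoef ζ ξ n ≠ 0) :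
    IsGoodStep ⊤ (P3 k) (K3 ζ ξ e f) ζ := by
  have S := K3_step (ζ := ζ) (ξ := ξ) hk E hc
  obtain ⟨h1, h2, h3, h4⟩ := parInd_isIrreducibleFiniteWeight (K3 ζ ξ e f) isHomogeneousCartan
    (gradedBy_P3 hk) (isParabolic_P3 hk).2.1 (isParabolic_P3 hk).2.2
    (K3_act_scalar hk (h := dElt) fun α hα => by
      rw [(isParabolic_P3 hk).2.1] at hα; exact hα.2)
    (fun α => inferInstance) finite_neg_dElt
    (fun α hα => wtPar_spec hk α hα) S.parity S.irred
  exact ⟨h1, h2, h3, h4⟩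

/-- The embedding of `K₂` into `K₄`. -/
def inclTwo (ζ ξ : ℂ) (e f : TwAff k) : (K2 ζ ξ e f).V →ₗ[ℂ] (K4 ζ ξ e f).V :=
  indIncl ⊤ (rootSum (cartan k) (P3 k \ -P3 k)) (K3 ζ ξ e f) ∘ₗ
    indIncl (B3 k) (rootSum (cartan k) (P2 k \ -P2 k)) (K2 ζ ξ e f)

/-- The embedding of `K₁` into `K₄`. -/
def inclOne (ζ ξ : ℂ) (e f : TwAff k) : (K1 ζ ξ e f).V →ₗ[ℂ] (K4 ζ ξ e f).V :=
  inclTwo ζ ξ e f ∘ₗ indIncl (B2 k) (rootSum (cartan k) (P1 k \ -P1 k)) (K1 ζ ξ e f)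

lemma inclTwo_injective (hk : 2 ≤ k) (E : IsDeltaPair e f) (hc : ∀ n, fCoef ζ ξ n ≠ 0) :
    Function.Injective (inclTwo ζ ξ e f) :=
  (K4_step hk E hc).isEmbeds.1.comp (K3_step hk E hc).isEmbeds.1

lemma inclOne_injective (hk : 2 ≤ k) (E : IsDeltaPair e f) (hc : ∀ n, fCoef ζ ξ n ≠ 0) :
    Function.Injective (inclOne ζ ξ e f) :=
  (inclTwo_injective hk E hc).comp (K2_step hk E hc).isEmbeds.1

lemma B2_le_B3 (hk : 2 ≤ k) : B2 k ≤ B3 k := rootSum_mono (P2_inter_subset hk)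

lemma B1_le_B2 (hk : 2 ≤ k) : B1 k ≤ B2 k :=
  rootSum_mono fun α hα => ((mem_P1 hk α).1 hα.1).1

lemma inclTwo_act (hk : 2 ≤ k) (x : (⊤ : Submodule ℂ (TwAff k))) (hx : (x : TwAff k) ∈ B2 k)
    (w : (K2 ζ ξ e f).V) :
    (K4 ζ ξ e f).act x (inclTwo ζ ξ e f w) = inclTwo ζ ξ e f ((K2 ζ ξ e f).act ⟨x, hx⟩ w) := by
  have h3 := B2_le_B3 hk hx
  exact (ind_act_incl (K3 ζ ξ e f) x h3 _).trans
    (congrArg _ (ind_act_incl (K2 ζ ξ e f) ⟨x, h3⟩ hx w))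

/-- Inside `K₄` the image of `K₂` is killed by the nilradicals of both `P₂` and `P₃`: that of `P₃`
kills all of `K₃`, that of `P₂` kills `K₂` inside `K₃`. -/
lemma inclTwo_act_eq_zero (hk : 2 ≤ k) {α : Wt k}
    (hα : α ∈ degPos (roots (cartan k)) dElt ∪ degPos (P3 k ∩ -P3 k) hTwo)
    (x : (⊤ : Submodule ℂ (TwAff k))) (hx : (x : TwAff k) ∈ rootSpace (cartan k) α)
    (w : (K2 ζ ξ e f).V) : (K4 ζ ξ e f).act x (inclTwo ζ ξ e f w) = 0 := by
  rw [← (isParabolic_P3 hk).2.2, ← (isParabolic_P2 hk).2.2] at hα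
  rcases hα with hα | hα
  · exact ind_act_incl_eq_zero (K3 ζ ξ e f) x (rootSpace_le_rootSum hα hx) _
  · have h3 : (x : TwAff k) ∈ B3 k :=
      rootSpace_le_rootSum ((mem_P2 hk α).1 hα.1).1 hx
    exact (ind_act_incl (K3 ζ ξ e f) x h3 _).trans ((congrArg _ (ind_act_incl_eq_zero
      (K2 ζ ξ e f) ⟨x, h3⟩ (rootSpace_le_rootSum hα hx) w)).trans (map_zero _))

lemma inclOne_act (hk : 2 ≤ k) (x : (⊤ : Submodule ℂ (TwAff k))) (hx : (x : TwAff k) ∈ B1 k)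
    (w : (K1 ζ ξ e f).V) :
    (K4 ζ ξ e f).act x (inclOne ζ ξ e f w) = inclOne ζ ξ e f ((K1 ζ ξ e f).act ⟨x, hx⟩ w) := by
  have h2 := B1_le_B2 hk hx
  exact (inclTwo_act hk x h2 _).trans
    (congrArg _ (ind_act_incl (K1 ζ ξ e f) ⟨x, h2⟩ hx w))

lemma inclOne_act_eq_zero (hk : 2 ≤ k) {α : Wt k} (hα : α ∈ degPos (P2 k ∩ -P2 k) hOne)
    (x : (⊤ : Submodule ℂ (TwAff k))) (hx : (x : TwAff k) ∈ rootSpace (cartan k) α)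
    (w : (K1 ζ ξ e f).V) : (K4 ζ ξ e f).act x (inclOne ζ ξ e f w) = 0 := by
  rw [← (isParabolic_P1 hk).2.2] at hα
  have h2 : (x : TwAff k) ∈ B2 k := rootSpace_le_rootSum ((mem_P1 hk α).1 hα.1).1 hx
  exact (inclTwo_act hk x h2 _).trans ((congrArg _ (ind_act_incl_eq_zero
    (K1 ζ ξ e f) ⟨x, h2⟩ (rootSpace_le_rootSum hα hx) w)).trans (map_zero _))

end

/-! ### Representations of `𝔰𝔩₂` and locally nilpotent root vectors. -/

section

variable {V : Type*} [AddCommGroup V] [Module ℂ V]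

lemma exists_pow_ne_zero {F : Module.End ℂ V} {v : V} (hv : v ≠ 0) (h : ∃ n : ℕ, (F ^ n) v = 0) :
    ∃ n : ℕ, (F ^ n) v ≠ 0 ∧ (F ^ (n + 1)) v = 0 := by
  classical
  obtain ⟨n, hn⟩ : ∃ n, Nat.find h = n + 1 :=
    Nat.exists_eq_succ_of_ne_zero fun h0 => hv (by simpa [h0] using Nat.find_spec h)
  exact ⟨n, Nat.find_min h (by omega), hn ▸ Nat.find_spec h⟩

lemma pow_apply_ne_zero {F : Module.End ℂ V} {v : V} {n j : ℕ} (h : (F ^ n) v ≠ 0) (hj : j ≤ n) :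
    (F ^ j) v ≠ 0 := fun h0 => h (by
  obtain ⟨i, rfl⟩ := Nat.exists_eq_add_of_le hj
  rw [add_comm, pow_add, Module.End.mul_apply, h0, map_zero])

/-- The action of `𝔰𝔩₂` on a primitive vector. -/
lemma sl2_apply_pow {E F H : Module.End ℂ V} (hEF : ∀ v, E (F v) = F (E v) + H v)
    (hHF : ∀ v, H (F v) = F (H v) - (2 : ℂ) • F v) {v : V} {c : ℂ} (hE : E v = 0)
    (hH : H v = c • v) (n : ℕ) :
    E ((F ^ (n + 1)) v) = ((n + 1) * (c - n)) • (F ^ n) v := by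
  have h1 : ∀ n : ℕ, H ((F ^ n) v) = (c - 2 * n) • (F ^ n) v := by
    intro n
    induction n with
    | zero => simpa using hH
    | succ n ih =>
      rw [pow_succ', Module.End.mul_apply, hHF, ih, map_smul]
      push_cast
      module
  induction n with
  | zero => simp [hEF, hE, hH]
  | succ n ih =>
    rw [pow_succ' F (n + 1), Module.End.mul_apply, hEF, ih, h1, map_smul, pow_succ' F n,
      Module.End.mul_apply]
    push_cast
    module

end

section

variable {L : Type} [AddCommGroup L] [Module ℂ L] [LieSuperalgebra L]
variable {𝔥 t : Submodule ℂ L} {p : Module.Dual ℂ 𝔥 → ZMod 2} {T : Set (Module.Dual ℂ 𝔥)} {h0 : 𝔥}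
variable {M : SuperRep t}

lemma GradedBy.act_act (H : IsHomogeneousCartan 𝔥 p) (D : GradedBy 𝔥 t T h0) (hM : M.Relations)
    {α β : Module.Dual ℂ 𝔥} {x y : t} (hx : (x : L) ∈ rootSpace 𝔥 α)
    (hy : (y : L) ∈ rootSpace 𝔥 β) (v : M.V) :
    M.act x (M.act y v) = M.act ⟨br (x : L) (y : L), D.br_mem_t H x y⟩ v +
      sgn (p α) (p β) • M.act y (M.act x v) :=
  (sub_eq_iff_eq_add.1 (hM (p α) (p β) x y (H.homog _ hx) (H.homog _ hy) v _ rfl).symm)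

lemma GradedBy.isInvariant (D : GradedBy 𝔥 t T h0) {N : Submodule ℂ M.V}
    (h : ∀ α ∈ T, ∀ x : t, (x : L) ∈ rootSpace 𝔥 α → ∀ v ∈ N, M.act x v ∈ N) :
    M.IsInvariant N := by
  intro x v hv
  let S : Submodule ℂ t :=
    { carrier := {x | M.act x v ∈ N}
      add_mem' := fun ha hb => by
        rw [Set.mem_ofPred_eq, map_add]; exact add_mem ha hb
      zero_mem' := by simp
      smul_mem' := fun c a ha => by
        rw [Set.mem_ofPred_eq, map_smul]; exact N.smul_mem c ha }
  exact mem_of_rootSum (T := T) D.eq_rootSum.ge S (fun α hα x hx => h α hα x hx v hv) x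
    (D.eq_rootSum ▸ x.2)

/-- On an irreducible module, an even root vector with finite root strings which is nilpotent on
one nonzero vector is locally nilpotent. -/
theorem exists_pow_act_eq_zero (H : IsHomogeneousCartan 𝔥 p) (D : GradedBy 𝔥 t T h0)
    (hM : M.Relations) (hirr : M.IsIrreducible) {α : Module.Dual ℂ 𝔥} (hα : p α = 0)
    (hstr : ∀ β : Module.Dual ℂ 𝔥, ∃ m : ℕ, β + m • α ∉ roots 𝔥) {x : t}
    (hx : (x : L) ∈ rootSpace 𝔥 α) {v : M.V} (hv : v ≠ 0) (hn : ∃ n : ℕ, (M.act x ^ n) v = 0)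
    (w : M.V) : ∃ n : ℕ, (M.act x ^ n) w = 0 := by
  -- A Leibniz count: each factor `x` either passes `y` and is spent on `v`, which allows `n` of
  -- them, or replaces `y` by `[x, y]`, which makes it vanish after `m` of them. Only `β + mα`
  -- itself has to be a non-root.
  have key : ∀ m : ℕ, ∀ β : Module.Dual ℂ 𝔥, β + m • α ∉ roots 𝔥 → ∀ y : t,
      (y : L) ∈ rootSpace 𝔥 β → ∀ (n : ℕ) (v : M.V), (M.act x ^ n) v = 0 →
      (M.act x ^ (m + n)) (M.act y v) = 0 := by
    intro m
    induction m with
    | zero =>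
      intro β hβ y hy n v _
      have : y = 0 := Subtype.ext (eq_zero_of_not_mem_roots (by simpa using hβ) hy)
      rw [this]; simp
    | succ m ihm =>
      intro β hβ y hy n
      induction n with
      | zero => intro v hv; simp [show v = 0 by simpa using hv]
      | succ n ihn =>
        intro v hv
        have e : m + 1 + (n + 1) = (m + 1 + n) + 1 := rfl
        rw [e, pow_succ, Module.End.mul_apply, D.act_act H hM hx hy, map_add, map_smul, hα,
          ihn _ (by rw [← Module.End.mul_apply, ← pow_succ, hv])]
        have h2 := ihm (α + β) (by
            rw [succ_nsmul'] at hβ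
            rwa [add_comm α β, add_assoc])
          ⟨_, D.br_mem_t H x y⟩ (H.br_mem_rootSpace hx hy) (n + 1) v hv
        rw [show m + 1 + n = m + (n + 1) by ring, h2]
        simp
  let N : Submodule ℂ M.V :=
    { carrier := {v | ∃ n : ℕ, (M.act x ^ n) v = 0}
      add_mem' := by
        rintro a b ⟨n, hn⟩ ⟨n', hn'⟩
        refine ⟨n + n', ?_⟩
        rw [map_add, pow_add, Module.End.mul_apply, Module.End.mul_apply, hn', map_zero, add_zero,
          ← Module.End.mul_apply, ← pow_add, add_comm, pow_add, Module.End.mul_apply, hn, map_zero]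
      zero_mem' := ⟨0, by simp⟩
      smul_mem' := by
        rintro c a ⟨n, hn⟩
        exact ⟨n, by rw [map_smul, hn, smul_zero]⟩ }
  have hN : M.IsInvariant N := D.isInvariant fun β _ y hy v ⟨n, hn⟩ => by
    obtain ⟨m, hm⟩ := hstr β
    exact ⟨m + n, key m β hm y hy n v hn⟩
  have : N = ⊤ := (hirr.2 N hN).resolve_left fun h0 => hv (by
    have : v ∈ N := hn
    rwa [h0, Submodule.mem_bot] at this)
  have hw : w ∈ N := by rw [this]; exact Submodule.mem_top
  exact hw

/-- A nonzero vector killed by all root vectors of positive degree bounds the degrees of the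
weights of an irreducible module. -/
theorem degree_of_mem_supp (H : IsHomogeneousCartan 𝔥 p) (D : GradedBy 𝔥 t T h0)
    (hM : M.Relations) (hirr : M.IsIrreducible) {a : ℂ} {v : M.V} (hv : v ≠ 0)
    (hva : ∀ x : t, (x : L) = h0 → M.act x v = a • v)
    (hkill : ∀ α ∈ degPos T h0, ∀ x : t, (x : L) ∈ rootSpace 𝔥 α → M.act x v = 0)
    {μ : Module.Dual ℂ 𝔥} (hμ : μ ∈ M.supp 𝔥) : ∃ n : ℕ, μ h0 = a - n := by
  have h0t : (h0 : L) ∈ t := D.cartan_le H h0.2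
  set f := M.act ⟨h0, h0t⟩ with hf
  -- The extremal vectors with `h0`-eigenvalue `a` form a subspace stable under root vectors of
  -- degree zero. Its lowering closure is thus invariant, hence the whole module, and its
  -- eigenvalues lie in `a - ℕ`.
  let W : Submodule ℂ M.V :=
    { carrier := {w | f w = a • w ∧ ∀ α ∈ degPos T h0, ∀ x : t, (x : L) ∈ rootSpace 𝔥 α →
        M.act x w = 0}
      add_mem' := fun hu hw => ⟨by rw [map_add, hu.1, hw.1, smul_add], fun α hα x hx => by
        rw [map_add, hu.2 α hα x hx, hw.2 α hα x hx, add_zero]⟩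
      zero_mem' := ⟨by simp, by simp⟩
      smul_mem' := fun c w hw => ⟨by rw [map_smul, hw.1, smul_comm], fun α hα x hx => by
        rw [map_smul, hw.2 α hα x hx, smul_zero]⟩ }
  have hW : ∀ α ∈ degZero T h0 ∪ degPos T h0, ∀ x : t, (x : L) ∈ rootSpace 𝔥 α → ∀ w ∈ W,
      M.act x w ∈ opClosure (lowOps T h0 M.act) W := by
    rintro α (hα | hα) x hx w hw
    · refine le_opClosure ⟨?_, fun β hβ y hy => ?_⟩
      · have := act_mem_eigenspace H hM hx (h := ⟨h0, h0t⟩) h0.2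
          (Module.End.mem_eigenspace_iff.2 hw.1)
        rwa [show α ⟨h0, h0.2⟩ = 0 from hα.2, add_zero, Module.End.mem_eigenspace_iff] at this
      · rw [D.act_act H hM hy hx, hw.2 β hβ y hy, map_zero, smul_zero, add_zero]
        have hz := H.br_mem_rootSpace hy hx
        by_cases hr : β + α ∈ roots 𝔥
        · obtain ⟨n, hn⟩ := hβ.2
          exact hw.2 _ ⟨D.closed _ hβ.1 _ hα.1 hr, n, by
            rw [LinearMap.add_apply, hn, hα.2, add_zero]⟩ _ hz
        · have : (⟨_, D.br_mem_t H y x⟩ : t) = 0 := Subtype.ext (eq_zero_of_not_mem_roots hr hz)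
          rw [this]; simp
    · rw [hw.2 α hα x hx]; exact zero_mem _
  have hst := opClosure_lowOps_stable H D M.act
    (fun α _ γ _ x y hx hy v => hM _ _ x y (H.homog _ hx) (H.homog _ hy) v) hW
  have hvW : v ∈ W := ⟨hva _ rfl, hkill⟩
  have htop : opClosure (lowOps T h0 M.act) W = ⊤ :=
    (hirr.2 _ fun x v hv => hst x v hv).resolve_left fun hb => hv (by
      have := le_opClosure (O := lowOps T h0 M.act) hvW
      rwa [hb, Submodule.mem_bot] at this)
  have hle := opClosure_lowOps_le (T := T) M.act ⟨h0, h0t⟩ rfl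
    (fun γ _ y hy v => hM 0 (p γ) _ y (H.even h0.2) (H.homog _ hy) v) (W := W) fun w hw => hw.1
  rw [htop] at hle
  by_contra hcon
  push Not at hcon
  obtain ⟨u, hu, hu0⟩ := (Submodule.ne_bot_iff _).1 hμ
  refine hu0 (Submodule.disjoint_def.1 (f.eigenspaces_iSupIndep.disjoint_biSup
    (x := μ h0) (y := {c | ∃ n : ℕ, c = a - n}) fun ⟨n, hn⟩ => hcon n hn) u
      (weightSpace_le_eigenspace μ (h := ⟨h0, h0t⟩) h0.2 hu) ?_)
  refine (sup_le ?_ (iSup_le fun n => ?_) : _ ≤ ⨆ c ∈ {c | ∃ n : ℕ, c = a - n}, f.eigenspace c)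
    (hle Submodule.mem_top)
  · exact fun w hw => (le_biSup f.eigenspace (show a ∈ {c | ∃ n : ℕ, c = a - n} from
      ⟨0, by simp⟩)) (Module.End.mem_eigenspace_iff.2 hw.1)
  · exact le_biSup f.eigenspace (show a - (n + 1) ∈ {c | ∃ n : ℕ, c = a - n} from
      ⟨n + 1, by simp⟩)

/-- `e` and `f` are even root vectors, of weights `α` and `-α`, spanning an `𝔰𝔩₂` with `h`. -/
structure IsSl2Pair (p : Module.Dual ℂ 𝔥 → ZMod 2) (α : Module.Dual ℂ 𝔥) (e f : t) (h : 𝔥) :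
    Prop where
  even : p α = 0
  even_neg : p (-α) = 0
  e_mem : (e : L) ∈ rootSpace 𝔥 α
  f_mem : (f : L) ∈ rootSpace 𝔥 (-α)
  br_eq : br (e : L) (f : L) = h
  two : α h = 2

variable {α : Module.Dual ℂ 𝔥} {e f : t} {h : 𝔥}

lemma IsSl2Pair.swap (H : IsHomogeneousCartan 𝔥 p) (S : IsSl2Pair p α e f h) :
    IsSl2Pair p (-α) f e (-h) where
  even := S.even_neg
  even_neg := by rw [neg_neg]; exact S.even
  e_mem := S.f_mem
  f_mem := by rw [neg_neg]; exact S.e_mem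
  br_eq := by
    rw [br_skew (H.homog _ S.f_mem) (H.homog _ S.e_mem), S.even, sgn_zero_right, one_smul, S.br_eq]
    rfl
  two := by rw [LinearMap.neg_apply, map_neg, neg_neg, S.two]

lemma IsSl2Pair.act_e_f (H : IsHomogeneousCartan 𝔥 p) (D : GradedBy 𝔥 t T h0) (hM : M.Relations)
    (S : IsSl2Pair p α e f h) (v : M.V) :
    M.act e (M.act f v) = M.act f (M.act e v) + M.act ⟨h, D.cartan_le H h.2⟩ v := by
  rw [D.act_act H hM S.e_mem S.f_mem, S.even, sgn_zero_left, one_smul, add_comm]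
  congr 3
  exact Subtype.ext S.br_eq

lemma IsSl2Pair.act_h_f (H : IsHomogeneousCartan 𝔥 p) (D : GradedBy 𝔥 t T h0) (hM : M.Relations)
    (S : IsSl2Pair p α e f h) (v : M.V) :
    M.act ⟨h, D.cartan_le H h.2⟩ (M.act f v) =
      M.act f (M.act ⟨h, D.cartan_le H h.2⟩ v) - (2 : ℂ) • M.act f v := by
  have e1 : ((-(2 : ℂ) • f : t) : L) = br (h : L) (f : L) := by
    rw [S.f_mem h, LinearMap.neg_apply, S.two]; rfl
  have := hM 0 0 ⟨h, D.cartan_le H h.2⟩ f (H.even h.2)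
    (by have := H.homog _ S.f_mem; rwa [S.even_neg] at this) v _ e1
  rw [map_smul, LinearMap.smul_apply, sgn_zero_left, one_smul] at this
  rw [eq_add_of_sub_eq this.symm]
  module

lemma pow_act_mem_weightSpace (H : IsHomogeneousCartan 𝔥 p) (hM : M.Relations)
    {β μ : Module.Dual ℂ 𝔥} {x : t} (hx : (x : L) ∈ rootSpace 𝔥 β) {v : M.V}
    (hv : v ∈ M.weightSpace 𝔥 μ) (n : ℕ) : (M.act x ^ n) v ∈ M.weightSpace 𝔥 (μ + n • β) := by
  induction n with
  | zero => simpa using hv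
  | succ n ih =>
    rw [pow_succ', Module.End.mul_apply, succ_nsmul, ← add_assoc]
    exact act_mem_weightSpace H hM hx ih

lemma mem_supp_of_ne_zero {μ : Module.Dual ℂ 𝔥} {v : M.V} (hv : v ≠ 0)
    (h : v ∈ M.weightSpace 𝔥 μ) : μ ∈ M.supp 𝔥 :=
  (Submodule.ne_bot_iff _).2 ⟨v, h, hv⟩

/-- If `e` and `f` are locally nilpotent, weights are integral, and the support contains the
reflection of each weight which is nonnegative on the coroot. -/
lemma IsSl2Pair.sub_mem_supp_of_nonneg (H : IsHomogeneousCartan 𝔥 p) (D : GradedBy 𝔥 t T h0)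
    (hM : M.Relations) (S : IsSl2Pair p α e f h) (he : ∀ v, ∃ n : ℕ, (M.act e ^ n) v = 0)
    (hf : ∀ v, ∃ n : ℕ, (M.act f ^ n) v = 0) {μ : Module.Dual ℂ 𝔥} (hμ : μ ∈ M.supp 𝔥) :
    ∃ c : ℤ, μ h = c ∧ (0 ≤ c → μ - μ h • α ∈ M.supp 𝔥) := by
  obtain ⟨v, hv, hv0⟩ := (Submodule.ne_bot_iff _).1 hμ
  -- `q` is the number of steps to the top of the `e`-string of `v`, and `r` the length of the
  -- `f`-string from there. The `𝔰𝔩₂` formula at the end of that string forces `μ(h) + 2q = r`, so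
  -- the reflected weight is that of `f^(r-q) e^q v`.
  obtain ⟨q, hq, hq'⟩ := exists_pow_ne_zero hv0 (he v)
  obtain ⟨r, hr, hr'⟩ := exists_pow_ne_zero hq (hf _)
  set v0 := (M.act e ^ q) v
  have hw0 := pow_act_mem_weightSpace H hM S.e_mem hv q
  have hH : M.act ⟨h, D.cartan_le H h.2⟩ v0 = (μ h + 2 * q) • v0 := by
    rw [hw0 ⟨h, D.cartan_le H h.2⟩ h.2]
    congr 1
    have := S.two
    simp [this, mul_comm]
  have hform := sl2_apply_pow (S.act_e_f H D hM) (S.act_h_f H D hM)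
    (by rw [← Module.End.mul_apply, ← pow_succ', hq']) hH r
  rw [hr', map_zero, eq_comm, smul_eq_zero, mul_eq_zero] at hform
  have hc : μ h + 2 * q = r := by
    rcases hform with (h1 | h1) | h1
    · exact absurd h1 (Nat.cast_add_one_ne_zero r)
    · exact sub_eq_zero.1 h1
    · exact absurd h1 hr
  refine ⟨r - 2 * q, by push_cast; rw [← hc]; ring, fun h0 => ?_⟩
  have hj : r - q ≤ r := Nat.sub_le _ _
  have hw := pow_act_mem_weightSpace H hM S.f_mem hw0 (r - q)
  have : μ + q • α + (r - q) • -α = μ - μ h • α := by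
    have hqr : q ≤ r := by omega
    rw [← Nat.cast_smul_eq_nsmul ℂ, ← Nat.cast_smul_eq_nsmul ℂ, Nat.cast_sub hqr, ← hc]
    module
  rw [this] at hw
  exact mem_supp_of_ne_zero (pow_apply_ne_zero hr hj) hw

/-- If `e` and `f` are locally nilpotent, the support is stable under the reflection. -/
theorem IsSl2Pair.sub_mem_supp (H : IsHomogeneousCartan 𝔥 p) (D : GradedBy 𝔥 t T h0)
    (hM : M.Relations) (S : IsSl2Pair p α e f h) (he : ∀ v, ∃ n : ℕ, (M.act e ^ n) v = 0)
    (hf : ∀ v, ∃ n : ℕ, (M.act f ^ n) v = 0) {μ : Module.Dual ℂ 𝔥} (hμ : μ ∈ M.supp 𝔥) :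
    μ - μ h • α ∈ M.supp 𝔥 := by
  obtain ⟨c, hc, h1⟩ := S.sub_mem_supp_of_nonneg H D hM he hf hμ
  obtain ⟨c', hc', h2⟩ := (S.swap H).sub_mem_supp_of_nonneg H D hM hf he hμ
  rcases le_total 0 c with h | h
  · exact h1 h
  · have hcc : (c' : ℂ) = -c := by rw [← hc', map_neg, hc]
    have := h2 (by have : c' = -c := by exact_mod_cast hcc
                   omega)
    rwa [map_neg, neg_smul_neg] at this

/-- A root vector for the negative of a simple root is nilpotent on an extremal vector whose weight
is a natural number on the coroot. -/
theorem IsSl2Pair.pow_act_eq_zero (H : IsHomogeneousCartan 𝔥 p) (D : GradedBy 𝔥 t T h0)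
    (hM : M.Relations) (hirr : M.IsIrreducible) (S : IsSl2Pair p α e f h)
    (hone : ∀ x : t, (x : L) ∈ rootSpace 𝔥 α → ∃ c : ℂ, x = c • e) (hα : α ∈ degPos T h0)
    (hsimple : ∀ β ∈ degPos T h0, β ≠ α →
      β - α ∉ roots 𝔥 ∨ (β - α ∈ degPos T h0 ∧ β - α ≠ α))
    {μ : Module.Dual ℂ 𝔥} {v : M.V} (hv : v ∈ M.weightSpace 𝔥 μ)
    (hkill : ∀ β ∈ degPos T h0, ∀ x : t, (x : L) ∈ rootSpace 𝔥 β → M.act x v = 0) {m : ℕ}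
    (hm : μ h = m) : (M.act f ^ (m + 1)) v = 0 := by
  -- Simplicity of `α`: bracketing a positive root vector for `β ≠ α` with `f` gives zero or a
  -- positive root vector, again for a root different from `α`. So these vectors kill all `f^n v`.
  have h1 : ∀ n : ℕ, ∀ β ∈ degPos T h0, β ≠ α → ∀ y : t, (y : L) ∈ rootSpace 𝔥 β →
      M.act y ((M.act f ^ n) v) = 0 := by
    intro n
    induction n with
    | zero => intro β hβ _ y hy; simpa using hkill β hβ y hy
    | succ n ih =>
      intro β hβ hne y hy
      rw [pow_succ', Module.End.mul_apply, D.act_act H hM hy S.f_mem, ih β hβ hne y hy, map_zero,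
        smul_zero, add_zero]
      have hz := H.br_mem_rootSpace hy S.f_mem
      rw [← sub_eq_add_neg] at hz
      rcases hsimple β hβ hne with h2 | h2
      · have : (⟨_, D.br_mem_t H y f⟩ : t) = 0 := Subtype.ext (eq_zero_of_not_mem_roots h2 hz)
        rw [this]; simp
      · exact ih _ h2.1 h2.2 _ hz
  by_contra hu
  have hv0 : v ≠ 0 := fun h0 => hu (by rw [h0, map_zero])
  have hw := pow_act_mem_weightSpace H hM S.f_mem hv (m + 1)
  obtain ⟨n, hn⟩ := hα.2
  -- `e` kills `f^(m+1) v` through the factor `m - m`. If this vector were nonzero it would be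
  -- extremal of degree below that of `v`, contradicting the bound of `degree_of_mem_supp` applied
  -- to the weight of `v`.
  have hku : ∀ β ∈ degPos T h0, ∀ x : t, (x : L) ∈ rootSpace 𝔥 β →
      M.act x ((M.act f ^ (m + 1)) v) = 0 := by
    intro β hβ x hx
    by_cases hne : β = α
    · subst hne
      obtain ⟨c, rfl⟩ := hone x hx
      rw [map_smul, LinearMap.smul_apply, sl2_apply_pow (S.act_e_f H D hM) (S.act_h_f H D hM)
        (hkill _ hα e S.e_mem) (hv ⟨h, D.cartan_le H h.2⟩ h.2) m]
      rw [show μ ⟨h, h.2⟩ = m from hm]; simp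
    · exact h1 _ β hβ hne x hx
  obtain ⟨n', hn'⟩ := degree_of_mem_supp H D hM hirr hu (a := (μ + (m + 1) • -α) h0)
    (fun x hx => by
      rw [hw x (by rw [hx]; exact h0.2)]
      congr 2
      exact Subtype.ext hx) hku (mem_supp_of_ne_zero hv0 hv)
  rw [LinearMap.add_apply, LinearMap.smul_apply, LinearMap.neg_apply, hn, add_sub_assoc,
    left_eq_add, nsmul_eq_mul] at hn'
  have : ((m + 1) * (n + 1) + n' : ℂ) = 0 := by push_cast at hn'; linear_combination -hn'
  norm_cast at this
  simp at this

end

/-! ### One-dimensional root spaces and explicit `𝔰𝔩₂`-triples. -/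

section

variable {k : ℕ}

/-- The elements of `𝔥` dual to the weights of the basis vectors. -/
def hD : Idx k → cartan k :=
  Sum.elim (Sum.elim (fun i => hElt (Pi.single i 1) 0 0 0) (fun i => hElt (-Pi.single i 1) 0 0 0))
    (Sum.elim (fun _ => hElt 0 1 0 0) (fun _ => hElt 0 (-1) 0 0))

lemma wI_hD (x c : Idx k) :
    wI x (hD c) = (if x = c then 1 else 0) - (if x = flipI c then 1 else 0) := by
  rcases c with (c | c) | (c | c) <;> rcases x with (x | x) | (x | x) <;>
    simp [hD, wI_hElt, flipI, Pi.single_apply] <;> exact Subsingleton.elim _ _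

lemma toAff_hD (u : Idx k) : toAff k (hD u) =
    (Finsupp.single 0 (Matrix.single u u 1 - Matrix.single (flipI u) (flipI u) 1), 0, 0) := by
  have key : ∀ (a : Fin k → ℂ) (b : ℂ), (∀ x, Sum.elim (Sum.elim a (-a))
      (Sum.elim (fun _ => b) (fun _ => -b)) x =
        (if u = x then (1 : ℂ) else 0) - (if flipI u = x then 1 else 0)) →
      diagMat a b = Matrix.single u u 1 - Matrix.single (flipI u) (flipI u) 1 := by
    intro a b h
    ext x y
    rw [diagMat, Matrix.sub_apply, Matrix.single_apply, Matrix.single_apply, Matrix.diagonal_apply]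
    by_cases hxy : x = y
    · subst hxy; simp [h]
    · rw [if_neg hxy, if_neg (fun h => hxy (h.1.symm.trans h.2)),
        if_neg (fun h => hxy (h.1.symm.trans h.2)), sub_zero]
  rcases u with (i | i) | (i | i)
  all_goals
    rw [hD]
    simp only [Sum.elim_inl, Sum.elim_inr]
    rw [toAff_hElt, key]
    rintro ((x | x) | (x | x)) <;>
      simp [flipI, Pi.single_apply, eq_comm] <;> exact Subsingleton.elim _ _

lemma flipI_flipI (u : Idx k) : flipI (flipI u) = u := by
  rcases u with (i | i) | (i | i) <;> rfl

lemma flipI_ne (u : Idx k) : flipI u ≠ u := by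
  rcases u with (i | i) | (i | i) <;> simp [flipI]

lemma wI_injective {u v : Idx k} (h : wI u = wI v) : u = v := by
  have := congrArg (fun α : Wt k => α (hD u)) h
  simp only [wI_hD] at this
  by_contra hne
  rw [if_pos trivial, if_neg (flipI_ne u).symm, if_neg (Ne.symm hne)] at this
  split_ifs at this <;> norm_num at this

/-- A difference of two weights of basis vectors determines them up to `σ`. -/
lemma eq_or_flip_of_wI_sub {u v a b : Idx k} {p q : ℤ} (huv : u ≠ v)
    (h : (wI u - wI v + p • im : Wt k) = wI a - wI b + q • im) :
    q = p ∧ ((a = u ∧ b = v) ∨ (a = flipI v ∧ b = flipI u)) := by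
  have hpq : q = p := by
    have := congrArg (fun α : Wt k => α dElt) h
    simp only [dElt, LinearMap.add_apply, LinearMap.sub_apply, wI_hElt, LinearMap.smul_apply,
      im_hElt, zsmul_eq_mul, mul_one] at this
    have h0 : ∀ x : Idx k, Sum.elim (Sum.elim (0 : Fin k → ℂ) (-0))
        (Sum.elim (fun _ => (0 : ℂ)) (fun _ => -0)) x = 0 := by
      rintro ((x | x) | (x | x)) <;> simp
    simp only [h0, sub_self, zero_add] at this
    exact_mod_cast this.symm
  subst hpq
  refine ⟨rfl, ?_⟩
  have h := add_right_cancel h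
  have hD := congrArg (fun α : Wt k => α (hD u)) h
  simp only [LinearMap.sub_apply, wI_hD] at hD
  by_cases hau : a = u
  · subst hau
    exact Or.inl ⟨rfl, (wI_injective (sub_right_injective h)).symm⟩
  by_cases hbu : b = flipI u
  · refine Or.inr ⟨wI_injective ?_, hbu⟩
    rw [hbu, wI_flipI, sub_neg_eq_add] at h
    rw [wI_flipI]
    linear_combination (norm := abel) -h
  · rw [if_pos trivial, if_neg (flipI_ne u).symm, if_neg (Ne.symm huv), if_neg hau, if_neg hbu] at hD
    split_ifs at hD <;> norm_num at hD

/-- The weight occurs only at the position `(u, v)` and at its image under `σ`, and the second entry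
is determined by the first. The `c`- and `d`-coordinates vanish because the root is not zero. -/
lemma eq_zero_of_entry_eq_zero {u v : Idx k} {p : ℤ} (huv : u ≠ v) {x : TwAff k}
    (hx : x ∈ rootSpace (cartan k) (wI u - wI v + p • im)) (h0 : (toAff k x).1 p u v = 0) :
    x = 0 := by
  obtain ⟨h1, h2⟩ := mem_rootSpace_iff.1 hx
  refine toAff_injective (Prod.ext (Finsupp.ext fun q => Matrix.ext fun a b => ?_) ?_)
  · by_contra hne
    obtain ⟨rfl, ⟨rfl, rfl⟩ | ⟨rfl, rfl⟩⟩ := eq_or_flip_of_wI_sub huv (h1 q a b hne)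
    · exact hne h0
    · have hs := congrFun (congrFun (mem_twPiece.1 (toAff_mem x q)).2 (flipI v)) (flipI u)
      obtain ⟨c, hc⟩ := sig_entry (k := k) (flipI v) (flipI u)
      rw [hc, flipI_flipI, flipI_flipI, h0, mul_zero, Matrix.smul_apply, smul_eq_mul, eq_comm,
        mul_eq_zero] at hs
      exact hne (hs.resolve_left (zpow_ne_zero _ (by norm_num)))
  · by_contra hne
    have := h2 hne
    obtain ⟨-, ⟨h, h'⟩ | ⟨h, h'⟩⟩ := eq_or_flip_of_wI_sub (a := u) (b := u) (q := 0) huv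
      (by rw [this]; simp)
    · exact huv h'
    · exact flipI_ne u h'.symm

/-- Root spaces of the roots `wI u - wI v + p δ`, `u ≠ v`, are one-dimensional. -/
lemma exists_eq_smul {u v : Idx k} {p : ℤ} (huv : u ≠ v) {e : (⊤ : Submodule ℂ (TwAff k))}
    (he : (e : TwAff k) ∈ rootSpace (cartan k) (wI u - wI v + p • im))
    (he0 : (toAff k e).1 p u v ≠ 0) (x : (⊤ : Submodule ℂ (TwAff k)))
    (hx : (x : TwAff k) ∈ rootSpace (cartan k) (wI u - wI v + p • im)) : ∃ c : ℂ, x = c • e := by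
  refine ⟨(toAff k x).1 p u v / (toAff k e).1 p u v, sub_eq_zero.1 (Subtype.ext ?_)⟩
  refine eq_zero_of_entry_eq_zero huv (sub_mem hx (Submodule.smul_mem _ _ he)) ?_
  change (toAff k x).1 p u v - _ * (toAff k e).1 p u v = 0
  rw [div_mul_cancel₀ _ he0, sub_self]

lemma sig_single (u v : Fin k ⊕ Fin k) :
    sig (Matrix.single (Sum.inl u) (Sum.inl v) (1 : ℂ) : Mat k) =
      -Matrix.single (Sum.inl v.swap) (Sum.inl u.swap) 1 := by
  ext a b
  rcases a with a | a <;> rcases b with b | b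
  · rw [sig_even, Matrix.neg_apply, Matrix.single_apply, Matrix.single_apply]
    congr 1
    refine if_congr ?_ rfl rfl
    simp only [Sum.inl.injEq]
    constructor
    · rintro ⟨rfl, rfl⟩; simp
    · rintro ⟨rfl, rfl⟩; simp
  all_goals
    obtain ⟨c, hc⟩ := sig_entry (k := k) _ _
    rw [hc]
    simp [flipI]

lemma wtPar_eq_zero {α : Wt k} (h : α hPar = 0) : wtPar α = 0 := by
  simpa using wtPar_eq (m := 0) (by simpa using h)

lemma oddPart_single (u v : Fin k ⊕ Fin k) :
    oddPart (Matrix.single (Sum.inl u) (Sum.inl v) (1 : ℂ) : Mat k) = 0 := by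
  ext a b
  rcases a with a | a <;> rcases b with b | b <;>
    simp [oddPart_inl_inl, oddPart_inl_inr, oddPart_inr_inl, oddPart_inr_inr]

lemma br_single_single {p q : ℤ} {x y : Mat k} (hx : x ∈ twPiece p) (hy : y ∈ twPiece q)
    (ho : oddPart x = 0) : toAff k (br (single p x hx) (single q y hy)) =
      (Finsupp.single (p + q) (x * y - y * x), if p + q = 0 then (p : ℂ) * kap x y else 0, 0) := by
  rw [toAff_br, toAff_single, toAff_single, affBr_apply]
  simp only [loopBr_single, loopDeg_single, zero_smul, add_zero, sub_zero, map_smul,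
    LinearMap.smul_apply, loopForm_single, matBr_apply, ho, mul_zero, smul_zero,
    smul_eq_mul, mul_ite]

/-- The element `E_{uv} - (-1)^p E_{v̄ū}`. -/
lemma single_sub_mem (p : ℤ) {u v : Fin k ⊕ Fin k} (huv : u ≠ v) :
    (Matrix.single (Sum.inl u) (Sum.inl v) 1 -
      (-1 : ℂ) ^ p • Matrix.single (Sum.inl v.swap) (Sum.inl u.swap) 1 : Mat k) ∈ twPiece p := by
  have hne : v.swap ≠ u.swap := fun h => huv (by
    have := congrArg Sum.swap h; rwa [Sum.swap_swap, Sum.swap_swap, eq_comm] at this)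
  refine mem_twPiece.2 ⟨str_eq_zero_of_offDiag fun a => ?_, ?_⟩
  · rw [Matrix.sub_apply, Matrix.smul_apply, Matrix.single_apply, Matrix.single_apply, if_neg,
      if_neg]
    · simp
    · exact fun h => hne (Sum.inl_injective (h.1.trans h.2.symm))
    · exact fun h => huv (Sum.inl_injective (h.1.trans h.2.symm))
  · rw [map_sub, map_smul, sig_single, sig_single, Sum.swap_swap, Sum.swap_swap, smul_sub,
      smul_smul, neg_one_zpow_sq, one_smul, smul_neg]
    abel

lemma single_sub_weight (c : ℂ) {u v : Fin k ⊕ Fin k} (a b : Idx k)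
    (h : (Matrix.single (Sum.inl u) (Sum.inl v) 1 -
      c • Matrix.single (Sum.inl v.swap) (Sum.inl u.swap) 1 : Mat k) a b ≠ 0) :
    wI a - wI b = (wI (Sum.inl u) - wI (Sum.inl v) : Wt k) := by
  by_cases h1 : (Matrix.single (Sum.inl u) (Sum.inl v) (1 : ℂ) : Mat k) a b = 0
  · rw [Matrix.sub_apply, h1, zero_sub, Matrix.smul_apply, neg_ne_zero] at h
    rw [single_weight _ _ a b (right_ne_zero_of_mul h)]
    have h1 := wI_flipI (k := k) (Sum.inl v)
    have h2 := wI_flipI (k := k) (Sum.inl u)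
    change wI (Sum.inl v.swap) = _ at h1
    change wI (Sum.inl u.swap) = _ at h2
    rw [h1, h2]; abel
  · exact single_weight _ _ a b h1

lemma wI_sub_hPar (u v : Fin k ⊕ Fin k) (p : ℤ) :
    (wI (Sum.inl u) - wI (Sum.inl v) + p • im : Wt k) hPar = 0 := by
  rw [LinearMap.add_apply, LinearMap.sub_apply, wI_hPar_inl, wI_hPar_inl]; simp [hPar]

/-- The `𝔰𝔩₂` of a root `±εᵢ ± εⱼ`. -/
theorem exists_sl2_finite {u v : Fin k ⊕ Fin k} (huv : u ≠ v) (huv' : u ≠ v.swap) :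
    ∃ e f : (⊤ : Submodule ℂ (TwAff k)),
      IsSl2Pair wtPar (wI (Sum.inl u) - wI (Sum.inl v)) e f (hD (Sum.inl u) - hD (Sum.inl v)) ∧
      ∀ x : (⊤ : Submodule ℂ (TwAff k)),
        (x : TwAff k) ∈ rootSpace (cartan k) (wI (Sum.inl u) - wI (Sum.inl v)) →
          ∃ c : ℂ, x = c • e := by
  have e0 : ∀ a b : Fin k ⊕ Fin k, (wI (Sum.inl a) - wI (Sum.inl b) : Wt k) =
      wI (Sum.inl a) - wI (Sum.inl b) + (0 : ℤ) • im := fun a b => by simp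
  have hsw : u.swap ≠ v := fun h => huv' (by rw [← h, Sum.swap_swap])
  have he := single_mem_rootSpace (single_sub_mem 0 huv) (single_sub_weight _)
  have hf := single_mem_rootSpace (single_sub_mem 0 huv.symm) (single_sub_weight _)
  rw [← e0] at he hf
  refine ⟨⟨single _ _ (single_sub_mem 0 huv), trivial⟩, ⟨single _ _ (single_sub_mem 0 huv.symm), trivial⟩,
    ⟨?_, ?_, he, ?_, ?_, ?_⟩, ?_⟩
  · exact wtPar_eq_zero (by rw [e0, wI_sub_hPar])
  · exact wtPar_eq_zero (by rw [neg_sub, e0, wI_sub_hPar])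
  · rw [neg_sub]; exact hf
  · refine toAff_injective ?_
    rw [br_single_single _ _ (by simp only [map_sub, map_smul, oddPart_single]; simp),
      show toAff k (hD (Sum.inl u) - hD (Sum.inl v) : cartan k) =
        toAff k (hD (Sum.inl u)) - toAff k (hD (Sum.inl v)) from map_sub (toAff k) _ _,
      toAff_hD, toAff_hD]
    have hi : ∀ {a b : Fin k ⊕ Fin k}, a ≠ b → (Sum.inl a : Idx k) ≠ Sum.inl b :=
      fun h h' => h (Sum.inl_injective h')
    have hm : ∀ {a b c d : Idx k}, b ≠ c →
        Matrix.single a b (1 : ℂ) * Matrix.single c d 1 = 0 :=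
      fun h => Matrix.single_mul_single_of_ne _ _ _ _ h _
    refine Prod.ext ?_ (by simp)
    simp only [zpow_zero, one_smul, add_zero, sub_mul, mul_sub, Matrix.single_mul_single_same,
      mul_one, hm (hi hsw.symm),
      hm (hi hsw),
      hm (hi huv'),
      hm (hi huv'.symm), sub_zero, zero_sub, flipI, Sum.map_inl,
      Prod.fst_sub, ← Finsupp.single_sub]
    congr 1
    abel
  · have hne : ∀ a : Fin k ⊕ Fin k, a ≠ a.swap := by
      rintro (a | a) <;> simp
    simp [wI_hD, flipI, huv, huv.symm, huv', hsw.symm, hne]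
    norm_num
  · rw [e0] at he ⊢
    refine exists_eq_smul (fun h => huv (Sum.inl_injective h)) he ?_
    change (Finsupp.single (0 : ℤ) _ : ℤ →₀ Mat k) 0 _ _ ≠ 0
    rw [Finsupp.single_eq_same, Matrix.sub_apply, Matrix.smul_apply, Matrix.single_apply,
      Matrix.single_apply, if_pos ⟨rfl, rfl⟩, if_neg fun h => huv' (Sum.inl_injective h.1).symm]
    simp

/-- The `𝔰𝔩₂` of the root `δ - 2εᵢ`. -/
theorem exists_sl2_affine (i : Fin k) : ∃ e f : (⊤ : Submodule ℂ (TwAff k)),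
      IsSl2Pair wtPar (im - (2 : ℤ) • ep i) e f (hElt (-Pi.single i 1) 0 (1 / 2) 0) ∧
      ∀ x : (⊤ : Submodule ℂ (TwAff k)),
        (x : TwAff k) ∈ rootSpace (cartan k) (im - (2 : ℤ) • ep i) → ∃ c : ℂ, x = c • e := by
  set u : Idx k := Sum.inl (Sum.inr i) with hu
  set v : Idx k := Sum.inl (Sum.inl i) with hv
  have huv : u ≠ v := by simp [hu, hv]
  have hmem : ∀ {a b : Fin k ⊕ Fin k}, a ≠ b → b = a.swap → ∀ p : ℤ, Odd p →
      Matrix.single (Sum.inl a) (Sum.inl b) (1 : ℂ) ∈ twPiece (k := k) p := by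
    rintro a b hab rfl p hp
    have := Submodule.smul_mem _ (1 / 2 : ℂ) (single_sub_mem (k := k) p hab)
    rw [hp.neg_one_zpow, Sum.swap_swap] at this
    convert this using 1
    module
  have e1 : (im - (2 : ℤ) • ep i : Wt k) = wI u - wI v + (1 : ℤ) • im := by
    rw [hu, hv, wI_inl_inr, wI_inl_inl]; module
  have e2 : (-(im - (2 : ℤ) • ep i) : Wt k) = wI v - wI u + (-1 : ℤ) • im := by
    rw [hu, hv, wI_inl_inr, wI_inl_inl]; module
  have m1 : Matrix.single u v (1 : ℂ) ∈ twPiece (k := k) 1 := hmem (by simp) rfl 1 odd_one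
  have m2 : Matrix.single v u (1 : ℂ) ∈ twPiece (k := k) (-1) := hmem (by simp) rfl _ odd_one.neg
  have he := single_mem_rootSpace m1 (single_weight u v)
  have hf := single_mem_rootSpace m2 (single_weight v u)
  rw [e1]
  refine ⟨⟨single _ _ m1, trivial⟩, ⟨single _ _ m2, trivial⟩, ⟨?_, ?_, he, ?_, ?_, ?_⟩, ?_⟩
  · exact wtPar_eq_zero (wI_sub_hPar _ _ _)
  · rw [← e1, e2]; exact wtPar_eq_zero (wI_sub_hPar _ _ _)
  · rw [← e1, e2]; exact hf
  · refine toAff_injective ?_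
    have h2 : hElt (-Pi.single i 1) 0 (1 / 2) 0 = hD u + hElt 0 0 (1 / 2) 0 := by
      have := hLin.map_add (-Pi.single i 1, 0, 0, 0) ((0, 0, 1 / 2, 0) : (Fin k → ℂ) × ℂ × ℂ × ℂ)
      simpa [hLin, hD, hu] using this
    rw [br_single_single m1 m2 (oddPart_single _ _), h2, Submodule.coe_add, map_add, toAff_hD,
      toAff_hElt]
    have hd0 : (diagMat 0 0 : Mat k) = 0 := by
      ext a b; rcases a with (a | a) | (a | a) <;> simp [diagMat, Matrix.diagonal_apply]
    -- The cocycle `p κ(x, y)` with `p = 1` contributes `c/2`; this is the central term of the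
    -- coroot of `δ - 2εᵢ`.
    have hk : kap (Matrix.single u v 1) (Matrix.single v u (1 : ℂ) : Mat k) = 1 / 2 := by
      rw [kap_apply, Matrix.single_mul_single_same]
      simp [str, Matrix.trace, Matrix.toBlocks₁₁, Matrix.toBlocks₂₂, hu, Matrix.single_apply]
    refine Prod.ext ?_ (by simp [hk])
    simp only [Matrix.single_mul_single_same, hd0, Finsupp.single_zero, Prod.fst_add, add_zero]
    simp [hu, hv, flipI]
  · rw [← e1]; simp
  · refine exists_eq_smul huv he ?_
    change (Finsupp.single (1 : ℤ) _ : ℤ →₀ Mat k) 1 _ _ ≠ 0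
    rw [Finsupp.single_eq_same, Matrix.single_apply, if_pos ⟨rfl, rfl⟩]
    exact one_ne_zero

end

/-! ### Degrees whose only root zeros are `0, ±2δ₁`, and simple roots. -/

section

variable {k : ℕ}

/-- The coordinates of `hPhi s`. -/
def phiC (s : ℤˣ) (i : Fin k) : ℤ := if (i : ℕ) + 1 = k then s else (k : ℤ) - (i : ℕ)

/-- An element of `𝔥` on which only the roots `0, ±2δ₁` vanish. -/
def hPhi (s : ℤˣ) : cartan k := hElt (fun i => (phiC s i : ℂ)) 0 0 ((2 * k + 1 : ℤ) : ℂ)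

lemma phiC_le (s : ℤˣ) (i : Fin k) : phiC s i ≤ k ∧ -(k : ℤ) ≤ phiC s i ∧ phiC s i ≠ 0 := by
  have hi := i.2
  rw [phiC]
  split_ifs with h
  · rcases Int.units_eq_one_or s with rfl | rfl <;> simp <;> omega
  · omega

/-- The coordinates are `k, k-1, …, 2, s`, with strictly decreasing absolute values. So no `±εᵢ ±
εⱼ` has degree zero and the earlier index decides the sign, for both choices of `s`. -/
lemma phiC_lt (s : ℤˣ) {i j : Fin k} (hij : i < j) :
    phiC s j < phiC s i ∧ -phiC s j < phiC s i := by
  have hi := i.2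
  have hj := j.2
  have hij' : (i : ℕ) < j := hij
  rw [phiC, phiC]
  split_ifs with h h'
  · omega
  · rcases Int.units_eq_one_or s with rfl | rfl <;> simp <;> omega
  · omega
  · omega

lemma roots_int_hPhi (hk : 2 ≤ k) (s : ℤˣ) : ∀ α ∈ roots (cartan k), ∃ m : ℤ, α (hPhi s) = m :=
  roots_int hk (fun _ => ⟨_, rfl⟩) ⟨0, by simp⟩ ⟨_, rfl⟩

lemma gradedBy_hPhi (hk : 2 ≤ k) (s : ℤˣ) :
    GradedBy (cartan k) ⊤ (roots (cartan k)) (hPhi s) where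
  eq_rootSum := rootSum_roots
  zero_mem := zero_mem_roots hk
  closed _ _ _ _ h := h
  int := roots_int_hPhi hk s

/-- The weight `2k + 1` given to `δ` exceeds the bound `2k` for the `εᵢ`-part, so a nonzero
coefficient at `δ` decides the sign of the degree. -/
lemma root_phi (hk : 2 ≤ k) (s : ℤˣ) {β : Wt k} (hβ : β ∈ roots (cartan k)) :
    ∃ n x : ℤ, β dElt = n ∧ β (hPhi s) = ((x + n * (2 * k + 1) : ℤ) : ℂ) ∧
      x ≤ 2 * k ∧ -(2 * (k : ℤ)) ≤ x := by
  rw [roots_eq hk] at hβ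
  rcases hβ with (((⟨n, rfl⟩ | ⟨i, j, hij, t, t', n, rfl⟩) | ⟨i, t, n, rfl⟩) | ⟨t, n, rfl⟩) |
    ⟨i, t, t', n, rfl⟩
  · exact ⟨n, 0, by simp [dElt], by simp [hPhi]; ring, by omega, by omega⟩
  · refine ⟨n, t * phiC s i + t' * phiC s j, by simp [dElt], by simp [hPhi]; ring, ?_, ?_⟩ <;>
    · have h1 := phiC_le s i
      have h2 := phiC_le s j
      rcases Int.units_eq_one_or t with rfl | rfl <;> rcases Int.units_eq_one_or t' with rfl | rfl <;>
        simp <;> omega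
  · refine ⟨2 * n + 1, 2 * t * phiC s i, by simp [dElt], by simp [hPhi]; ring, ?_, ?_⟩ <;>
    · have h1 := phiC_le s i
      rcases Int.units_eq_one_or t with rfl | rfl <;> simp <;> omega
  · exact ⟨2 * n, 0, by simp [dElt], by simp [hPhi]; ring, by omega, by omega⟩
  · refine ⟨n, t * phiC s i, by simp [dElt], by simp [hPhi]; ring, ?_, ?_⟩ <;>
    · have h1 := phiC_le s i
      rcases Int.units_eq_one_or t with rfl | rfl <;> simp <;> omega

/-- The roots killed by `hPhi s`. -/
lemma root_phi_zero (hk : 2 ≤ k) (s : ℤˣ) {β : Wt k} (hβ : β ∈ roots (cartan k))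
    (h0 : β (hPhi s) = 0) : β = 0 ∨ ∃ t : ℤˣ, β = (2 * t : ℤ) • dl := by
  obtain ⟨n, x, hn, hx, h1, h2⟩ := root_phi hk s hβ
  rw [hx] at h0
  have h0' : x + n * (2 * k + 1) = 0 := by exact_mod_cast h0
  have hn0 : n = 0 := by
    rcases lt_trichotomy n 0 with h | h | h
    · nlinarith
    · exact h
    · nlinarith
  have hβ' : β ∈ P3 k ∩ -P3 k := by
    rw [(isParabolic_P3 hk).2.1]
    exact ⟨hβ, by rw [hn, hn0, Int.cast_zero]⟩
  have h0 : β (hPhi s) = 0 := by rw [hx, h0', Int.cast_zero]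
  rcases (mem_P3_inter hk β).1 hβ' with ((h | ⟨i, j, hij, t, t', rfl⟩) | h) | ⟨i, t, t', rfl⟩
  · exact Or.inl h
  · exfalso
    have e : (t : ℤ) * phiC s i + t' * phiC s j = 0 := by
      simp only [hPhi, LinearMap.add_apply, LinearMap.smul_apply, ep_hElt, zsmul_eq_mul] at h0
      exact_mod_cast h0
    have := phiC_lt s hij
    rcases Int.units_eq_one_or t with rfl | rfl <;> rcases Int.units_eq_one_or t' with rfl | rfl <;>
      simp at e <;> omega
  · exact Or.inr h
  · exfalso
    have e : (t : ℤ) * phiC s i = 0 := by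
      simp only [hPhi, LinearMap.add_apply, LinearMap.smul_apply, ep_hElt, dl_hElt, smul_zero,
        add_zero, zsmul_eq_mul] at h0
      exact_mod_cast h0
    have := phiC_le s i
    rcases Int.units_eq_one_or t with rfl | rfl <;> simp at e <;> omega

/-- The roots positive on `hPhi s`. -/
lemma root_phi_pos (hk : 2 ≤ k) (s : ℤˣ) {β : Wt k} (hβ : β ∈ degPos (roots (cartan k)) (hPhi s)) :
    β ∈ degPos (roots (cartan k)) dElt ∪ degPos (P3 k ∩ -P3 k) hTwo ∨
      ∃ (i : Fin k) (t : ℤˣ), (i : ℕ) + 1 = k ∧ β = (s : ℤ) • ep i + (t : ℤ) • dl := by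
  obtain ⟨hβ, m, hm⟩ := hβ
  obtain ⟨n, x, hn, hx, h1, h2⟩ := root_phi hk s hβ
  have e : x + n * (2 * k + 1) = m + 1 := by rw [hx] at hm; exact_mod_cast hm
  rcases lt_trichotomy n 0 with h | h | h
  · nlinarith
  · have hβ' : β ∈ P3 k ∩ -P3 k := by
      rw [(isParabolic_P3 hk).2.1]
      exact ⟨hβ, by rw [hn, h, Int.cast_zero]⟩
    rcases (mem_P3_inter hk β).1 hβ' with ((rfl | ⟨i, j, hij, t, t', rfl⟩) | ⟨t, rfl⟩) |
      ⟨i, t, t', rfl⟩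
    · exfalso
      simp only [LinearMap.zero_apply] at hm
      norm_cast at hm
    · have e : (t : ℤ) * phiC s i + t' * phiC s j = m + 1 := by
        simp only [hPhi, LinearMap.add_apply, LinearMap.smul_apply, ep_hElt, zsmul_eq_mul] at hm
        exact_mod_cast hm
      have := phiC_lt s hij
      have hij' : (i : ℕ) < j := hij
      have hj := j.2
      refine Or.inl (Or.inr ⟨hβ', ?_⟩)
      rcases Int.units_eq_one_or t with rfl | rfl
      · obtain ⟨q, hq⟩ : ∃ q : ℕ, ((k : ℤ) - 1 - (i : ℕ)) + (t' : ℤ) * ((k : ℤ) - 1 - (j : ℕ)) = q + 1 := by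
          refine ⟨(((k : ℤ) - 1 - (i : ℕ)) + (t' : ℤ) * ((k : ℤ) - 1 - (j : ℕ)) - 1).toNat, ?_⟩
          rcases Int.units_eq_one_or t' with rfl | rfl <;> simp <;> omega
        refine ⟨q, ?_⟩
        simp only [hTwo, LinearMap.add_apply, LinearMap.smul_apply, ep_hElt, zsmul_eq_mul,
          Units.val_one, Int.cast_one, one_mul]
        exact_mod_cast hq
      · exfalso
        rcases Int.units_eq_one_or t' with rfl | rfl <;> simp at e <;> omega
    · exfalso
      simp only [hPhi, LinearMap.smul_apply, dl_hElt, smul_zero] at hm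
      norm_cast at hm
    · have e : (t : ℤ) * phiC s i = m + 1 := by
        simp only [hPhi, LinearMap.add_apply, LinearMap.smul_apply, ep_hElt, dl_hElt, smul_zero,
          add_zero, zsmul_eq_mul] at hm
        exact_mod_cast hm
      have hi := i.2
      -- Only the last coordinate depends on `s`. Replacing `s = 1` by `s = -1` exchanges `εₖ ± δ₁`
      -- for `-εₖ ± δ₁` among the positive roots: two odd reflections.
      by_cases hl : (i : ℕ) + 1 = k
      · refine Or.inr ⟨i, t', hl, ?_⟩
        rw [phiC, if_pos hl] at e
        have : t = s := by
          rcases Int.units_eq_one_or t with rfl | rfl <;>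
            rcases Int.units_eq_one_or s with rfl | rfl <;> simp at e ⊢ <;> omega
        rw [this]
      · rw [phiC, if_neg hl] at e
        refine Or.inl (Or.inr ⟨hβ', k - 2 - i, ?_⟩)
        rcases Int.units_eq_one_or t with rfl | rfl
        · simp only [hTwo, LinearMap.add_apply, LinearMap.smul_apply, ep_hElt, dl_hElt, smul_zero,
            add_zero, Units.val_one, one_smul]
          rw [Nat.cast_sub (by omega), Nat.cast_sub (by omega)]
          push_cast; ring
        · exfalso
          simp at e; omega
  · refine Or.inl (Or.inl ⟨hβ, (n - 1).toNat, ?_⟩)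
    obtain ⟨q, rfl⟩ : ∃ q : ℕ, n = q + 1 := ⟨(n - 1).toNat, by omega⟩
    rw [hn]; simp

/-- The element of `𝔥` giving the coordinate at `εᵢ`. -/
def hC (i : Fin k) : cartan k := hElt (Pi.single i 1) 0 0 0

@[simp] lemma ep_hC (i j : Fin k) : ep i (hC j) = if i = j then 1 else 0 := by
  simp [hC, Pi.single_apply]

@[simp] lemma dl_hC (j : Fin k) : dl (hC j) = 0 := by simp [hC]

@[simp] lemma im_hC (j : Fin k) : im (hC j) = 0 := by simp [hC]

lemma root_coord (hk : 2 ≤ k) {β : Wt k} (hβ : β ∈ roots (cartan k)) (i : Fin k) :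
    ∃ m : ℤ, β (hC i) = m ∧ m ∈ Set.Icc (-2) 2 := by
  rw [roots_eq hk] at hβ
  rcases hβ with (((⟨n, rfl⟩ | ⟨a, b, hij, t, t', n, rfl⟩) | ⟨a, t, n, rfl⟩) | ⟨t, n, rfl⟩) |
    ⟨a, t, t', n, rfl⟩
  · exact ⟨0, by simp, by simp⟩
  · refine ⟨t * (if a = i then 1 else 0) + t' * (if b = i then 1 else 0), by simp, ?_⟩
    rcases Int.units_eq_one_or t with rfl | rfl <;> rcases Int.units_eq_one_or t' with rfl | rfl <;>
      split_ifs <;> simp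
  · refine ⟨2 * t * (if a = i then 1 else 0), by simp, ?_⟩
    rcases Int.units_eq_one_or t with rfl | rfl <;> split_ifs <;> simp
  · exact ⟨0, by simp, by simp⟩
  · refine ⟨t * (if a = i then 1 else 0), by simp, ?_⟩
    rcases Int.units_eq_one_or t with rfl | rfl <;> split_ifs <;> simp

/-- Roots with `δ₁`-coefficient `±2` have no `εᵢ`-part. Consequently adding `±2δ₁` to a root with an
`εᵢ`-part and no `δ₁`-part never gives a root. -/
lemma root_coord_of_par (hk : 2 ≤ k) {β : Wt k} (hβ : β ∈ roots (cartan k)) {s : ℤˣ}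
    (h : β hPar = 2 * (s : ℤ)) (i : Fin k) : β (hC i) = 0 := by
  rw [roots_eq hk] at hβ
  rcases hβ with (((⟨n, rfl⟩ | ⟨a, b, hij, t, t', n, rfl⟩) | ⟨a, t, n, rfl⟩) | ⟨t, n, rfl⟩) |
    ⟨a, t, t', n, rfl⟩
  · simp
  · rcases Int.units_eq_one_or s with rfl | rfl <;> simp [hPar] at h
  · rcases Int.units_eq_one_or s with rfl | rfl <;> simp [hPar] at h
  · simp
  · exfalso
    have : (t' : ℤ) = 2 * s := by
      simp [hPar] at h; exact_mod_cast h
    rcases Int.units_eq_one_or s with rfl | rfl <;>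
      rcases Int.units_eq_one_or t' with rfl | rfl <;> simp at this

/-- The `εᵢ`-coordinate of a root is an integer between `-2` and `2`, whereas along the string it
takes infinitely many values. -/
lemma root_string_finite (hk : 2 ≤ k) {α : Wt k} {i : Fin k} (hα : α (hC i) ≠ 0) (β : Wt k) :
    ∃ m : ℕ, β + m • α ∉ roots (cartan k) := by
  by_contra hcon
  push Not at hcon
  choose m hm using fun n => root_coord hk (hcon n) i
  have hinj : Function.Injective m := fun n n' h => by
    have h1 := (hm n).1
    rw [h, ← (hm n').1] at h1
    simp only [LinearMap.add_apply, LinearMap.smul_apply, nsmul_eq_mul, add_right_inj] at h1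
    exact_mod_cast mul_right_cancel₀ hα h1
  exact Set.infinite_range_of_injective hinj ((Set.finite_Icc (-2) (2 : ℤ)).subset
    (Set.range_subset_iff.2 fun n => (hm n).2))

/-- For use in `simple_of_degree_one`, where the possibility `β - α = α` has to be excluded. -/
lemma two_nsmul_ep_not_mem (hk : 2 ≤ k) {i j : Fin k} (hij : i ≠ j) (s : ℤˣ) :
    (2 : ℕ) • (ep i + (s : ℤ) • ep j : Wt k) ∉ roots (cartan k) := by
  rw [roots_eq hk]
  intro h
  have hi : ((2 : ℕ) • (ep i + (s : ℤ) • ep j : Wt k)) (hC i) = (2 : ℤ) := by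
    simp [Ne.symm hij]
  have hj : ((2 : ℕ) • (ep i + (s : ℤ) • ep j : Wt k)) (hC j) = (2 * s : ℤ) := by
    simp [hij]
  generalize (2 : ℕ) • (ep i + (s : ℤ) • ep j : Wt k) = β at h hi hj
  rcases h with (((⟨n, rfl⟩ | ⟨a, b, hab, t, t', n, rfl⟩) | ⟨a, t, n, rfl⟩) | ⟨t, n, rfl⟩) |
    ⟨a, t, t', n, rfl⟩
  · simp at hi
  · have : (t : ℤ) * (if a = i then 1 else 0) + t' * (if b = i then 1 else 0) = 2 := by
      simp only [LinearMap.add_apply, LinearMap.smul_apply, ep_hC, im_hC, zsmul_eq_mul, mul_zero,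
        add_zero] at hi
      exact_mod_cast hi
    have hne : ¬(a = i ∧ b = i) := fun h => hab (h.1.trans h.2.symm)
    rcases Int.units_eq_one_or t with rfl | rfl <;> rcases Int.units_eq_one_or t' with rfl | rfl <;>
      split_ifs at this <;> simp_all
  · have hai : a = i := by
      by_contra hne
      simp [hne] at hi
    have haj : a = j := by
      by_contra hne
      simp [hne] at hj
    exact hij (hai.symm.trans haj)
  · simp at hi
  · have : (t : ℤ) * (if a = i then 1 else 0) = 2 := by
      simp only [LinearMap.add_apply, LinearMap.smul_apply, ep_hC, im_hC, dl_hC, zsmul_eq_mul,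
        mul_zero, add_zero] at hi
      exact_mod_cast hi
    rcases Int.units_eq_one_or t with rfl | rfl <;> split_ifs at this <;> simp at this

lemma two_nsmul_im_not_mem (hk : 2 ≤ k) (i : Fin k) :
    (2 : ℕ) • (im - (2 : ℤ) • ep i : Wt k) ∉ roots (cartan k) := by
  intro h
  obtain ⟨m, hm, hm'⟩ := root_coord hk h i
  have : (m : ℂ) = (-4 : ℤ) := by rw [← hm]; simp; norm_num
  rw [Int.cast_injective this] at hm'
  simp at hm'

/-- A root of degree one which is not connected to `2δ₁` is simple. -/
lemma simple_of_degree_one (hk : 2 ≤ k) {s : ℤˣ} {α : Wt k} (h1 : α (hPhi s) = 1)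
    (h2 : (2 : ℕ) • α ∉ roots (cartan k)) {i : Fin k} (hi : α (hC i) ≠ 0) (hp : α hPar = 0) :
    ∀ β ∈ degPos (roots (cartan k)) (hPhi s), β ≠ α →
      β - α ∉ roots (cartan k) ∨ (β - α ∈ degPos (roots (cartan k)) (hPhi s) ∧ β - α ≠ α) := by
  rintro β ⟨hβ, n, hn⟩ hne
  refine or_iff_not_imp_left.2 fun hr => ?_
  rw [not_not] at hr
  have hr1 : (β - α) (hPhi s) = n := by rw [LinearMap.sub_apply, hn, h1]; ring
  -- If `β - α` has degree zero, it is `0` or `±2δ₁`; the latter is impossible, for `β` would be a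
  -- root with `δ₁`-coefficient `±2` and a nonzero `εᵢ`-coordinate.
  rcases n with _ | n
  · exfalso
    rcases root_phi_zero hk s hr (by simpa using hr1) with h | ⟨t, h⟩
    · exact hne (sub_eq_zero.1 h)
    · have hβ' : β = α + (2 * t : ℤ) • dl := by rw [← h]; abel
      have := root_coord_of_par hk hβ (s := t) (by rw [hβ']; simp [hp]; simp [hPar]) i
      rw [hβ'] at this
      simp [hi] at this
  · refine ⟨⟨hr, n, by rw [hr1]; push_cast; rfl⟩, fun h => h2 ?_⟩
    rwa [two_nsmul, ← sub_eq_iff_eq_add.1 h]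

end

/-! ### Reflections acting on a set of weights. -/

section Reflections

variable {L : Type} [AddCommGroup L] [Module ℂ L] {𝔥 : Submodule ℂ L}

/-- The set `S` of weights is stable under the reflection `μ ↦ μ - μ(h) α`. -/
structure IsReflection (S : Set (Module.Dual ℂ 𝔥)) (α : Module.Dual ℂ 𝔥) (h : 𝔥) : Prop where
  two : α h = 2
  sub_mem : ∀ μ ∈ S, μ - μ h • α ∈ S

/-- Some ray in the direction of `β` starting in `S` leaves `S`. -/
def ExitsAlong (S : Set (Module.Dual ℂ 𝔥)) (β : Module.Dual ℂ 𝔥) : Prop :=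
  ∃ μ ∈ S, ∃ n : ℕ, μ + n • β ∉ S

variable {S : Set (Module.Dual ℂ 𝔥)} {α β : Module.Dual ℂ 𝔥} {h h' : 𝔥}

lemma IsReflection.neg (R : IsReflection S α h) : IsReflection S (-α) (-h) where
  two := by rw [LinearMap.neg_apply, map_neg, neg_neg, R.two]
  sub_mem μ hμ := by rw [map_neg, neg_smul_neg]; exact R.sub_mem μ hμ

/-- The reflection in `s_α β` is `s_α s_β s_α`. -/
lemma IsReflection.conj (R : IsReflection S α h) (R' : IsReflection S β h') {c c' : ℂ}
    (hc : β h = c) (hc' : α h' = c') : IsReflection S (β - c • α) (h' - c' • h) where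
  two := by
    simp only [LinearMap.sub_apply, LinearMap.smul_apply, map_sub, map_smul, smul_eq_mul, R.two,
      R'.two, hc, hc']
    ring
  sub_mem μ hμ := by
    have := R.sub_mem _ (R'.sub_mem _ (R.sub_mem μ hμ))
    convert this using 1
    simp only [LinearMap.sub_apply, LinearMap.smul_apply, map_sub, map_smul, smul_eq_mul, R.two, hc, hc']
    module

/-- The reflection carries the ray from `μ` along `β` to the ray along `s_α β`. Being an involution
that preserves `S`, it also carries a point outside `S` to one outside `S`. -/
lemma ExitsAlong.reflect (R : IsReflection S α h) (G : ExitsAlong S β) {c : ℂ} (hc : β h = c) :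
    ExitsAlong S (β - c • α) := by
  obtain ⟨μ, hμ, n, hn⟩ := G
  refine ⟨_, R.sub_mem μ hμ, n, fun hcon => hn ?_⟩
  have := R.sub_mem _ hcon
  convert this using 1
  simp only [LinearMap.sub_apply, LinearMap.add_apply, LinearMap.smul_apply, smul_eq_mul, R.two, hc,
    nsmul_eq_mul]
  module

end Reflections

/-! ### From simple reflections to all real roots of `S(2)`. -/

section

variable {k : ℕ} {S : Set (Wt k)}

/-- The multiple of `c` in the coroot of `δ - 2εᵢ`. -/
def hHalf : cartan k := hElt 0 0 (1 / 2) 0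

@[simp] lemma ep_hHalf (i : Fin k) : ep i (hHalf : cartan k) = 0 := by simp [hHalf]

@[simp] lemma im_hHalf : im (hHalf : cartan k) = 0 := by simp [hHalf]

/-- Stability under the simple reflections other than those of `2δ₁` and `2δ - 2δ₁`. -/
structure IsWeylStable (S : Set (Wt k)) : Prop where
  adj : ∀ i j : Fin k, (i : ℕ) + 1 = j → IsReflection S (ep i - ep j) (hC i - hC j)
  last : ∀ i j : Fin k, (i : ℕ) + 1 = j → (j : ℕ) + 1 = k → IsReflection S (ep i + ep j) (hC i + hC j)
  affine : ∀ i : Fin k, (i : ℕ) = 0 → IsReflection S (im - (2 : ℤ) • ep i) (hHalf - hC i)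

namespace IsWeylStable

/-- `εᵢ - εⱼ` is the image of `εᵢ - εⱼ₋₁` under the adjacent reflection in `εⱼ₋₁ - εⱼ`. -/
lemma sub_of_lt (W : IsWeylStable S) (d : ℕ) : ∀ i j : Fin k, (i : ℕ) + d + 1 = j →
    IsReflection S (ep i - ep j) (hC i - hC j) := by
  induction d with
  | zero => exact fun i j h => W.adj i j (by omega)
  | succ d ih =>
    intro i j h
    have hj := j.2
    let l : Fin k := ⟨j - 1, by omega⟩
    have hl : (l : ℕ) = j - 1 := rfl
    rw [← Nat.add_assoc] at h
    have h1 := ih i l (by omega)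
    have h2 := W.adj l j (by omega)
    have hil : i ≠ l := fun e => by have := congrArg Fin.val e; omega
    have hlj : l ≠ j := fun e => by have := congrArg Fin.val e; omega
    have hij : i ≠ j := fun e => by have := congrArg Fin.val e; omega
    have := h2.conj h1 (c := -1) (c' := -1) (by simp [hil, hij, hlj])
      (by simp [hil.symm, hij.symm, hlj.symm])
    convert this using 1 <;> module

lemma sub (W : IsWeylStable S) {i j : Fin k} (hij : i ≠ j) : IsReflection S (ep i - ep j) (hC i - hC j) := by
  rcases lt_or_gt_of_ne hij with h | h
  · have h' : (i : ℕ) < j := h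
    exact W.sub_of_lt (j - i - 1) i j (by omega)
  · have h' : (j : ℕ) < i := h
    have := (W.sub_of_lt (i - j - 1) j i (by omega)).neg
    rwa [neg_sub, neg_sub] at this

/-- All `εᵢ + εⱼ` are obtained from `εₖ₋₁ + εₖ` by permutations, which are available through `sub`;
the two indices are moved one after the other. -/
lemma add (W : IsWeylStable S) {i j : Fin k} (hij : i ≠ j) : IsReflection S (ep i + ep j) (hC i + hC j) := by
  have hi := i.2
  have hj := j.2
  have hij' : (i : ℕ) ≠ j := fun h => hij (Fin.ext h)
  let l : Fin k := ⟨k - 1, by omega⟩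
  let m : Fin k := ⟨k - 2, by omega⟩
  have hml : m ≠ l := fun h => by have : k - 2 = k - 1 := congrArg Fin.val h; omega
  have hlm := W.last m l (show k - 2 + 1 = k - 1 by omega) (show k - 1 + 1 = k by omega)
  have step : ∀ a : Fin k, a ≠ l → IsReflection S (ep a + ep l) (hC a + hC l) := by
    intro a ha
    by_cases ham : a = m
    · rw [ham]; exact hlm
    · have := (W.sub ham).conj hlm (c := -1) (c' := -1) (by simp [hml.symm, ha.symm, Ne.symm ham])
        (by simp [hml, ha, ham])
      convert this using 1 <;> module
  by_cases hil : i = l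
  · rw [hil, add_comm, add_comm (hC l)]
    exact step j fun h => hij (hil.trans h.symm)
  · by_cases hjl : j = l
    · rw [hjl]; exact step i hil
    · have := (W.sub hjl).conj (step i hil) (c := -1) (c' := -1)
        (by simp [hij, hil, Ne.symm hjl]) (by simp [hij.symm, Ne.symm hil, hjl])
      convert this using 1 <;> module

lemma im_sub (W : IsWeylStable S) (i : Fin k) : IsReflection S (im - (2 : ℤ) • ep i) (hHalf - hC i) := by
  have hi := i.2
  let z : Fin k := ⟨0, by omega⟩
  by_cases hz : i = z
  · exact W.affine i (by rw [hz])
  · have := (W.sub hz).conj (W.affine z rfl) (c := 2) (c' := 1) (by simp [Ne.symm hz])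
      (by simp [hz])
    convert this using 1 <;> module

/-- The degree `hPhi 1` is bounded above on `S` and increases along `β`, so the ray cannot stay in
`S`. -/
lemma exits_add_of_nonneg {a : ℂ} (hne : S.Nonempty)
    (hb : ∀ μ ∈ S, ∃ n : ℕ, μ (hPhi 1) = a - n) {β : Wt k} {m : ℤ} (hm : 0 < m)
    (hβ : β (hPhi 1) = m) : ExitsAlong S β := by
  obtain ⟨μ, hμ⟩ := hne
  by_contra hcon
  simp only [ExitsAlong, not_exists, not_and, not_not] at hcon
  obtain ⟨n, hn⟩ := hb μ hμ
  -- Starting in degree `a - n`, a number `n + 1` of steps of size at least `1` exceeds `a`.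
  obtain ⟨n', hn'⟩ := hb _ (hcon μ hμ (n + 1))
  rw [LinearMap.add_apply, hn, LinearMap.smul_apply, hβ, nsmul_eq_mul] at hn'
  have : ((n : ℤ) + 1) * m + n' = n := by
    have : ((n : ℂ) + 1) * m + n' = n := by push_cast at hn'; linear_combination hn'
    exact_mod_cast this
  nlinarith

/-- For `n ≥ 1` the direction is positive. Smaller `n` are reached because the composite of the
reflections in `εᵢ + εⱼ`, `δ - 2εᵢ`, `δ - 2εⱼ` fixes `εᵢ + εⱼ` modulo `δ` and lowers the coefficient
at `δ` by `2`. -/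
lemma exits_add (W : IsWeylStable S) {a : ℂ} (hne : S.Nonempty)
    (hb : ∀ μ ∈ S, ∃ n : ℕ, μ (hPhi 1) = a - n) {i j : Fin k} (hij : i ≠ j) (n : ℤ) :
    ExitsAlong S (ep i + ep j + n • im) := by
  have key : ∀ d : ℕ, ∀ n : ℤ, 1 ≤ n + 2 * d → ExitsAlong S (ep i + ep j + n • im) := by
    intro d
    induction d with
    | zero =>
      intro n hn
      -- Positive, since `n (2k+1) ≥ 2k + 1` while the two coordinates add up to at least `-2k`.
      refine exits_add_of_nonneg hne hb (m := phiC 1 i + phiC 1 j + n * (2 * k + 1)) ?_ ?_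
      · have h1 := phiC_le 1 i
        have h2 := phiC_le 1 j
        have : (2 * k + 1 : ℤ) ≤ n * (2 * k + 1) := le_mul_of_one_le_left (by omega) (by simpa using hn)
        omega
      · simp [hPhi]; ring
    | succ d ih =>
      intro n hn
      have h1 := ih (n + 2) (by push_cast at hn; omega)
      have h2 := h1.reflect (W.add hij) (c := 2) (by simp [hij, hij.symm]; norm_num)
      have h3 := h2.reflect (W.im_sub i) (c := 1) (by simp [hij.symm]; norm_num)
      have h4 := h3.reflect (W.im_sub j) (c := 1) (by simp [hij]; norm_num)
      convert h4 using 1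
      module
  exact key (1 - n).toNat n (by omega)

/-- Reflecting in `εᵢ + εⱼ` changes both signs, and reflecting in `δ - 2εᵢ` changes one sign at the
cost of a shift by `δ`. The shift is harmless because all coefficients at `δ` are treated at once.
-/
lemma exits_pair (W : IsWeylStable S) {a : ℂ} (hne : S.Nonempty)
    (hb : ∀ μ ∈ S, ∃ n : ℕ, μ (hPhi 1) = a - n) {i j : Fin k} (hij : i ≠ j) (s t : ℤˣ) (n : ℤ) :
    ExitsAlong S ((s : ℤ) • ep i + (t : ℤ) • ep j + n • im) := by
  have hneg : ∀ n : ℤ, ExitsAlong S (-ep i - ep j + n • im) := fun n => by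
    have := (W.exits_add hne hb hij n).reflect (W.add hij) (c := 2)
      (by simp [hij, hij.symm]; norm_num)
    convert this using 1
    module
  have hmix : ∀ {i j : Fin k}, i ≠ j → (∀ n : ℤ, ExitsAlong S (-ep i - ep j + n • im)) → ∀ n : ℤ,
      ExitsAlong S (ep i - ep j + n • im) := fun {i j} hij h n => by
    have := (h (n + 1)).reflect (W.im_sub i) (c := 1) (by simp [hij.symm])
    convert this using 1
    module
  rcases Int.units_eq_one_or s with rfl | rfl <;> rcases Int.units_eq_one_or t with rfl | rfl
  · convert W.exits_add hne hb hij n using 1; simp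
  · convert hmix hij hneg n using 1; simp; module
  · have := hmix hij.symm (fun n => by convert hneg n using 1; module) n
    convert this using 1; simp; module
  · convert hneg n using 1; simp; module

/-- The reflections in `εᵢ - εⱼ` and `εᵢ + εⱼ`, with any `j ≠ i`, together negate `2εᵢ`. The
reflection in `δ - 2εᵢ` negates it back and lowers the coefficient at `δ` by `2`, which reduces the
claim to positive directions. -/
lemma exits_two (W : IsWeylStable S) (hk : 2 ≤ k) {a : ℂ} (hne : S.Nonempty)
    (hb : ∀ μ ∈ S, ∃ n : ℕ, μ (hPhi 1) = a - n) (i : Fin k) (s : ℤˣ) (n : ℤ) :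
    ExitsAlong S ((2 * s : ℤ) • ep i + n • im) := by
  obtain ⟨j, hij⟩ : ∃ j : Fin k, i ≠ j := by
    by_cases h : (i : ℕ) = 0
    · exact ⟨⟨1, by omega⟩, fun e => by rw [e] at h; simp at h⟩
    · exact ⟨⟨0, by omega⟩, fun e => h (by rw [e])⟩
  have hneg : ∀ n : ℤ, ExitsAlong S ((2 : ℤ) • ep i + n • im) →
      ExitsAlong S (-((2 : ℤ) • ep i) + n • im) := fun n h => by
    have h1 := h.reflect (W.sub hij) (c := 2) (by simp [hij])
    have h2 := h1.reflect (W.add hij) (c := 2) (by simp [hij, hij.symm])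
    convert h2 using 1
    module
  have key : ∀ d : ℕ, ∀ n : ℤ, 1 ≤ n + 2 * d → ExitsAlong S ((2 : ℤ) • ep i + n • im) := by
    intro d
    induction d with
    | zero =>
      intro n hn
      refine exits_add_of_nonneg hne hb (m := 2 * phiC 1 i + n * (2 * k + 1)) ?_ ?_
      · have h1 := phiC_le 1 i
        have : (2 * k + 1 : ℤ) ≤ n * (2 * k + 1) := le_mul_of_one_le_left (by omega) (by simpa using hn)
        omega
      · simp [hPhi]; ring
    | succ d ih =>
      intro n hn
      have h1 := hneg _ (ih (n + 2) (by push_cast at hn; omega))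
      have h2 := h1.reflect (W.im_sub i) (c := 2) (by simp)
      convert h2 using 1
      module
  have hpos := fun n : ℤ => key (1 - n).toNat n (by omega)
  rcases Int.units_eq_one_or s with rfl | rfl
  · convert hpos n using 1; simp
  · convert hneg n (hpos n) using 1; simp

end IsWeylStable

end

/-! ### Extremal vectors of `M` and the reflections of its support. -/

section

variable {k : ℕ} {ζ ξ : ℂ} {e f : TwAff k}

lemma mem_P3_inter_of_dElt (hk : 2 ≤ k) {β : Wt k} (hβ : β ∈ roots (cartan k)) (h0 : β dElt = 0) :
    β ∈ P3 k ∩ -P3 k := by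
  rw [(isParabolic_P3 hk).2.1]
  exact ⟨hβ, h0⟩

/-- Makes the odd root vectors for `-εₖ + δ₁` and `-εₖ - δ₁` anticommute with one another and square
to zero. -/
lemma sub_ep_not_mem (hk : 2 ≤ k) (i : Fin k) (t t' : ℤˣ) :
    (-ep i + (t : ℤ) • dl) + (-ep i + (t' : ℤ) • dl) ∉ roots (cartan k) := by
  intro h
  have hi : ((-ep i + (t : ℤ) • dl) + (-ep i + (t' : ℤ) • dl) : Wt k) (hC i) = -2 := by
    simp; norm_num
  have hd := mem_P3_inter_of_dElt hk h (by simp [dElt])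
  generalize (-ep i + (t : ℤ) • dl) + (-ep i + (t' : ℤ) • dl) = β at hi hd
  rcases (mem_P3_inter hk β).1 hd with ((rfl | ⟨a, b, hab, s, s', rfl⟩) | ⟨s, rfl⟩) |
    ⟨a, s, s', rfl⟩
  · simp at hi
  · have : (s : ℤ) * (if a = i then 1 else 0) + s' * (if b = i then 1 else 0) = -2 := by
      simp only [LinearMap.add_apply, LinearMap.smul_apply, ep_hC, zsmul_eq_mul] at hi
      exact_mod_cast hi
    have hne : ¬(a = i ∧ b = i) := fun h => hab.ne (h.1.trans h.2.symm)
    rcases Int.units_eq_one_or s with rfl | rfl <;> rcases Int.units_eq_one_or s' with rfl | rfl <;>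
      split_ifs at this <;> simp_all
  · simp at hi
  · have : (s : ℤ) * (if a = i then 1 else 0) = -2 := by
      simp only [LinearMap.add_apply, LinearMap.smul_apply, ep_hC, dl_hC, zsmul_eq_mul,
        mul_zero, add_zero] at hi
      exact_mod_cast hi
    rcases Int.units_eq_one_or s with rfl | rfl <;> split_ifs at this <;> simp at this

lemma wtPar_sub_ep (i : Fin k) (t : ℤˣ) : wtPar (-ep i + (t : ℤ) • dl : Wt k) = 1 := by
  rw [wtPar_eq (m := t) (by simp [hPar])]
  rcases Int.units_eq_one_or t with rfl | rfl <;> decide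

/-- The root spaces of `-εᵢ ± δ₁` are spanned by one element. -/
lemma exists_span_sub_ep (i : Fin k) (t : ℤˣ) : ∃ y : (⊤ : Submodule ℂ (TwAff k)),
    (y : TwAff k) ∈ rootSpace (cartan k) (-ep i + (t : ℤ) • dl) ∧
    ∀ x : (⊤ : Submodule ℂ (TwAff k)),
      (x : TwAff k) ∈ rootSpace (cartan k) (-ep i + (t : ℤ) • dl) → ∃ c : ℂ, x = c • y := by
  obtain ⟨u, v, huv, h⟩ : ∃ u v : Idx k, u ≠ v ∧
      (-ep i + (t : ℤ) • dl : Wt k) = wI u - wI v + (0 : ℤ) • im := by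
    rcases Int.units_eq_one_or t with rfl | rfl
    · exact ⟨Sum.inr (Sum.inl 0), Sum.inl (Sum.inl i), by simp, by
        rw [wI_inl_inl, wI_inr_inl]; simp; abel⟩
    · exact ⟨Sum.inr (Sum.inr 0), Sum.inl (Sum.inl i), by simp, by
        rw [wI_inl_inl, wI_inr_inr]; simp; abel⟩
  rw [h]
  by_cases he : ∃ y : (⊤ : Submodule ℂ (TwAff k)),
      (y : TwAff k) ∈ rootSpace (cartan k) (wI u - wI v + (0 : ℤ) • im) ∧ (toAff k y).1 0 u v ≠ 0
  · obtain ⟨y, hy, hy0⟩ := he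
    exact ⟨y, hy, exists_eq_smul huv hy hy0⟩
  · push Not at he
    refine ⟨0, zero_mem _, fun x hx => ⟨0, ?_⟩⟩
    rw [smul_zero]
    exact Subtype.ext (eq_zero_of_entry_eq_zero huv hx (he x hx))

lemma act_of_mem_weightSpace {t : Submodule ℂ (TwAff k)} {M : SuperRep t} {μ : Wt k} {v : M.V}
    (hv : v ∈ M.weightSpace (cartan k) μ) (x : t) (hx : (x : TwAff k) ∈ cartan k) :
    M.act x v = μ ⟨x, hx⟩ • v := hv x hx

/-- The basis vector `v_ζ` of `K₁`. -/
def vOne (ζ ξ : ℂ) (e f : TwAff k) : (K1 ζ ξ e f).V := (Finsupp.single 0 1 : ℤ →₀ ℂ)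

lemma vOne_ne_zero : vOne ζ ξ e f ≠ 0 := fun h =>
  one_ne_zero (Finsupp.single_eq_zero.1 (show (Finsupp.single 0 1 : ℤ →₀ ℂ) = 0 from h))

lemma vOne_mem_weightSpace : vOne ζ ξ e f ∈ (K1 ζ ξ e f).weightSpace (cartan k) (rho k ζ) := by
  have := K1_single_mem_weightSpace (ζ := ζ) (ξ := ξ) (e := e) (f := f) 0 1
  rwa [mul_zero, zero_smul, add_zero] at this

/-- The image of `v_ζ` in `K₂`. -/
def vTwo (ζ ξ : ℂ) (e f : TwAff k) : (K2 ζ ξ e f).V :=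
  indIncl (B2 k) (rootSum (cartan k) (P1 k \ -P1 k)) (K1 ζ ξ e f) (vOne ζ ξ e f)

lemma inclTwo_vTwo : inclTwo ζ ξ e f (vTwo ζ ξ e f) =
    inclOne ζ ξ e f (vOne ζ ξ e f) := rfl

lemma vOne_act (x : B1 k) (y : cartan k) (hxy : (x : TwAff k) = y) :
    (K1 ζ ξ e f).act x (vOne ζ ξ e f) = rho k ζ y • vOne ζ ξ e f := by
  obtain ⟨y, hy⟩ := y
  subst hxy
  exact act_of_mem_weightSpace vOne_mem_weightSpace x hy

lemma vTwo_mem_weightSpace (hk : 2 ≤ k) :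
    inclTwo ζ ξ e f (vTwo ζ ξ e f) ∈ (K4 ζ ξ e f).weightSpace (cartan k) (rho k ζ) := by
  intro x hx
  have h1 := cartan_le_B1 hk hx
  rw [inclTwo_vTwo, inclOne_act hk x h1, vOne_act (k := k) ⟨x, h1⟩ ⟨x, hx⟩ rfl, map_smul]

lemma inclTwo_vTwo_ne_zero (hk : 2 ≤ k) (E : IsDeltaPair e f) (hc : ∀ n, fCoef ζ ξ n ≠ 0) :
    inclTwo ζ ξ e f (vTwo ζ ξ e f) ≠ 0 := fun h => by
  rw [inclTwo_vTwo, map_eq_zero_iff _ (inclOne_injective hk E hc)] at h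
  exact vOne_ne_zero h

lemma K4_relations (hk : 2 ≤ k) (E : IsDeltaPair e f) (hc : ∀ n, fCoef ζ ξ n ≠ 0) :
    (K4 ζ ξ e f).Relations := (K4_step hk E hc).irred.1.relations

lemma K4_irreducible (hk : 2 ≤ k) (E : IsDeltaPair e f) (hc : ∀ n, fCoef ζ ξ n ≠ 0) :
    (K4 ζ ξ e f).IsIrreducible := (K4_step hk E hc).irred.2.2

/-- `v_ζ` is extremal for `hPhi 1`. -/
lemma vTwo_kill (hk : 2 ≤ k) {β : Wt k} (hβ : β ∈ degPos (roots (cartan k)) (hPhi 1))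
    (x : (⊤ : Submodule ℂ (TwAff k))) (hx : (x : TwAff k) ∈ rootSpace (cartan k) β) :
    (K4 ζ ξ e f).act x (inclTwo ζ ξ e f (vTwo ζ ξ e f)) = 0 := by
  rcases root_phi_pos hk 1 hβ with h | ⟨i, t, hi, rfl⟩
  · exact inclTwo_act_eq_zero hk h x hx _
  · refine inclOne_act_eq_zero hk ⟨(mem_P2_inter hk _).2 (Or.inr ⟨i, hi, 1, t, rfl⟩), 0, ?_⟩ x hx _
    simp [hOne, hi]

lemma sub_ep_mem_P2 (hk : 2 ≤ k) {i : Fin k} (hi : (i : ℕ) + 1 = k) (t : ℤˣ) :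
    (-ep i + (t : ℤ) • dl : Wt k) ∈ P2 k ∩ -P2 k :=
  (mem_P2_inter hk _).2 (Or.inr ⟨i, hi, -1, t, by simp⟩)

lemma exists_pow_of_sq_zero {V : Type*} [AddCommGroup V] [Module ℂ V] {Y : Module.End ℂ V}
    (h : ∀ v, Y (Y v) = 0) {v : V} (hv : v ≠ 0) :
    ∃ j : ℕ, j ≤ 1 ∧ (Y ^ j) v ≠ 0 ∧ Y ((Y ^ j) v) = 0 := by
  by_cases h0 : Y v = 0
  · exact ⟨0, by simp, by simpa using hv, by simpa using h0⟩
  · exact ⟨1, le_rfl, by simpa using h0, by simpa using h v⟩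

/-- A vector extremal for `hPhi (-1)`. -/
lemma exists_extremal (hk : 2 ≤ k) (E : IsDeltaPair e f) (hc : ∀ n, fCoef ζ ξ n ≠ 0) {l : Fin k}
    (hl : (l : ℕ) + 1 = k) : ∃ (j : ℕ) (m : ℤ) (v : (K4 ζ ξ e f).V), j ≤ 2 ∧ v ≠ 0 ∧
      v ∈ (K4 ζ ξ e f).weightSpace (cartan k) (rho k ζ - j • ep l + m • dl) ∧
      ∀ β ∈ degPos (roots (cartan k)) (hPhi (-1)), ∀ x : (⊤ : Submodule ℂ (TwAff k)),
        (x : TwAff k) ∈ rootSpace (cartan k) β → (K4 ζ ξ e f).act x v = 0 := by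
  have hM := K4_relations hk E hc
  have D := gradedBy_hPhi hk 1
  choose y hy hspan using exists_span_sub_ep (k := k) l
  set Y := fun t => (K4 ζ ξ e f).act (y t) with hY
  have anti : ∀ t t' v, Y t (Y t' v) = -Y t' (Y t v) := by
    intro t t' v
    have := D.act_act isHomogeneousCartan hM (hy t) (hy t') v
    have hz : (⟨_, D.br_mem_t isHomogeneousCartan (y t) (y t')⟩ : (⊤ : Submodule ℂ (TwAff k))) = 0 :=
      Subtype.ext (eq_zero_of_not_mem_roots (sub_ep_not_mem hk l t t')
        (isHomogeneousCartan.br_mem_rootSpace (hy t) (hy t')))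
    rw [hz, map_zero, LinearMap.zero_apply, zero_add, wtPar_sub_ep, wtPar_sub_ep] at this
    simpa [sgn] using this
  have sq : ∀ t v, Y t (Y t v) = 0 := fun t v => by
    have h2 : (2 : ℂ) • Y t (Y t v) = 0 := by rw [two_smul]; exact add_eq_zero_iff_eq_neg.2 (anti t t v)
    exact (smul_eq_zero.1 h2).resolve_left two_ne_zero
  -- The roots `-εₖ ± δ₁` belong to `𝓑₂`, so the vectors obtained stay in the image of `K₂`, where
  -- the nilradicals of `P₂` and `P₃` act by zero.
  have hrange : ∀ t (n : ℕ), ∀ v ∈ LinearMap.range (inclTwo ζ ξ e f),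
      (Y t ^ n) v ∈ LinearMap.range (inclTwo ζ ξ e f) := by
    intro t n v hv
    induction n with
    | zero => simpa using hv
    | succ n ih =>
      obtain ⟨w, hw⟩ := ih
      rw [pow_succ', Module.End.mul_apply, ← hw, hY]
      exact ⟨_, (inclTwo_act hk (y t) (rootSpace_le_rootSum (sub_ep_mem_P2 hk hl t) (hy t)) w).symm⟩
  -- Each odd root vector is applied once if the result is nonzero and not at all otherwise. The
  -- outcome is a nonzero vector killed by both, and the `εₖ`-coordinate drops by at most `2`.
  obtain ⟨j, hj, hv1, hk1⟩ := exists_pow_of_sq_zero (sq 1) (inclTwo_vTwo_ne_zero hk E hc)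
  obtain ⟨j', hj', hv2, hk2⟩ := exists_pow_of_sq_zero (sq (-1)) hv1
  have hr := hrange (-1) j' _ (hrange 1 j _ (LinearMap.mem_range_self _ (vTwo ζ ξ e f)))
  have hw := pow_act_mem_weightSpace isHomogeneousCartan hM (hy (-1))
    (pow_act_mem_weightSpace isHomogeneousCartan hM (hy 1)
      (vTwo_mem_weightSpace (ζ := ζ) (ξ := ξ) (e := e) (f := f) hk) j) j'
  have hk3 : Y 1 ((Y (-1) ^ j') ((Y 1 ^ j) (inclTwo ζ ξ e f (vTwo ζ ξ e f)))) = 0 := by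
    interval_cases j'
    · simpa using hk1
    · rw [pow_one, anti, hk1, map_zero, neg_zero]
  refine ⟨j + j', j - j', _, by omega, hv2, ?_, fun β hβ x hx => ?_⟩
  · convert hw using 2
    push_cast
    module
  · rcases root_phi_pos hk (-1) hβ with h | ⟨i, t, hi, rfl⟩
    · obtain ⟨w, hw⟩ := hr
      rw [← hw]
      exact inclTwo_act_eq_zero hk h x hx w
    · have hil : i = l := Fin.ext (by omega)
      subst hil
      rw [Units.val_neg, Units.val_one, neg_smul, one_smul] at hx
      obtain ⟨c, rfl⟩ := hspan t x hx
      rw [map_smul, LinearMap.smul_apply]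
      rcases Int.units_eq_one_or t with rfl | rfl
      · exact (congrArg _ hk3).trans (smul_zero _)
      · exact (congrArg _ hk2).trans (smul_zero _)

/-- A simple root with nonnegative integral value on an extremal weight reflects the support. -/
theorem isReflection_supp (hk : 2 ≤ k) {M : SuperRep (⊤ : Submodule ℂ (TwAff k))}
    (hM : M.Relations) (hirr : M.IsIrreducible) {s : ℤˣ} {α : Wt k}
    {x y : (⊤ : Submodule ℂ (TwAff k))} {h : cartan k} (S : IsSl2Pair wtPar α x y h)
    (hone : ∀ z : (⊤ : Submodule ℂ (TwAff k)), (z : TwAff k) ∈ rootSpace (cartan k) α →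
      ∃ c : ℂ, z = c • x)
    (h1 : α (hPhi s) = 1) (h2 : (2 : ℕ) • α ∉ roots (cartan k)) {i : Fin k} (hi : α (hC i) ≠ 0)
    (hp : α hPar = 0) {μ : Wt k} {v : M.V} (hv0 : v ≠ 0) (hv : v ∈ M.weightSpace (cartan k) μ)
    (hkill : ∀ β ∈ degPos (roots (cartan k)) (hPhi s), ∀ x : (⊤ : Submodule ℂ (TwAff k)),
        (x : TwAff k) ∈ rootSpace (cartan k) β → M.act x v = 0) {m : ℕ} (hm : μ h = m) :
    IsReflection (M.supp (cartan k)) α h := by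
  have D := gradedBy_hPhi hk s
  have H := isHomogeneousCartan (k := k)
  -- If `α` were not a root, the vector `x` and hence the coroot `h` would vanish, contrary to `α(h)
  -- = 2`.
  have hα : α ∈ degPos (roots (cartan k)) (hPhi s) := by
    refine ⟨?_, 0, by simpa using h1⟩
    by_contra hr
    have hx := eq_zero_of_not_mem_roots hr S.e_mem
    have h3 := S.br_eq
    rw [hx, map_zero, LinearMap.zero_apply] at h3
    have h4 := S.two
    have h5 : h = 0 := Subtype.ext h3.symm
    rw [h5, map_zero] at h4
    norm_num at h4
  have hf := S.pow_act_eq_zero H D hM hirr hone hα (simple_of_degree_one hk h1 h2 hi hp) hv hkill hm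
  have he := hkill α hα x S.e_mem
  exact ⟨S.two, fun μ hμ => S.sub_mem_supp H D hM
    (exists_pow_act_eq_zero H D hM hirr S.even (root_string_finite hk hi) S.e_mem hv0
      ⟨1, by simpa using he⟩)
    (exists_pow_act_eq_zero H D hM hirr S.even_neg
      (root_string_finite hk (i := i) (by simpa using hi)) S.f_mem hv0 ⟨_, hf⟩) hμ⟩

lemma rho_hElt (a : Fin k → ℂ) (b r s : ℂ) : rho k ζ (hElt a b r s) =
    (2 * k + 2) * r + ∑ i : Fin k, ((k : ℂ) - (i : ℕ) + 1) * a i + ζ * b := topFun_hElt ζ a b r s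

@[simp] lemma rho_hC (i : Fin k) : rho k ζ (hC i) = (k : ℂ) - (i : ℕ) + 1 := by
  simp [hC, rho_hElt, Pi.single_apply]

@[simp] lemma rho_hHalf : rho k ζ hHalf = k + 1 := by
  simp [hHalf, rho_hElt]; ring

lemma hD_inl_inr (i : Fin k) : (hD (Sum.inl (Sum.inr i)) : cartan k) = -hC i := by
  have := hLin.map_neg ((Pi.single i 1, 0, 0, 0) : (Fin k → ℂ) × ℂ × ℂ × ℂ)
  simpa [hLin, hD, hC] using this

lemma hHalf_sub_hC (i : Fin k) : hHalf - hC i = (hElt (-Pi.single i 1) 0 (1 / 2) 0 : cartan k) := by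
  have := hLin.map_sub (0, 0, 1 / 2, 0) ((Pi.single i 1, 0, 0, 0) : (Fin k → ℂ) × ℂ × ℂ × ℂ)
  simpa [hLin, hHalf, hC] using this.symm

/-- The coordinates of `ϱ` at `ε₁, …, εₖ` are `k+1, …, 2`, and its value at `c/2` is `k+1`. So the
coroots of `εᵢ - εᵢ₊₁` and `δ - 2ε₁` take the values `1` and `0` at `v_ζ`. The root `εₖ₋₁ + εₖ` has
degree one only for `hPhi (-1)`; the extremal vector there has lost at most `2` at `εₖ`, so the
value `3 + 2` drops to no less than `3`. -/
theorem isWeylStable_supp (hk : 2 ≤ k) (E : IsDeltaPair e f) (hc : ∀ n, fCoef ζ ξ n ≠ 0) :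
    IsWeylStable ((K4 ζ ξ e f).supp (cartan k)) where
  adj i j hij := by
    have hj := j.2
    have hne : i ≠ j := fun h => by rw [h] at hij; omega
    obtain ⟨x, y, S, hone⟩ := exists_sl2_finite (k := k) (u := Sum.inl i) (v := Sum.inl j)
      (by simpa using hne) (by simp)
    rw [wI_inl_inl, wI_inl_inl] at S hone
    refine isReflection_supp hk (K4_relations hk E hc) (K4_irreducible hk E hc) (s := 1) (i := i) S
      hone ?_ ?_ (by simp [Ne.symm hne]) (by simp [hPar]) (inclTwo_vTwo_ne_zero hk E hc)
      (vTwo_mem_weightSpace hk) (fun β hβ x hx => vTwo_kill hk hβ x hx) (m := 1) ?_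
    · have : phiC 1 i - phiC 1 j = 1 := by
        rw [phiC, phiC, if_neg (by omega)]; split_ifs <;> simp <;> omega
      simp only [hPhi, LinearMap.sub_apply, ep_hElt]
      exact_mod_cast this
    · simpa [sub_eq_add_neg] using two_nsmul_ep_not_mem hk hne (-1)
    · rw [map_sub, rho_hC, rho_hC, ← hij]; push_cast; ring
  last i j hij hjk := by
    have hj := j.2
    have hne : i ≠ j := fun h => by rw [h] at hij; omega
    obtain ⟨x, y, S, hone⟩ := exists_sl2_finite (k := k) (u := Sum.inl i) (v := Sum.inr j)
      (by simp) (by simpa using hne)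
    rw [wI_inl_inl, wI_inl_inr, sub_neg_eq_add, hD_inl_inr, sub_neg_eq_add] at S
    rw [wI_inl_inl, wI_inl_inr, sub_neg_eq_add] at hone
    obtain ⟨n, m, v, hn, hv0, hv, hkill⟩ := exists_extremal hk E hc hjk
    refine isReflection_supp hk (K4_relations hk E hc) (K4_irreducible hk E hc) (s := -1) (i := i) S
      hone ?_ ?_ (by simp [Ne.symm hne]) (by simp [hPar]) hv0 hv hkill (m := 5 - n) ?_
    · have : phiC (-1) i + phiC (-1) j = 1 := by
        rw [phiC, phiC, if_neg (by omega), if_pos hjk]; simp; omega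
      simp only [hPhi, LinearMap.add_apply, ep_hElt]
      exact_mod_cast this
    · simpa using two_nsmul_ep_not_mem hk hne 1
    · have hi' : ((i : ℕ) : ℂ) + 2 = k := by exact_mod_cast (by omega : (i : ℕ) + 2 = k)
      have hj' : ((j : ℕ) : ℂ) + 1 = k := by exact_mod_cast hjk
      change (rho k ζ - n • ep j + m • dl : Wt k) (hC i + hC j) = _
      rw [map_add, Nat.cast_sub (by omega)]
      simp [Ne.symm hne]
      linear_combination -hi' - hj'
  affine i hi := by
    obtain ⟨x, y, S, hone⟩ := exists_sl2_affine (k := k) i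
    rw [← hHalf_sub_hC] at S
    refine isReflection_supp hk (K4_relations hk E hc) (K4_irreducible hk E hc) (s := 1) (i := i) S
      hone ?_ (two_nsmul_im_not_mem hk i) (by simp) (by simp [hPar]) (inclTwo_vTwo_ne_zero hk E hc)
      (vTwo_mem_weightSpace hk) (fun β hβ x hx => vTwo_kill hk hβ x hx) (m := 0) ?_
    · have : (2 * k + 1 : ℤ) - 2 * phiC 1 i = 1 := by
        rw [phiC, if_neg (by omega)]; omega
      simp only [hPhi, LinearMap.sub_apply, LinearMap.smul_apply, ep_hElt, im_hElt, zsmul_eq_mul]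
      exact_mod_cast this
    · rw [map_sub, rho_hC, rho_hHalf, hi]; simp

end

/-! ### Local nilpotency, hybridity, and the absence of highest weight vectors. -/

section

variable {k : ℕ} {ζ ξ : ℂ} {e f : TwAff k}

/-- Root vectors along whose root the support is bounded are locally nilpotent. -/
lemma locallyNilpotent_of_exits (hk : 2 ≤ k) {M : SuperRep (⊤ : Submodule ℂ (TwAff k))}
    (hM : M.Relations) (hirr : M.IsIrreducible) {β : Wt k} {i : Fin k} (hi : β (hC i) ≠ 0)
    (hp : β hPar = 0) (hG : ExitsAlong (M.supp (cartan k)) β) :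
    M.ActsLocallyNilpotently (cartan k) β := by
  intro x hx _ v
  obtain ⟨μ, hμ, n, hn⟩ := hG
  obtain ⟨w, hw, hw0⟩ := (Submodule.ne_bot_iff _).1 hμ
  refine exists_pow_act_eq_zero isHomogeneousCartan (gradedBy_hPhi hk 1) hM hirr
    (wtPar_eq_zero hp) (root_string_finite hk hi) hx hw0 ⟨n, ?_⟩ v
  by_contra h0
  exact hn (mem_supp_of_ne_zero h0 (pow_act_mem_weightSpace isHomogeneousCartan hM hx hw n))

lemma hPar_of_mem_S2 {α : Wt k} (h : α ∈ S2 k) : α hPar = 0 := by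
  have hR : ∀ α ∈ R2 k, α hPar = 0 := by
    rintro α ((⟨n, rfl⟩ | ⟨i, j, hij, s, s', n, rfl⟩) | ⟨i, s, n, rfl⟩) <;> simp [hPar]
  rcases h with (⟨n, rfl⟩ | h) | ⟨-, h⟩
  · simp [hPar]
  · exact hR α h
  · simpa using hR _ h

lemma wtForm_im (n : ℤ) : wtForm (n • im : Wt k) (n • im) = 0 := by
  rw [wtForm_eq]; simp [hPar, cElt]

/-- The roots of `S(2)` have no `δ₁`-part, so the real ones among them are `±εᵢ ± εⱼ + nδ` and `±2εᵢ
+ (2n+1)δ`. The support is bounded above for `hPhi 1`, as `v_ζ` is extremal, and Weyl stability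
makes it end along all these directions. -/
lemma locallyNilpotent_S2 (hk : 2 ≤ k) (E : IsDeltaPair e f) (hc : ∀ n, fCoef ζ ξ n ≠ 0)
    {α : Wt k} (hα : α ∈ S2 k ∩ roots (cartan k)) (h0 : wtForm α α ≠ 0) :
    (K4 ζ ξ e f).ActsLocallyNilpotently (cartan k) α := by
  have hM := K4_relations hk E hc
  have hirr := K4_irreducible hk E hc
  have W := isWeylStable_supp hk E hc
  have hv := vTwo_mem_weightSpace (ζ := ζ) (ξ := ξ) (e := e) (f := f) hk
  have hv0 := inclTwo_vTwo_ne_zero hk E hc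
  have hne : ((K4 ζ ξ e f).supp (cartan k)).Nonempty := ⟨_, mem_supp_of_ne_zero hv0 hv⟩
  have hb : ∀ μ ∈ (K4 ζ ξ e f).supp (cartan k), ∃ n : ℕ, μ (hPhi 1) = rho k ζ (hPhi 1) - n :=
    fun μ hμ => degree_of_mem_supp isHomogeneousCartan (gradedBy_hPhi hk 1) hM hirr hv0
      (fun x hx => by
        have hx' : (x : TwAff k) ∈ cartan k := by rw [hx]; exact (hPhi 1).2
        rw [act_of_mem_weightSpace hv x hx']
        congr 2
        exact Subtype.ext hx) (fun β hβ x hx => vTwo_kill hk hβ x hx) hμ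
  obtain ⟨hS, hr⟩ := hα
  have hp := hPar_of_mem_S2 hS
  rw [roots_eq hk] at hr
  rcases hr with (((⟨n, rfl⟩ | ⟨i, j, hij, s, s', n, rfl⟩) | ⟨i, s, n, rfl⟩) | ⟨s, n, rfl⟩) |
    ⟨i, s, s', n, rfl⟩
  · exact absurd (wtForm_im n) h0
  · refine locallyNilpotent_of_exits hk hM hirr (i := i) ?_ hp (W.exits_pair hne hb hij s s' n)
    simp [Ne.symm hij]
  · refine locallyNilpotent_of_exits hk hM hirr (i := i) ?_ hp (W.exits_two hk hne hb i s _)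
    simp
  · simp [hPar] at hp
  · simp [hPar] at hp

/-- Elements of `R(1)` have no `εᵢ`-part, and halving does not create one. This excludes every
family of roots except `ℤδ`, which is isotropic, and `±2δ₁ + 2ℤδ`. -/
lemma eq_of_mem_S1 (hk : 2 ≤ k) {α : Wt k} (h : α ∈ S1 k) (h0 : wtForm α α ≠ 0) :
    ∃ (s : ℤˣ) (n : ℤ), α = (2 * s : ℤ) • dl + (2 * n) • im := by
  have hR : ∀ α ∈ R1 k, ∀ i : Fin k, α (hC i) = 0 := by
    rintro α (⟨n, rfl⟩ | ⟨s, n, rfl⟩) i <;> simp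
  rcases h with (⟨n, rfl⟩ | h) | ⟨hr, h⟩
  · exact absurd (wtForm_im n) h0
  · rcases h with ⟨n, rfl⟩ | h
    · exact absurd (wtForm_im _) h0
    · exact h
  · have h2 : ∀ i : Fin k, α (hC i) = 0 := fun i => by simpa using hR _ h i
    rw [roots_eq hk] at hr
    rcases hr with (((⟨n, rfl⟩ | ⟨i, j, hij, s, s', n, rfl⟩) | ⟨i, s, n, rfl⟩) | ⟨s, n, rfl⟩) |
      ⟨i, s, s', n, rfl⟩
    · exact absurd (wtForm_im n) h0
    · simpa [Ne.symm hij] using h2 i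
    · simpa using h2 i
    · exact ⟨s, n, rfl⟩
    · simpa using h2 i

/-- The powers can be computed in `K₁`, which embeds in `M` compatibly with `𝓑₁` and on which root
vectors for `±2δ₁` are injective. -/
lemma pow_act_two_dl_ne_zero (hk : 2 ≤ k) (E : IsDeltaPair e f) (hc : ∀ n, fCoef ζ ξ n ≠ 0)
    (s : ℤˣ) {x : (⊤ : Submodule ℂ (TwAff k))}
    (hx : (x : TwAff k) ∈ rootSpace (cartan k) ((2 * s : ℤ) • dl)) (hx0 : x ≠ 0) (n : ℕ) :
    ((K4 ζ ξ e f).act x ^ n) (inclOne ζ ξ e f (vOne ζ ξ e f)) ≠ 0 := by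
  have hx1 : (x : TwAff k) ∈ B1 k :=
    rootSpace_le_rootSum ((mem_P1_inter hk _).2 (Or.inr ⟨s, rfl⟩)) hx
  have hinj : Function.Injective ((K1 ζ ξ e f).act ⟨x, hx1⟩) := by
    have h := K1_injective ζ ξ E hc
    have hne : (⟨x, hx1⟩ : B1 k) ≠ 0 := fun h => hx0 (Subtype.ext (Subtype.ext_iff.1 h :))
    rcases Int.units_eq_one_or s with rfl | rfl
    · exact h.1 ⟨x, hx1⟩ (by simpa using hx) hne
    · exact h.2 ⟨x, hx1⟩ (by simpa using hx) hne
  have key : ∀ n : ℕ, ((K4 ζ ξ e f).act x ^ n) (inclOne ζ ξ e f (vOne ζ ξ e f)) =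
      inclOne ζ ξ e f (((K1 ζ ξ e f).act ⟨x, hx1⟩ ^ n) (vOne ζ ξ e f)) := by
    intro n
    induction n with
    | zero => rfl
    | succ n ih =>
      rw [pow_succ', Module.End.mul_apply, ih, inclOne_act hk x hx1, pow_succ',
        Module.End.mul_apply]
  rw [key n, Ne, map_eq_zero_iff _ (inclOne_injective hk E hc)]
  induction n with
  | zero => exact vOne_ne_zero
  | succ n ih => rwa [pow_succ', Module.End.mul_apply, map_eq_zero_iff _ hinj]

lemma exists_mem_rootSpace_ne_zero {α : Wt k} (hα : α ∈ roots (cartan k)) :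
    ∃ x : (⊤ : Submodule ℂ (TwAff k)), (x : TwAff k) ∈ rootSpace (cartan k) α ∧ x ≠ 0 := by
  obtain ⟨x, hx, hx0⟩ := (Submodule.ne_bot_iff _).1 hα
  exact ⟨⟨x, trivial⟩, hx, fun h => hx0 (congrArg Subtype.val h)⟩

lemma two_dl_add_mem_roots (hk : 2 ≤ k) (s : ℤˣ) (n : ℤ) :
    (2 * s : ℤ) • dl + (2 * n) • im ∈ roots (cartan k) := by
  rw [roots_eq hk]; exact Or.inl (Or.inr ⟨s, n, rfl⟩)

lemma two_dl_mem_roots (hk : 2 ≤ k) (s : ℤˣ) : (2 * s : ℤ) • dl ∈ roots (cartan k) := by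
  simpa using two_dl_add_mem_roots hk s 0

/-- Every coset in question contains both `±2δ₁`, which is not nilpotent on `v_ζ`, and `±2δ₁ + 2δ`,
which kills `v_ζ` because its degree in `δ` is positive. Neither alternative of tightness survives.
-/
theorem isHybrid_S1 (hk : 2 ≤ k) (E : IsDeltaPair e f) (hc : ∀ n, fCoef ζ ξ n ≠ 0) :
    IsHybrid (K4 ζ ξ e f) (S1 k) := by
  rintro ⟨α, hα, h0, h⟩
  obtain ⟨s, n, rfl⟩ := eq_of_mem_S1 hk hα h0
  have hmem : ∀ m : ℤ, (2 * s : ℤ) • dl + (2 * m) • im ∈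
      {β | ∃ n' : ℤ, β = (2 * s : ℤ) • dl + (2 * n) • im + n' • im} ∩ S1 k := fun m =>
    ⟨⟨2 * m - 2 * n, by module⟩, Or.inl (Or.inr (Or.inr ⟨s, m, rfl⟩))⟩
  rcases h with h | h
  · obtain ⟨x, hx, hx0⟩ := exists_mem_rootSpace_ne_zero (two_dl_add_mem_roots hk s 0)
    obtain ⟨n, hn⟩ := (h (hmem 0)).2.2 x hx hx0 (inclOne ζ ξ e f (vOne ζ ξ e f))
    exact pow_act_two_dl_ne_zero hk E hc s (by simpa using hx) hx0 n hn
  · obtain ⟨x, hx, hx0⟩ := exists_mem_rootSpace_ne_zero (two_dl_add_mem_roots hk s 1)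
    have hz := inclTwo_act_eq_zero (ζ := ζ) (ξ := ξ) (e := e) (f := f) hk
      (Or.inl ⟨two_dl_add_mem_roots hk s 1, 1, by simp [dElt]; norm_num⟩) x hx (vTwo ζ ξ e f)
    exact inclTwo_vTwo_ne_zero hk E hc
      ((map_eq_zero_iff _ ((h (hmem 1)).2.2 x hx hx0)).1 hz)

/-- The `εᵢ`-coordinates do not bound this string. Instead its members all have the same degree in
`δ`, and only finitely many roots do. -/
lemma dl_string_finite (hk : 2 ≤ k) (s : ℤˣ) (β : Wt k) :
    ∃ m : ℕ, β + m • ((2 * s : ℤ) • dl) ∉ roots (cartan k) := by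
  by_contra hcon
  push Not at hcon
  obtain ⟨p, hp⟩ : ∃ p : ℤ, β dElt = p :=
    roots_int hk (fun _ => ⟨0, by simp⟩) ⟨0, by simp⟩ ⟨1, by simp⟩ β (by simpa using hcon 0)
  refine Set.infinite_range_of_injective (f := fun m : ℕ => β + m • ((2 * s : ℤ) • dl : Wt k))
    (fun m m' h => ?_) ((finite_roots_dElt p).subset ?_)
  · have := congrArg (fun α : Wt k => α hPar) h
    simpa [hPar] using this
  · rintro _ ⟨m, rfl⟩
    exact ⟨hcon m, by simp [hp]; simp [dElt]⟩

/-- A parabolic subset contains `2δ₁` or `-2δ₁`, so some nonzero root vector for one of them would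
kill the highest weight vector. By irreducibility it would be locally nilpotent on `M`, but it is
not nilpotent on `v_ζ`. Neither generation by the vector nor `P ∩ -P = {0}` enters the argument. -/
theorem not_isHighestWeight (hk : 2 ≤ k) (E : IsDeltaPair e f) (hc : ∀ n, fCoef ζ ξ n ≠ 0) :
    ¬ IsHighestWeight (K4 ζ ξ e f) := by
  rintro ⟨P, hP, -, μ, v, hv0, -, hkill, -⟩
  obtain ⟨s, hs⟩ : ∃ s : ℤˣ, (2 * s : ℤ) • dl ∈ P := by
    have h := two_dl_mem_roots hk 1
    rw [hP.1] at h
    rcases h with h | h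
    · exact ⟨1, h⟩
    · exact ⟨-1, by simpa using h⟩
  have hr := two_dl_mem_roots hk s
  obtain ⟨x, hx, hx0⟩ := exists_mem_rootSpace_ne_zero hr
  have hne : ((2 * s : ℤ) • dl : Wt k) ≠ 0 := fun h => by
    have := congrArg (fun α : Wt k => α hPar) h
    simp [hPar] at this
  have hpar : wtPar ((2 * s : ℤ) • dl : Wt k) = 0 := by
    rw [wtPar_eq (m := 2 * s) (by simp [hPar])]
    rcases Int.units_eq_one_or s with rfl | rfl <;> decide
  obtain ⟨n, hn⟩ := exists_pow_act_eq_zero isHomogeneousCartan (gradedBy_hPhi hk 1)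
    (K4_relations hk E hc) (K4_irreducible hk E hc) hpar (dl_string_finite hk s) hx hv0
    ⟨1, by simpa using hkill _ hs hne x hx⟩ (inclOne ζ ξ e f (vOne ζ ξ e f))
  exact pow_act_two_dl_ne_zero hk E hc s hx hx0 n hn

theorem isTwoQuasiIntegrable (hk : 2 ≤ k) (E : IsDeltaPair e f) (hc : ∀ n, fCoef ζ ξ n ≠ 0) :
    IsTwoQuasiIntegrable (K4 ζ ξ e f) :=
  ⟨(K4_step hk E hc).irred, isHybrid_S1 hk E hc, fun _ hα h0 =>
    ⟨hα.2, h0, locallyNilpotent_S2 hk E hc hα h0⟩⟩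

end

end SuperAffine

end

theorem mainTheorem2 (k : ℕ) (hk : 2 ≤ k) :
    -- the sets `P₁, P₂, P₃` are parabolic, and elements `e`, `f` as required exist
    (IsParabolic (P2 k ∩ -P2 k) (P1 k) ∧ IsParabolic (P3 k ∩ -P3 k) (P2 k) ∧
      IsParabolic (roots (cartan k)) (P3 k)) ∧
    (∃ e f : TwAff k, e ∈ rootSpace (cartan k) ((2 : ℤ) • dl) ∧
      f ∈ rootSpace (cartan k) (-((2 : ℤ) • dl)) ∧ br e f = tElt ((2 : ℤ) • dl : Wt k)) ∧
    ∀ (ζ : ℚ) (_ : ∀ m : ℤ, ζ ≠ m) (ξ : ℝ) (_ : Irrational ξ) (e f : TwAff k)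
      (_ : e ∈ rootSpace (cartan k) ((2 : ℤ) • dl))
      (_ : f ∈ rootSpace (cartan k) (-((2 : ℤ) • dl)))
      (_ : br e f = tElt ((2 : ℤ) • dl : Wt k)),
      -- the action on `K₁`
      (e ∈ B1 k ∧ f ∈ B1 k ∧ ∀ (x : B1 k) (n : ℤ),
        ((x : TwAff k) = e →
          (K1 ζ ξ e f).act x (Finsupp.single n 1) = Finsupp.single (n + 1) 1) ∧
        ((x : TwAff k) = f → (K1 ζ ξ e f).act x (Finsupp.single n 1) =
          Finsupp.single (n - 1) (-(1 / 2) * ((ξ : ℂ) - ((ζ : ℂ) + 2 * n - 1) ^ 2))) ∧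
        ((x : TwAff k) = (dElt : cartan k) → (K1 ζ ξ e f).act x (Finsupp.single n 1) = 0) ∧
        ((x : TwAff k) = (cElt : cartan k) → (K1 ζ ξ e f).act x (Finsupp.single n 1) =
          Finsupp.single n (2 * k + 2 : ℂ)) ∧
        ((x : TwAff k) = (tElt ((2 : ℤ) • dl : Wt k) : TwAff k) →
          (K1 ζ ξ e f).act x (Finsupp.single n 1) =
            Finsupp.single n (-2 * ((ζ : ℂ) + 2 * n))) ∧
        ∀ i : Fin k, (x : TwAff k) = (tElt (ep i) : TwAff k) →
          (K1 ζ ξ e f).act x (Finsupp.single n 1) =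
            Finsupp.single n ((k : ℂ) - ((i : ℕ) + 1) + 2)) ∧
      -- `K₁` is an irreducible finite weight module with the stated support, and `±2δ₁` act
      -- injectively
      (K1 ζ ξ e f).IsIrreducibleFiniteWeight (cartan k) ∧
      (K1 ζ ξ e f).supp (cartan k) = {μ | ∃ n : ℤ, μ = rho k ζ + (2 * n) • dl} ∧
      (2 : ℤ) • dl ∈ inSet (K1 ζ ξ e f) (P1 k ∩ -P1 k) ∧
      -((2 : ℤ) • dl) ∈ inSet (K1 ζ ξ e f) (P1 k ∩ -P1 k) ∧
      -- the three parabolic inductions make sense and give irreducible finite weight modules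
      (parIndExists (B2 k) (P1 k) (K1 ζ ξ e f) ∧ parIndEmbeds (B2 k) (P1 k) (K1 ζ ξ e f) ∧
        (K2 ζ ξ e f).IsIrreducibleFiniteWeight (cartan k)) ∧
      (parIndExists (B3 k) (P2 k) (K2 ζ ξ e f) ∧ parIndEmbeds (B3 k) (P2 k) (K2 ζ ξ e f) ∧
        (K3 ζ ξ e f).IsIrreducibleFiniteWeight (cartan k)) ∧
      (parIndExists ⊤ (P3 k) (K3 ζ ξ e f) ∧ parIndEmbeds ⊤ (P3 k) (K3 ζ ξ e f) ∧
        (K4 ζ ξ e f).IsIrreducibleFiniteWeight (cartan k)) ∧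
      -- `M = K₄` is `2`-quasi-integrable and not a highest weight module
      IsTwoQuasiIntegrable (K4 ζ ξ e f) ∧ ¬ IsHighestWeight (K4 ζ ξ e f) := by
  refine ⟨⟨(isParabolic_P1 hk).1, (isParabolic_P2 hk).1, (isParabolic_P3 hk).1⟩, exists_ef,
    fun ζ _ ξ hξ e f he hf hef => ?_⟩
  have E : IsDeltaPair e f := ⟨he, hf, hef⟩
  have hc := fCoef_ne_zero ζ hξ
  have S2 := K2_step hk E hc
  have S3 := K3_step hk E hc
  have S4 := K4_step hk E hc
  exact ⟨K1_action ζ ξ hk E, K1_isIrreducibleFiniteWeight hk E hc, K1_supp ζ ξ hk,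
    (K1_inSet ζ ξ hk E hc).1, (K1_inSet ζ ξ hk E hc).2,
    ⟨S2.isExists, S2.isEmbeds, S2.irred⟩, ⟨S3.isExists, S3.isEmbeds, S3.irred⟩,
    ⟨S4.isExists, S4.isEmbeds, S4.irred⟩, isTwoQuasiIntegrable hk E hc, not_isHighestWeight hk E hc⟩
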